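/- Let $H=H(q,p)\colon\mathbb{R}^{n}\times\mathbb{R}^n\to\mathbb{R}$ be a $C^2$ Hamiltonian of classical type: $H(q,-p)=H(q,p)$ for all $q,p$, and there is a continuous function $\nu\colon\mathbb{R}^n\to(0,\infty)$ with $\frac{\partial^2H}{\partial p^2}(q,p)[\xi,\xi]\ge\nu(q)\|\xi\|^2$ for all $q,p,\xi\in\mathbb{R}^n$. Put $V(q)=H(q,0)$. Let $D\subset\mathbb{R}^n$ be a potential well for $H$ with energy $E\in\mathbb{R}$, that is, an open set with boundary of class $C^2$ such that $V<E$ on $D$, and $V=E$ and $\nabla V\ne0$ at every point of $\partial D$. Assume that $\overline D$ is compact. A curve $q\colon[0,T]\to\overline D$, $T>0$, is called a brake orbit if there is $p\colon[0,T]\to\mathbb{R}^n$ such that $\dot q=\frac{\partial H}{\partial p}(q,p)$, $\dot p=-\frac{\partial H}{\partial q}(q,p)$ and $H(q,p)=E$ on $[0,T]$, $q(t)\in D$ for $0<t<T$, and $q(0),q(T)\in\partial D$. A Finsler metric on the open set $D$ is a continuous function $F\colon D\times\mathbb{R}^n\to[0,\infty)$ that is of class $C^2$ and positive on $D\times(\mathbb{R}^n\setminus\{0\})$,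 positively homogeneous of degree $1$ in $v$, and such that $\frac{\partial^2F^2}{\partial v^2}(q,v)$ is positive definite for all $q\in D$, $v\neq0$. Its geodesics are the $C^1$ curves $\gamma$ in $D$ with nowhere vanishing velocity that satisfy $\frac{d}{ds}\frac{\partial F^2}{\partial v}(\gamma,\dot\gamma)=\frac{\partial F^2}{\partial q}(\gamma,\dot\gamma)$. Then there exist an open set $\Omega$ with $\overline\Omega\subset D$ and a Finsler metric $F$ on $D$ (hence on $\overline\Omega$) such that: 1. $\partial\Omega$ is of class $C^2$; 2. $\overline\Omega$ is homeomorphic to $\overline D$; 3. $\overline\Omega$ is strongly concave with respect to $F$: there is a $C^2$ function $\psi\colon D\to\mathbb{R}$ with $\psi>0$ on $\Omega$, and with $\psi=0$ and $d\psi\neq0$ at every point of $\partial\Omega$, such that, for every $q\in\partial\Omega$ and every $v\in T_q\partial\Omega$ with $v\ne0$, the geodesic $\gamma$ with $\gamma(0)=q$ and $\dot\gamma(0)=v$ exists on some interval $(-\epsilon,\epsilon)$ and satisfies $\frac{d^2}{ds^2}(\psi\circ\gamma)(0)>0$; 4. if $\gamma\colon[0,1]\to\overline\Omega$ is an orthogonal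 Finsler geodesic chord, i.e. a geodesic of $F$ with $\gamma(0),\gamma(1)\in\partial\Omega$ and $\gamma(s)\in\Omega$ for $0<s<1$ such that $\frac{\partial F^2}{\partial v}(\gamma(s),\dot\gamma(s))[\xi]=0$ for all $\xi\in T_{\gamma(s)}\partial\Omega$ and $s=0,1$, then there exist an interval $[\alpha,\beta]\supset[0,1]$ and a continuous extension $\hat\gamma\colon[\alpha,\beta]\to\overline D$ of $\gamma$ such that $\hat\gamma$ is a geodesic of $(D,F)$ on $(\alpha,\beta)$ and, for some $T>0$ and some orientation preserving $C^1$ diffeomorphism $\sigma\colon[0,T]\to[\alpha,\beta]$, the curve $\hat\gamma\circ\sigma$ is a brake orbit. The triple $(\alpha,\beta,\hat\gamma)$ with these properties is unique. -/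

import Mathlib

open Set Filter Topology

namespace BrakeOrbit

noncomputable section

/-- `H` is a `C²` Hamiltonian on `ℝⁿ × ℝⁿ` of classical type: even in the momenta, with
`∂²H/∂p² (q, p)[ξ, ξ] ≥ ν(q) ‖ξ‖²` for a positive continuous function `ν`. -/
structure IsClassicalType {n : ℕ}
    (H : EuclideanSpace ℝ (Fin n) × EuclideanSpace ℝ (Fin n) → ℝ) : Prop where
  contDiff : ContDiff ℝ 2 H
  even : ∀ q p, H (q, -p) = H (q, p)
  hessian_pos : ∃ ν : EuclideanSpace ℝ (Fin n) → ℝ, Continuous ν ∧ (∀ q, 0 < ν q) ∧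
    ∀ q p ξ, ν q * ‖ξ‖ ^ 2 ≤ iteratedFDeriv ℝ 2 (fun p' => H (q, p')) p ![ξ, ξ]

/-- The potential energy `V(q) = H(q, 0)`. -/
def potential {n : ℕ} (H : EuclideanSpace ℝ (Fin n) × EuclideanSpace ℝ (Fin n) → ℝ)
    (q : EuclideanSpace ℝ (Fin n)) : ℝ :=
  H (q, 0)

/-- `ψ` is a local defining function of class `C²` of the open set `U` at its boundary point `q`:
near `q` the set `U` is `{ψ > 0}`, and `dψ(q) ≠ 0`. -/
structure IsLocalDefining {n : ℕ} (U : Set (EuclideanSpace ℝ (Fin n)))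
    (q : EuclideanSpace ℝ (Fin n)) (ψ : EuclideanSpace ℝ (Fin n) → ℝ) : Prop where
  contDiffAt : ContDiffAt ℝ 2 ψ q
  eq_zero : ψ q = 0
  fderiv_ne_zero : fderiv ℝ ψ q ≠ 0
  mem_iff : ∀ᶠ x in 𝓝 q, x ∈ U ↔ 0 < ψ x

/-- The boundary of the open set `U` is of class `C²`. -/
def HasC2Boundary {n : ℕ} (U : Set (EuclideanSpace ℝ (Fin n))) : Prop :=
  ∀ q ∈ frontier U, ∃ ψ, IsLocalDefining U q ψ

/-- The tangent space `T_q ∂U`, the kernel of the differential at `q` of a local defining function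
(all of these differentials are positive multiples of each other). -/
def boundaryTangent {n : ℕ} (U : Set (EuclideanSpace ℝ (Fin n)))
    (q : EuclideanSpace ℝ (Fin n)) : Set (EuclideanSpace ℝ (Fin n)) :=
  {v | ∃ ψ, IsLocalDefining U q ψ ∧ fderiv ℝ ψ q v = 0}

/-- `D` is a potential well for `H`, with energy level `E`. -/
structure IsPotentialWell {n : ℕ}
    (H : EuclideanSpace ℝ (Fin n) × EuclideanSpace ℝ (Fin n) → ℝ)
    (D : Set (EuclideanSpace ℝ (Fin n))) (E : ℝ) : Prop where
  isOpen : IsOpen D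
  boundary : HasC2Boundary D
  lt_energy : ∀ q ∈ D, potential H q < E
  eq_energy : ∀ q ∈ frontier D, potential H q = E
  gradient_ne_zero : ∀ q ∈ frontier D, gradient (potential H) q ≠ 0

/-- `(q, p)` solves Hamilton's equations on `[0, T]`
(with one-sided derivatives at the end points). -/
def IsHamiltonSolution {n : ℕ}
    (H : EuclideanSpace ℝ (Fin n) × EuclideanSpace ℝ (Fin n) → ℝ) (T : ℝ)
    (q p : ℝ → EuclideanSpace ℝ (Fin n)) : Prop :=
  ∀ t ∈ Icc 0 T,
    HasDerivWithinAt q (gradient (fun y => H (q t, y)) (p t)) (Icc 0 T) t ∧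
    HasDerivWithinAt p (-gradient (fun x => H (x, p t)) (q t)) (Icc 0 T) t

/-- `q : [0, T] → closure D` is a brake orbit: with a suitable momentum `p` (which is determined by
`q' = ∂H/∂p (q, p)`) it solves Hamilton's equations with energy `E`, it lies in `D` for
`0 < t < T`, and it starts and ends on the boundary of `D`. -/
def IsBrakeOrbit {n : ℕ}
    (H : EuclideanSpace ℝ (Fin n) × EuclideanSpace ℝ (Fin n) → ℝ)
    (D : Set (EuclideanSpace ℝ (Fin n))) (E T : ℝ)
    (q : ℝ → EuclideanSpace ℝ (Fin n)) : Prop :=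
  0 < T ∧
  (∃ p : ℝ → EuclideanSpace ℝ (Fin n),
    IsHamiltonSolution H T q p ∧ ∀ t ∈ Icc 0 T, H (q t, p t) = E) ∧
  (∀ t ∈ Ioo 0 T, q t ∈ D) ∧ q 0 ∈ frontier D ∧ q T ∈ frontier D

/-- `F` is a Finsler metric on the open set `M`: continuous on `TM`, of class `C²` off the zero
section, positive, positively homogeneous, with `∂²F²/∂v²` positive definite off the
zero section. -/
structure IsFinslerMetric {n : ℕ} (M : Set (EuclideanSpace ℝ (Fin n)))
    (F : EuclideanSpace ℝ (Fin n) → EuclideanSpace ℝ (Fin n) → ℝ) : Prop where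
  continuousOn : ContinuousOn (Function.uncurry F) (M ×ˢ univ)
  contDiffOn : ContDiffOn ℝ 2 (Function.uncurry F) (M ×ˢ {0}ᶜ)
  pos : ∀ q ∈ M, ∀ v, v ≠ 0 → 0 < F q v
  homogeneous : ∀ q ∈ M, ∀ v, ∀ c : ℝ, 0 ≤ c → F q (c • v) = c * F q v
  hessian_pos : ∀ q ∈ M, ∀ v, v ≠ 0 → ∀ ξ, ξ ≠ 0 →
    0 < iteratedFDeriv ℝ 2 (fun v' => F q v' ^ 2) v ![ξ, ξ]

/-- The curve `γ`, restricted to the interval `I`, is a (nonconstant, affinely parametrized)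
geodesic of the Finsler metric `F` on the open set `M`: it is of class `C¹` with nonvanishing
velocity and satisfies the Euler-Lagrange equation
`d/ds (∂F²/∂v (γ, γ')) = ∂F²/∂q (γ, γ')` on `I`. -/
structure IsGeodesicOn {n : ℕ} (M : Set (EuclideanSpace ℝ (Fin n)))
    (F : EuclideanSpace ℝ (Fin n) → EuclideanSpace ℝ (Fin n) → ℝ)
    (γ : ℝ → EuclideanSpace ℝ (Fin n)) (I : Set ℝ) : Prop where
  mapsTo : MapsTo γ I M
  contDiffOn : ContDiffOn ℝ 1 γ I
  velocity_ne_zero : ∀ s ∈ I, derivWithin γ I s ≠ 0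
  euler_lagrange : ∀ s ∈ I,
    HasDerivWithinAt (fun r => fderiv ℝ (fun v => F (γ r) v ^ 2) (derivWithin γ I r))
      (fderiv ℝ (fun x => F x (derivWithin γ I s) ^ 2) (γ s)) I s

/-- `γ : [a, b] → closure Ω` is an orthogonal Finsler geodesic chord of `Ω`, where `Ω` is an open
set whose closure lies in the Finsler manifold `(M, F)`. -/
structure IsOrthogonalChord {n : ℕ} (M : Set (EuclideanSpace ℝ (Fin n)))
    (F : EuclideanSpace ℝ (Fin n) → EuclideanSpace ℝ (Fin n) → ℝ)
    (Ω : Set (EuclideanSpace ℝ (Fin n)))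
    (a b : ℝ) (γ : ℝ → EuclideanSpace ℝ (Fin n)) : Prop where
  geodesic : IsGeodesicOn M F γ (Icc a b)
  left_mem : γ a ∈ frontier Ω
  right_mem : γ b ∈ frontier Ω
  interior_mem : ∀ s ∈ Ioo a b, γ s ∈ Ω
  left_orthogonal : ∀ ξ ∈ boundaryTangent Ω (γ a),
    fderiv ℝ (fun v => F (γ a) v ^ 2) (derivWithin γ (Icc a b) a) ξ = 0
  right_orthogonal : ∀ ξ ∈ boundaryTangent Ω (γ b),
    fderiv ℝ (fun v => F (γ b) v ^ 2) (derivWithin γ (Icc a b) b) ξ = 0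

/-- `closure Ω` is strongly concave in the Finsler manifold `(M, F)`. For a function `ψ` of class
`C²` on `M` that is positive on `Ω` and zero with nonzero differential on `∂Ω`, and for each
nonzero `v` tangent to `∂Ω` at `q`, the geodesic `γ` with `γ(0) = q`, `γ'(0) = v` (which exists,
and is unique up to its interval of definition) satisfies `(ψ ∘ γ)''(0) > 0`. -/
def IsStronglyConcave {n : ℕ} (M : Set (EuclideanSpace ℝ (Fin n)))
    (F : EuclideanSpace ℝ (Fin n) → EuclideanSpace ℝ (Fin n) → ℝ)
    (Ω : Set (EuclideanSpace ℝ (Fin n))) : Prop :=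
  ∃ ψ : EuclideanSpace ℝ (Fin n) → ℝ,
    ContDiffOn ℝ 2 ψ M ∧ (∀ x ∈ Ω, 0 < ψ x) ∧
    (∀ x ∈ frontier Ω, ψ x = 0 ∧ fderiv ℝ ψ x ≠ 0) ∧
    ∀ q ∈ frontier Ω, ∀ v ∈ boundaryTangent Ω q, v ≠ 0 →
      (∃ ε > 0, ∃ γ : ℝ → EuclideanSpace ℝ (Fin n),
        IsGeodesicOn M F γ (Ioo (-ε) ε) ∧ γ 0 = q ∧ deriv γ 0 = v) ∧
      ∀ ε > 0, ∀ γ : ℝ → EuclideanSpace ℝ (Fin n),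
        IsGeodesicOn M F γ (Ioo (-ε) ε) → γ 0 = q → deriv γ 0 = v →
          0 < iteratedDeriv 2 (ψ ∘ γ) 0

/-- `σ` is an orientation preserving `C¹` diffeomorphism from `[0, T]` onto `[α, β]`. -/
structure IsTimeReparametrization (T α β : ℝ) (σ : ℝ → ℝ) : Prop where
  contDiffOn : ContDiffOn ℝ 1 σ (Icc 0 T)
  deriv_pos : ∀ t ∈ Icc 0 T, 0 < derivWithin σ (Icc 0 T) t
  left : σ 0 = α
  right : σ T = β

/-- `γ' : [α, β] → closure D` is a continuous extension of `γ : [0, 1] → D` that is a geodesic of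
`(D, F)` on the open interval and, up to a time reparametrization, a brake orbit. -/
structure IsBrakeExtension {n : ℕ}
    (H : EuclideanSpace ℝ (Fin n) × EuclideanSpace ℝ (Fin n) → ℝ)
    (D : Set (EuclideanSpace ℝ (Fin n))) (E : ℝ)
    (F : EuclideanSpace ℝ (Fin n) → EuclideanSpace ℝ (Fin n) → ℝ)
    (γ : ℝ → EuclideanSpace ℝ (Fin n)) (α β : ℝ)
    (γ' : ℝ → EuclideanSpace ℝ (Fin n)) : Prop where
  left_le : α ≤ 0
  le_right : 1 ≤ β
  continuousOn : ContinuousOn γ' (Icc α β)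
  mapsTo : MapsTo γ' (Icc α β) (closure D)
  extends_eq : EqOn γ' γ (Icc 0 1)
  geodesic : IsGeodesicOn D F γ' (Ioo α β)
  brake : ∃ T : ℝ, ∃ σ : ℝ → ℝ,
    IsTimeReparametrization T α β σ ∧ IsBrakeOrbit H D E T (γ' ∘ σ)

end

end BrakeOrbit

/-! The metric is the Jacobi-Finsler metric of the energy level `E`, conformally changed near `∂D`.
For `q ∈ D` the set `{p | H(q, p) ≤ E}` is compact and strongly convex with `0` in its interior. Its
support function `F₀(q, v) = ⟪p, v⟫`, with `p` the momentum of energy `E` whose velocity `∂H/∂p` is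
a positive multiple of `v`, is a Finsler metric. Its geodesics are exactly the time changes of
Hamiltonian orbits of energy `E` (`IsJacobiOrbit.isGeodesicOn`, `IsGeodesicOn.isJacobiOrbit`). It
degenerates at `∂D`, where the momentum vanishes.

Points near `∂D` are reached by brake orbits `(Q t x, P t x)` that start at rest at `x ∈ ∂D`. Let `b
= -∂H/∂q(x, 0) ≠ 0` be the initial force and `A = H_pp b` the initial acceleration; then `⟪b, A⟫ >
0`, `P = t b + o(t)` and `Q = x + (t²/2) A + o(t²)`. The map `(t, x) ↦ Q t x` folds along `t = 0`,
but in the variable `τ = t²` it becomes a local diffeomorphism transversal to `∂D`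
(`IsBrakeFlow.exists_hasStrictFDerivAt_collarMap`), and compactness of `∂D` turns this into a
collar. The action `ℓ` accumulated along the brake orbit from the boundary to `q` has the momentum
of that orbit as its gradient (`IsBrakeCollar.hasFDerivAt_action`), so `ℓ` is `C²` inside `D` and
solves `H(q, ∇ℓ) = E`.

The domain is `Ω = {ℓ > δ₀ / 2}`. Stretching the collar along brake orbits maps the closure of `Ω`
homeomorphically onto that of `D`. For an orbit tangent to a level set of `ℓ` near `∂D`, the second
derivative of `ℓ` in Hamiltonian time is `t ⟪b, A⟫ + o(t) > 0` (`IsBrakeFlow.eventually_concave`),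
which is strong concavity. At an end of an orthogonal chord the momentum is a multiple of `∇ℓ`;
equality of energies and evenness leave only the sign, and the sign is fixed because the chord stays
in `Ω`. So the chord continues on both sides along the brake orbits of the collar and reaches `∂D`
at rest.

The conformal change makes the geodesic parameter a `C¹` diffeomorphic image of time up to `∂D`.
Along a brake orbit `F₀` grows like `⟪b, A⟫ t²` per unit time while `ℓ` grows like `⟪b, A⟫ t³ / 3`,
so `F = F₀ / ℓ^(2/3)` has speed with a positive finite limit (`CollarData.exists_tendsto_speed`). As
the factor depends on `ℓ` alone, brake orbits, being normal to the level sets of `ℓ`, remain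
geodesics up to a time change (`CollarData.hasDerivAt_rescale`); near the closure of `Ω` the factor
is `1`.

Uniqueness follows from uniqueness for the orbit equation: two extensions agree on their common
interval, and an extension meets `∂D` only at its ends. -/

open scoped BoundedContinuousFunction

namespace BrakeOrbit

set_option linter.unusedSectionVars false

/-! ### Differentiable dependence of flows on time and initial point -/

section Flow

variable {E : Type*} [NormedAddCommGroup E] [NormedSpace ℝ E]

/-- The Nemytskii operator `z ↦ X ∘ z` on continuous paths. -/
noncomputable def pathComp {F : Type*} [NormedAddCommGroup F] {X : E → F} (hX : Continuous X)
    (z : unitInterval →ᵇ E) : unitInterval →ᵇ F :=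
  BoundedContinuousFunction.mkOfCompact ⟨fun s => X (z s), hX.comp z.continuous⟩

@[simp] theorem pathComp_apply {F : Type*} [NormedAddCommGroup F] {X : E → F}
    (hX : Continuous X) (z : (unitInterval →ᵇ E)) (s : unitInterval) :
    pathComp hX z s = X (z s) := rfl

/-- Pointwise application of a continuous path of operators to a path. -/
noncomputable def pathApply (A : (unitInterval →ᵇ (E →L[ℝ] E))) :
    (unitInterval →ᵇ E) →L[ℝ] (unitInterval →ᵇ E) :=
  LinearMap.mkContinuous
    { toFun := fun h => BoundedContinuousFunction.mkOfCompact
        ⟨fun s => A s (h s), A.continuous.clm_apply h.continuous⟩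
      map_add' := fun h k => by ext s; simp
      map_smul' := fun c h => by ext s; simp } ‖A‖ (fun h => by
    refine (BoundedContinuousFunction.norm_le (by positivity)).2 fun s => ?_
    exact ((A s).le_opNorm _).trans (mul_le_mul (A.norm_coe_le_norm s) (h.norm_coe_le_norm s)
      (norm_nonneg _) (norm_nonneg A)))

@[simp] theorem pathApply_apply (A : (unitInterval →ᵇ (E →L[ℝ] E))) (h : (unitInterval →ᵇ E))
    (s : unitInterval) : pathApply A h s = A s (h s) := rfl

theorem norm_pathApply_le (A : (unitInterval →ᵇ (E →L[ℝ] E))) : ‖pathApply A‖ ≤ ‖A‖ :=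
  LinearMap.mkContinuous_norm_le _ (norm_nonneg A) _

theorem pathApply_sub (A B : (unitInterval →ᵇ (E →L[ℝ] E))) :
    pathApply A - pathApply B = pathApply (A - B) := by
  ext h s; simp

/-- The mean value inequality on the ball around `z s` bounds the error pointwise. Uniform
continuity of `fderiv ℝ X` makes its radius independent of `s`, which turns the bound into one in
the sup norm. -/
theorem hasStrictFDerivAt_pathComp {X : E → E} (hX : ContDiff ℝ 1 X)
    (hU : UniformContinuous (fderiv ℝ X)) (z : (unitInterval →ᵇ E)) :
    HasStrictFDerivAt (pathComp hX.continuous)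
      (pathApply (pathComp hU.continuous z)) z := by
  rw [hasStrictFDerivAt_iff_isLittleO, Asymptotics.isLittleO_iff]
  intro ε hε
  obtain ⟨δ, hδ, hδX⟩ := Metric.uniformContinuous_iff.1 hU ε hε
  have hev : ∀ᶠ p in 𝓝 (z, z), p ∈ Metric.ball z δ ×ˢ Metric.ball z δ :=
    prod_mem_nhds (Metric.ball_mem_nhds _ hδ) (Metric.ball_mem_nhds _ hδ)
  filter_upwards [hev] with p hp
  refine (BoundedContinuousFunction.norm_le (by positivity)).2 fun s => ?_
  have h1 : p.1 s ∈ Metric.ball (z s) δ := lt_of_le_of_lt (BoundedContinuousFunction.dist_coe_le_dist s) hp.1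
  have h2 : p.2 s ∈ Metric.ball (z s) δ := lt_of_le_of_lt (BoundedContinuousFunction.dist_coe_le_dist s) hp.2
  have := (convex_ball (z s) δ).norm_image_sub_le_of_norm_hasFDerivWithin_le' (f := X)
    (f' := fderiv ℝ X) (φ := fderiv ℝ X (z s)) (C := ε)
    (fun u _ => ((hX.differentiable one_ne_zero) u).hasFDerivAt.hasFDerivWithinAt)
    (fun u hu => by
      have := hδX hu
      rw [dist_eq_norm] at this
      exact this.le) h2 h1
  refine le_trans (by simpa using this) ?_
  exact mul_le_mul_of_nonneg_left ((p.1 - p.2).norm_coe_le_norm s) hε.le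

theorem contDiff_pathComp {X : E → E} (hX : ContDiff ℝ 1 X)
    (hU : UniformContinuous (fderiv ℝ X)) : ContDiff ℝ 1 (pathComp hX.continuous) := by
  rw [contDiff_one_iff_fderiv]
  refine ⟨fun z => (hasStrictFDerivAt_pathComp hX hU z).hasFDerivAt.differentiableAt, ?_⟩
  have : fderiv ℝ (pathComp hX.continuous) = fun z =>
      pathApply (pathComp hU.continuous z) :=
    funext fun z => (hasStrictFDerivAt_pathComp hX hU z).hasFDerivAt.fderiv
  rw [this, Metric.continuous_iff]
  intro z ε hε
  obtain ⟨δ, hδ, hδX⟩ := Metric.uniformContinuous_iff.1 hU (ε / 2) (by positivity)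
  refine ⟨δ, hδ, fun w hw => ?_⟩
  rw [dist_eq_norm, pathApply_sub]
  refine lt_of_le_of_lt (norm_pathApply_le _) (lt_of_le_of_lt ?_ (half_lt_self hε))
  refine (BoundedContinuousFunction.norm_le (by positivity)).2 fun s => ?_
  have := hδX (lt_of_le_of_lt (BoundedContinuousFunction.dist_coe_le_dist s) hw : dist (w s) (z s) < δ)
  rw [dist_eq_norm] at this
  exact this.le

variable [CompleteSpace E]

/-- The primitive of a continuous path that vanishes at `0`. -/
noncomputable def pathPrimitive : (unitInterval →ᵇ E) →L[ℝ] (unitInterval →ᵇ E) :=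
  LinearMap.mkContinuous
    { toFun := fun h => BoundedContinuousFunction.mkOfCompact ⟨fun s => ∫ r in (0 : ℝ)..s, IccExtend zero_le_one h r, by
        have h1 : Continuous fun u : ℝ => ∫ r in (0 : ℝ)..u, IccExtend zero_le_one h r :=
          intervalIntegral.continuous_primitive
            (fun a b => (h.continuous.Icc_extend' (h := zero_le_one)).intervalIntegrable a b) 0
        exact h1.comp continuous_subtype_val⟩
      map_add' := fun h k => by
        ext s
        simp only [BoundedContinuousFunction.mkOfCompact_apply, ContinuousMap.coe_mk,
          BoundedContinuousFunction.add_apply]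
        rw [← intervalIntegral.integral_add
          ((h.continuous.Icc_extend' (h := zero_le_one)).intervalIntegrable _ _)
          ((k.continuous.Icc_extend' (h := zero_le_one)).intervalIntegrable _ _)]
        rfl
      map_smul' := fun c h => by
        ext s
        simp only [BoundedContinuousFunction.mkOfCompact_apply, ContinuousMap.coe_mk,
          BoundedContinuousFunction.smul_apply, RingHom.id_apply]
        rw [← intervalIntegral.integral_smul]
        rfl } 1 (fun h => by
    refine (BoundedContinuousFunction.norm_le (by positivity)).2 fun s => ?_
    have := intervalIntegral.norm_integral_le_of_norm_le_const (a := (0 : ℝ)) (b := s)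
      (f := IccExtend zero_le_one h) (C := ‖h‖) (fun r _ => h.norm_coe_le_norm _)
    refine this.trans ?_
    rw [sub_zero, abs_of_nonneg s.2.1, one_mul]
    exact mul_le_of_le_one_right (norm_nonneg _) s.2.2)

theorem norm_pathPrimitive_le : ‖(pathPrimitive : (unitInterval →ᵇ E) →L[ℝ] _)‖ ≤ 1 :=
  LinearMap.mkContinuous_norm_le _ zero_le_one _

/-- The constant path, as a continuous linear map. -/
noncomputable def constPath : E →L[ℝ] (unitInterval →ᵇ E) :=
  LinearMap.mkContinuous
    { toFun := fun x => BoundedContinuousFunction.const _ x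
      map_add' := fun _ _ => rfl
      map_smul' := fun _ _ => rfl } 1 (fun x => by
    refine (BoundedContinuousFunction.norm_le (by positivity)).2 fun s => by
      rw [one_mul]; exact le_rfl)

@[simp] theorem constPath_apply (x : E) (s : unitInterval) : constPath x s = x := rfl

/-- The defect of a path `z` as a solution of `z' = t X(z)`, `z(0) = x`. -/
noncomputable def pathDefect {X : E → E} (hX : Continuous X)
    (u : (ℝ × E) × (unitInterval →ᵇ E)) : (unitInterval →ᵇ E) :=
  u.2 - constPath u.1.2 - u.1.1 • pathPrimitive (pathComp hX u.2)

theorem contDiff_pathDefect {X : E → E} (hX : ContDiff ℝ 1 X)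
    (hU : UniformContinuous (fderiv ℝ X)) : ContDiff ℝ 1 (pathDefect hX.continuous) := by
  have h1 := contDiff_pathComp hX hU
  have h2 : ContDiff ℝ 1 fun u : (ℝ × E) × (unitInterval →ᵇ E) =>
      pathPrimitive (pathComp hX.continuous u.2) :=
    pathPrimitive.contDiff.comp (h1.comp contDiff_snd)
  have h3 : ContDiff ℝ 1 fun u : (ℝ × E) × (unitInterval →ᵇ E) =>
      (constPath u.1.2 : (unitInterval →ᵇ E)) :=
    (constPath (E := E)).contDiff.comp (contDiff_snd.comp contDiff_fst)
  exact (contDiff_snd.sub h3).sub ((contDiff_fst.comp contDiff_fst).smul h2)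

/-- The partial derivative in the path variable is the identity minus `t` times the primitive of
`DX(z) h`. Since `|t| * L < 1`, this perturbation has norm less than `1` and a Neumann series
inverts the difference. -/
theorem isInvertible_fderiv_pathDefect {X : E → E} (hX : ContDiff ℝ 1 X)
    (hU : UniformContinuous (fderiv ℝ X)) {L : ℝ} (hL0 : 0 ≤ L) (hL : ∀ x, ‖fderiv ℝ X x‖ ≤ L)
    (u : (ℝ × E) × (unitInterval →ᵇ E)) (hu : |u.1.1| * L < 1) :
    (fderiv ℝ (pathDefect hX.continuous) u ∘L .inr ℝ (ℝ × E) (unitInterval →ᵇ E)).IsInvertible := by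
  set A := pathApply (pathComp hU.continuous u.2) with hA
  set B : (unitInterval →ᵇ E) →L[ℝ] (unitInterval →ᵇ E) := u.1.1 • (pathPrimitive ∘L A) with hB
  have hBn : ‖B‖ < 1 := by
    have h1 : ‖A‖ ≤ L := (norm_pathApply_le _).trans
      ((BoundedContinuousFunction.norm_le hL0).2 fun s => hL _)
    have h2 : ‖pathPrimitive ∘L A‖ ≤ L := by
      refine (ContinuousLinearMap.opNorm_comp_le _ _).trans ?_
      calc _ ≤ 1 * L := mul_le_mul norm_pathPrimitive_le h1 (norm_nonneg _) zero_le_one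
        _ = L := one_mul L
    calc ‖B‖ ≤ |u.1.1| * L := by
          rw [hB, norm_smul]; exact mul_le_mul_of_nonneg_left h2 (norm_nonneg _)
      _ < 1 := hu
  have hder : fderiv ℝ (pathDefect hX.continuous) u ∘L .inr ℝ (ℝ × E) (unitInterval →ᵇ E)
      = 1 - B := by
    have h0 : HasFDerivAt (fun z : (unitInterval →ᵇ E) => pathDefect hX.continuous (u.1, z))
        (1 - B) u.2 := by
      have h1 := (hasStrictFDerivAt_pathComp hX hU u.2).hasFDerivAt
      have h2 := (pathPrimitive.hasFDerivAt.comp u.2 h1).const_smul u.1.1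
      exact ((hasFDerivAt_id u.2).sub_const (constPath u.1.2)).sub h2
    have h3 : HasFDerivAt (fun z : (unitInterval →ᵇ E) => pathDefect hX.continuous (u.1, z))
        (fderiv ℝ (pathDefect hX.continuous) u ∘L .inr ℝ (ℝ × E) (unitInterval →ᵇ E)) u.2 := by
      have h4 := ((contDiff_pathDefect hX hU).differentiable one_ne_zero u).hasFDerivAt
      exact HasFDerivAt.comp (f := fun z : (unitInterval →ᵇ E) => (u.1, z)) u.2 h4
        (hasFDerivAt_prodMk_right u.1 u.2)
    exact h3.unique h0
  rw [hder]
  have hun : IsUnit (1 - B) := isUnit_one_sub_of_norm_lt_one hBn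
  obtain ⟨w, hw⟩ := hun
  exact ⟨ContinuousLinearEquiv.unitsEquiv ℝ _ w, hw⟩

theorem pathDefect_eq_zero_iff {X : E → E} (hX : Continuous X) (t : ℝ) (x : E)
    (z : (unitInterval →ᵇ E)) : pathDefect hX ((t, x), z) = 0 ↔
      ∀ s : unitInterval, z s = x + t • ∫ r in (0 : ℝ)..s, X (IccExtend zero_le_one z r) := by
  have : ∀ s : unitInterval, pathPrimitive (pathComp hX z) s =
    ∫ r in (0 : ℝ)..s, X (IccExtend zero_le_one z r) := fun s => rfl
  simp only [pathDefect, BoundedContinuousFunction.ext_iff, BoundedContinuousFunction.sub_apply, constPath_apply,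
    BoundedContinuousFunction.smul_apply, this]
  refine forall_congr' fun s => ?_
  rw [sub_sub]
  exact sub_eq_zero

/-- The Picard operator is a contraction with constant `|t| * L`. Uniqueness among all paths is what
identifies the local implicit functions with one globally defined map. -/
theorem existsUnique_pathDefect_eq_zero {X : E → E} (hX : ContDiff ℝ 1 X)
    {L : ℝ} (hL0 : 0 ≤ L) (hL : ∀ x, ‖fderiv ℝ X x‖ ≤ L) (t : ℝ) (x : E) (ht : |t| * L < 1) :
    ∃! z : (unitInterval →ᵇ E), pathDefect hX.continuous ((t, x), z) = 0 := by
  set K : (unitInterval →ᵇ E) → (unitInterval →ᵇ E) := fun z =>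
    constPath x + t • pathPrimitive (pathComp hX.continuous z) with hK
  have hlip : LipschitzWith ⟨L, hL0⟩ X :=
    lipschitzWith_of_nnnorm_fderiv_le (hX.differentiable one_ne_zero) fun y => hL y
  have hc : ContractingWith ⟨|t| * L, by positivity⟩ K := by
    refine ⟨by exact_mod_cast ht, LipschitzWith.of_dist_le_mul fun z w => ?_⟩
    rw [dist_eq_norm, hK]
    simp only [add_sub_add_left_eq_sub]
    rw [← smul_sub, ← map_sub, norm_smul]
    have h1 : ‖pathComp hX.continuous z - pathComp hX.continuous w‖ ≤ L * dist z w := by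
      refine (BoundedContinuousFunction.norm_le (by positivity)).2 fun s => ?_
      have h2 : dist (X (z s)) (X (w s)) ≤ L * dist (z s) (w s) := hlip.dist_le_mul _ _
      rw [dist_eq_norm] at h2
      exact h2.trans (mul_le_mul_of_nonneg_left (BoundedContinuousFunction.dist_coe_le_dist s) hL0)
    have h3 := (pathPrimitive (E := E)).le_opNorm
      (pathComp hX.continuous z - pathComp hX.continuous w)
    have h4 : ‖pathPrimitive (pathComp hX.continuous z - pathComp hX.continuous w)‖
        ≤ L * dist z w := by
      refine h3.trans ?_
      calc _ ≤ 1 * (L * dist z w) :=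
            mul_le_mul norm_pathPrimitive_le h1 (norm_nonneg _) zero_le_one
        _ = _ := one_mul _
    calc _ ≤ |t| * (L * dist z w) := mul_le_mul_of_nonneg_left h4 (abs_nonneg _)
      _ = |t| * L * dist z w := by ring
  have hiff : ∀ z, pathDefect hX.continuous ((t, x), z) = 0 ↔ K z = z := fun z => by
    simp only [pathDefect, hK]
    rw [sub_sub, sub_eq_zero, eq_comm]
  refine ⟨hc.fixedPoint, (hiff _).2 hc.fixedPoint_isFixedPt, fun z hz => ?_⟩
  exact hc.fixedPoint_unique ((hiff z).1 hz)

/-- The local flow of a compactly supported `C¹` vector field is of class `C¹`. -/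
theorem exists_contDiff_flow {X : E → E} (hX : ContDiff ℝ 1 X) (hc : HasCompactSupport X) :
    ∃ T > 0, ∃ φ : ℝ → E → E, (∀ x, φ 0 x = x) ∧
      (∀ t ∈ Ioo (-T) T, ∀ x, HasDerivAt (fun r => φ r x) (X (φ t x)) t) ∧
      (∀ t ∈ Ioo (-T) T, ∀ x, ContDiffAt ℝ 1 (fun u : ℝ × E => φ u.1 u.2) (t, x)) ∧
      (∀ t ∈ Ioo (-T) T, ∀ x, ∃ C : ℝ, 0 ≤ C ∧ ∀ᶠ u : ℝ × E in 𝓝 (t, x), ∀ s ∈ Icc (0 : ℝ) 1,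
        ‖φ (s * u.1) u.2 - φ (s * t) x‖ ≤ C * ‖u - (t, x)‖) := by
  have hU : UniformContinuous (fderiv ℝ X) :=
    (hc.fderiv (𝕜 := ℝ)).uniformContinuous_of_continuous (hX.continuous_fderiv one_ne_zero)
  obtain ⟨L', hL'⟩ := (hc.fderiv (𝕜 := ℝ)).exists_bound_of_continuous
    (hX.continuous_fderiv one_ne_zero)
  set L : ℝ := max L' 0 with hLdef
  have hL0 : 0 ≤ L := le_max_right _ _
  have hL : ∀ x, ‖fderiv ℝ X x‖ ≤ L := fun x => (hL' x).trans (le_max_left _ _)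
  set T : ℝ := 1 / (L + 1) with hT
  have hT0 : 0 < T := by positivity
  have hTL : ∀ t ∈ Ioo (-T) T, |t| * L < 1 := fun t ht => by
    have h1 : |t| < T := abs_lt.2 ht
    calc |t| * L ≤ T * L := mul_le_mul_of_nonneg_right h1.le hL0
      _ < 1 := by rw [hT, div_mul_eq_mul_div, one_mul, div_lt_one (by positivity)]; linarith
  choose! Z hZ hZu using fun (u : ℝ × E) (hu : u.1 ∈ Ioo (-T) T) =>
    existsUnique_pathDefect_eq_zero hX hL0 hL u.1 u.2 (hTL u.1 hu)
  have hZ' : ∀ u : ℝ × E, u.1 ∈ Ioo (-T) T → ∀ s : unitInterval,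
      Z u s = u.2 + u.1 • ∫ r in (0 : ℝ)..s, X (IccExtend zero_le_one (Z u) r) := fun u hu =>
    (pathDefect_eq_zero_iff hX.continuous u.1 u.2 (Z u)).1 (hZ u hu)
  have hZC : ∀ u : ℝ × E, u.1 ∈ Ioo (-T) T → ContDiffAt ℝ 1 Z u := fun u hu => by
    have hd : ContDiffAt ℝ 1 (pathDefect hX.continuous) (u, Z u) :=
      (contDiff_pathDefect hX hU).contDiffAt
    have hinv := isInvertible_fderiv_pathDefect hX hU hL0 hL (u, Z u) (hTL u.1 hu)
    have h1 := hd.contDiffAt_implicitFunction one_ne_zero hinv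
    refine h1.congr_of_eventuallyEq ?_
    have h2 := hd.eventually_apply_implicitFunction one_ne_zero hinv
    have h3 : ∀ᶠ v : ℝ × E in 𝓝 u, v.1 ∈ Ioo (-T) T :=
      continuous_fst.continuousAt.eventually (isOpen_Ioo.mem_nhds hu)
    filter_upwards [h2, h3] with v hv hv3
    exact (hZu v hv3 _ (hv.trans (hZ u hu))).symm
  -- The path for `(t, x)` at parameter `s` is the solution at time `s * t`: its reparametrization
  -- is a zero of the defect for `(s * t, x)`, and zeros are unique. So evaluation at `1` recovers
  -- the whole path.
  have hscale : ∀ u : ℝ × E, u.1 ∈ Ioo (-T) T → ∀ s : unitInterval,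
      Z (s * u.1, u.2) 1 = Z u s := fun u hu s => by
    have hsu : (s : ℝ) * u.1 ∈ Ioo (-T) T := by
      rw [mem_Ioo, ← abs_lt] at hu ⊢
      rw [abs_mul, abs_of_nonneg s.2.1]
      exact lt_of_le_of_lt (mul_le_of_le_one_left (abs_nonneg _) s.2.2) hu
    let w : unitInterval →ᵇ E := BoundedContinuousFunction.mkOfCompact
      ⟨fun r => Z u (s * r), (Z u).continuous.comp (continuous_const.mul continuous_id)⟩
    have hw : pathDefect hX.continuous ((s * u.1, u.2), w) = 0 := by
      rw [pathDefect_eq_zero_iff]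
      intro r
      have h1 : w r = Z u (s * r) := rfl
      rw [h1, hZ' u hu, mul_comm (s : ℝ) u.1, mul_smul]
      congr 2
      have h2 := intervalIntegral.smul_integral_comp_mul_left (a := (0 : ℝ)) (b := (r : ℝ))
        (fun r => X (IccExtend zero_le_one (Z u) r)) (s : ℝ)
      rw [mul_zero] at h2
      rw [show ((s * r : unitInterval) : ℝ) = (s : ℝ) * r from rfl, ← h2]
      congr 1
      refine intervalIntegral.integral_congr fun q hq => ?_
      rw [uIcc_of_le r.2.1] at hq
      have hq1 : q ∈ Icc (0 : ℝ) 1 := ⟨hq.1, hq.2.trans r.2.2⟩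
      have hq2 : (s : ℝ) * q ∈ Icc (0 : ℝ) 1 :=
        ⟨mul_nonneg s.2.1 hq1.1, mul_le_one₀ s.2.2 hq1.1 hq1.2⟩
      simp only [IccExtend_of_mem zero_le_one _ hq1, IccExtend_of_mem zero_le_one _ hq2]
      rfl
    have h4 := hZu (s * u.1, u.2) hsu w hw
    rw [← h4]
    simp [w]
  refine ⟨T, hT0, fun t x => Z (t, x) 1, fun x => ?_, fun t ht x => ?_, fun t ht x => ?_,
    fun t ht x => ?_⟩
  · have := hZ' (0, x) ⟨by simpa using hT0, hT0⟩ 1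
    simpa using this
  -- Paths live on `[0, 1]`, so `σ = T'` and `σ = -T'` give derivatives within `[0, T']` and `[-T',
  -- 0]`; the two are glued at `t = 0`.
  · obtain ⟨T', hT', hT'T⟩ := exists_between (abs_lt.2 ht)
    have hT'pos : 0 < T' := lt_of_le_of_lt (abs_nonneg _) hT'
    have key : ∀ σ : ℝ, (σ = T' ∨ σ = -T') → ∀ r ∈ Icc (0 : ℝ) 1,
        HasDerivWithinAt (fun r => Z (r * σ, x) 1) (σ • X (Z (r * σ, x) 1)) (Icc 0 1) r := by
      intro σ hσ r hr
      have hσT : σ ∈ Ioo (-T) T := by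
        rcases hσ with rfl | rfl <;> constructor <;> linarith
      have h1 : ∀ r ∈ Icc (0 : ℝ) 1, Z (r * σ, x) 1 =
          x + σ • ∫ q in (0 : ℝ)..r, X (IccExtend zero_le_one (Z (σ, x)) q) := fun r hr => by
        have := hscale (σ, x) hσT ⟨r, hr⟩
        rw [this, hZ' (σ, x) hσT]
      have hcont : Continuous fun q => X (IccExtend zero_le_one (Z (σ, x)) q) :=
        hX.continuous.comp ((Z (σ, x)).continuous.Icc_extend' (h := zero_le_one))
      have h2 : HasDerivAt (fun r : ℝ => x + σ • ∫ q in (0 : ℝ)..r,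
          X (IccExtend zero_le_one (Z (σ, x)) q))
          (σ • X (IccExtend zero_le_one (Z (σ, x)) r)) r :=
        ((intervalIntegral.integral_hasDerivAt_right (hcont.intervalIntegrable _ _)
          (hcont.stronglyMeasurableAtFilter _ _) hcont.continuousAt).const_smul σ).const_add x
      have h3 := h2.hasDerivWithinAt (s := Icc 0 1)
      have h4 : IccExtend zero_le_one (Z (σ, x)) r = Z (r * σ, x) 1 := by
        rw [IccExtend_of_mem zero_le_one _ hr]
        exact (hscale (σ, x) hσT ⟨r, hr⟩).symm
      rw [h4] at h3
      exact h3.congr h1 (h1 r hr)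
    have conv : ∀ σ : ℝ, (σ = T' ∨ σ = -T') → t / σ ∈ Icc (0 : ℝ) 1 →
        HasDerivWithinAt (fun r => Z (r, x) 1) (X (Z (t, x) 1))
          ((fun r => r / σ) ⁻¹' Icc 0 1) t := by
      intro σ hσ hr
      have hσ0 : σ ≠ 0 := by rcases hσ with rfl | rfl <;> linarith
      have h1 := key σ hσ _ hr
      have h2 : HasDerivWithinAt (fun r : ℝ => r / σ) (1 / σ) ((fun r => r / σ) ⁻¹' Icc 0 1) t :=
        ((hasDerivAt_id t).div_const σ).hasDerivWithinAt
      have h3 := h1.scomp t h2 (fun r hr => hr)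
      have h5 : ∀ r : ℝ, r / σ * σ = r := fun r => div_mul_cancel₀ r hσ0
      have h4 : ((fun r => Z (r * σ, x) 1) ∘ fun r => r / σ) = fun r => Z (r, x) 1 := by
        funext r
        simp only [Function.comp, h5]
      rw [h4, smul_smul, one_div, inv_mul_cancel₀ hσ0, one_smul, h5] at h3
      exact h3
    have hdn : ∀ r : ℝ, 0 ≤ r / T' ↔ 0 ≤ r := fun r => by
      rw [le_div_iff₀ hT'pos, zero_mul]
    have e1 : (fun r : ℝ => r / T') ⁻¹' Icc 0 1 = Icc 0 T' := by
      ext r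
      simp only [mem_preimage, mem_Icc, div_le_one hT'pos]
      exact and_congr_left fun _ => hdn r
    have e2 : (fun r : ℝ => r / (-T')) ⁻¹' Icc 0 1 = Icc (-T') 0 := by
      ext r
      simp only [mem_preimage, mem_Icc, div_neg, ← neg_div, div_le_one hT'pos]
      rw [hdn]
      constructor <;> rintro ⟨h1, h2⟩ <;> constructor <;> linarith
    have c1 := conv T' (Or.inl rfl)
    have c2 := conv (-T') (Or.inr rfl)
    rw [e1] at c1
    rw [e2] at c2
    have m1 : t / T' ∈ Icc (0 : ℝ) 1 ↔ t ∈ Icc 0 T' := by rw [← e1]; rfl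
    have m2 : t / (-T') ∈ Icc (0 : ℝ) 1 ↔ t ∈ Icc (-T') 0 := by rw [← e2]; rfl
    rw [m1] at c1
    rw [m2] at c2
    have hab := abs_lt.1 hT'
    rcases lt_trichotomy t 0 with h | h | h
    · exact (c2 ⟨hab.1.le, h.le⟩).hasDerivAt (Icc_mem_nhds hab.1 h)
    · subst h
      have := (c2 ⟨hab.1.le, le_rfl⟩).union (c1 ⟨le_rfl, hab.2.le⟩)
      rw [Icc_union_Icc_eq_Icc hab.1.le hab.2.le] at this
      exact this.hasDerivAt (Icc_mem_nhds hab.1 hab.2)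
    · exact (c1 ⟨h.le, hab.2.le⟩).hasDerivAt (Icc_mem_nhds h hab.2)
  · have h1 := hZC (t, x) ht
    exact (BoundedContinuousFunction.evalCLM ℝ (1 : unitInterval)).contDiff.contDiffAt.comp (t, x) h1
  -- The bound uniform in `s` is the local Lipschitz bound of `Z` as a map into paths with the sup
  -- norm.
  · obtain ⟨C, s, hs, hC⟩ := (hZC (t, x) ht).hasStrictFDerivAt one_ne_zero
      |>.exists_lipschitzOnWith
    refine ⟨C, C.2, ?_⟩
    have h3 : ∀ᶠ v : ℝ × E in 𝓝 (t, x), v.1 ∈ Ioo (-T) T :=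
      continuous_fst.continuousAt.eventually (isOpen_Ioo.mem_nhds ht)
    filter_upwards [hs, h3] with u hu hu3 r hr
    have h4 := hC.dist_le_mul u hu (t, x) (mem_of_mem_nhds hs)
    rw [← dist_eq_norm, ← dist_eq_norm]
    have h5 : Z (r * u.1, u.2) 1 = Z u ⟨r, hr⟩ := hscale u hu3 ⟨r, hr⟩
    have h6 : Z (r * t, x) 1 = Z (t, x) ⟨r, hr⟩ := hscale (t, x) ht ⟨r, hr⟩
    rw [h5, h6]
    exact (BoundedContinuousFunction.dist_coe_le_dist _).trans h4

end Flow

/-! ### Hamiltonians that are even and strongly convex in the momenta -/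

section Hamiltonian

open scoped RealInnerProductSpace

variable {V : Type*} [NormedAddCommGroup V] [InnerProductSpace ℝ V] [CompleteSpace V]
  [FiniteDimensional ℝ V]

/-- The partial gradient `∂H/∂p`. -/
noncomputable def pGrad (H : V × V → ℝ) (z : V × V) : V := gradient (fun y => H (z.1, y)) z.2

/-- The partial gradient `∂H/∂q`. -/
noncomputable def qGrad (H : V × V → ℝ) (z : V × V) : V := gradient (fun x => H (x, z.2)) z.1

variable {H : V × V → ℝ} {z : V × V}

theorem pGrad_eq_toDual_symm (hd : DifferentiableAt ℝ H z) :
    pGrad H z = (InnerProductSpace.toDual ℝ V).symm (fderiv ℝ H z ∘L .inr ℝ V V) := by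
  have h1 : HasFDerivAt (fun y => H (z.1, y)) (fderiv ℝ H z ∘L .inr ℝ V V) z.2 :=
    HasFDerivAt.comp (g := H) (f := fun y => (z.1, y)) z.2 hd.hasFDerivAt
      (hasFDerivAt_prodMk_right z.1 z.2)
  rw [pGrad, gradient, h1.fderiv]

theorem qGrad_eq_toDual_symm (hd : DifferentiableAt ℝ H z) :
    qGrad H z = (InnerProductSpace.toDual ℝ V).symm (fderiv ℝ H z ∘L .inl ℝ V V) := by
  have h1 : HasFDerivAt (fun x => H (x, z.2)) (fderiv ℝ H z ∘L .inl ℝ V V) z.1 :=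
    HasFDerivAt.comp (g := H) (f := fun x => (x, z.2)) z.1 hd.hasFDerivAt
      (hasFDerivAt_prodMk_left z.1 z.2)
  rw [qGrad, gradient, h1.fderiv]

theorem inner_pGrad (hd : DifferentiableAt ℝ H z) (b : V) :
    ⟪pGrad H z, b⟫ = fderiv ℝ H z (0, b) := by
  rw [pGrad_eq_toDual_symm hd, InnerProductSpace.toDual_symm_apply]; rfl

theorem inner_qGrad (hd : DifferentiableAt ℝ H z) (a : V) :
    ⟪qGrad H z, a⟫ = fderiv ℝ H z (a, 0) := by
  rw [qGrad_eq_toDual_symm hd, InnerProductSpace.toDual_symm_apply]; rfl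

theorem fderiv_eq_inner_add_inner (hd : DifferentiableAt ℝ H z) (w : V × V) :
    fderiv ℝ H z w = ⟪qGrad H z, w.1⟫ + ⟪pGrad H z, w.2⟫ := by
  rw [inner_pGrad hd, inner_qGrad hd, ← map_add]; simp

theorem _root_.ContDiffAt.eventually_differentiableAt_two (h : ContDiffAt ℝ 2 H z) :
    ∀ᶠ w in 𝓝 z, DifferentiableAt ℝ H w :=
  (h.eventually (by simp)).mono fun _ hw => hw.differentiableAt two_ne_zero

theorem contDiffAt_pGrad (h : ContDiffAt ℝ 2 H z) : ContDiffAt ℝ 1 (pGrad H) z := by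
  have h1 : ContDiffAt ℝ 1 (fderiv ℝ H) z := h.fderiv_right (m := 1) (by norm_num)
  have h2 : ContDiffAt ℝ 1 (fun w => (InnerProductSpace.toDual ℝ V).symm
      (fderiv ℝ H w ∘L .inr ℝ V V)) z :=
    (InnerProductSpace.toDual ℝ V).symm.toContinuousLinearEquiv.contDiff.contDiffAt.comp z
      (h1.clm_comp contDiffAt_const)
  refine h2.congr_of_eventuallyEq ?_
  filter_upwards [h.eventually_differentiableAt_two] with w hw
  exact pGrad_eq_toDual_symm hw

theorem contDiffAt_qGrad (h : ContDiffAt ℝ 2 H z) : ContDiffAt ℝ 1 (qGrad H) z := by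
  have h1 : ContDiffAt ℝ 1 (fderiv ℝ H) z := h.fderiv_right (m := 1) (by norm_num)
  have h2 : ContDiffAt ℝ 1 (fun w => (InnerProductSpace.toDual ℝ V).symm
      (fderiv ℝ H w ∘L .inl ℝ V V)) z :=
    (InnerProductSpace.toDual ℝ V).symm.toContinuousLinearEquiv.contDiff.contDiffAt.comp z
      (h1.clm_comp contDiffAt_const)
  refine h2.congr_of_eventuallyEq ?_
  filter_upwards [h.eventually_differentiableAt_two] with w hw
  exact qGrad_eq_toDual_symm hw

attribute [irreducible] pGrad qGrad

/-- A `C²` Hamiltonian over the open set `M` that is even and strongly convex in the momenta. -/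
structure IsConvexHamiltonian (M : Set V) (H : V × V → ℝ) : Prop where
  isOpen : IsOpen M
  contDiffOn : ContDiffOn ℝ 2 H (M ×ˢ univ)
  even : ∀ q ∈ M, ∀ p, H (q, -p) = H (q, p)
  hessian : ∃ ν : V → ℝ, ContinuousOn ν M ∧ (∀ q ∈ M, 0 < ν q) ∧
    ∀ q ∈ M, ∀ p ξ, ν q * ‖ξ‖ ^ 2 ≤ ⟪fderiv ℝ (pGrad H) (q, p) (0, ξ), ξ⟫

namespace IsConvexHamiltonian

variable {M : Set V} (hH : IsConvexHamiltonian M H) {q : V}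

include hH

theorem contDiffAt (hq : q ∈ M) (p : V) : ContDiffAt ℝ 2 H (q, p) :=
  hH.contDiffOn.contDiffAt ((hH.isOpen.prod isOpen_univ).mem_nhds ⟨hq, mem_univ p⟩)

theorem differentiableAt (hq : q ∈ M) (p : V) : DifferentiableAt ℝ H (q, p) :=
  (hH.contDiffAt hq p).differentiableAt two_ne_zero

theorem contDiffAt_pGrad (hq : q ∈ M) (p : V) : ContDiffAt ℝ 1 (pGrad H) (q, p) :=
  BrakeOrbit.contDiffAt_pGrad (hH.contDiffAt hq p)

theorem contDiffAt_qGrad (hq : q ∈ M) (p : V) : ContDiffAt ℝ 1 (qGrad H) (q, p) :=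
  BrakeOrbit.contDiffAt_qGrad (hH.contDiffAt hq p)

theorem hasFDerivAt_pGrad (hq : q ∈ M) (p : V) :
    HasFDerivAt (pGrad H) (fderiv ℝ (pGrad H) (q, p)) (q, p) :=
  ((hH.contDiffAt_pGrad hq p).differentiableAt one_ne_zero).hasFDerivAt

theorem hasDerivAt_line (hq : q ∈ M) (p d : V) (s : ℝ) :
    HasDerivAt (fun s : ℝ => H (q, p + s • d)) ⟪pGrad H (q, p + s • d), d⟫ s := by
  have h1 : HasDerivAt (fun s : ℝ => (q, p + s • d)) ((0 : V), d) s := by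
    have h0 := ((hasDerivAt_id s).smul_const d).const_add p
    rw [one_smul] at h0
    exact (hasDerivAt_const s q).prodMk h0
  have h2 := (hH.differentiableAt hq (p + s • d)).hasFDerivAt.comp_hasDerivAt s h1
  rw [inner_pGrad (hH.differentiableAt hq _)]
  exact h2

theorem hasDerivAt_pGrad_line (hq : q ∈ M) (p d : V) (s : ℝ) :
    HasDerivAt (fun s : ℝ => pGrad H (q, p + s • d))
      (fderiv ℝ (pGrad H) (q, p + s • d) (0, d)) s := by
  have h1 : HasDerivAt (fun s : ℝ => (q, p + s • d)) ((0 : V), d) s := by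
    have h0 := ((hasDerivAt_id s).smul_const d).const_add p
    rw [one_smul] at h0
    exact (hasDerivAt_const s q).prodMk h0
  exact (hH.hasFDerivAt_pGrad hq (p + s • d)).comp_hasDerivAt s h1

theorem mul_norm_sub_sq_le {ν : ℝ} (hq : q ∈ M)
    (hν : ∀ p ξ, ν * ‖ξ‖ ^ 2 ≤ ⟪fderiv ℝ (pGrad H) (q, p) (0, ξ), ξ⟫) (p₁ p₂ : V) :
    ν * ‖p₂ - p₁‖ ^ 2 ≤ ⟪pGrad H (q, p₂) - pGrad H (q, p₁), p₂ - p₁⟫ := by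
  set d := p₂ - p₁ with hd
  set f : ℝ → ℝ := fun s => ⟪pGrad H (q, p₁ + s • d), d⟫ with hf
  have hder : ∀ s, HasDerivAt f ⟪fderiv ℝ (pGrad H) (q, p₁ + s • d) (0, d), d⟫ s := fun s => by
    have := (hH.hasDerivAt_pGrad_line hq p₁ d s).inner ℝ (hasDerivAt_const s d)
    simpa using this
  obtain ⟨c, -, hc⟩ := exists_hasDerivAt_eq_slope f _ zero_lt_one
    (fun s _ => (hder s).continuousAt.continuousWithinAt) (fun s _ => hder s)
  have h1 := hν (p₁ + c • d) d
  rw [hc] at h1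
  simpa [hf, hd, inner_sub_left] using h1

/-- Strong monotonicity of the gradient makes the difference of the two sides, taken along the
segment, nondecreasing. This quadratic lower bound is the form in which convexity is used everywhere
below. -/
theorem add_le_of_hessian {ν : ℝ} (hq : q ∈ M)
    (hν : ∀ p ξ, ν * ‖ξ‖ ^ 2 ≤ ⟪fderiv ℝ (pGrad H) (q, p) (0, ξ), ξ⟫) (p₁ p₂ : V) :
    H (q, p₁) + ⟪pGrad H (q, p₁), p₂ - p₁⟫ + ν / 2 * ‖p₂ - p₁‖ ^ 2 ≤ H (q, p₂) := by
  set d := p₂ - p₁ with hd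
  set g : ℝ → ℝ := fun s => H (q, p₁ + s • d) - s * ⟪pGrad H (q, p₁), d⟫ - ν / 2 * ‖d‖ ^ 2 * s ^ 2
    with hg
  have hder : ∀ s, HasDerivAt g (⟪pGrad H (q, p₁ + s • d), d⟫ - ⟪pGrad H (q, p₁), d⟫
      - ν / 2 * ‖d‖ ^ 2 * (2 * s)) s := fun s => by
    have h1 := hH.hasDerivAt_line hq p₁ d s
    have h2 := (hasDerivAt_id s).mul_const ⟪pGrad H (q, p₁), d⟫
    have h3 := (hasDerivAt_pow 2 s).const_mul (ν / 2 * ‖d‖ ^ 2)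
    refine ((h1.sub h2).sub h3).congr_deriv ?_
    simp
  have hmono : MonotoneOn g (Icc 0 1) := by
    refine monotoneOn_of_deriv_nonneg (convex_Icc 0 1)
      (fun s _ => (hder s).continuousAt.continuousWithinAt)
      (fun s _ => (hder s).differentiableAt.differentiableWithinAt) fun s hs => ?_
    rw [interior_Icc] at hs
    rw [(hder s).deriv]
    have h1 := hH.mul_norm_sub_sq_le hq hν p₁ (p₁ + s • d)
    rw [add_sub_cancel_left, norm_smul, inner_smul_right, inner_sub_left, Real.norm_eq_abs,
      abs_of_pos hs.1] at h1
    have h2 : s * (ν * s * ‖d‖ ^ 2) ≤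
        s * (⟪pGrad H (q, p₁ + s • d), d⟫ - ⟪pGrad H (q, p₁), d⟫) := by
      refine le_trans (le_of_eq ?_) h1
      ring
    have h3 := le_of_mul_le_mul_left h2 hs.1
    linarith
  have h := hmono (left_mem_Icc.2 zero_le_one) (right_mem_Icc.2 zero_le_one) zero_le_one
  simp only [hg, zero_smul, add_zero, one_smul, zero_mul, one_mul, hd, add_sub_cancel] at h
  rw [← hd] at h
  norm_num at h
  linarith

theorem pGrad_neg (hq : q ∈ M) (p : V) : pGrad H (q, -p) = -pGrad H (q, p) := by
  refine ext_inner_right ℝ fun d => ?_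
  have h1 := hH.hasDerivAt_line hq (-p) d 0
  have h2 := hH.hasDerivAt_line hq p (-d) 0
  have h3 : (fun s : ℝ => H (q, -p + s • d)) = fun s : ℝ => H (q, p + s • -d) := by
    funext s
    rw [← hH.even q hq (p + s • -d)]
    congr 2
    rw [smul_neg, neg_add, neg_neg]
  rw [h3] at h1
  have := h1.unique h2
  simpa using this

theorem qGrad_neg (hq : q ∈ M) (p : V) : qGrad H (q, -p) = qGrad H (q, p) := by
  have h : (fun x => H (x, -p)) =ᶠ[𝓝 q] fun x => H (x, p) := by
    filter_upwards [hH.isOpen.mem_nhds hq] with x hx using hH.even x hx p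
  simp only [qGrad]
  rw [gradient, gradient, h.fderiv_eq]

theorem pGrad_zero (hq : q ∈ M) : pGrad H (q, 0) = 0 := by
  have := hH.pGrad_neg hq 0
  rw [neg_zero] at this
  have h2 : (2 : ℝ) • pGrad H (q, 0) = 0 := by
    rw [two_smul]
    nth_rewrite 1 [this]
    exact neg_add_cancel _
  exact (smul_eq_zero.1 h2).resolve_left two_ne_zero

theorem inner_pGrad_self_pos (hq : q ∈ M) {p : V} (hp : p ≠ 0) : 0 < ⟪p, pGrad H (q, p)⟫ := by
  obtain ⟨ν, -, hν, h⟩ := hH.hessian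
  have h1 := hH.mul_norm_sub_sq_le hq (h q hq) 0 p
  rw [hH.pGrad_zero hq, sub_zero, sub_zero, real_inner_comm] at h1
  have : 0 < ν q * ‖p‖ ^ 2 := mul_pos (hν q hq) (by positivity)
  linarith

theorem pGrad_ne_zero (hq : q ∈ M) {p : V} (hp : p ≠ 0) : pGrad H (q, p) ≠ 0 := fun h => by
  have := hH.inner_pGrad_self_pos hq hp
  rw [h, inner_zero_right] at this
  exact lt_irrefl _ this

theorem lt_of_ne_zero (hq : q ∈ M) {p : V} (hp : p ≠ 0) : H (q, 0) < H (q, p) := by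
  obtain ⟨ν, -, hν, h⟩ := hH.hessian
  have h1 := hH.add_le_of_hessian hq (h q hq) 0 p
  rw [hH.pGrad_zero hq, sub_zero, inner_zero_left] at h1
  have : 0 < ν q / 2 * ‖p‖ ^ 2 := mul_pos (half_pos (hν q hq)) (by positivity)
  linarith

/-- Momenta at the same energy with positively proportional velocities agree. -/
theorem eq_of_smul_pGrad_eq (hq : q ∈ M) {p₁ p₂ : V} (he : H (q, p₁) = H (q, p₂)) {μ₁ μ₂ : ℝ}
    (h₁ : 0 < μ₁) (h₂ : 0 < μ₂) (h : μ₁ • pGrad H (q, p₁) = μ₂ • pGrad H (q, p₂)) : p₁ = p₂ := by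
  by_contra hne
  obtain ⟨ν, -, hν, hh⟩ := hH.hessian
  have a1 := hH.add_le_of_hessian hq (hh q hq) p₁ p₂
  have a2 := hH.add_le_of_hessian hq (hh q hq) p₂ p₁
  have hpos : 0 < ν q / 2 * ‖p₂ - p₁‖ ^ 2 :=
    mul_pos (half_pos (hν q hq)) (pow_pos (norm_pos_iff.2 (sub_ne_zero.2 (Ne.symm hne))) 2)
  rw [norm_sub_rev p₁ p₂] at a2
  have b1 : ⟪pGrad H (q, p₁), p₂ - p₁⟫ < 0 := by linarith
  have b2 : ⟪pGrad H (q, p₂), p₁ - p₂⟫ < 0 := by linarith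
  have c1 : ⟪μ₁ • pGrad H (q, p₁), p₂ - p₁⟫ < 0 := by
    rw [real_inner_smul_left]; exact mul_neg_of_pos_of_neg h₁ b1
  have c2 : ⟪μ₂ • pGrad H (q, p₂), p₁ - p₂⟫ < 0 := by
    rw [real_inner_smul_left]; exact mul_neg_of_pos_of_neg h₂ b2
  rw [← h, ← neg_sub p₂ p₁, inner_neg_right] at c2
  linarith

/-- On a line through the origin, the energy determines the momentum up to sign. -/
theorem eq_one_or_eq_neg_one (hq : q ∈ M) {p : V} (hp : p ≠ 0) {k : ℝ}
    (he : H (q, k • p) = H (q, p)) : k = 1 ∨ k = -1 := by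
  have key : ∀ c : ℝ, 0 < c → H (q, c • p) = H (q, p) → c = 1 := fun c hc hcp => by
    obtain ⟨ν, -, hν, hh⟩ := hH.hessian
    by_contra hne
    have a1 := hH.add_le_of_hessian hq (hh q hq) p (c • p)
    have a2 := hH.add_le_of_hessian hq (hh q hq) (c • p) p
    have hcp0 : c • p ≠ 0 := smul_ne_zero hc.ne' hp
    have d1 : c • p - p = (c - 1) • p := by rw [sub_smul, one_smul]
    have d2 : p - c • p = (1 - c) • p := by rw [sub_smul, one_smul]
    have i1 := hH.inner_pGrad_self_pos hq hp
    have i2 := hH.inner_pGrad_self_pos hq hcp0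
    rw [real_inner_smul_left, real_inner_comm] at i2
    rw [real_inner_comm] at i1
    have i3 : 0 < ⟪pGrad H (q, c • p), p⟫ := pos_of_mul_pos_right i2 hc.le
    have hpos : ∀ w : V, w ≠ 0 → 0 < ν q / 2 * ‖w‖ ^ 2 := fun w hw =>
      mul_pos (half_pos (hν q hq)) (pow_pos (norm_pos_iff.2 hw) 2)
    rw [d1, real_inner_smul_right] at a1
    rw [d2, real_inner_smul_right] at a2
    have p1 := hpos ((c - 1) • p) (smul_ne_zero (sub_ne_zero.2 hne) hp)
    have p2 := hpos ((1 - c) • p) (smul_ne_zero (sub_ne_zero.2 (Ne.symm hne)) hp)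
    have e1 : (c - 1) * ⟪pGrad H (q, p), p⟫ < 0 := by linarith
    have e2 : (1 - c) * ⟪pGrad H (q, c • p), p⟫ < 0 := by linarith
    have f1 : c - 1 < 0 := by by_contra hh; exact absurd (mul_nonneg (not_lt.1 hh) i1.le) (by linarith)
    have f2 : 1 - c < 0 := by by_contra hh; exact absurd (mul_nonneg (not_lt.1 hh) i3.le) (by linarith)
    linarith
  rcases lt_trichotomy k 0 with h | h | h
  · right
    have := key (-k) (by linarith) (by rw [neg_smul, hH.even q hq]; exact he)
    linarith
  · subst h
    rw [zero_smul] at he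
    exact absurd he (hH.lt_of_ne_zero hq hp).ne
  · exact Or.inl (key k h he)

theorem mono {N : Set V} (hN : IsOpen N) (h : N ⊆ M) : IsConvexHamiltonian N H where
  isOpen := hN
  contDiffOn := hH.contDiffOn.mono (prod_mono h subset_rfl)
  even := fun q hq => hH.even q (h hq)
  hessian := by
    obtain ⟨ν, h1, h2, h3⟩ := hH.hessian
    exact ⟨ν, h1.mono h, fun q hq => h2 q (h hq), fun q hq => h3 q (h hq)⟩

end IsConvexHamiltonian

/-- Along a solution of Hamilton's equations (possibly with a varying time change) the energy is
constant. -/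
theorem hasDerivWithinAt_energy {γ y : ℝ → V} {m : ℝ} {I : Set ℝ} {s : ℝ}
    (hd : DifferentiableAt ℝ H (γ s, y s))
    (hγ : HasDerivWithinAt γ (m • pGrad H (γ s, y s)) I s)
    (hy : HasDerivWithinAt y (-(m • qGrad H (γ s, y s))) I s) :
    HasDerivWithinAt (fun r => H (γ r, y r)) 0 I s := by
  have h := HasFDerivAt.comp_hasDerivWithinAt (l := H) (f := fun r => (γ r, y r)) s
    hd.hasFDerivAt (hγ.prodMk hy)
  refine h.congr_deriv ?_
  rw [fderiv_eq_inner_add_inner hd]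
  simp only [inner_neg_right, real_inner_smul_right]
  rw [real_inner_comm (pGrad H (γ s, y s))]
  ring

end Hamiltonian

/-- The Riesz isometry identifies the second iterated derivative with the derivative of the
gradient. -/
theorem IsClassicalType.isConvexHamiltonian {n : ℕ}
    {H : EuclideanSpace ℝ (Fin n) × EuclideanSpace ℝ (Fin n) → ℝ} (hH : IsClassicalType H) :
    IsConvexHamiltonian univ H where
  isOpen := isOpen_univ
  contDiffOn := hH.contDiff.contDiffOn
  even := fun q _ => hH.even q
  hessian := by
    obtain ⟨ν, h1, h2, h3⟩ := hH.hessian_pos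
    refine ⟨ν, h1.continuousOn, fun q _ => h2 q, fun q _ p ξ => (h3 q p ξ).trans (le_of_eq ?_)⟩
    have hd : ∀ z, DifferentiableAt ℝ H z := hH.contDiff.differentiable two_ne_zero
    have e1 : fderiv ℝ (fun p' => H (q, p')) =
        fun p' => InnerProductSpace.toDual ℝ _ (pGrad H (q, p')) := by
      funext p'
      rw [pGrad, gradient, LinearIsometryEquiv.apply_symm_apply]
    have h4 : HasFDerivAt (fun p' => pGrad H (q, p'))
        (fderiv ℝ (pGrad H) (q, p) ∘L .inr ℝ _ _) p :=
      HasFDerivAt.comp (g := pGrad H) (f := fun y => (q, y)) p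
        ((contDiffAt_pGrad hH.contDiff.contDiffAt).differentiableAt one_ne_zero).hasFDerivAt
        (hasFDerivAt_prodMk_right q p)
    rw [iteratedFDeriv_two_apply, e1]
    have h5 := (InnerProductSpace.toDual ℝ (EuclideanSpace ℝ (Fin n))).toContinuousLinearEquiv
      |>.toContinuousLinearMap.hasFDerivAt.comp p h4
    have h6 := h5.fderiv
    simp only [Function.comp_def] at h6
    erw [h6]
    rfl

/-! ### The Jacobi-Finsler metric as support function of the energy sublevel sets -/

section Jacobi

open scoped RealInnerProductSpace

variable {V : Type*} [NormedAddCommGroup V] [InnerProductSpace ℝ V] [CompleteSpace V]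
  [FiniteDimensional ℝ V]

/-- `(p, μ)` is the momentum of energy `E`, with its positive multiplier, whose velocity is
proportional to `v`. -/
def IsJacobiMomentum (H : V × V → ℝ) (E : ℝ) (q v p : V) (μ : ℝ) : Prop :=
  0 < μ ∧ H (q, p) = E ∧ v = μ • pGrad H (q, p)

open Classical in
/-- The momentum of energy `E` in the direction of the velocity `v`. -/
noncomputable def jacobiMomentum (H : V × V → ℝ) (E : ℝ) (q v : V) : V :=
  if h : ∃ u : V × ℝ, IsJacobiMomentum H E q v u.1 u.2 then h.choose.1 else 0

open Classical in
/-- The factor `μ` in `v = μ ∂H/∂p`. -/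
noncomputable def jacobiFactor (H : V × V → ℝ) (E : ℝ) (q v : V) : ℝ :=
  if h : ∃ u : V × ℝ, IsJacobiMomentum H E q v u.1 u.2 then h.choose.2 else 0

/-- The Jacobi-Finsler metric of the energy level `E`. -/
noncomputable def jacobiMetric (H : V × V → ℝ) (E : ℝ) (q v : V) : ℝ :=
  ⟪jacobiMomentum H E q v, v⟫

namespace IsConvexHamiltonian

variable {M : Set V} {H : V × V → ℝ} {E : ℝ} (hH : IsConvexHamiltonian M H)
  (hE : ∀ q ∈ M, H (q, 0) < E) {q v : V}

include hH

omit hH in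
theorem ne_zero_of_energy_eq (hE : ∀ q ∈ M, H (q, 0) < E) (hq : q ∈ M) {p : V}
    (hp : H (q, p) = E) : p ≠ 0 := by
  rintro rfl
  exact (hE q hq).ne hp

theorem norm_sq_le_of_energy_le {ν : ℝ} (hν0 : 0 < ν) (hq : q ∈ M)
    (hν : ∀ p ξ, ν * ‖ξ‖ ^ 2 ≤ ⟪fderiv ℝ (pGrad H) (q, p) (0, ξ), ξ⟫) {p : V}
    (hp : H (q, p) ≤ E) : ‖p‖ ^ 2 ≤ 2 * (E - H (q, 0)) / ν := by
  have h := hH.add_le_of_hessian hq hν 0 p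
  rw [hH.pGrad_zero hq, sub_zero, inner_zero_left] at h
  rw [le_div_iff₀ hν0]
  linarith

/-- For small `s` the slope at `p + s • d` is still negative, and the tangent at that point, which
lies below `H`, then forces the energy there to be at most the energy at `p`. -/
theorem eventually_energy_le (hq : q ∈ M) {p d : V} (hp : H (q, p) ≤ E)
    (hd : ⟪pGrad H (q, p), d⟫ < 0) : ∃ ε > 0, H (q, p + (ε : ℝ) • d) ≤ E := by
  have hc : ContinuousAt (fun s : ℝ => ⟪pGrad H (q, p + s • d), d⟫) 0 :=
    (hH.hasDerivAt_pGrad_line hq p d 0).continuousAt.inner continuousAt_const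
  have h1 : ∀ᶠ s in 𝓝[>] (0 : ℝ), ⟪pGrad H (q, p + s • d), d⟫ < 0 := by
    refine (hc.eventually (gt_mem_nhds ?_)).filter_mono nhdsWithin_le_nhds
    simpa using hd
  obtain ⟨s, hs, hs0⟩ := (h1.and self_mem_nhdsWithin).exists
  obtain ⟨ν, -, hν, hh⟩ := hH.hessian
  refine ⟨s, hs0, ?_⟩
  have a := hH.add_le_of_hessian hq (hh q hq) (p + s • d) p
  have e : p - (p + s • d) = (-s) • d := by rw [neg_smul]; abel
  rw [e, real_inner_smul_right] at a
  have b : 0 ≤ ν q / 2 * ‖(-s) • d‖ ^ 2 := mul_nonneg (half_pos (hν q hq)).le (by positivity)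
  have c := mul_neg_of_pos_of_neg (show (0 : ℝ) < s from hs0) hs
  linarith

include hE

/-- The momentum maximizes `⟪·, v⟫` over the compact set of momenta of energy at most `E`, and the
factor is the Lagrange multiplier. -/
theorem exists_isJacobiMomentum (hq : q ∈ M) (hv : v ≠ 0) :
    ∃ u : V × ℝ, IsJacobiMomentum H E q v u.1 u.2 := by
  obtain ⟨ν, -, hν, hh⟩ := hH.hessian
  have hcont : Continuous fun p => H (q, p) := continuous_iff_continuousAt.2 fun p =>
    (hH.differentiableAt hq p).continuousAt.comp (by fun_prop)
  set K := {p : V | H (q, p) ≤ E} with hK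
  have hKc : IsCompact K := by
    refine Metric.isCompact_of_isClosed_isBounded (isClosed_le hcont continuous_const) ?_
    refine (Metric.isBounded_closedBall (x := (0 : V))
      (r := Real.sqrt (2 * (E - H (q, 0)) / ν q))).subset fun p hp => ?_
    rw [mem_closedBall_zero_iff]
    exact Real.le_sqrt_of_sq_le (hH.norm_sq_le_of_energy_le (hν q hq) hq (hh q hq) hp)
  have h0K : (0 : V) ∈ K := (hE q hq).le
  obtain ⟨p, hpK, hmax⟩ := hKc.exists_isMaxOn ⟨0, h0K⟩
    (f := fun p => ⟪p, v⟫) (by fun_prop)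
  have hmax' : ∀ p' ∈ K, ⟪p', v⟫ ≤ ⟪p, v⟫ := fun p' hp' => hmax hp'
  have hvv : 0 < ⟪v, v⟫ := real_inner_self_pos.2 hv
  -- interior points are not maximal
  have hint : ∀ p' : V, H (q, p') < E → ∃ ε > 0, p' + (ε : ℝ) • v ∈ K := fun p' hp' => by
    have hc : ContinuousAt (fun s : ℝ => H (q, p' + s • v)) 0 :=
      (hH.hasDerivAt_line hq p' v 0).continuousAt
    have h1 : ∀ᶠ s in 𝓝[>] (0 : ℝ), H (q, p' + s • v) < E := by
      refine (hc.eventually (gt_mem_nhds ?_)).filter_mono nhdsWithin_le_nhds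
      simpa using hp'
    obtain ⟨s, hs, hs0⟩ := (h1.and self_mem_nhdsWithin).exists
    exact ⟨s, hs0, hs.le⟩
  have hpE : H (q, p) = E := by
    refine le_antisymm hpK (not_lt.1 fun hlt => ?_)
    obtain ⟨ε, hε, hεK⟩ := hint p hlt
    have := hmax' _ hεK
    rw [inner_add_left, real_inner_smul_left] at this
    linarith [mul_pos hε hvv]
  have hpv : 0 < ⟪p, v⟫ := by
    obtain ⟨ε, hε, hεK⟩ := hint 0 (hE q hq)
    have := hmax' _ hεK
    rw [zero_add, real_inner_smul_left] at this
    linarith [mul_pos hε hvv]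
  have hp0 : p ≠ 0 := ne_zero_of_energy_eq hE hq hpE
  set g := pGrad H (q, p) with hg
  have hg0 : g ≠ 0 := hH.pGrad_ne_zero hq hp0
  have hgg : 0 < ⟪g, g⟫ := real_inner_self_pos.2 hg0
  set μ := ⟪g, v⟫ / ⟪g, g⟫ with hμ
  set w := v - μ • g with hw
  have hgw : ⟪g, w⟫ = 0 := by
    rw [hw, inner_sub_right, real_inner_smul_right, hμ, div_mul_cancel₀ _ hgg.ne', sub_self]
  have hwv : ⟪w, v⟫ = ⟪w, w⟫ := by
    have : v = w + μ • g := by rw [hw]; abel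
    rw [show ⟪w, v⟫ = ⟪w, w + μ • g⟫ from congrArg (fun x => ⟪w, x⟫) this]
    rw [inner_add_right, real_inner_smul_right, real_inner_comm g w, hgw, mul_zero, add_zero]
  -- Here `w` is the part of `v` orthogonal to the gradient `g`. For every `η > 0` the direction `w
  -- - η • g` lowers the energy, so by maximality it cannot increase `⟪·, v⟫`. Letting `η → 0` gives
  -- `w = 0`.
  have hη : ∀ η : ℝ, 0 < η → ⟪w, w⟫ ≤ η * ⟪g, v⟫ := fun η hη => by
    obtain ⟨ε, hε, hle⟩ := hH.eventually_energy_le (E := E) hq (p := p) (d := w - η • g) hpK (by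
      rw [inner_sub_right, real_inner_smul_right, ← hg, hgw, zero_sub]
      exact neg_neg_of_pos (mul_pos hη hgg))
    have := hmax' _ hle
    rw [inner_add_left, real_inner_smul_left, inner_sub_left, real_inner_smul_left, hwv] at this
    have h2 : ε * (⟪w, w⟫ - η * ⟪g, v⟫) ≤ 0 := by linarith
    by_contra hcon
    exact absurd (mul_pos hε (sub_pos.2 (not_le.1 hcon))) (not_lt.2 h2)
  have hw0 : w = 0 := by
    have hlim : Tendsto (fun η : ℝ => η * ⟪g, v⟫) (𝓝[>] 0) (𝓝 0) := by
      have : Tendsto (fun η : ℝ => η * ⟪g, v⟫) (𝓝 0) (𝓝 (0 * ⟪g, v⟫)) :=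
        (continuous_id.mul continuous_const).tendsto 0
      rw [zero_mul] at this
      exact this.mono_left nhdsWithin_le_nhds
    have hle : ⟪w, w⟫ ≤ 0 := ge_of_tendsto hlim (by
      filter_upwards [self_mem_nhdsWithin] with η hη0 using hη η hη0)
    by_contra hne
    exact absurd (real_inner_self_pos.2 hne) (not_lt.2 hle)
  have hvg : v = μ • g := sub_eq_zero.1 hw0
  refine ⟨(p, μ), ?_, hpE, hvg⟩
  rw [hvg, real_inner_smul_right] at hpv
  exact pos_of_mul_pos_left hpv (hH.inner_pGrad_self_pos hq hp0).le

theorem isJacobiMomentum (hq : q ∈ M) (hv : v ≠ 0) :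
    IsJacobiMomentum H E q v (jacobiMomentum H E q v) (jacobiFactor H E q v) := by
  have h := hH.exists_isJacobiMomentum hE hq hv
  rw [jacobiMomentum, jacobiFactor, dif_pos h, dif_pos h]
  exact h.choose_spec

omit hE in
theorem isJacobiMomentum_unique (hq : q ∈ M) (hv : v ≠ 0) {p₁ p₂ : V} {μ₁ μ₂ : ℝ}
    (h₁ : IsJacobiMomentum H E q v p₁ μ₁) (h₂ : IsJacobiMomentum H E q v p₂ μ₂) :
    p₁ = p₂ ∧ μ₁ = μ₂ := by
  have hp : p₁ = p₂ := hH.eq_of_smul_pGrad_eq hq (h₁.2.1.trans h₂.2.1.symm) h₁.1 h₂.1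
    (h₁.2.2.symm.trans h₂.2.2)
  subst hp
  refine ⟨rfl, ?_⟩
  have hg : pGrad H (q, p₁) ≠ 0 := fun h => hv (by rw [h₁.2.2, h, smul_zero])
  exact smul_left_injective ℝ hg (h₁.2.2.symm.trans h₂.2.2)

theorem jacobiMomentum_eq (hq : q ∈ M) (hv : v ≠ 0) {p : V} {μ : ℝ}
    (h : IsJacobiMomentum H E q v p μ) :
    jacobiMomentum H E q v = p ∧ jacobiFactor H E q v = μ :=
  hH.isJacobiMomentum_unique hq hv (hH.isJacobiMomentum hE hq hv) h

theorem jacobiMomentum_ne_zero (hq : q ∈ M) (hv : v ≠ 0) : jacobiMomentum H E q v ≠ 0 :=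
  ne_zero_of_energy_eq hE hq (hH.isJacobiMomentum hE hq hv).2.1

omit hE in
-- The system `(v - μ ∂H/∂p, H) = (0, E)` determines `(p, μ)` from `(q, v)` by the implicit function
-- theorem.
theorem contDiffAt_jacobiEquation (hq : q ∈ M) (v p : V) (μ : ℝ) :
    ContDiffAt ℝ 1 (fun u : (V × V) × (V × ℝ) =>
      (u.1.2 - u.2.2 • pGrad H (u.1.1, u.2.1), H (u.1.1, u.2.1))) ((q, v), (p, μ)) := by
  have h0 : ContDiffAt ℝ 1 (fun u : (V × V) × (V × ℝ) => (u.1.1, u.2.1)) ((q, v), (p, μ)) := by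
    fun_prop
  have h1 : ContDiffAt ℝ 1 (fun u : (V × V) × (V × ℝ) => pGrad H (u.1.1, u.2.1))
      ((q, v), (p, μ)) := (hH.contDiffAt_pGrad hq p).comp ((q, v), (p, μ)) h0
  have h2 : ContDiffAt ℝ 1 (fun u : (V × V) × (V × ℝ) => H (u.1.1, u.2.1))
      ((q, v), (p, μ)) :=
    ((hH.contDiffAt hq p).of_le one_le_two).comp ((q, v), (p, μ)) h0
  have h3 : ContDiffAt ℝ 1 (fun u : (V × V) × (V × ℝ) => u.2.2) ((q, v), (p, μ)) := by fun_prop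
  have h4 : ContDiffAt ℝ 1 (fun u : (V × V) × (V × ℝ) => u.1.2) ((q, v), (p, μ)) := by fun_prop
  exact (h4.sub (h3.smul h1)).prodMk h2

omit hE in
-- The linearization is the bordered Hessian `(a, s) ↦ (-(μ H_pp a + s g), ⟪g, a⟫)` with `g =
-- ∂H/∂p`. On its kernel, pairing the first component with `a` removes the `g` term, so positivity
-- of `H_pp` gives `a = 0`, and then `g ≠ 0` gives `s = 0`.
theorem isInvertible_fderiv_jacobiEquation (hq : q ∈ M) (v : V) {p : V} (hp : p ≠ 0) {μ : ℝ}
    (hμ : 0 < μ) :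
    (fderiv ℝ (fun u : (V × V) × (V × ℝ) =>
      (u.1.2 - u.2.2 • pGrad H (u.1.1, u.2.1), H (u.1.1, u.2.1))) ((q, v), (p, μ)) ∘L
        .inr ℝ (V × V) (V × ℝ)).IsInvertible := by
  set A := fderiv ℝ (fun u : (V × V) × (V × ℝ) =>
      (u.1.2 - u.2.2 • pGrad H (u.1.1, u.2.1), H (u.1.1, u.2.1))) ((q, v), (p, μ)) ∘L
        .inr ℝ (V × V) (V × ℝ) with hA
  have hform : ∀ w : V × ℝ, A w = (-(μ • fderiv ℝ (pGrad H) (q, p) (0, w.1)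
      + w.2 • pGrad H (q, p)), ⟪pGrad H (q, p), w.1⟫) := by
    have e1 : HasFDerivAt (fun w : V × ℝ => (v - w.2 • pGrad H (q, w.1), H (q, w.1))) A (p, μ) :=
      HasFDerivAt.comp (g := fun u : (V × V) × (V × ℝ) =>
        (u.1.2 - u.2.2 • pGrad H (u.1.1, u.2.1), H (u.1.1, u.2.1)))
        (f := fun w : V × ℝ => ((q, v), w)) (p, μ)
        ((hH.contDiffAt_jacobiEquation hq v p μ).differentiableAt one_ne_zero).hasFDerivAt
        (hasFDerivAt_prodMk_right (q, v) (p, μ))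
    intro w
    have h1 : HasFDerivAt (fun w : V × ℝ => (q, w.1))
        ((ContinuousLinearMap.inr ℝ V V) ∘L .fst ℝ V ℝ) (p, μ) :=
      (hasFDerivAt_prodMk_right q p).comp (p, μ) hasFDerivAt_fst
    have h2 := (hH.hasFDerivAt_pGrad hq p).comp (p, μ) h1
    have h3 := ((hH.differentiableAt hq p).hasFDerivAt).comp (p, μ) h1
    have h4 := ((hasFDerivAt_snd (p := (p, μ)) (𝕜 := ℝ)).smul h2).const_sub v
    have h5 := e1.unique (h4.prodMk h3)
    rw [h5, inner_pGrad (hH.differentiableAt hq p)]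
    simp
  have hinj : Function.Injective A.toLinearMap := by
    rw [← LinearMap.ker_eq_bot, LinearMap.ker_eq_bot']
    intro w hw
    have hw' : A w = 0 := hw
    rw [hform] at hw'
    obtain ⟨e1, e2⟩ := Prod.mk.inj hw'
    rw [neg_eq_zero] at e1
    obtain ⟨ν, -, hν, hh⟩ := hH.hessian
    have e3 : ⟪μ • fderiv ℝ (pGrad H) (q, p) (0, w.1) + w.2 • pGrad H (q, p), w.1⟫ = 0 := by
      rw [e1, inner_zero_left]
    rw [inner_add_left, real_inner_smul_left, real_inner_smul_left, e2, mul_zero, add_zero] at e3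
    have e4 := (mul_eq_zero.1 e3).resolve_left hμ.ne'
    have e5 := hh q hq p w.1
    rw [e4] at e5
    have e6 : w.1 = 0 := by
      by_contra hne
      exact absurd (mul_pos (hν q hq) (pow_pos (norm_pos_iff.2 hne) 2)) (not_lt.2 e5)
    rw [e6] at e1
    rw [show ((0 : V), (0 : V)) = 0 from rfl, map_zero, smul_zero, zero_add] at e1
    have e7 := (smul_eq_zero.1 e1).resolve_right (hH.pGrad_ne_zero hq hp)
    exact Prod.ext e6 e7
  refine ⟨(LinearEquiv.ofInjectiveEndo A.toLinearMap hinj).toContinuousLinearEquiv, ?_⟩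
  ext w <;> rfl

/-- The momentum and the factor depend on position and velocity in a `C¹` way. -/
theorem contDiffAt_jacobiMomentum_prod (hq : q ∈ M) (hv : v ≠ 0) :
    ContDiffAt ℝ 1 (fun u : V × V => (jacobiMomentum H E u.1 u.2, jacobiFactor H E u.1 u.2))
      (q, v) := by
  have hJ := hH.isJacobiMomentum hE hq hv
  have hd := hH.contDiffAt_jacobiEquation hq v (jacobiMomentum H E q v) (jacobiFactor H E q v)
  have hi := hH.isInvertible_fderiv_jacobiEquation hq v (hH.jacobiMomentum_ne_zero hE hq hv) hJ.1
  have h1 := hd.contDiffAt_implicitFunction one_ne_zero hi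
  refine h1.congr_of_eventuallyEq ?_
  have h2 := hd.eventually_apply_implicitFunction one_ne_zero hi
  have h3 := hd.implicitFunction_apply_self one_ne_zero hi
  have h4 : ∀ᶠ u in 𝓝 (q, v), 0 < (hd.implicitFunction one_ne_zero hi u).2 := by
    refine (continuous_snd.continuousAt.comp h1.continuousAt).eventually (lt_mem_nhds ?_)
    simp only [Function.comp]
    rw [h3]
    exact hJ.1
  have h5 : ∀ᶠ u : V × V in 𝓝 (q, v), u.1 ∈ M :=
    continuous_fst.continuousAt.eventually (hH.isOpen.mem_nhds hq)
  have h6 : ∀ᶠ u : V × V in 𝓝 (q, v), u.2 ≠ 0 :=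
    continuous_snd.continuousAt.eventually (eventually_ne_nhds hv)
  filter_upwards [h2, h4, h5, h6] with u e2 e4 e5 e6
  obtain ⟨a, b⟩ := Prod.mk.inj e2
  rw [hJ.2.1] at b
  rw [← hJ.2.2, sub_self, sub_eq_zero] at a
  have := hH.jacobiMomentum_eq hE e5 e6 ⟨e4, b, a⟩
  exact Prod.ext this.1 this.2

theorem contDiffAt_jacobiMomentum (hq : q ∈ M) (hv : v ≠ 0) :
    ContDiffAt ℝ 1 (fun u : V × V => jacobiMomentum H E u.1 u.2) (q, v) :=
  (hH.contDiffAt_jacobiMomentum_prod hE hq hv).fst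

theorem contDiffAt_jacobiFactor (hq : q ∈ M) (hv : v ≠ 0) :
    ContDiffAt ℝ 1 (fun u : V × V => jacobiFactor H E u.1 u.2) (q, v) :=
  (hH.contDiffAt_jacobiMomentum_prod hE hq hv).snd

theorem eventually_mem_and_ne_zero (hq : q ∈ M) (hv : v ≠ 0) :
    ∀ᶠ u : V × V in 𝓝 (q, v), u.1 ∈ M ∧ u.2 ≠ 0 :=
  (continuous_fst.continuousAt.eventually (hH.isOpen.mem_nhds hq)).and
    (continuous_snd.continuousAt.eventually (eventually_ne_nhds hv))

/-- An envelope formula. The derivative `dy` of the momentum enters only through `⟪dy, v⟫ = μ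
⟪∂H/∂p, dy⟫`, which the differentiated energy identity turns into `-μ ⟪∂H/∂q, dq⟫`. -/
theorem hasFDerivAt_jacobiMetric (hq : q ∈ M) (hv : v ≠ 0) :
    HasFDerivAt (fun u : V × V => jacobiMetric H E u.1 u.2)
      (innerSL ℝ (-(jacobiFactor H E q v • qGrad H (q, jacobiMomentum H E q v))) ∘L .fst ℝ V V +
        innerSL ℝ (jacobiMomentum H E q v) ∘L .snd ℝ V V) (q, v) := by
  have hJ := hH.isJacobiMomentum hE hq hv
  set y := jacobiMomentum H E q v with hy
  set dy := fderiv ℝ (fun u : V × V => jacobiMomentum H E u.1 u.2) (q, v) with hdy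
  have h1 : HasFDerivAt (fun u : V × V => jacobiMomentum H E u.1 u.2) dy (q, v) :=
    ((hH.contDiffAt_jacobiMomentum hE hq hv).differentiableAt one_ne_zero).hasFDerivAt
  have h2 : HasFDerivAt (fun u : V × V => jacobiMetric H E u.1 u.2) _ (q, v) :=
    h1.inner ℝ (hasFDerivAt_snd (p := (q, v)) (𝕜 := ℝ))
  refine h2.congr_fderiv ?_
  -- differentiate the energy identity
  have h3 : HasFDerivAt (fun u : V × V => H (u.1, jacobiMomentum H E u.1 u.2))
      (fderiv ℝ H (q, y) ∘L ((ContinuousLinearMap.fst ℝ V V).prod dy)) (q, v) :=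
    HasFDerivAt.comp (g := H) (f := fun u : V × V => (u.1, jacobiMomentum H E u.1 u.2)) (q, v)
      (hH.differentiableAt hq y).hasFDerivAt
      ((hasFDerivAt_fst (p := (q, v)) (𝕜 := ℝ)).prodMk h1)
  have h4 : (fun u : V × V => H (u.1, jacobiMomentum H E u.1 u.2)) =ᶠ[𝓝 (q, v)] fun _ => E := by
    filter_upwards [hH.eventually_mem_and_ne_zero hE hq hv] with u hu
    exact (hH.isJacobiMomentum hE hu.1 hu.2).2.1
  have h5 := (h3.congr_of_eventuallyEq h4.symm).unique (hasFDerivAt_const E (q, v))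
  refine ContinuousLinearMap.ext fun w => ?_
  have h6 : ⟪qGrad H (q, y), w.1⟫ + ⟪pGrad H (q, y), dy w⟫ = 0 := by
    have := congrArg (fun A : V × V →L[ℝ] ℝ => A w) h5
    rw [← fderiv_eq_inner_add_inner (hH.differentiableAt hq y) (w.1, dy w)]
    exact this
  have h7 : ⟪dy w, v⟫ = -(jacobiFactor H E q v * ⟪qGrad H (q, y), w.1⟫) := by
    have : ⟪dy w, v⟫ = jacobiFactor H E q v * ⟪pGrad H (q, y), dy w⟫ := by
      conv_lhs => rw [hJ.2.2]
      rw [real_inner_smul_right, real_inner_comm]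
    rw [this, eq_neg_of_add_eq_zero_right h6]
    ring
  simp only [ContinuousLinearMap.comp_apply, fderivInnerCLM_apply, ContinuousLinearMap.prod_apply,
    add_apply, ContinuousLinearMap.coe_fst', ContinuousLinearMap.coe_snd',
    innerSL_apply_apply, inner_neg_left, real_inner_smul_left]
  rw [h7]
  ring

/-- The envelope formula contains no derivative of the momentum, so the metric is one order smoother
than the `C¹` momentum and factor. -/
theorem contDiffAt_jacobiMetric (hq : q ∈ M) (hv : v ≠ 0) :
    ContDiffAt ℝ 2 (fun u : V × V => jacobiMetric H E u.1 u.2) (q, v) := by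
  rw [show (2 : WithTop ℕ∞) = ((1 : ℕ) : WithTop ℕ∞) + 1 by norm_num]
  rw [contDiffAt_succ_iff_hasFDerivAt]
  refine ⟨fun u => innerSL ℝ (-(jacobiFactor H E u.1 u.2 •
      qGrad H (u.1, jacobiMomentum H E u.1 u.2))) ∘L .fst ℝ V V +
        innerSL ℝ (jacobiMomentum H E u.1 u.2) ∘L .snd ℝ V V,
    ⟨_, hH.eventually_mem_and_ne_zero hE hq hv, fun u hu =>
      hH.hasFDerivAt_jacobiMetric hE hu.1 hu.2⟩, ?_⟩
  have hm := hH.contDiffAt_jacobiMomentum hE hq hv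
  have h1 : ContDiffAt ℝ 1 (fun u : V × V => qGrad H (u.1, jacobiMomentum H E u.1 u.2)) (q, v) :=
    (hH.contDiffAt_qGrad hq _).comp (q, v) (contDiffAt_fst.prodMk hm)
  have h2 := ((hH.contDiffAt_jacobiFactor hE hq hv).smul h1).neg
  exact (((innerSL ℝ).contDiff.contDiffAt.comp (q, v) h2).clm_comp contDiffAt_const).add
    (((innerSL ℝ).contDiff.contDiffAt.comp (q, v) hm).clm_comp contDiffAt_const)

theorem jacobiMetric_eq (hq : q ∈ M) (hv : v ≠ 0) :
    jacobiMetric H E q v = jacobiFactor H E q v *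
      ⟪jacobiMomentum H E q v, pGrad H (q, jacobiMomentum H E q v)⟫ := by
  rw [jacobiMetric]
  nth_rewrite 2 [(hH.isJacobiMomentum hE hq hv).2.2]
  rw [real_inner_smul_right]

theorem jacobiMetric_pos (hq : q ∈ M) (hv : v ≠ 0) : 0 < jacobiMetric H E q v := by
  rw [hH.jacobiMetric_eq hE hq hv]
  exact mul_pos (hH.isJacobiMomentum hE hq hv).1
    (hH.inner_pGrad_self_pos hq (hH.jacobiMomentum_ne_zero hE hq hv))

theorem hasFDerivAt_jacobiMetric_sq_velocity (hq : q ∈ M) (hv : v ≠ 0) :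
    HasFDerivAt (fun v => jacobiMetric H E q v ^ 2)
      ((2 * jacobiMetric H E q v) • innerSL ℝ (jacobiMomentum H E q v)) v := by
  have h := HasFDerivAt.comp (f := fun v => (q, v)) v (hH.hasFDerivAt_jacobiMetric hE hq hv)
    (hasFDerivAt_prodMk_right q v)
  refine (h.pow 2).congr_fderiv ?_
  ext w
  simp

theorem hasFDerivAt_jacobiMetric_sq_position (hq : q ∈ M) (hv : v ≠ 0) :
    HasFDerivAt (fun x => jacobiMetric H E x v ^ 2)
      ((2 * jacobiMetric H E q v) •
        innerSL ℝ (-(jacobiFactor H E q v • qGrad H (q, jacobiMomentum H E q v)))) q := by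
  have h := HasFDerivAt.comp (f := fun x => (x, v)) q (hH.hasFDerivAt_jacobiMetric hE hq hv)
    (hasFDerivAt_prodMk_left q v)
  refine (h.pow 2).congr_fderiv ?_
  ext w
  simp

/-- With `dy` the velocity derivative of the momentum, the Hessian of `F²` is `2 F ⟪dy ξ, ξ⟫ + 2 ⟪y,
ξ⟫²`. Differentiating the equations for `(y, μ)` gives `⟪dy ξ, ξ⟫ = μ ⟪H_pp dy ξ, dy ξ⟫ ≥ 0`. If
this vanishes then `dy ξ = 0`, so `ξ` is a multiple of `∂H/∂p` and `⟪y, ξ⟫ ≠ 0`. -/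
theorem hessian_jacobiMetric_pos (hq : q ∈ M) (hv : v ≠ 0) {ξ : V} (hξ : ξ ≠ 0) :
    0 < iteratedFDeriv ℝ 2 (fun v' => jacobiMetric H E q v' ^ 2) v ![ξ, ξ] := by
  have hJ := hH.isJacobiMomentum hE hq hv
  have hF := hH.jacobiMetric_pos hE hq hv
  set y := jacobiMomentum H E q v with hy
  set μ := jacobiFactor H E q v with hμ
  have hm : DifferentiableAt ℝ (fun v' => (jacobiMomentum H E q v', jacobiFactor H E q v')) v :=
    ((hH.contDiffAt_jacobiMomentum_prod hE hq hv).differentiableAt one_ne_zero).comp v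
      (hasFDerivAt_prodMk_right q v).differentiableAt
  set dy := fderiv ℝ (fun v' => jacobiMomentum H E q v') v with hdy
  set dμ := fderiv ℝ (fun v' => jacobiFactor H E q v') v with hdμ
  have hdy' : HasFDerivAt (fun v' => jacobiMomentum H E q v') dy v := hm.fst.hasFDerivAt
  have hdμ' : HasFDerivAt (fun v' => jacobiFactor H E q v') dμ v := hm.snd.hasFDerivAt
  have hne : ∀ᶠ v' in 𝓝 v, v' ≠ 0 := isOpen_ne.mem_nhds hv
  -- the velocity identity
  have h1 : HasFDerivAt (fun v' => pGrad H (q, jacobiMomentum H E q v'))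
      (fderiv ℝ (pGrad H) (q, y) ∘L ((ContinuousLinearMap.inr ℝ V V) ∘L dy)) v :=
    HasFDerivAt.comp (g := pGrad H) (f := fun v' => (q, jacobiMomentum H E q v')) v
      (hH.hasFDerivAt_pGrad hq y) ((hasFDerivAt_prodMk_right q y).comp v hdy')
  have h2 := hdμ'.smul h1
  have h3 : (fun v' => jacobiFactor H E q v' • pGrad H (q, jacobiMomentum H E q v'))
      =ᶠ[𝓝 v] fun v' => v' := by
    filter_upwards [hne] with v' hv' using (hH.isJacobiMomentum hE hq hv').2.2.symm
  have h4 := (h2.congr_of_eventuallyEq h3.symm).unique (hasFDerivAt_id v)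
  have h5 : μ • fderiv ℝ (pGrad H) (q, y) (0, dy ξ) + dμ ξ • pGrad H (q, y) = ξ := by
    have := congrArg (fun A : V →L[ℝ] V => A ξ) h4
    simpa using this
  have hcons : ⟪pGrad H (q, y), dy ξ⟫ = 0 := by
    have a1 : HasFDerivAt (fun v' => H (q, jacobiMomentum H E q v'))
        (fderiv ℝ H (q, y) ∘L ((ContinuousLinearMap.inr ℝ V V) ∘L dy)) v :=
      HasFDerivAt.comp (g := H) (f := fun v' => (q, jacobiMomentum H E q v')) v
        (hH.differentiableAt hq y).hasFDerivAt ((hasFDerivAt_prodMk_right q y).comp v hdy')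
    have a2 : (fun v' => H (q, jacobiMomentum H E q v')) =ᶠ[𝓝 v] fun _ => E := by
      filter_upwards [hne] with v' hv' using (hH.isJacobiMomentum hE hq hv').2.1
    have a3 := (a1.congr_of_eventuallyEq a2.symm).unique (hasFDerivAt_const E v)
    rw [inner_pGrad (hH.differentiableAt hq y)]
    exact congrArg (fun A : V →L[ℝ] ℝ => A ξ) a3
  have hfd : fderiv ℝ (fun v' => jacobiMetric H E q v' ^ 2) =ᶠ[𝓝 v] fun v' =>
      (2 * jacobiMetric H E q v') • innerSL ℝ (jacobiMomentum H E q v') := by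
    filter_upwards [hne] with v' hv'
    exact (hH.hasFDerivAt_jacobiMetric_sq_velocity hE hq hv').fderiv
  have hFd : HasFDerivAt (fun v' => 2 * jacobiMetric H E q v') ((2 : ℝ) • innerSL ℝ y) v := by
    have := ((hH.hasFDerivAt_jacobiMetric hE hq hv).comp v
      (hasFDerivAt_prodMk_right q v)).const_mul 2
    refine this.congr_fderiv ?_
    ext w
    simp [hy]
  have h6 : HasFDerivAt (fun v' => (2 * jacobiMetric H E q v') •
      innerSL ℝ (jacobiMomentum H E q v')) _ v := hFd.smul ((innerSL ℝ).hasFDerivAt.comp v hdy')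
  rw [iteratedFDeriv_two_apply, hfd.fderiv_eq]
  rw [h6.fderiv]
  obtain ⟨ν, -, hν, hh⟩ := hH.hessian
  have e1 : ⟪dy ξ, ξ⟫ = μ * ⟪fderiv ℝ (pGrad H) (q, y) (0, dy ξ), dy ξ⟫ := by
    rw [show ⟪dy ξ, ξ⟫ = ⟪dy ξ, μ • fderiv ℝ (pGrad H) (q, y) (0, dy ξ) + dμ ξ • pGrad H (q, y)⟫
      from congrArg (fun x => ⟪dy ξ, x⟫) h5.symm]
    rw [inner_add_right, real_inner_smul_right, real_inner_smul_right, real_inner_comm,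
      real_inner_comm (pGrad H (q, y)), hcons, mul_zero, add_zero]
  have e2 := hh q hq y (dy ξ)
  have e3 : 0 ≤ ⟪dy ξ, ξ⟫ := by
    rw [e1]
    exact mul_nonneg hJ.1.le (le_trans (mul_nonneg (hν q hq).le (by positivity)) e2)
  have goal : 0 < 2 * jacobiMetric H E q v * ⟪dy ξ, ξ⟫ + 2 * ⟪y, ξ⟫ * ⟪y, ξ⟫ := by
    rcases e3.lt_or_eq with hpos | hzero
    · have : 0 ≤ 2 * ⟪y, ξ⟫ * ⟪y, ξ⟫ := by nlinarith [sq_nonneg ⟪y, ξ⟫]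
      have h7 : 0 < 2 * jacobiMetric H E q v * ⟪dy ξ, ξ⟫ := by positivity
      linarith
    · rw [← hzero, mul_zero, zero_add]
      rw [e1] at hzero
      have b1 := (mul_eq_zero.1 hzero.symm).resolve_left hJ.1.ne'
      rw [b1] at e2
      have b2 : dy ξ = 0 := by
        by_contra hne
        exact absurd (mul_pos (hν q hq) (pow_pos (norm_pos_iff.2 hne) 2)) (not_lt.2 e2)
      rw [b2, show ((0 : V), (0 : V)) = 0 from rfl, map_zero, smul_zero, zero_add] at h5
      have b3 : ⟪y, ξ⟫ ≠ 0 := by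
        rw [← h5, real_inner_smul_right]
        refine mul_ne_zero (fun h0 => hξ ?_)
          (hH.inner_pGrad_self_pos hq (hH.jacobiMomentum_ne_zero hE hq hv)).ne'
        rw [← h5, h0, zero_smul]
      have : 0 < ⟪y, ξ⟫ ^ 2 := by positivity
      nlinarith
  refine lt_of_lt_of_eq goal ?_
  simp [hy]
  exact Or.inl rfl

theorem jacobiMetric_smul (hq : q ∈ M) (v : V) {c : ℝ} (hc : 0 ≤ c) :
    jacobiMetric H E q (c • v) = c * jacobiMetric H E q v := by
  rcases hc.eq_or_lt with rfl | hc
  · simp [jacobiMetric]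
  by_cases hv : v = 0
  · simp [jacobiMetric, hv]
  have hJ := hH.isJacobiMomentum hE hq hv
  have h := hH.jacobiMomentum_eq hE hq (smul_ne_zero hc.ne' hv)
    (p := jacobiMomentum H E q v) (μ := c * jacobiFactor H E q v)
    ⟨mul_pos hc hJ.1, hJ.2.1, by rw [mul_smul, ← hJ.2.2]⟩
  rw [jacobiMetric, h.1, real_inner_smul_right, jacobiMetric]

/-- Only `v = 0` needs an argument: momenta of energy `E` are bounded locally uniformly in `q`,
which squeezes the metric to `0`. -/
theorem continuousOn_jacobiMetric :
    ContinuousOn (Function.uncurry (jacobiMetric H E)) (M ×ˢ univ) := by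
  rintro ⟨q, v⟩ ⟨hq, -⟩
  refine ContinuousAt.continuousWithinAt ?_
  by_cases hv : v = 0
  swap
  · exact (hH.contDiffAt_jacobiMetric hE hq hv).continuousAt
  subst hv
  obtain ⟨ν, hνc, hν, hh⟩ := hH.hessian
  have hbd : ∀ u : V × V, u.1 ∈ M → ‖jacobiMetric H E u.1 u.2‖ ≤
      Real.sqrt (2 * (E - H (u.1, 0)) / ν u.1) * ‖u.2‖ := fun u hu => by
    by_cases h0 : u.2 = 0
    · simp [jacobiMetric, h0]
    refine (norm_inner_le_norm _ _).trans (mul_le_mul_of_nonneg_right ?_ (norm_nonneg _))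
    exact Real.le_sqrt_of_sq_le (hH.norm_sq_le_of_energy_le (hν u.1 hu) hu (hh u.1 hu)
      (hH.isJacobiMomentum hE hu h0).2.1.le)
  have hc : ContinuousAt (fun u : V × V =>
      Real.sqrt (2 * (E - H (u.1, 0)) / ν u.1) * ‖u.2‖) (q, 0) := by
    have c1 : ContinuousAt (fun u : V × V => H (u.1, 0)) (q, 0) :=
      ContinuousAt.comp (g := H) (f := fun u : V × V => (u.1, (0 : V)))
        (hH.differentiableAt hq 0).continuousAt (by fun_prop)
    have c2 : ContinuousAt (fun u : V × V => ν u.1) (q, 0) :=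
      ContinuousAt.comp (g := ν) (f := fun u : V × V => u.1)
        (hνc.continuousAt (hH.isOpen.mem_nhds hq)) (by fun_prop)
    have c3 := ((continuousAt_const (y := (2 : ℝ))).mul ((continuousAt_const (y := E)).sub c1)).div
      c2 (hν q hq).ne'
    exact c3.sqrt.mul (by fun_prop)
  have h0 : Function.uncurry (jacobiMetric H E) (q, 0) = 0 := by simp [jacobiMetric]
  unfold ContinuousAt
  rw [h0]
  refine squeeze_zero_norm' (a := fun u : V × V =>
    Real.sqrt (2 * (E - H (u.1, 0)) / ν u.1) * ‖u.2‖) ?_ ?_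
  · filter_upwards [continuous_fst.continuousAt.eventually (hH.isOpen.mem_nhds hq)] with u hu
    exact hbd u hu
  · have := hc.tendsto
    simpa using this

end IsConvexHamiltonian

end Jacobi

/-- The Jacobi-Finsler metric is a Finsler metric. -/
theorem IsConvexHamiltonian.isFinslerMetric {n : ℕ} {M : Set (EuclideanSpace ℝ (Fin n))}
    {H : EuclideanSpace ℝ (Fin n) × EuclideanSpace ℝ (Fin n) → ℝ} {E : ℝ}
    (hH : IsConvexHamiltonian M H) (hE : ∀ q ∈ M, H (q, 0) < E) :
    IsFinslerMetric M (jacobiMetric H E) where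
  continuousOn := hH.continuousOn_jacobiMetric hE
  contDiffOn := fun _ hu => (hH.contDiffAt_jacobiMetric hE hu.1 hu.2).contDiffWithinAt
  pos := fun _ hq _ hv => hH.jacobiMetric_pos hE hq hv
  homogeneous := fun _ hq v _ hc => hH.jacobiMetric_smul hE hq v hc
  hessian_pos := fun _ hq _ hv _ hξ => hH.hessian_jacobiMetric_pos hE hq hv hξ

/-! ### Hamiltonian orbits parametrized with constant Jacobi-Finsler speed -/

section Orbit

open scoped RealInnerProductSpace

variable {V : Type*} [NormedAddCommGroup V] [InnerProductSpace ℝ V] [CompleteSpace V]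
  [FiniteDimensional ℝ V]

/-- The time change that turns Hamiltonian orbits into curves of Jacobi-Finsler speed `c`. -/
noncomputable def jacobiRate (H : V × V → ℝ) (c : ℝ) (z : V × V) : ℝ := c / ⟪z.2, pGrad H z⟫

/-- The Hamiltonian vector field, reparametrized to Jacobi-Finsler speed `c`. -/
noncomputable def jacobiField (H : V × V → ℝ) (c : ℝ) (z : V × V) : V × V :=
  (jacobiRate H c z • pGrad H z, -(jacobiRate H c z • qGrad H z))

/-- `(γ, y)` is an orbit of energy `E`, parametrized with Jacobi-Finsler speed `c`. -/
structure IsJacobiOrbit (M : Set V) (H : V × V → ℝ) (E c : ℝ) (γ y : ℝ → V) (I : Set ℝ) :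
    Prop where
  mapsTo : MapsTo γ I M
  energy : ∀ s ∈ I, H (γ s, y s) = E
  hasDerivWithinAt : ∀ s ∈ I,
    HasDerivWithinAt (fun r => (γ r, y r)) (jacobiField H c (γ s, y s)) I s

namespace IsJacobiOrbit

variable {M : Set V} {H : V × V → ℝ} {E c : ℝ} {γ y : ℝ → V} {I : Set ℝ}

theorem hasDerivWithinAt_fst (h : IsJacobiOrbit M H E c γ y I) {s : ℝ} (hs : s ∈ I) :
    HasDerivWithinAt γ (jacobiRate H c (γ s, y s) • pGrad H (γ s, y s)) I s :=
  (h.hasDerivWithinAt s hs).fst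

theorem hasDerivWithinAt_snd (h : IsJacobiOrbit M H E c γ y I) {s : ℝ} (hs : s ∈ I) :
    HasDerivWithinAt y (-(jacobiRate H c (γ s, y s) • qGrad H (γ s, y s))) I s :=
  (h.hasDerivWithinAt s hs).snd

theorem mono (h : IsJacobiOrbit M H E c γ y I) {J : Set ℝ} (hJ : J ⊆ I) :
    IsJacobiOrbit M H E c γ y J :=
  ⟨h.mapsTo.mono_left hJ, fun s hs => h.energy s (hJ hs),
    fun s hs => (h.hasDerivWithinAt s (hJ hs)).mono hJ⟩

theorem continuousOn (h : IsJacobiOrbit M H E c γ y I) : ContinuousOn (fun r => (γ r, y r)) I :=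
  fun s hs => (h.hasDerivWithinAt s hs).continuousWithinAt

end IsJacobiOrbit

namespace IsConvexHamiltonian

variable {M : Set V} {H : V × V → ℝ} {E : ℝ} (hH : IsConvexHamiltonian M H)
  (hE : ∀ q ∈ M, H (q, 0) < E) {q v : V}

include hH

theorem contDiffAt_jacobiRate {z : V × V} (hq : z.1 ∈ M) (hz : z.2 ≠ 0) (c : ℝ) :
    ContDiffAt ℝ 1 (jacobiRate H c) z := by
  have h1 := hH.contDiffAt_pGrad hq z.2
  exact contDiffAt_const.div (contDiffAt_snd.inner ℝ h1) (hH.inner_pGrad_self_pos hq hz).ne'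

theorem contDiffAt_jacobiField {z : V × V} (hq : z.1 ∈ M) (hz : z.2 ≠ 0) (c : ℝ) :
    ContDiffAt ℝ 1 (jacobiField H c) z := by
  have h1 := hH.contDiffAt_pGrad hq z.2
  have h2 := hH.contDiffAt_qGrad hq z.2
  have h3 := hH.contDiffAt_jacobiRate hq hz c
  exact (h3.smul h1).prodMk (h3.smul h2).neg

include hE

theorem _root_.BrakeOrbit.IsJacobiOrbit.isJacobiMomentum {c : ℝ} (hc : 0 < c) {γ y : ℝ → V}
    {I : Set ℝ} (h : IsJacobiOrbit M H E c γ y I) {s : ℝ} (hs : s ∈ I) :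
    IsJacobiMomentum H E (γ s) (jacobiRate H c (γ s, y s) • pGrad H (γ s, y s)) (y s)
      (jacobiRate H c (γ s, y s)) :=
  ⟨div_pos hc (hH.inner_pGrad_self_pos (h.mapsTo hs)
    (ne_zero_of_energy_eq hE (h.mapsTo hs) (h.energy s hs))), h.energy s hs, rfl⟩

theorem _root_.BrakeOrbit.IsJacobiOrbit.velocity_ne_zero {c : ℝ} (hc : 0 < c) {γ y : ℝ → V}
    {I : Set ℝ} (h : IsJacobiOrbit M H E c γ y I) {s : ℝ} (hs : s ∈ I) :
    jacobiRate H c (γ s, y s) • pGrad H (γ s, y s) ≠ 0 :=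
  smul_ne_zero (h.isJacobiMomentum hH hE hc hs).1.ne'
    (hH.pGrad_ne_zero (h.mapsTo hs) (ne_zero_of_energy_eq hE (h.mapsTo hs) (h.energy s hs)))

theorem _root_.BrakeOrbit.IsJacobiOrbit.jacobiMetric_eq {c : ℝ} (hc : 0 < c) {γ y : ℝ → V}
    {I : Set ℝ} (h : IsJacobiOrbit M H E c γ y I) {s : ℝ} (hs : s ∈ I) :
    jacobiMetric H E (γ s) (jacobiRate H c (γ s, y s) • pGrad H (γ s, y s)) = c := by
  have h1 := h.isJacobiMomentum hH hE hc hs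
  have hv := h.velocity_ne_zero hH hE hc hs
  have h2 := hH.jacobiMomentum_eq hE (h.mapsTo hs) hv h1
  rw [hH.jacobiMetric_eq hE (h.mapsTo hs) hv, h2.1, h2.2, jacobiRate, div_mul_cancel₀]
  exact (hH.inner_pGrad_self_pos (h.mapsTo hs)
    (ne_zero_of_energy_eq hE (h.mapsTo hs) (h.energy s hs))).ne'

omit hE in
/-- Two orbits of the same speed that meet coincide. -/
theorem eqOn_of_isJacobiOrbit (hE : ∀ q ∈ M, H (q, 0) < E) {c a b s₀ : ℝ} {γ₁ y₁ γ₂ y₂ : ℝ → V}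
    (h₁ : IsJacobiOrbit M H E c γ₁ y₁ (Ioo a b)) (h₂ : IsJacobiOrbit M H E c γ₂ y₂ (Ioo a b))
    (hs₀ : s₀ ∈ Ioo a b) (h0 : (γ₁ s₀, y₁ s₀) = (γ₂ s₀, y₂ s₀)) :
    EqOn (fun s => (γ₁ s, y₁ s)) (fun s => (γ₂ s, y₂ s)) (Ioo a b) := by
  intro s hs
  obtain ⟨a', ha, ha'⟩ := exists_between (lt_min hs.1 hs₀.1)
  obtain ⟨b', hb', hb⟩ := exists_between (max_lt hs.2 hs₀.2)
  have hsub : Icc a' b' ⊆ Ioo a b := fun r hr => ⟨ha.trans_le hr.1, hr.2.trans_lt hb⟩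
  -- The field is only locally Lipschitz; it is Lipschitz on the compact union `S` of the two orbit
  -- pieces, which is all that uniqueness needs.
  set S := (fun s => (γ₁ s, y₁ s)) '' Icc a' b' ∪ (fun s => (γ₂ s, y₂ s)) '' Icc a' b' with hS
  have hSc : IsCompact S := (isCompact_Icc.image_of_continuousOn (h₁.continuousOn.mono hsub)).union
    (isCompact_Icc.image_of_continuousOn (h₂.continuousOn.mono hsub))
  have hSM : ∀ z ∈ S, z.1 ∈ M ∧ z.2 ≠ 0 := by
    rintro z (⟨r, hr, rfl⟩ | ⟨r, hr, rfl⟩)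
    · exact ⟨h₁.mapsTo (hsub hr),
        ne_zero_of_energy_eq hE (h₁.mapsTo (hsub hr)) (h₁.energy r (hsub hr))⟩
    · exact ⟨h₂.mapsTo (hsub hr),
        ne_zero_of_energy_eq hE (h₂.mapsTo (hsub hr)) (h₂.energy r (hsub hr))⟩
  have hloc : LocallyLipschitzOn S (jacobiField H c) := fun z hz => by
    obtain ⟨K, t, ht, hK⟩ := ((hH.contDiffAt_jacobiField (hSM z hz).1 (hSM z hz).2
      c).hasStrictFDerivAt one_ne_zero).exists_lipschitzOnWith
    exact ⟨K, t, mem_nhdsWithin_of_mem_nhds ht, hK⟩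
  obtain ⟨K, hK⟩ := hloc.exists_lipschitzOnWith_of_compact hSc
  have hd : ∀ {γ y : ℝ → V}, IsJacobiOrbit M H E c γ y (Ioo a b) → ∀ r ∈ Ioo a' b',
      HasDerivAt (fun r => (γ r, y r)) (jacobiField H c (γ r, y r)) r := fun h r hr =>
    (h.hasDerivWithinAt r (hsub (Ioo_subset_Icc_self hr))).hasDerivAt
      (isOpen_Ioo.mem_nhds (hsub (Ioo_subset_Icc_self hr)))
  exact ODE_solution_unique_of_mem_Ioo (v := fun _ => jacobiField H c) (s := fun _ => S) (K := K)
    (fun _ _ => hK)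
    (show s₀ ∈ Ioo a' b' from ⟨ha'.trans_le (min_le_right _ _), (le_max_right _ _).trans_lt hb'⟩)
    (fun r hr => ⟨hd h₁ r hr, Or.inl ⟨r, Ioo_subset_Icc_self hr, rfl⟩⟩)
    (fun r hr => ⟨hd h₂ r hr, Or.inr ⟨r, Ioo_subset_Icc_self hr, rfl⟩⟩) h0
    (show s ∈ Ioo a' b' from ⟨ha'.trans_le (min_le_left _ _), (le_max_left _ _).trans_lt hb'⟩)

/-- Local existence of orbits of any speed. -/
theorem exists_isJacobiOrbit (hq : q ∈ M) {p : V} (hp : H (q, p) = E) (c : ℝ) :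
    ∃ ε > 0, ∃ γ y : ℝ → V, IsJacobiOrbit M H E c γ y (Ioo (-ε) ε) ∧ γ 0 = q ∧ y 0 = p := by
  have hp0 := ne_zero_of_energy_eq hE hq hp
  obtain ⟨α, hα0, ε, hε, hα⟩ := (hH.contDiffAt_jacobiField (z := (q, p)) hq hp0
    c).exists_forall_mem_closedBall_exists_eq_forall_mem_Ioo_hasDerivAt₀ 0
  have hcont : ContinuousAt α 0 := (hα 0 ⟨by linarith, by linarith⟩).continuousAt
  have hM : ∀ᶠ s in 𝓝 (0 : ℝ), (α s).1 ∈ M := by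
    refine (continuous_fst.continuousAt.comp hcont).eventually (hH.isOpen.mem_nhds ?_)
    rw [Function.comp, hα0]
    exact hq
  obtain ⟨δ, hδ, hδM⟩ := Metric.eventually_nhds_iff_ball.1 hM
  set η := min ε δ with hη
  have hη0 : 0 < η := lt_min hε hδ
  have hsub1 : ∀ s ∈ Ioo (-η) η, s ∈ Ioo (0 - ε) (0 + ε) := fun s hs =>
    ⟨by linarith [hs.1, min_le_left ε δ], by linarith [hs.2, min_le_left ε δ]⟩
  have hsub2 : ∀ s ∈ Ioo (-η) η, (α s).1 ∈ M := fun s hs => hδM s (by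
    rw [mem_ball_zero_iff, Real.norm_eq_abs, abs_lt]
    exact ⟨by linarith [hs.1, min_le_right ε δ], by linarith [hs.2, min_le_right ε δ]⟩)
  have h0 : (0 : ℝ) ∈ Ioo (-η) η := ⟨by linarith, hη0⟩
  have hen : ∀ s ∈ Ioo (-η) η, HasDerivWithinAt (fun r => H ((α r).1, (α r).2)) 0 (Ioo (-η) η) s :=
    fun s hs => by
      have hd := (hα s (hsub1 s hs)).hasDerivWithinAt (s := Ioo (-η) η)
      exact hasDerivWithinAt_energy (γ := fun r => (α r).1) (y := fun r => (α r).2)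
        (m := jacobiRate H c (α s))
        (hH.differentiableAt (hsub2 s hs) _) hd.fst hd.snd
  refine ⟨η, hη0, fun s => (α s).1, fun s => (α s).2, ⟨hsub2, fun s hs => ?_, fun s hs => ?_⟩, ?_⟩
  · have h1 := (convex_Ioo (-η) η).norm_image_sub_le_of_norm_hasDerivWithin_le (C := 0) hen
      (fun _ _ => by simp) h0 hs
    rw [zero_mul, norm_le_zero_iff, sub_eq_zero, hα0] at h1
    exact h1.trans hp
  · exact (hα s (hsub1 s hs)).hasDerivWithinAt
  · simp [hα0]

omit hE in
/-- The scaling factor that brings a momentum to energy `E` has derivative `0` along curves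
`(γ, P)` that follow Hamilton's equations to first order. -/
theorem hasDerivWithinAt_scale {γ P : ℝ → V} {a : ℝ → ℝ} {I : Set ℝ} {s m : ℝ} (hs : s ∈ I)
    (hI : UniqueDiffWithinAt ℝ I s)
    (hγM : γ s ∈ M) (ha : ContinuousWithinAt a I s) (ha0 : 0 < a s) (hP : a s • P s ≠ 0)
    (hen : ∀ r ∈ I, H (γ r, a r • P r) = E)
    (hγ : HasDerivWithinAt γ (m • pGrad H (γ s, a s • P s)) I s)
    (hP' : HasDerivWithinAt P (-((m / a s) • qGrad H (γ s, a s • P s))) I s) :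
    HasDerivWithinAt a 0 I s := by
  set f : (V × V) × ℝ → ℝ := fun u => H (u.1.1, u.2 • u.1.2) with hf
  set u₀ : (V × V) × ℝ := ((γ s, P s), a s) with hu₀
  set z₀ : V × V := (γ s, a s • P s) with hz₀
  have hdH := hH.differentiableAt hγM (a s • P s)
  have hfC : ContDiffAt ℝ 1 f u₀ := by
    have h0 : ContDiffAt ℝ 1 (fun u : (V × V) × ℝ => (u.1.1, u.2 • u.1.2)) u₀ := by fun_prop
    exact ContDiffAt.comp (g := H) u₀ ((hH.contDiffAt hγM _).of_le one_le_two) h0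
  have hκ : ⟪pGrad H z₀, P s⟫ ≠ 0 := by
    have h1 := hH.inner_pGrad_self_pos hγM hP
    rw [real_inner_smul_left, real_inner_comm] at h1
    exact (pos_of_mul_pos_right h1 ha0.le).ne'
  have hinr : ∀ w : ℝ, (fderiv ℝ f u₀ ∘L .inr ℝ (V × V) ℝ) w = w * ⟪pGrad H z₀, P s⟫ := by
    intro w
    have e1 : HasFDerivAt (fun w : ℝ => H (γ s, w • P s)) (fderiv ℝ f u₀ ∘L .inr ℝ (V × V) ℝ)
        (a s) :=
      HasFDerivAt.comp (g := f) (f := fun w : ℝ => ((γ s, P s), w)) (a s)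
        (hfC.differentiableAt one_ne_zero).hasFDerivAt (hasFDerivAt_prodMk_right (γ s, P s) (a s))
    have e2 : HasFDerivAt (fun w : ℝ => H (γ s, w • P s)) _ (a s) :=
      HasFDerivAt.comp (g := H) (f := fun w : ℝ => (γ s, w • P s)) (a s) hdH.hasFDerivAt
        (((hasFDerivAt_const (γ s) (a s)).prodMk ((hasFDerivAt_id (a s)).smul_const (P s))))
    rw [e1.unique e2, ContinuousLinearMap.comp_apply, fderiv_eq_inner_add_inner hdH]
    simp [real_inner_smul_right, z₀]
  have hinv : (fderiv ℝ f u₀ ∘L .inr ℝ (V × V) ℝ).IsInvertible := by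
    refine ⟨ContinuousLinearEquiv.unitsEquivAut ℝ (Units.mk0 _ hκ), ?_⟩
    ext
    rw [hinr]
    simp
  -- So far `a` is only continuous. Solving `H (γ, a • P) = E` for `a` by the implicit function
  -- theorem makes it differentiable, and differentiating the identity then forces its derivative to
  -- be `0`.
  set ψ := hfC.implicitFunction one_ne_zero hinv with hψ
  have hγPa : Tendsto (fun r => ((γ r, P r), a r)) (𝓝[I] s) (𝓝 u₀) :=
    (hγ.continuousWithinAt.prodMk hP'.continuousWithinAt).prodMk ha
  have heq : a =ᶠ[𝓝[I] s] fun r => ψ (γ r, P r) := by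
    filter_upwards [hγPa.eventually (hfC.eventually_apply_eq_iff_implicitFunction one_ne_zero hinv),
      self_mem_nhdsWithin] with r hr hrI
    exact (hr.1 ((hen r hrI).trans (hen s hs).symm)).symm
  have hψd : DifferentiableAt ℝ ψ (γ s, P s) :=
    (hfC.contDiffAt_implicitFunction one_ne_zero hinv).differentiableAt one_ne_zero
  have hψs : ψ (γ s, P s) = a s := hfC.implicitFunction_apply_self one_ne_zero hinv
  have had : HasDerivWithinAt a (derivWithin a I s) I s := by
    have h1 := hψd.hasFDerivAt.comp_hasDerivWithinAt s (hγ.prodMk hP')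
    exact (h1.congr_of_eventuallyEq heq hψs.symm).differentiableWithinAt.hasDerivWithinAt
  set a' := derivWithin a I s with ha'
  have hE' : HasDerivWithinAt (fun r => H (γ r, a r • P r)) _ I s :=
    HasFDerivAt.comp_hasDerivWithinAt (l := H) (f := fun r => (γ r, a r • P r)) s
      hdH.hasFDerivAt (hγ.prodMk (had.smul hP'))
  have hE0 : HasDerivWithinAt (fun r => H (γ r, a r • P r)) 0 I s :=
    (hasDerivWithinAt_const s I E).congr hen (hen s hs)
  have := hI.eq_deriv I hE' hE0
  rw [fderiv_eq_inner_add_inner hdH] at this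
  simp only [inner_add_right, inner_neg_right, real_inner_smul_right, smul_neg, smul_smul,
    mul_div_cancel₀ m ha0.ne'] at this
  rw [real_inner_comm (pGrad H (γ s, a s • P s))] at this
  have h2 : a' * ⟪pGrad H z₀, P s⟫ = 0 := by
    rw [hz₀]
    linear_combination this
  rw [(mul_eq_zero.1 h2).resolve_right hκ] at had
  exact had

end IsConvexHamiltonian

end Orbit

/-! ### Geodesics and orbits are the same curves -/

section Geodesic

open scoped RealInnerProductSpace

variable {n : ℕ} {M : Set (EuclideanSpace ℝ (Fin n))}
  {H : EuclideanSpace ℝ (Fin n) × EuclideanSpace ℝ (Fin n) → ℝ} {E : ℝ}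

/-- Orbits are geodesics of the Jacobi-Finsler metric. -/
theorem IsJacobiOrbit.isGeodesicOn (hH : IsConvexHamiltonian M H) (hE : ∀ q ∈ M, H (q, 0) < E)
    {c : ℝ} (hc : 0 < c) {γ y : ℝ → EuclideanSpace ℝ (Fin n)} {I : Set ℝ}
    (hI : UniqueDiffOn ℝ I) (h : IsJacobiOrbit M H E c γ y I) :
    IsGeodesicOn M (jacobiMetric H E) γ I := by
  have hder : ∀ s ∈ I, derivWithin γ I s = jacobiRate H c (γ s, y s) • pGrad H (γ s, y s) :=
    fun s hs => (h.hasDerivWithinAt_fst hs).derivWithin (hI s hs)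
  have hmom : ∀ s ∈ I, jacobiMomentum H E (γ s) (derivWithin γ I s) = y s ∧
      jacobiFactor H E (γ s) (derivWithin γ I s) = jacobiRate H c (γ s, y s) := fun s hs => by
    rw [hder s hs]
    exact hH.jacobiMomentum_eq hE (h.mapsTo hs) (h.velocity_ne_zero hH hE hc hs)
      (h.isJacobiMomentum hH hE hc hs)
  have hF : ∀ s ∈ I, jacobiMetric H E (γ s) (derivWithin γ I s) = c := fun s hs => by
    rw [hder s hs]
    exact h.jacobiMetric_eq hH hE hc hs
  have hv : ∀ s ∈ I, derivWithin γ I s ≠ 0 := fun s hs => by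
    rw [hder s hs]
    exact h.velocity_ne_zero hH hE hc hs
  refine ⟨h.mapsTo, ?_, hv, fun s hs => ?_⟩
  · rw [show (1 : WithTop ℕ∞) = 0 + 1 by norm_num, contDiffOn_succ_iff_derivWithin hI]
    refine ⟨fun s hs => (h.hasDerivWithinAt_fst hs).differentiableWithinAt, by simp, ?_⟩
    rw [contDiffOn_zero]
    refine ContinuousOn.congr (f := fun s => (jacobiField H c (γ s, y s)).1) ?_ hder
    intro s hs
    exact continuous_fst.continuousAt.comp_continuousWithinAt
      ((hH.contDiffAt_jacobiField (z := (γ s, y s)) (h.mapsTo hs) (IsConvexHamiltonian.ne_zero_of_energy_eq hE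
        (h.mapsTo hs) (h.energy s hs)) c).continuousAt.comp_continuousWithinAt
        (f := fun r => (γ r, y r)) (h.continuousOn s hs))
  · have e1 : ∀ r ∈ I, fderiv ℝ (fun v => jacobiMetric H E (γ r) v ^ 2) (derivWithin γ I r) =
        (2 * c) • innerSL ℝ (y r) := fun r hr => by
      rw [(hH.hasFDerivAt_jacobiMetric_sq_velocity hE (h.mapsTo hr) (hv r hr)).fderiv, hF r hr,
        (hmom r hr).1]
    rw [(hH.hasFDerivAt_jacobiMetric_sq_position hE (h.mapsTo hs) (hv s hs)).fderiv, hF s hs,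
      (hmom s hs).1, (hmom s hs).2]
    refine HasDerivWithinAt.congr (f := fun r => (2 * c) • innerSL ℝ (y r)) ?_ e1 (e1 s hs)
    exact (((innerSL ℝ).hasFDerivAt.comp_hasDerivWithinAt s
      (h.hasDerivWithinAt_snd hs))).const_smul (2 * c)

/-- Geodesics of the Jacobi-Finsler metric are orbits. -/
theorem IsGeodesicOn.isJacobiOrbit (hH : IsConvexHamiltonian M H) (hE : ∀ q ∈ M, H (q, 0) < E)
    {γ : ℝ → EuclideanSpace ℝ (Fin n)} {I : Set ℝ} (hI : UniqueDiffOn ℝ I) (hconv : Convex ℝ I)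
    (h : IsGeodesicOn M (jacobiMetric H E) γ I) {s₀ : ℝ} (hs₀ : s₀ ∈ I) :
    IsJacobiOrbit M H E (jacobiMetric H E (γ s₀) (derivWithin γ I s₀)) γ
      (fun s => jacobiMomentum H E (γ s) (derivWithin γ I s)) I := by
  set y := fun s => jacobiMomentum H E (γ s) (derivWithin γ I s) with hy
  set u := fun s => jacobiMetric H E (γ s) (derivWithin γ I s) with hu
  have hJ : ∀ s ∈ I, IsJacobiMomentum H E (γ s) (derivWithin γ I s) (y s)
      (jacobiFactor H E (γ s) (derivWithin γ I s)) := fun s hs =>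
    hH.isJacobiMomentum hE (h.mapsTo hs) (h.velocity_ne_zero s hs)
  have hupos : ∀ s ∈ I, 0 < u s := fun s hs =>
    hH.jacobiMetric_pos hE (h.mapsTo hs) (h.velocity_ne_zero s hs)
  have hγ : ∀ s ∈ I, HasDerivWithinAt γ (jacobiFactor H E (γ s) (derivWithin γ I s) •
      pGrad H (γ s, y s)) I s := fun s hs => by
    have := (h.contDiffOn.differentiableOn one_ne_zero s hs).hasDerivWithinAt
    rwa [(hJ s hs).2.2] at this
  have hcv : ContinuousOn (derivWithin γ I) I := h.contDiffOn.continuousOn_derivWithin hI le_rfl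
  have hcu : ContinuousOn u I := fun s hs =>
    ContinuousAt.comp_continuousWithinAt (g := fun w : EuclideanSpace ℝ (Fin n) × _ =>
        jacobiMetric H E w.1 w.2) (f := fun s => (γ s, derivWithin γ I s))
      (hH.contDiffAt_jacobiMetric hE (h.mapsTo hs) (h.velocity_ne_zero s hs)).continuousAt
      ((h.contDiffOn.continuousOn s hs).prodMk (hcv s hs))
  -- `P` is the velocity gradient of `F²`, the only combination that the Euler-Lagrange equation
  -- differentiates; the speed `u` and the momentum `y` are separately only continuous at this
  -- stage. Constancy of `u` comes from `hasDerivWithinAt_scale`, applied to `a = 1 / (2 u)`.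
  set P := fun s => (2 * u s) • y s with hP
  have hP' : ∀ s ∈ I, HasDerivWithinAt P (-((2 * u s * jacobiFactor H E (γ s)
      (derivWithin γ I s)) • qGrad H (γ s, y s))) I s := fun s hs => by
    have h1 := h.euler_lagrange s hs
    rw [(hH.hasFDerivAt_jacobiMetric_sq_position hE (h.mapsTo hs) (h.velocity_ne_zero s hs)).fderiv]
      at h1
    have h2 := ((InnerProductSpace.toDual ℝ (EuclideanSpace ℝ (Fin n))).symm
      |>.toContinuousLinearEquiv.toContinuousLinearMap.hasFDerivAt.comp_hasDerivWithinAt s h1)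
    have e1 : ∀ (c : ℝ) (w : EuclideanSpace ℝ (Fin n)),
        (InnerProductSpace.toDual ℝ (EuclideanSpace ℝ (Fin n))).symm (c • innerSL ℝ w) = c • w := by
      intro c w
      rw [LinearIsometryEquiv.symm_apply_eq]
      ext x
      simp
    refine (h2.congr_deriv ?_).congr ?_ ?_
    · refine (e1 _ _).trans ?_
      rw [smul_neg, smul_smul]
    · intro r hr
      refine Eq.trans ?_ (Eq.symm ((congrArg _ (hH.hasFDerivAt_jacobiMetric_sq_velocity hE
        (h.mapsTo hr) (h.velocity_ne_zero r hr)).fderiv).trans (e1 _ _)))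
      rfl
    · refine Eq.trans ?_ (Eq.symm ((congrArg _ (hH.hasFDerivAt_jacobiMetric_sq_velocity hE
        (h.mapsTo hs) (h.velocity_ne_zero s hs)).fderiv).trans (e1 _ _)))
      rfl
  set a := fun s => (2 * u s)⁻¹ with ha
  have haP : ∀ s ∈ I, a s • P s = y s := fun s hs => by
    simp only [ha, hP, smul_smul]
    rw [inv_mul_cancel₀ (mul_pos two_pos (hupos s hs)).ne', one_smul]
  have ha' : ∀ s ∈ I, HasDerivWithinAt a 0 I s := fun s hs => by
    have hapos : 0 < a s := inv_pos.2 (mul_pos two_pos (hupos s hs))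
    refine hH.hasDerivWithinAt_scale (E := E) (γ := γ) (P := P)
      (m := jacobiFactor H E (γ s) (derivWithin γ I s)) hs (hI s hs) (h.mapsTo hs)
      (((continuousOn_const.mul hcu) s hs).inv₀ (mul_pos two_pos (hupos s hs)).ne') hapos
      ?_ (fun r hr => ?_) ?_ ?_
    · rw [haP s hs]
      exact IsConvexHamiltonian.ne_zero_of_energy_eq hE (h.mapsTo hs) (hJ s hs).2.1
    · rw [haP r hr]
      exact (hJ r hr).2.1
    · rw [haP s hs]
      exact hγ s hs
    · rw [haP s hs]
      refine (hP' s hs).congr_deriv ?_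
      simp only [ha]
      rw [div_inv_eq_mul, mul_comm]
  have hconst : ∀ s ∈ I, u s = u s₀ := fun s hs => by
    have h1 := hconv.norm_image_sub_le_of_norm_hasDerivWithin_le (C := 0) ha'
      (fun _ _ => by simp) hs₀ hs
    rw [zero_mul, norm_le_zero_iff, sub_eq_zero] at h1
    exact mul_left_cancel₀ two_ne_zero (inv_injective h1)
  have hrate : ∀ s ∈ I, jacobiRate H (u s₀) (γ s, y s) =
      jacobiFactor H E (γ s) (derivWithin γ I s) := fun s hs => by
    rw [jacobiRate, ← hconst s hs, hu]
    simp only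
    rw [hH.jacobiMetric_eq hE (h.mapsTo hs) (h.velocity_ne_zero s hs)]
    exact mul_div_cancel_right₀ _ (hH.inner_pGrad_self_pos (h.mapsTo hs)
      (IsConvexHamiltonian.ne_zero_of_energy_eq hE (h.mapsTo hs) (hJ s hs).2.1)).ne'
  refine ⟨h.mapsTo, fun s hs => (hJ s hs).2.1, fun s hs => ?_⟩
  have hyd : HasDerivWithinAt y (-(jacobiFactor H E (γ s) (derivWithin γ I s) •
      qGrad H (γ s, y s))) I s := by
    have h1 := (ha' s hs).smul (hP' s hs)
    refine (h1.congr_deriv ?_).congr (fun r hr => (haP r hr).symm) (haP s hs).symm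
    rw [zero_smul, add_zero, smul_neg, smul_smul]
    simp only [ha]
    rw [← mul_assoc, inv_mul_cancel₀ (mul_pos two_pos (hupos s hs)).ne', one_mul]
  rw [jacobiField, hrate s hs]
  exact (hγ s hs).prodMk hyd

end Geodesic

/-! ### Local defining functions; the well is locally a sublevel set of the potential -/

section Boundary

variable {V : Type*} [NormedAddCommGroup V] [NormedSpace ℝ V]

theorem hasDerivAt_comp_line {f : V → ℝ} {x e : V} {s : ℝ} (h : DifferentiableAt ℝ f (x + s • e)) :
    HasDerivAt (fun r : ℝ => f (x + r • e)) (fderiv ℝ f (x + s • e) e) s := by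
  have h0 := ((hasDerivAt_id s).smul_const e).const_add x
  rw [one_smul] at h0
  exact h.hasFDerivAt.comp_hasDerivAt s h0

theorem eventually_pos_line {f : V → ℝ} {x e : V} (h : DifferentiableAt ℝ f x) (h0 : f x = 0)
    (he : 0 < fderiv ℝ f x e) : ∀ᶠ s in 𝓝[>] (0 : ℝ), 0 < f (x + s • e) := by
  have hx : x + (0 : ℝ) • e = x := by simp
  have h1 := hasDerivAt_comp_line (f := f) (x := x) (e := e) (s := 0) (by rwa [hx])
  rw [hx] at h1
  have h2 := (hasDerivAt_iff_tendsto_slope.1 h1).eventually (lt_mem_nhds he)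
  have h3 : ∀ᶠ s in 𝓝[>] (0 : ℝ), 0 < slope (fun r : ℝ => f (x + r • e)) 0 s :=
    h2.filter_mono (nhdsWithin_mono 0 (fun s (hs : 0 < s) => hs.ne'))
  filter_upwards [h3, self_mem_nhdsWithin] with s hs hs0
  rw [slope_def_field, hx, h0, sub_zero, sub_zero] at hs
  exact (div_pos_iff_of_pos_right hs0).1 hs

theorem tendsto_line (x e : V) : Tendsto (fun s : ℝ => x + s • e) (𝓝[>] 0) (𝓝 x) := by
  have : Tendsto (fun s : ℝ => x + s • e) (𝓝 0) (𝓝 (x + (0 : ℝ) • e)) :=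
    (continuous_const.add (continuous_id.smul continuous_const)).tendsto 0
  rw [zero_smul, add_zero] at this
  exact this.mono_left nhdsWithin_le_nhds

/-- If locally `f > 0` implies `g > 0` and both vanish at `x`, then directions that increase `f`
increase `g`. -/
theorem fderiv_pos_of_imp {f g : V → ℝ} {x : V} (hf : DifferentiableAt ℝ f x)
    (hg : DifferentiableAt ℝ g x) (hf0 : f x = 0) (hg0 : g x = 0) (hg' : fderiv ℝ g x ≠ 0)
    (h : ∀ᶠ y in 𝓝 x, 0 < f y → 0 < g y) {e : V} (he : 0 < fderiv ℝ f x e) :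
    0 < fderiv ℝ g x e := by
  have key : ∀ e' : V, 0 < fderiv ℝ f x e' → 0 ≤ fderiv ℝ g x e' := fun e' he' => by
    by_contra hneg
    have h1 := eventually_pos_line hf hf0 he'
    have h2 := eventually_pos_line (f := fun y => -g y) hg.neg (by simp [hg0]) (e := e') (by
      have : fderiv ℝ (fun y => -g y) x = -fderiv ℝ g x := fderiv_fun_neg
      rw [this, neg_apply]; linarith)
    obtain ⟨s, ⟨a, b⟩, c⟩ := ((h1.and h2).and ((tendsto_line x e').eventually h)).exists
    linarith [c a]
  -- If the derivative of `g` vanished at `e`, then, since `{fderiv ℝ f x > 0}` is open, small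
  -- perturbations of `e` along `w` and `-w` would make it nonnegative in both directions, hence
  -- zero on every `w`.
  refine (key e he).lt_of_ne fun h0 => hg' ?_
  ext w
  have hcont : ∀ σ : ℝ, (σ = 1 ∨ σ = -1) → 0 ≤ σ * fderiv ℝ g x w := fun σ hσ => by
    have h1 : ∀ᶠ s in 𝓝[>] (0 : ℝ), 0 < fderiv ℝ f x (e + s • (σ • w)) :=
      ((fderiv ℝ f x).continuous.tendsto e |>.comp (tendsto_line e (σ • w))).eventually
        (lt_mem_nhds he)
    obtain ⟨s, hs, hs0⟩ := (h1.and self_mem_nhdsWithin).exists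
    have h2 := key _ hs
    rw [map_add, ← h0, zero_add, map_smul, map_smul, smul_eq_mul, smul_eq_mul] at h2
    exact nonneg_of_mul_nonneg_right h2 hs0
  have a := hcont 1 (Or.inl rfl)
  have b := hcont (-1) (Or.inr rfl)
  rw [zero_apply]
  linarith

/-- Near a boundary point, a domain of sublevel type is a sublevel set. -/
theorem eventually_mem_iff_lt {D : Set V} {f ψ : V → ℝ} {E : ℝ} {x₀ : V}
    (hf : ContDiffAt ℝ 1 f x₀) (hψ : ContDiffAt ℝ 1 ψ x₀) (hψ0 : ψ x₀ = 0)
    (hψ' : fderiv ℝ ψ x₀ ≠ 0) (hD : ∀ᶠ x in 𝓝 x₀, x ∈ D ↔ 0 < ψ x)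
    (hlt : ∀ x ∈ D, f x < E) (heq : ∀ x ∈ frontier D, f x = E) (hx₀ : x₀ ∈ frontier D)
    (hf' : fderiv ℝ f x₀ ≠ 0) :
    ∀ᶠ x in 𝓝 x₀, (x ∈ D ↔ f x < E) ∧ (x ∈ frontier D ↔ f x = E) := by
  obtain ⟨e, he⟩ : ∃ e, 0 < fderiv ℝ ψ x₀ e := by
    obtain ⟨w, hw⟩ : ∃ w, fderiv ℝ ψ x₀ w ≠ 0 := by
      by_contra hcon
      push Not at hcon
      exact hψ' (ContinuousLinearMap.ext hcon)
    rcases lt_or_gt_of_ne hw with h | h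
    · exact ⟨-w, by rw [map_neg]; linarith⟩
    · exact ⟨w, h⟩
  have hfe : fderiv ℝ f x₀ e < 0 := by
    have hg : fderiv ℝ (fun x => E - f x) x₀ = -fderiv ℝ f x₀ := fderiv_const_sub E
    have := fderiv_pos_of_imp (g := fun x => E - f x) (hψ.differentiableAt one_ne_zero)
      ((hf.differentiableAt one_ne_zero).const_sub E) hψ0 (by simp [heq x₀ hx₀])
      (by rw [hg]; exact neg_ne_zero.2 hf') (by
        filter_upwards [hD] with x hx h0
        exact sub_pos.2 (hlt x (hx.2 h0))) he
    rw [hg, neg_apply] at this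
    linarith
  have hψc : ContinuousAt (fun x => fderiv ℝ ψ x e) x₀ :=
    ((hψ.fderiv_right (m := 0) (by norm_num)).continuousAt).clm_apply continuousAt_const
  have hfc : ContinuousAt (fun x => fderiv ℝ f x e) x₀ :=
    ((hf.fderiv_right (m := 0) (by norm_num)).continuousAt).clm_apply continuousAt_const
  have hev : ∀ᶠ x in 𝓝 x₀, (x ∈ D ↔ 0 < ψ x) ∧ DifferentiableAt ℝ ψ x ∧ DifferentiableAt ℝ f x ∧
      0 < fderiv ℝ ψ x e ∧ fderiv ℝ f x e < 0 := by
    filter_upwards [hD, hψ.eventually (by simp), hf.eventually (by simp),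
      hψc.eventually (lt_mem_nhds he), hfc.eventually (gt_mem_nhds hfe)] with x h1 h2 h3 h4 h5
    exact ⟨h1, h2.differentiableAt one_ne_zero, h3.differentiableAt one_ne_zero, h4, h5⟩
  obtain ⟨r, hr, hball⟩ := Metric.eventually_nhds_iff_ball.1 hev
  set η := r / (2 * (‖e‖ + 1)) with hη
  have hη0 : 0 < η := by positivity
  have hline : ∀ x ∈ Metric.ball x₀ (r / 2), ∀ s ∈ Icc (-η) η, x + s • e ∈ Metric.ball x₀ r := by
    intro x hx s hs
    rw [mem_ball_iff_norm] at hx ⊢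
    have h1 : ‖s • e‖ < r / 2 := by
      rw [norm_smul, Real.norm_eq_abs]
      calc |s| * ‖e‖ ≤ η * ‖e‖ := mul_le_mul_of_nonneg_right (abs_le.2 hs) (norm_nonneg _)
        _ < η * (‖e‖ + 1) := mul_lt_mul_of_pos_left (lt_add_one _) hη0
        _ = r / 2 := by rw [hη]; field_simp
    calc ‖x + s • e - x₀‖ = ‖(x - x₀) + s • e‖ := by congr 1; abel
      _ ≤ ‖x - x₀‖ + ‖s • e‖ := norm_add_le _ _
      _ < r := by linarith
  -- On short segments in the direction `e`, `ψ` strictly increases and `f` strictly decreases. The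
  -- zero of `ψ` on such a segment is a frontier point, where `f = E`, so both functions cross their
  -- critical values at the same parameter and describe the same side.
  have hmono : ∀ x ∈ Metric.ball x₀ (r / 2), StrictMonoOn (fun s : ℝ => ψ (x + s • e)) (Icc (-η) η) :=
    fun x hx => strictMonoOn_of_deriv_pos (convex_Icc _ _)
      (fun s hs => (hasDerivAt_comp_line
        (hball _ (hline x hx s hs)).2.1).continuousAt.continuousWithinAt) fun s hs => by
        rw [interior_Icc] at hs
        have h1 := hball _ (hline x hx s (Ioo_subset_Icc_self hs))
        rw [(hasDerivAt_comp_line h1.2.1).deriv]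
        exact h1.2.2.2.1
  have hanti : ∀ x ∈ Metric.ball x₀ (r / 2),
      StrictAntiOn (fun s : ℝ => f (x + s • e)) (Icc (-η) η) :=
    fun x hx => strictAntiOn_of_deriv_neg (convex_Icc _ _)
      (fun s hs => (hasDerivAt_comp_line
        (hball _ (hline x hx s hs)).2.2.1).continuousAt.continuousWithinAt) fun s hs => by
        rw [interior_Icc] at hs
        have h1 := hball _ (hline x hx s (Ioo_subset_Icc_self hs))
        rw [(hasDerivAt_comp_line h1.2.2.1).deriv]
        exact h1.2.2.2.2
  have m0 : (0 : ℝ) ∈ Icc (-η) η := ⟨by linarith, hη0.le⟩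
  have mη : η ∈ Icc (-η) η := ⟨by linarith, le_rfl⟩
  have mη' : -η ∈ Icc (-η) η := ⟨le_rfl, by linarith⟩
  have hx₀b : x₀ ∈ Metric.ball x₀ (r / 2) := Metric.mem_ball_self (by positivity)
  have hend : ∀ s ∈ Icc (-η) η, ContinuousAt (fun x => ψ (x + s • e)) x₀ := fun s hs =>
    ContinuousAt.comp (g := ψ) (f := fun x => x + s • e)
      (hball _ (hline x₀ hx₀b s hs)).2.1.continuousAt (by fun_prop)
  have hp : 0 < ψ (x₀ + η • e) := by
    have := hmono x₀ hx₀b m0 mη hη0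
    simpa [hψ0] using this
  have hn : ψ (x₀ + (-η) • e) < 0 := by
    have := hmono x₀ hx₀b mη' m0 (by linarith)
    simpa [hψ0] using this
  filter_upwards [Metric.ball_mem_nhds x₀ (half_pos hr),
    (hend η mη).eventually (lt_mem_nhds hp), (hend (-η) mη').eventually (gt_mem_nhds hn)]
    with x hx hxp hxn
  have hc : ContinuousOn (fun s : ℝ => ψ (x + s • e)) (Icc (-η) η) := fun s hs =>
    (hasDerivAt_comp_line (hball _ (hline x hx s hs)).2.1).continuousAt.continuousWithinAt
  obtain ⟨s, hs, hs0⟩ := intermediate_value_Icc (by linarith : -η ≤ η) hc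
    (show (0 : ℝ) ∈ Icc _ _ from ⟨hxn.le, hxp.le⟩)
  have hs0' : ψ (x + s • e) = 0 := hs0
  set z := x + s • e with hz
  have hzb := hball z (hline x hx s hs)
  have hzf : z ∈ frontier D := by
    refine ⟨?_, fun hi => ?_⟩
    · refine mem_closure_of_tendsto (tendsto_line z e) ?_
      have h1 := eventually_pos_line hzb.2.1 hs0' hzb.2.2.2.1
      have h2 : ∀ᶠ y in 𝓝 z, y ∈ Metric.ball x₀ r :=
        Metric.isOpen_ball.mem_nhds (hline x hx s hs)
      filter_upwards [h1, (tendsto_line z e).eventually h2] with σ a b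
      exact (hball _ b).1.2 a
    · exact absurd (hzb.1.1 (interior_subset hi)) (by rw [hs0']; exact lt_irrefl _)
  have hzE := heq z hzf
  have hx0 : x + (0 : ℝ) • e = x := by simp
  have hxb : x ∈ Metric.ball x₀ r := Metric.ball_subset_ball (by linarith) hx
  have c1 : 0 < ψ x ↔ s < 0 := by
    have := (hmono x hx).lt_iff_lt hs m0
    simp only [hx0] at this
    rw [← this, hs0']
  have c2 : f x < E ↔ s < 0 := by
    have := (hanti x hx).lt_iff_gt m0 hs
    simp only [hx0] at this
    rw [← this, ← hz, hzE]
  refine ⟨(hball x hxb).1.trans (c1.trans c2.symm), fun h => heq x h, fun h => ?_⟩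
  have : s = 0 := (hanti x hx).injOn hs m0 (by
    change f z = f (x + (0 : ℝ) • e)
    rw [hx0, hzE, h])
  rw [hz, this, hx0] at hzf
  exact hzf

end Boundary

/-! ### The Hamiltonian flow from points at rest -/

section BrakeFlow

open scoped RealInnerProductSpace

variable {V : Type*} [NormedAddCommGroup V] [InnerProductSpace ℝ V] [CompleteSpace V]
  [FiniteDimensional ℝ V]

/-- The Hamiltonian vector field. -/
noncomputable def hamiltonField (H : V × V → ℝ) (z : V × V) : V × V := (pGrad H z, -qGrad H z)

theorem contDiffAt_hamiltonField {H : V × V → ℝ} {z : V × V} (h : ContDiffAt ℝ 2 H z) :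
    ContDiffAt ℝ 1 (hamiltonField H) z :=
  (contDiffAt_pGrad h).prodMk (contDiffAt_qGrad h).neg

theorem hamiltonField_congr {H G : V × V → ℝ} {z : V × V} (h : H =ᶠ[𝓝 z] G)
    (hd : DifferentiableAt ℝ H z) : hamiltonField H z = hamiltonField G z := by
  have hd' : DifferentiableAt ℝ G z := hd.congr_of_eventuallyEq h.symm
  rw [hamiltonField, hamiltonField, pGrad_eq_toDual_symm hd, pGrad_eq_toDual_symm hd',
    qGrad_eq_toDual_symm hd, qGrad_eq_toDual_symm hd', h.fderiv_eq]

theorem hasCompactSupport_hamiltonField {H : V × V → ℝ} (h : ContDiff ℝ 2 H)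
    (hc : HasCompactSupport H) : HasCompactSupport (hamiltonField H) := by
  have hd : Differentiable ℝ H := h.differentiable two_ne_zero
  have e : hamiltonField H = (fun A : V × V →L[ℝ] ℝ =>
      ((InnerProductSpace.toDual ℝ V).symm (A ∘L .inr ℝ V V),
        -(InnerProductSpace.toDual ℝ V).symm (A ∘L .inl ℝ V V))) ∘ fderiv ℝ H := by
    funext z
    rw [hamiltonField, pGrad_eq_toDual_symm (hd z), qGrad_eq_toDual_symm (hd z)]
    rfl
  rw [e]
  exact (hc.fderiv (𝕜 := ℝ)).comp_left (by simp)

/-- The flow of Hamilton's equations for small times, from initial points at rest. -/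
theorem exists_brakeFlow {H : V × V → ℝ} (hH : ContDiff ℝ 2 H) (R : ℝ) :
    ∃ T > 0, ∃ Q P : ℝ → V → V, (∀ x, Q 0 x = x ∧ P 0 x = 0) ∧
      (∀ t ∈ Ioo (-T) T, ∀ x ∈ Metric.ball (0 : V) R,
        HasDerivAt (fun r => (Q r x, P r x)) (hamiltonField H (Q t x, P t x)) t) ∧
      (∀ t ∈ Ioo (-T) T, ∀ x, ContDiffAt ℝ 1 (fun u : ℝ × V => (Q u.1 u.2, P u.1 u.2)) (t, x)) ∧
      (∀ t ∈ Ioo (-T) T, ∀ x, ∃ C : ℝ, 0 ≤ C ∧ ∀ᶠ u : ℝ × V in 𝓝 (t, x), ∀ s ∈ Icc (0 : ℝ) 1,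
        ‖(Q (s * u.1) u.2, P (s * u.1) u.2) - (Q (s * t) x, P (s * t) x)‖ ≤ C * ‖u - (t, x)‖) := by
  set R' := max R 0 + 1 with hR'
  have hR'0 : 0 < R' := by positivity
  -- Cutting `H` off makes the vector field compactly supported. With `C` a bound for it, an orbit
  -- moves by at most `C * |t| ≤ 1` for `|t| < 1 / (C + 1)`, so from the ball of radius `R` it never
  -- leaves the region where `H` is unchanged.
  let f : ContDiffBump (0 : V × V) := ⟨R', R' + 1, hR'0, by linarith⟩
  set G : V × V → ℝ := fun z => f z * H z with hG
  have hGC : ContDiff ℝ 2 G := f.contDiff.mul hH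
  have hGc : HasCompactSupport G := f.hasCompactSupport.mul_right
  have hGH : ∀ z ∈ Metric.ball (0 : V × V) R', H =ᶠ[𝓝 z] G := fun z hz => by
    filter_upwards [Metric.isOpen_ball.mem_nhds hz] with w hw
    rw [hG]
    simp only
    rw [f.one_of_mem_closedBall (Metric.ball_subset_closedBall hw), one_mul]
  have hXC : ContDiff ℝ 1 (hamiltonField G) :=
    contDiff_iff_contDiffAt.2 fun z => contDiffAt_hamiltonField hGC.contDiffAt
  have hXc := hasCompactSupport_hamiltonField hGC hGc
  obtain ⟨T, hT, φ, h0, hode, hC1, hlip⟩ := exists_contDiff_flow hXC hXc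
  obtain ⟨C, hC⟩ := hXc.exists_bound_of_continuous hXC.continuous
  have hC0 : 0 ≤ C := (norm_nonneg _).trans (hC 0)
  set T' := min T (1 / (C + 1)) with hT'
  have hT'0 : 0 < T' := lt_min hT (by positivity)
  have hsub : ∀ t ∈ Ioo (-T') T', t ∈ Ioo (-T) T := fun t ht =>
    ⟨by linarith [ht.1, min_le_left T (1 / (C + 1))], ht.2.trans_le (min_le_left _ _)⟩
  refine ⟨T', hT'0, fun t x => (φ t (x, 0)).1, fun t x => (φ t (x, 0)).2,
    fun x => by simp [h0], fun t ht x hx => ?_, fun t ht x => ?_, fun t ht x => ?_⟩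
  · have hd := hode t (hsub t ht) (x, 0)
    have hz : φ t (x, 0) ∈ Metric.ball (0 : V × V) R' := by
      have h1 := (convex_Ioo (-T') T').norm_image_sub_le_of_norm_hasDerivWithin_le
        (f := fun r => φ r (x, 0)) (C := C)
        (fun r hr => (hode r (hsub r hr) (x, 0)).hasDerivWithinAt) (fun r _ => hC _)
        (show (0 : ℝ) ∈ Ioo (-T') T' from ⟨by linarith, hT'0⟩) ht
      rw [h0, sub_zero, Real.norm_eq_abs] at h1
      have h2 : |t| < 1 / (C + 1) := (abs_lt.2 ht).trans_le (min_le_right _ _)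
      have h3 : C * |t| ≤ 1 := by
        have : |t| * (C + 1) < 1 := (lt_div_iff₀ (by positivity)).1 h2
        nlinarith [abs_nonneg t]
      have h4 : ‖((x, 0) : V × V)‖ < R := by
        rw [mem_ball_zero_iff] at hx
        rw [Prod.norm_def]
        simp only [norm_zero]
        exact max_lt hx ((norm_nonneg x).trans_lt hx)
      rw [mem_ball_zero_iff]
      calc ‖φ t (x, 0)‖ = ‖(φ t (x, 0) - (x, 0)) + (x, 0)‖ := by rw [sub_add_cancel]
        _ ≤ ‖φ t (x, 0) - (x, 0)‖ + ‖((x, 0) : V × V)‖ := norm_add_le _ _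
        _ < 1 + R := by linarith
        _ ≤ R' := by rw [hR']; linarith [le_max_left R 0]
    rw [← hamiltonField_congr (hGH _ hz) (hH.differentiable two_ne_zero _)] at hd
    exact hd
  · exact (hC1 t (hsub t ht) (x, 0)).comp (t, x)
      (f := fun u : ℝ × V => (u.1, ((u.2, 0) : V × V))) (by fun_prop)
  · obtain ⟨K, hK0, hK⟩ := hlip t (hsub t ht) (x, 0)
    refine ⟨K, hK0, ?_⟩
    have hcont : Tendsto (fun u : ℝ × V => (u.1, ((u.2, 0) : V × V))) (𝓝 (t, x))
        (𝓝 (t, (x, 0))) := Continuous.tendsto' (by fun_prop) _ _ rfl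
    filter_upwards [hcont.eventually hK] with u hu s hs
    refine (hu s hs).trans_eq ?_
    congr 1
    simp [Prod.norm_def]

end BrakeFlow

/-! ### Two consequences of strict differentiability -/

section StrictDerivative

variable {X Y : Type*} [NormedAddCommGroup X] [NormedSpace ℝ X] [NormedAddCommGroup Y]
  [NormedSpace ℝ Y]

/-- Derivatives at nearby points are uniformly bounded below. -/
theorem exists_norm_le_of_hasStrictFDerivAt {f : X → Y} {e : X ≃L[ℝ] Y} {x : X}
    (h : HasStrictFDerivAt f (e : X →L[ℝ] Y) x) :
    ∃ C > 0, ∀ᶠ u in 𝓝 x, ∀ A : X →L[ℝ] Y, HasFDerivAt f A u → ∀ w, ‖w‖ ≤ C * ‖A w‖ := by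
  set c := ‖(e.symm : Y →L[ℝ] X)‖ + 1 with hc
  have hc0 : 0 < c := by positivity
  refine ⟨2 * c, by positivity, ?_⟩
  have h1 := (h.isLittleO.bound (show 0 < 1 / (2 * c) by positivity)).eventually_nhds
  have hdiag : Tendsto (fun u : X => (u, u)) (𝓝 x) (𝓝 (x, x)) :=
    Continuous.tendsto' (by fun_prop) _ _ rfl
  filter_upwards [hdiag.eventually h1] with u hu A hA w
  have hu' : ∀ᶠ v in 𝓝 u, ‖f v - f u - e (v - u)‖ ≤ 1 / (2 * c) * ‖v - u‖ := by
    have : Tendsto (fun v : X => (v, u)) (𝓝 u) (𝓝 (u, u)) := Continuous.tendsto' (by fun_prop) _ _ rfl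
    exact this.eventually hu
  have hd : HasFDerivAt (fun v => f v - e v) (A - (e : X →L[ℝ] Y)) u :=
    hA.sub (e : X →L[ℝ] Y).hasFDerivAt
  have hn : ‖A - (e : X →L[ℝ] Y)‖ ≤ 1 / (2 * c) := by
    refine hd.le_of_lip' (by positivity) ?_
    filter_upwards [hu'] with v hv
    rw [map_sub] at hv
    convert hv using 2
    abel
  have hw : ‖w‖ ≤ c * ‖e w‖ := by
    calc ‖w‖ = ‖(e.symm : Y →L[ℝ] X) (e w)‖ := by simp
      _ ≤ ‖(e.symm : Y →L[ℝ] X)‖ * ‖e w‖ := ContinuousLinearMap.le_opNorm _ _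
      _ ≤ c * ‖e w‖ := mul_le_mul_of_nonneg_right (by rw [hc]; linarith) (norm_nonneg _)
  have h2 : ‖e w‖ ≤ ‖A w‖ + 1 / (2 * c) * ‖w‖ := by
    have h3 : e w = A w - (A - (e : X →L[ℝ] Y)) w := by simp
    calc ‖e w‖ = ‖A w - (A - (e : X →L[ℝ] Y)) w‖ := by rw [← h3]
      _ ≤ ‖A w‖ + ‖(A - (e : X →L[ℝ] Y)) w‖ := norm_sub_le _ _
      _ ≤ _ := by gcongr; exact (A - (e : X →L[ℝ] Y)).le_of_opNorm_le hn w
  have h4 : c * (1 / (2 * c) * ‖w‖) = ‖w‖ / 2 := by field_simp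
  nlinarith [mul_le_mul_of_nonneg_left h2 hc0.le]

/-- Strict differentiability compares `u` with `(0, u.2)` for moving `u.2`. The difference quotient
in the first variable thus converges jointly in both variables, not just along a fixed `x`. -/
theorem tendsto_inv_smul_of_hasStrictFDerivAt {g : ℝ × X → Y} {L : ℝ × X →L[ℝ] Y} {x : X}
    (h : HasStrictFDerivAt g L (0, x)) (h0 : ∀ᶠ x' in 𝓝 x, g (0, x') = 0) :
    Tendsto (fun u : ℝ × X => u.1⁻¹ • g u) (𝓝[{u | u.1 ≠ 0}] (0, x)) (𝓝 (L (1, 0))) := by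
  rw [Metric.tendsto_nhds]
  intro ε hε
  have hpair : Tendsto (fun u : ℝ × X => (u, ((0 : ℝ), u.2))) (𝓝 (0, x)) (𝓝 ((0, x), (0, x))) :=
    Continuous.tendsto' (by fun_prop) _ _ rfl
  have hsnd : Tendsto (fun u : ℝ × X => u.2) (𝓝 (0, x)) (𝓝 x) :=
    Continuous.tendsto' (by fun_prop) _ _ rfl
  have h1 := hpair.eventually (h.isLittleO.bound (half_pos hε))
  filter_upwards [mem_nhdsWithin_of_mem_nhds (h1.and (hsnd.eventually h0)), self_mem_nhdsWithin]
    with u hu hu0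
  obtain ⟨ha, hb⟩ := hu
  have hu0 : u.1 ≠ 0 := hu0
  have e1 : u - ((0 : ℝ), u.2) = u.1 • ((1 : ℝ), (0 : X)) := by ext <;> simp
  rw [hb, sub_zero, e1, map_smul] at ha
  have e2 : ‖u.1 • ((1 : ℝ), (0 : X))‖ = |u.1| := by
    rw [norm_smul, Prod.norm_def]; simp
  rw [e2] at ha
  rw [dist_eq_norm]
  have e3 : u.1⁻¹ • g u - L (1, 0) = u.1⁻¹ • (g u - u.1 • L (1, 0)) := by
    rw [smul_sub, smul_smul, inv_mul_cancel₀ hu0, one_smul]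
  rw [e3, norm_smul, norm_inv, Real.norm_eq_abs]
  have hpos : 0 < |u.1| := abs_pos.2 hu0
  calc |u.1|⁻¹ * ‖g u - u.1 • L (1, 0)‖ ≤ |u.1|⁻¹ * (ε / 2 * |u.1|) := by gcongr
    _ = ε / 2 := by field_simp
    _ < ε := half_lt_self hε

end StrictDerivative

/-! ### First-order behaviour of the brake flow at time zero -/

section Flow

open scoped RealInnerProductSpace

variable {V : Type*} [NormedAddCommGroup V] [InnerProductSpace ℝ V] [CompleteSpace V]
  [FiniteDimensional ℝ V]

/-- `(Q, P)` is the flow of Hamilton's equations for times `|t| < T`, from initial points at rest in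
the ball of radius `R`. -/
structure IsBrakeFlow (H : V × V → ℝ) (R T : ℝ) (Q P : ℝ → V → V) : Prop where
  pos : 0 < T
  zero : ∀ x, Q 0 x = x ∧ P 0 x = 0
  hasDerivAt : ∀ t ∈ Ioo (-T) T, ∀ x ∈ Metric.ball (0 : V) R,
    HasDerivAt (fun r => (Q r x, P r x)) (hamiltonField H (Q t x, P t x)) t
  contDiffAt : ∀ t ∈ Ioo (-T) T, ∀ x,
    ContDiffAt ℝ 1 (fun u : ℝ × V => (Q u.1 u.2, P u.1 u.2)) (t, x)
  lipschitz : ∀ t ∈ Ioo (-T) T, ∀ x, ∃ C : ℝ, 0 ≤ C ∧ ∀ᶠ u : ℝ × V in 𝓝 (t, x),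
    ∀ s ∈ Icc (0 : ℝ) 1,
      ‖(Q (s * u.1) u.2, P (s * u.1) u.2) - (Q (s * t) x, P (s * t) x)‖ ≤ C * ‖u - (t, x)‖

theorem exists_isBrakeFlow {H : V × V → ℝ} (hH : ContDiff ℝ 2 H) (R : ℝ) :
    ∃ T Q P, IsBrakeFlow H R T Q P := by
  obtain ⟨T, hT, Q, P, h1, h2, h3, h4⟩ := exists_brakeFlow hH R
  exact ⟨T, Q, P, hT, h1, h2, h3, h4⟩

/-- The initial force at a point of rest. -/
noncomputable def restForce (H : V × V → ℝ) (x : V) : V := -qGrad H (x, 0)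

/-- The initial acceleration at a point of rest. -/
noncomputable def restAccel (H : V × V → ℝ) (x : V) : V :=
  fderiv ℝ (pGrad H) (x, 0) (0, restForce H x)

theorem continuous_restForce {H : V × V → ℝ} (hH : ContDiff ℝ 2 H) : Continuous (restForce H) :=
  continuous_iff_continuousAt.2 fun x => ((contDiffAt_qGrad (z := (x, 0))
    hH.contDiffAt).continuousAt.comp (f := fun x : V => (x, (0 : V))) (by fun_prop)).neg

theorem continuous_fderiv_pGrad {H : V × V → ℝ} (hH : ContDiff ℝ 2 H) :
    Continuous (fderiv ℝ (pGrad H)) :=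
  continuous_iff_continuousAt.2 fun _ =>
    ((contDiffAt_pGrad hH.contDiffAt).fderiv_right (m := 0) (by norm_num)).continuousAt

theorem continuous_restAccel {H : V × V → ℝ} (hH : ContDiff ℝ 2 H) : Continuous (restAccel H) :=
  ((continuous_fderiv_pGrad hH).comp (f := fun x : V => (x, (0 : V))) (by fun_prop)).clm_apply
    (continuous_const.prodMk (continuous_restForce hH))

theorem IsConvexHamiltonian.inner_restForce_restAccel_pos {H : V × V → ℝ}
    (hC : IsConvexHamiltonian univ H) {x : V} (hx : restForce H x ≠ 0) :
    0 < ⟪restForce H x, restAccel H x⟫ := by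
  obtain ⟨ν, -, hν, h⟩ := hC.hessian
  have := h x (mem_univ x) 0 (restForce H x)
  rw [real_inner_comm]
  refine lt_of_lt_of_le ?_ this
  exact mul_pos (hν x (mem_univ x)) (by positivity)

theorem hasFDerivAt_potential {H : V × V → ℝ} (hH : ContDiff ℝ 2 H) (x : V) :
    HasFDerivAt (fun x => H (x, 0)) (-innerSL ℝ (restForce H x)) x := by
  have h := HasFDerivAt.comp (g := H) (f := fun x => (x, (0 : V))) x
    (hH.differentiable two_ne_zero (x, 0)).hasFDerivAt (hasFDerivAt_prodMk_left x 0)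
  refine HasFDerivAt.congr_fderiv h ?_
  ext w
  rw [ContinuousLinearMap.comp_apply, neg_apply, innerSL_apply_apply, restForce, inner_neg_left,
    neg_neg, inner_qGrad (hH.differentiable two_ne_zero (x, 0))]
  rfl

namespace IsBrakeFlow

variable {H : V × V → ℝ} {R T : ℝ} {Q P : ℝ → V → V} (hF : IsBrakeFlow H R T Q P)

include hF

theorem zero_mem : (0 : ℝ) ∈ Ioo (-T) T := ⟨by linarith [hF.pos], hF.pos⟩

theorem hasDerivAt_fst {t : ℝ} (ht : t ∈ Ioo (-T) T) {x : V} (hx : x ∈ Metric.ball (0 : V) R) :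
    HasDerivAt (fun r => Q r x) (pGrad H (Q t x, P t x)) t := (hF.hasDerivAt t ht x hx).fst

theorem hasDerivAt_snd {t : ℝ} (ht : t ∈ Ioo (-T) T) {x : V} (hx : x ∈ Metric.ball (0 : V) R) :
    HasDerivAt (fun r => P r x) (-qGrad H (Q t x, P t x)) t := (hF.hasDerivAt t ht x hx).snd

theorem energy (hH : ContDiff ℝ 2 H) {t : ℝ} (ht : t ∈ Ioo (-T) T) {x : V}
    (hx : x ∈ Metric.ball (0 : V) R) : H (Q t x, P t x) = H (x, 0) := by
  have h := (convex_Ioo (-T) T).norm_image_sub_le_of_norm_hasDerivWithin_le (C := 0)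
    (f := fun r => H (Q r x, P r x)) (f' := fun _ => 0) (fun r hr =>
      hasDerivWithinAt_energy (m := 1) (hH.differentiable two_ne_zero _)
        (by rw [one_smul]; exact (hF.hasDerivAt_fst hr hx).hasDerivWithinAt)
        (by rw [one_smul]; exact (hF.hasDerivAt_snd hr hx).hasDerivWithinAt))
    (fun _ _ => by simp) hF.zero_mem ht
  rw [zero_mul, norm_le_zero_iff, sub_eq_zero, (hF.zero x).1, (hF.zero x).2] at h
  exact h

/-- At time `0` the flow is the identity on points at rest, and since the velocity vanishes with the
momentum, the time derivative is `(0, restForce H x)`. -/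
theorem hasStrictFDerivAt_zero (hC : IsConvexHamiltonian univ H) {x : V}
    (hx : x ∈ Metric.ball (0 : V) R) :
    HasStrictFDerivAt (fun u : ℝ × V => (Q u.1 u.2, P u.1 u.2))
      ((ContinuousLinearMap.snd ℝ ℝ V).prod
        ((ContinuousLinearMap.fst ℝ ℝ V).smulRight (restForce H x))) (0, x) := by
  have h := (hF.contDiffAt 0 hF.zero_mem x).hasStrictFDerivAt one_ne_zero
  refine h.congr_fderiv ?_
  set L := fderiv ℝ (fun u : ℝ × V => (Q u.1 u.2, P u.1 u.2)) (0, x)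
  have e1 : L ∘L .inr ℝ ℝ V = .inl ℝ V V := by
    have a1 : HasFDerivAt (fun y : V => (Q 0 y, P 0 y)) (L ∘L .inr ℝ ℝ V) x :=
      HasFDerivAt.comp (g := fun u : ℝ × V => (Q u.1 u.2, P u.1 u.2)) (f := fun y => ((0 : ℝ), y)) x
        h.hasFDerivAt (hasFDerivAt_prodMk_right 0 x)
    refine a1.unique ?_
    simp only [hF.zero]
    exact hasFDerivAt_prodMk_left x 0
  have e2 : L (1, 0) = (0, restForce H x) := by
    have a1 : HasDerivAt (fun t : ℝ => (Q t x, P t x)) (L (1, 0)) 0 :=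
      HasFDerivAt.comp_hasDerivAt (l := fun u : ℝ × V => (Q u.1 u.2, P u.1 u.2))
        (f := fun t : ℝ => (t, x)) 0 h.hasFDerivAt
        ((hasDerivAt_id (0 : ℝ)).prodMk (hasDerivAt_const (0 : ℝ) x))
    rw [a1.unique (hF.hasDerivAt 0 hF.zero_mem x hx), hamiltonField, (hF.zero x).1, (hF.zero x).2,
      hC.pGrad_zero (mem_univ x), restForce]
  refine ContinuousLinearMap.ext fun w => ?_
  have e3 : w = w.1 • ((1 : ℝ), (0 : V)) + (0, w.2) := by ext <;> simp
  have e4 : L (0, w.2) = (w.2, 0) := congrArg (fun A : V →L[ℝ] V × V => A w.2) e1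
  rw [e3, map_add, map_smul, e2, e4]
  ext <;> simp

theorem tendsto_fderiv (hC : IsConvexHamiltonian univ H) {x : V}
    (hx : x ∈ Metric.ball (0 : V) R) :
    Tendsto (fderiv ℝ (fun u : ℝ × V => (Q u.1 u.2, P u.1 u.2))) (𝓝 (0, x))
      (𝓝 ((ContinuousLinearMap.snd ℝ ℝ V).prod
        ((ContinuousLinearMap.fst ℝ ℝ V).smulRight (restForce H x)))) := by
  rw [← (hF.hasStrictFDerivAt_zero hC hx).hasFDerivAt.fderiv]
  exact ((hF.contDiffAt 0 hF.zero_mem x).fderiv_right (m := 0) (by norm_num)).continuousAt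

theorem hasStrictFDerivAt_velocity_zero (hC : IsConvexHamiltonian univ H) {x : V}
    (hx : x ∈ Metric.ball (0 : V) R) :
    HasStrictFDerivAt (fun u : ℝ × V => pGrad H (Q u.1 u.2, P u.1 u.2))
      (fderiv ℝ (pGrad H) (x, 0) ∘L ((ContinuousLinearMap.snd ℝ ℝ V).prod
        ((ContinuousLinearMap.fst ℝ ℝ V).smulRight (restForce H x)))) (0, x) := by
  refine HasStrictFDerivAt.comp (g := pGrad H) (f := fun u : ℝ × V => (Q u.1 u.2, P u.1 u.2)) (0, x)
    ?_ (hF.hasStrictFDerivAt_zero hC hx)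
  simp only [hF.zero]
  exact (hC.contDiffAt_pGrad (mem_univ x) 0).hasStrictFDerivAt one_ne_zero

theorem tendsto_inv_smul_momentum (hC : IsConvexHamiltonian univ H) {x : V}
    (hx : x ∈ Metric.ball (0 : V) R) :
    Tendsto (fun u : ℝ × V => u.1⁻¹ • P u.1 u.2) (𝓝[{u | u.1 ≠ 0}] (0, x))
      (𝓝 (restForce H x)) := by
  have h := tendsto_inv_smul_of_hasStrictFDerivAt (hF.hasStrictFDerivAt_zero hC hx).snd
    (Eventually.of_forall fun x' => (hF.zero x').2)
  refine h.trans_eq ?_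
  simp

theorem tendsto_inv_smul_velocity (hC : IsConvexHamiltonian univ H) {x : V}
    (hx : x ∈ Metric.ball (0 : V) R) :
    Tendsto (fun u : ℝ × V => u.1⁻¹ • pGrad H (Q u.1 u.2, P u.1 u.2)) (𝓝[{u | u.1 ≠ 0}] (0, x))
      (𝓝 (restAccel H x)) := by
  have h := tendsto_inv_smul_of_hasStrictFDerivAt (hF.hasStrictFDerivAt_velocity_zero hC hx)
    (Eventually.of_forall fun x' => by
      simp only [hF.zero]
      exact hC.pGrad_zero (mem_univ x'))
  refine h.trans_eq ?_
  simp [restAccel]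

open Classical in
/-- `Q̇ / t`, extended by the acceleration at `t = 0`. -/
theorem continuousAt_velocityQuotient (hH : ContDiff ℝ 2 H) (hC : IsConvexHamiltonian univ H)
    {x : V} (hx : x ∈ Metric.ball (0 : V) R) :
    ContinuousAt (fun u : ℝ × V => if u.1 = 0 then restAccel H u.2 else
      u.1⁻¹ • pGrad H (Q u.1 u.2, P u.1 u.2)) (0, x) := by
  rw [continuousAt_iff_punctured_nhds]
  simp only [if_true]
  have h1 := hF.tendsto_inv_smul_velocity hC hx
  have h2 : Tendsto (fun u : ℝ × V => restAccel H u.2) (𝓝[{u | u.1 = 0}] (0, x))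
      (𝓝 (restAccel H x)) :=
    ((continuous_restAccel hH).continuousAt.comp (f := fun u : ℝ × V => u.2)
      continuous_snd.continuousAt).mono_left nhdsWithin_le_nhds
  have hle : 𝓝[≠] ((0 : ℝ), x) ≤ 𝓝[{u | u.1 = 0}] (0, x) ⊔ 𝓝[{u | u.1 ≠ 0}] (0, x) := by
    rw [← nhdsWithin_union]
    refine nhdsWithin_mono _ fun u _ => ?_
    exact Classical.em (u.1 = 0)
  refine Tendsto.mono_left (tendsto_sup.2 ⟨?_, ?_⟩) hle
  · refine h2.congr' ?_
    filter_upwards [self_mem_nhdsWithin] with u hu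
    rw [if_pos hu]
  · refine h1.congr' ?_
    filter_upwards [self_mem_nhdsWithin] with u hu
    rw [if_neg hu]

end IsBrakeFlow

end Flow

/-! ### Unfolding the brake flow in the variable `τ = t²` -/

section Fold

open scoped RealInnerProductSpace

variable {V : Type*} [NormedAddCommGroup V] [InnerProductSpace ℝ V] [CompleteSpace V]
  [FiniteDimensional ℝ V]

/-- The brake flow in the time variable `τ = t²`, extended oddly to negative `τ`. -/
noncomputable def unfoldedFlow (Q : ℝ → V → V) (τ : ℝ) (x : V) : V :=
  x + (Q (√τ) x - Q (√(-τ)) x)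

/-- The collar map, which records the starting energy next to the position. -/
noncomputable def collarMap (H : V × V → ℝ) (Q : ℝ → V → V) (u : ℝ × V) : V × ℝ :=
  (unfoldedFlow Q u.1 u.2, H (u.2, 0))

namespace IsBrakeFlow

variable {H : V × V → ℝ} {R T : ℝ} {Q P : ℝ → V → V} (hF : IsBrakeFlow H R T Q P)

include hF

theorem sqrt_mem {τ : ℝ} (h : |τ| < T ^ 2) : √τ ∈ Ioo (-T) T ∧ √(-τ) ∈ Ioo (-T) T := by
  have hT := hF.pos
  have h1 := abs_lt.1 h
  refine ⟨⟨by linarith [Real.sqrt_nonneg τ], (Real.sqrt_lt' hT).2 h1.2⟩,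
    ⟨by linarith [Real.sqrt_nonneg (-τ)], (Real.sqrt_lt' hT).2 (by linarith)⟩⟩

theorem unfoldedFlow_of_nonneg {τ : ℝ} (h : 0 ≤ τ) (x : V) : unfoldedFlow Q τ x = Q (√τ) x := by
  -- `√` vanishes on negative numbers, so one of the two flow terms is always `Q 0 x = x`.
  rw [unfoldedFlow, Real.sqrt_eq_zero_of_nonpos (neg_nonpos.2 h), (hF.zero x).1]
  abel

theorem unfoldedFlow_zero (x : V) : unfoldedFlow Q 0 x = x := by
  rw [hF.unfoldedFlow_of_nonneg le_rfl, Real.sqrt_zero, (hF.zero x).1]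

theorem unfoldedFlow_neg (τ : ℝ) (x : V) :
    unfoldedFlow Q (-τ) x = (2 : ℝ) • x - unfoldedFlow Q τ x := by
  rw [unfoldedFlow, unfoldedFlow, neg_neg, two_smul]
  abel

theorem continuousAt_position {t : ℝ} (ht : t ∈ Ioo (-T) T) (x : V) :
    ContinuousAt (fun u : ℝ × V => Q u.1 u.2) (t, x) :=
  (hF.contDiffAt t ht x).fst.continuousAt

theorem continuousAt_collarMap (hH : ContDiff ℝ 2 H) {u : ℝ × V} (hu : |u.1| < T ^ 2) :
    ContinuousAt (collarMap H Q) u := by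
  have h1 : ContinuousAt (fun w : ℝ × V => Q (√w.1) w.2) u :=
    ContinuousAt.comp (g := fun w : ℝ × V => Q w.1 w.2) (f := fun w : ℝ × V => (√w.1, w.2))
      (hF.continuousAt_position (hF.sqrt_mem hu).1 u.2) (by fun_prop)
  have h2 : ContinuousAt (fun w : ℝ × V => Q (√(-w.1)) w.2) u :=
    ContinuousAt.comp (g := fun w : ℝ × V => Q w.1 w.2) (f := fun w : ℝ × V => (√(-w.1), w.2))
      (hF.continuousAt_position (hF.sqrt_mem hu).2 u.2) (by fun_prop)
  have h3 : ContinuousAt (fun w : ℝ × V => H (w.2, 0)) u :=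
    (hH.continuous.comp (f := fun w : ℝ × V => (w.2, (0 : V))) (by fun_prop)).continuousAt
  exact (continuousAt_snd.add (h1.sub h2)).prodMk h3

theorem contDiffAt_collarMap (hH : ContDiff ℝ 2 H) {u : ℝ × V} (hu : |u.1| < T ^ 2)
    (hu0 : 0 < u.1) : ContDiffAt ℝ 1 (collarMap H Q) u := by
  have hs : ContDiffAt ℝ 1 (fun w : ℝ × V => (√w.1, w.2)) u :=
    (contDiffAt_fst.sqrt hu0.ne').prodMk contDiffAt_snd
  have h1 : ContDiffAt ℝ 1 (fun w : ℝ × V => Q (√w.1) w.2) u :=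
    ContDiffAt.comp (g := fun w : ℝ × V => Q w.1 w.2) (f := fun w : ℝ × V => (√w.1, w.2)) u
      (hF.contDiffAt _ (hF.sqrt_mem hu).1 u.2).fst hs
  have h3 : ContDiffAt ℝ 1 (fun w : ℝ × V => H (w.2, 0)) u :=
    ((hH.of_le one_le_two).comp (f := fun w : ℝ × V => (w.2, (0 : V))) (by fun_prop)).contDiffAt
  refine (h1.prodMk h3).congr_of_eventuallyEq ?_
  filter_upwards [continuous_fst.continuousAt.eventually (lt_mem_nhds hu0)] with w hw
  rw [collarMap, hF.unfoldedFlow_of_nonneg (le_of_lt hw)]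

/-- The velocity at time `s` is `s • restAccel H x + o(s)`, and the mean value inequality integrates
this to the second-order expansion of the position. -/
theorem eventually_norm_sub_le (hH : ContDiff ℝ 2 H) (hC : IsConvexHamiltonian univ H) {x : V}
    (hx : x ∈ Metric.ball (0 : V) R) {ε : ℝ} (hε : 0 < ε) :
    ∀ᶠ t in 𝓝[≥] (0 : ℝ), ‖Q t x - x - (t ^ 2) • ((1 / 2 : ℝ) • restAccel H x)‖ ≤ ε * t ^ 2 := by
  have hT := hF.pos
  have h1 := hF.continuousAt_velocityQuotient hH hC hx
  have h2 := (h1.comp (f := fun t : ℝ => (t, x)) (x := (0 : ℝ)) (by fun_prop)).eventually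
    (Metric.ball_mem_nhds _ hε)
  obtain ⟨η, hη, hball⟩ := Metric.eventually_nhds_iff_ball.1 h2
  have hbd : ∀ s ∈ Ico 0 η, ‖pGrad H (Q s x, P s x) - s • restAccel H x‖ ≤ ε * s := by
    intro s hs
    rcases hs.1.eq_or_lt with h0 | h0
    · rw [← h0, (hF.zero x).1, (hF.zero x).2, hC.pGrad_zero (mem_univ x)]
      simp
    · have h3 := hball s (by rw [mem_ball_zero_iff, Real.norm_eq_abs, abs_of_pos h0]; exact hs.2)
      simp only [Function.comp, if_neg h0.ne', if_true] at h3
      rw [dist_eq_norm] at h3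
      have e : pGrad H (Q s x, P s x) - s • restAccel H x =
          s • (s⁻¹ • pGrad H (Q s x, P s x) - restAccel H x) := by
        rw [smul_sub, smul_smul, mul_inv_cancel₀ h0.ne', one_smul]
      rw [e, norm_smul, Real.norm_eq_abs, abs_of_pos h0, mul_comm]
      exact mul_le_mul_of_nonneg_right h3.le h0.le
  have hnear : ∀ᶠ t in 𝓝[≥] (0 : ℝ), t < min η T :=
    mem_nhdsWithin_of_mem_nhds (gt_mem_nhds (lt_min hη hT))
  filter_upwards [hnear, self_mem_nhdsWithin] with t ht ht0
  have ht0 : 0 ≤ t := ht0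
  have h4 := (convex_Icc 0 t).norm_image_sub_le_of_norm_hasDerivWithin_le
    (f := fun s => Q s x - (s ^ 2) • ((1 / 2 : ℝ) • restAccel H x)) (C := ε * t)
    (f' := fun s => pGrad H (Q s x, P s x) - s • restAccel H x) (fun s hs => by
      have hsT : s ∈ Ioo (-T) T :=
        ⟨by linarith [hs.1], lt_of_le_of_lt hs.2 (ht.trans_le (min_le_right _ _))⟩
      have h5 := (hasDerivAt_pow 2 s).smul_const ((1 / 2 : ℝ) • restAccel H x)
      refine (((hF.hasDerivAt_fst hsT hx).sub h5).congr_deriv ?_).hasDerivWithinAt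
      rw [smul_smul]
      congr 2
      norm_num
      ring)
    (fun s hs => (hbd s ⟨hs.1, lt_of_le_of_lt hs.2 (ht.trans_le (min_le_left _ _))⟩).trans
      (mul_le_mul_of_nonneg_left hs.2 hε.le))
    (left_mem_Icc.2 ht0) (right_mem_Icc.2 ht0)
  simp only [(hF.zero x).1, sub_zero, Real.norm_eq_abs, abs_of_nonneg ht0] at h4
  convert h4 using 1
  · congr 1
    simp
    abel
  · ring

theorem hasDerivAt_unfoldedFlow_of_pos {τ : ℝ} (hτ : |τ| < T ^ 2) (h0 : 0 < τ) {x : V}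
    (hx : x ∈ Metric.ball (0 : V) R) :
    HasDerivAt (fun r => unfoldedFlow Q r x)
      ((1 / 2 : ℝ) • (√|τ|)⁻¹ • pGrad H (Q (√|τ|) x, P (√|τ|) x)) τ := by
  rw [abs_of_pos h0]
  have h1 := (hF.hasDerivAt_fst (hF.sqrt_mem hτ).1 hx).scomp τ (Real.hasDerivAt_sqrt h0.ne')
  have h2 : HasDerivAt (fun r => Q (√r) x)
      ((1 / 2 : ℝ) • (√τ)⁻¹ • pGrad H (Q (√τ) x, P (√τ) x)) τ := by
    refine h1.congr_deriv ?_
    rw [smul_smul]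
    congr 1
    rw [one_div, mul_inv, one_div]
  refine h2.congr_of_eventuallyEq ?_
  filter_upwards [lt_mem_nhds h0] with r hr
  exact hF.unfoldedFlow_of_nonneg hr.le x

theorem hasDerivAt_unfoldedFlow_of_neg {τ : ℝ} (hτ : |τ| < T ^ 2) (h0 : τ < 0) {x : V}
    (hx : x ∈ Metric.ball (0 : V) R) :
    HasDerivAt (fun r => unfoldedFlow Q r x)
      ((1 / 2 : ℝ) • (√|τ|)⁻¹ • pGrad H (Q (√|τ|) x, P (√|τ|) x)) τ := by
  have h1 := hF.hasDerivAt_unfoldedFlow_of_pos (τ := -τ) (by rwa [abs_neg]) (neg_pos.2 h0) hx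
  have h2 := (h1.scomp τ (hasDerivAt_neg τ)).const_sub ((2 : ℝ) • x)
  rw [abs_neg] at h2
  refine (h2.congr_deriv ?_).congr_of_eventuallyEq ?_
  · rw [neg_one_smul, neg_neg]
  · refine Eventually.of_forall fun r => ?_
    simp only [Function.comp]
    rw [← hF.unfoldedFlow_neg, neg_neg]

theorem hasDerivAt_unfoldedFlow_zero (hH : ContDiff ℝ 2 H) (hC : IsConvexHamiltonian univ H)
    {x : V} (hx : x ∈ Metric.ball (0 : V) R) :
    HasDerivAt (fun r => unfoldedFlow Q r x) ((1 / 2 : ℝ) • restAccel H x) 0 := by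
  rw [hasDerivAt_iff_isLittleO, Asymptotics.isLittleO_iff]
  intro ε hε
  have h1 := hF.eventually_norm_sub_le hH hC hx hε
  have hs : Tendsto (fun τ : ℝ => √|τ|) (𝓝 0) (𝓝[≥] 0) :=
    tendsto_nhdsWithin_iff.2 ⟨Continuous.tendsto' (by fun_prop) _ _ (by simp),
      Eventually.of_forall fun τ => Real.sqrt_nonneg _⟩
  filter_upwards [hs.eventually h1] with τ hτ
  rw [Real.sq_sqrt (abs_nonneg τ)] at hτ
  rw [hF.unfoldedFlow_zero, sub_zero, Real.norm_eq_abs]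
  rcases le_total 0 τ with h0 | h0
  · rw [abs_of_nonneg h0] at hτ ⊢
    rwa [hF.unfoldedFlow_of_nonneg h0]
  · rw [abs_of_nonpos h0] at hτ ⊢
    have e : unfoldedFlow Q τ x = (2 : ℝ) • x - Q (√(-τ)) x := by
      rw [← hF.unfoldedFlow_of_nonneg (neg_nonneg.2 h0), ← hF.unfoldedFlow_neg, neg_neg]
    have e2 : -((2 : ℝ) • x - Q (√(-τ)) x - x - τ • ((1 / 2 : ℝ) • restAccel H x)) =
        Q (√(-τ)) x - x - -τ • ((1 / 2 : ℝ) • restAccel H x) := by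
      rw [two_smul, neg_smul]
      abel
    rw [e, ← norm_neg, e2]
    exact hτ

/-- Both partial derivatives exist near `(0, x)` and are continuous at `(0, x)`. The one in `τ` is
`Q̇ / (2 t)`, which extends to `τ = 0` by half the rest acceleration; oddness gives the same formula
with `t = √|τ|` for `τ < 0`. -/
theorem hasStrictFDerivAt_unfoldedFlow (hH : ContDiff ℝ 2 H) (hC : IsConvexHamiltonian univ H)
    {x : V} (hx : x ∈ Metric.ball (0 : V) R) :
    HasStrictFDerivAt (fun u : ℝ × V => unfoldedFlow Q u.1 u.2)
      ((ContinuousLinearMap.fst ℝ ℝ V).smulRight ((1 / 2 : ℝ) • restAccel H x) +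
        ContinuousLinearMap.snd ℝ ℝ V) (0, x) := by
  classical
  have hT := hF.pos
  set Z := fun u : ℝ × V => (Q u.1 u.2, P u.1 u.2) with hZ
  set G := fun u : ℝ × V => if u.1 = 0 then restAccel H u.2 else
      u.1⁻¹ • pGrad H (Q u.1 u.2, P u.1 u.2) with hG
  set D := fun u : ℝ × V => .fst ℝ V V ∘L fderiv ℝ Z u ∘L .inr ℝ ℝ V with hD
  have near : ∀ᶠ u : ℝ × V in 𝓝 (0, x), |u.1| < T ^ 2 ∧ u.2 ∈ Metric.ball (0 : V) R := by
    have c1 : ContinuousAt (fun u : ℝ × V => |u.1|) (0, x) := by fun_prop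
    have c2 : ContinuousAt (fun u : ℝ × V => u.2) (0, x) := by fun_prop
    exact (c1.eventually (gt_mem_nhds (by simpa using sq_pos_of_pos hT))).and
      (c2.eventually (Metric.isOpen_ball.mem_nhds hx))
  have hs0 : (√|((0 : ℝ), x).1|, ((0 : ℝ), x).2) = (0, x) := by simp
  have hDc : ContinuousAt D (0, x) :=
    (continuousAt_const.clm_comp (((hF.contDiffAt 0 hF.zero_mem x).fderiv_right (m := 0)
      (by norm_num)).continuousAt.clm_comp continuousAt_const))
  have hD0 : D (0, x) = .id ℝ V := by
    rw [hD]
    simp only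
    rw [(hF.hasStrictFDerivAt_zero hC hx).hasFDerivAt.fderiv]
    ext w
    simp
  have hDd : ∀ t ∈ Ioo (-T) T, ∀ y, HasFDerivAt (fun y => Q t y) (D (t, y)) y := fun t ht y =>
    (HasFDerivAt.comp (g := Z) (f := fun y => (t, y)) y
      ((hF.contDiffAt t ht y).differentiableAt one_ne_zero).hasFDerivAt
      (hasFDerivAt_prodMk_right t y)).fst
  have main := hasStrictFDerivAt_uncurry_coprod (𝕜 := ℝ) (u := ((0 : ℝ), x))
    (f := fun τ y => unfoldedFlow Q τ y)
    (f₁ := fun τ y => (ContinuousLinearMap.id ℝ ℝ).smulRight ((1 / 2 : ℝ) • G (√|τ|, y)))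
    (f₂ := fun τ y => .id ℝ V + (D (√τ, y) - D (√(-τ), y))) ?_ ?_ ?_ ?_
  · refine main.congr_fderiv ?_
    ext w
    · simp [Function.HasUncurry.uncurry, hG]
    · simp [Function.HasUncurry.uncurry]
  · filter_upwards [near] with u hu
    have : HasDerivAt (fun r => unfoldedFlow Q r u.2) ((1 / 2 : ℝ) • G (√|u.1|, u.2)) u.1 := by
      rcases lt_trichotomy u.1 0 with h | h | h
      · rw [hG]
        simp only [(Real.sqrt_pos.2 (abs_pos.2 h.ne)).ne', if_false]
        exact hF.hasDerivAt_unfoldedFlow_of_neg hu.1 h hu.2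
      · rw [hG, h]
        simp only [abs_zero, Real.sqrt_zero, if_true]
        exact hF.hasDerivAt_unfoldedFlow_zero hH hC hu.2
      · rw [hG]
        simp only [(Real.sqrt_pos.2 (abs_pos.2 h.ne')).ne', if_false]
        exact hF.hasDerivAt_unfoldedFlow_of_pos hu.1 h hu.2
    refine this.hasFDerivAt.congr_fderiv ?_
    ext
    simp [Function.HasUncurry.uncurry]
  · filter_upwards [near] with u hu
    exact (hasFDerivAt_id u.2).add
      ((hDd _ (hF.sqrt_mem hu.1).1 u.2).sub (hDd _ (hF.sqrt_mem hu.1).2 u.2))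
  · have h1 : ContinuousAt (fun u : ℝ × V => G (√|u.1|, u.2)) (0, x) :=
      ContinuousAt.comp (g := G) (f := fun u : ℝ × V => (√|u.1|, u.2))
        (by rw [hs0]; exact hF.continuousAt_velocityQuotient hH hC hx) (by fun_prop)
    exact ((ContinuousLinearMap.smulRightL ℝ ℝ V (ContinuousLinearMap.id ℝ ℝ)).continuous.continuousAt).comp
      (continuousAt_const.smul h1)
  · have h1 : ContinuousAt (fun u : ℝ × V => D (√u.1, u.2)) (0, x) :=
      ContinuousAt.comp (g := D) (f := fun u : ℝ × V => (√u.1, u.2))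
        (by simpa using hDc) (by fun_prop)
    have h2 : ContinuousAt (fun u : ℝ × V => D (√(-u.1), u.2)) (0, x) :=
      ContinuousAt.comp (g := D) (f := fun u : ℝ × V => (√(-u.1), u.2))
        (by simpa using hDc) (by fun_prop)
    exact continuousAt_const.add (h1.sub h2)

/-- The collar map is a local diffeomorphism at boundary points. -/
theorem exists_hasStrictFDerivAt_collarMap (hH : ContDiff ℝ 2 H) (hC : IsConvexHamiltonian univ H)
    {x : V} (hx : x ∈ Metric.ball (0 : V) R) (hb : restForce H x ≠ 0) :
    ∃ e : (ℝ × V) ≃L[ℝ] (V × ℝ),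
      HasStrictFDerivAt (collarMap H Q) (e : (ℝ × V) →L[ℝ] (V × ℝ)) (0, x) := by
  have h1 := hF.hasStrictFDerivAt_unfoldedFlow hH hC hx
  have h2 : HasStrictFDerivAt (fun x => H (x, 0)) (-innerSL ℝ (restForce H x)) x := by
    rw [← (hasFDerivAt_potential hH x).fderiv]
    exact (ContDiffAt.comp (g := H) (f := fun x : V => (x, (0 : V))) x (hH.of_le one_le_two).contDiffAt
      (by fun_prop)).hasStrictFDerivAt one_ne_zero
  have h3 := h1.prodMk (HasStrictFDerivAt.comp (g := fun x => H (x, 0)) (f := Prod.snd)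
    ((0 : ℝ), x) h2 hasStrictFDerivAt_snd)
  set A := ((ContinuousLinearMap.fst ℝ ℝ V).smulRight ((1 / 2 : ℝ) • restAccel H x) +
        ContinuousLinearMap.snd ℝ ℝ V).prod (-innerSL ℝ (restForce H x) ∘L .snd ℝ ℝ V) with hA
  -- A kernel vector `(s, w)` has `w = -(s / 2) • restAccel` and `⟪restForce, w⟫ = 0`; as
  -- `⟪restForce, restAccel⟫ > 0`, this forces `s = 0`.
  have hinj : Function.Injective (A : (ℝ × V) →ₗ[ℝ] (V × ℝ)) := by
    rw [← LinearMap.ker_eq_bot, LinearMap.ker_eq_bot']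
    rintro ⟨s, w⟩ hw
    have e1 : s • ((1 / 2 : ℝ) • restAccel H x) + w = 0 := congrArg Prod.fst hw
    have e2 : -⟪restForce H x, w⟫ = 0 := congrArg Prod.snd hw
    have e3 : w = -(s • ((1 / 2 : ℝ) • restAccel H x)) := (neg_eq_of_add_eq_zero_right e1).symm
    rw [e3, inner_neg_right, real_inner_smul_right, real_inner_smul_right, neg_neg] at e2
    have e4 := hC.inner_restForce_restAccel_pos hb
    have e5 : s = 0 := by
      rcases mul_eq_zero.1 e2 with h | h
      · exact h
      · linarith
    rw [e5, zero_smul, neg_zero] at e3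
    rw [e5, e3]
    rfl
  have hfr : Module.finrank ℝ (ℝ × V) = Module.finrank ℝ (V × ℝ) := by
    rw [Module.finrank_prod, Module.finrank_prod, add_comm]
  refine ⟨(LinearEquiv.ofInjectiveOfFinrankEq _ hinj hfr).toContinuousLinearEquiv, ?_⟩
  refine HasStrictFDerivAt.congr_fderiv (f' := A) h3 ?_
  ext w <;> rfl

end IsBrakeFlow

end Fold

/-! ### Asymptotic concavity near the boundary -/

section Concavity

open scoped RealInnerProductSpace

variable {V : Type*} [NormedAddCommGroup V] [InnerProductSpace ℝ V] [CompleteSpace V]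
  [FiniteDimensional ℝ V]

namespace IsBrakeFlow

variable {H : V × V → ℝ} {R T : ℝ} {Q P : ℝ → V → V} (hF : IsBrakeFlow H R T Q P)

include hF

/-- Near a boundary point, the potential decreases along the unfolded flow. -/
theorem eventually_potential_unfoldedFlow (hH : ContDiff ℝ 2 H) (hC : IsConvexHamiltonian univ H)
    {x : V} (hx : x ∈ Metric.ball (0 : V) R) (hb : restForce H x ≠ 0) :
    ∀ᶠ u : ℝ × V in 𝓝 (0, x), (0 < u.1 → H (unfoldedFlow Q u.1 u.2, 0) < H (u.2, 0)) ∧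
      (u.1 < 0 → H (u.2, 0) < H (unfoldedFlow Q u.1 u.2, 0)) := by
  have h1 := hF.hasStrictFDerivAt_unfoldedFlow hH hC hx
  have h2 : HasStrictFDerivAt (fun x => H (x, 0)) (-innerSL ℝ (restForce H x)) x := by
    rw [← (hasFDerivAt_potential hH x).fderiv]
    exact (ContDiffAt.comp (g := H) (f := fun x : V => (x, (0 : V))) x
      (hH.of_le one_le_two).contDiffAt (by fun_prop)).hasStrictFDerivAt one_ne_zero
  have h3 : HasStrictFDerivAt (fun u : ℝ × V => H (unfoldedFlow Q u.1 u.2, 0)) _ (0, x) :=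
    HasStrictFDerivAt.comp (g := fun x => H (x, 0)) (f := fun u : ℝ × V => unfoldedFlow Q u.1 u.2)
      ((0 : ℝ), x) (by simpa only [hF.unfoldedFlow_zero] using h2) h1
  have h4 : HasStrictFDerivAt (fun u : ℝ × V => H (u.2, 0)) _ (0, x) :=
    HasStrictFDerivAt.comp (g := fun x => H (x, 0)) (f := Prod.snd)
      ((0 : ℝ), x) h2 hasStrictFDerivAt_snd
  -- The difference quotient of the potential in `τ` tends to `-(1 / 2) ⟪restForce, restAccel⟫ < 0`,
  -- jointly in `τ` and the starting point.
  have h5 := tendsto_inv_smul_of_hasStrictFDerivAt (h3.fun_sub h4)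
    (Eventually.of_forall fun x' => by rw [hF.unfoldedFlow_zero, sub_self])
  have h6 := h5.eventually (gt_mem_nhds (show _ < (0 : ℝ) by
    have := hC.inner_restForce_restAccel_pos hb
    simp
    exact this))
  rw [eventually_nhdsWithin_iff] at h6
  filter_upwards [h6] with u hu
  refine ⟨fun h => ?_, fun h => ?_⟩
  · have := hu h.ne'
    rw [smul_eq_mul] at this
    have := (pos_iff_neg_of_mul_neg this).1 (inv_pos.2 h)
    linarith
  · have := hu h.ne
    rw [smul_eq_mul] at this
    have := (neg_iff_pos_of_mul_neg this).1 (inv_lt_zero.2 h)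
    linarith

/-- The positive quantity is the second derivative of the boundary action along an orbit with
momentum `y` tangent to a level set, in collar coordinates: `w` stands for the preimage of the
velocity `ξ = ∂H/∂p` under the derivative of the collar map. Put `t = √τ` and let `b` be the rest
force. Then `P = t b + o(t)`, while `y`, `ξ` and `w` are `O(t)`. The second summand is `t ⟪b,
restAccel⟫ + o(t)`. In the first, the derivative of the momentum is `(w.1 / (2 t)) b + o(1)` with a
bounded coefficient, and `⟪P, ξ⟫ = 0` makes `⟪b, ξ⟫ = o(t)`, so the whole summand is `o(t)`. -/
theorem eventually_concave (hH : ContDiff ℝ 2 H) (hC : IsConvexHamiltonian univ H)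
    {x : V} (hx : x ∈ Metric.ball (0 : V) R) (hb : restForce H x ≠ 0) {C : ℝ} (hC0 : 0 ≤ C) :
    ∀ᶠ u : ℝ × V in 𝓝 (0, x), 0 < u.1 → ∀ (w : ℝ × V) (y : V),
      H (Q (√u.1) u.2, y) = H (u.2, 0) → ‖w‖ ≤ C * ‖pGrad H (Q (√u.1) u.2, y)‖ →
      ⟪P (√u.1) u.2, pGrad H (Q (√u.1) u.2, y)⟫ = 0 →
      0 < ⟪(fderiv ℝ (fun v : ℝ × V => (Q v.1 v.2, P v.1 v.2)) (√u.1, u.2)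
          (w.1 / (2 * √u.1), w.2)).2, pGrad H (Q (√u.1) u.2, y)⟫ +
        ⟪P (√u.1) u.2, fderiv ℝ (pGrad H) (Q (√u.1) u.2, y)
          (pGrad H (Q (√u.1) u.2, y), -qGrad H (Q (√u.1) u.2, y))⟫ := by
  have hT := hF.pos
  set b := restForce H x with hbdef
  -- the filter that describes admissible `(u, w, y)` with `u` tending to the boundary point
  set S : Set ((ℝ × V) × (ℝ × V) × V) := {z | 0 < z.1.1 ∧
    H (Q (√z.1.1) z.1.2, z.2.2) = H (z.1.2, 0) ∧
    ‖z.2.1‖ ≤ C * ‖pGrad H (Q (√z.1.1) z.1.2, z.2.2)‖ ∧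
    ⟪P (√z.1.1) z.1.2, pGrad H (Q (√z.1.1) z.1.2, z.2.2)⟫ = 0} with hS
  set F : Filter ((ℝ × V) × (ℝ × V) × V) := comap Prod.fst (𝓝 ((0 : ℝ), x)) ⊓ 𝓟 S with hFdef
  suffices hmain : ∀ᶠ z in F, 0 < ⟪(fderiv ℝ (fun v : ℝ × V => (Q v.1 v.2, P v.1 v.2))
      (√z.1.1, z.1.2) (z.2.1.1 / (2 * √z.1.1), z.2.1.2)).2, pGrad H (Q (√z.1.1) z.1.2, z.2.2)⟫ +
        ⟪P (√z.1.1) z.1.2, fderiv ℝ (pGrad H) (Q (√z.1.1) z.1.2, z.2.2)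
          (pGrad H (Q (√z.1.1) z.1.2, z.2.2), -qGrad H (Q (√z.1.1) z.1.2, z.2.2))⟫ by
    rw [hFdef, eventually_inf_principal, eventually_comap] at hmain
    filter_upwards [hmain] with u hu h0 w y h1 h2 h3
    exact hu (u, w, y) rfl ⟨h0, h1, h2, h3⟩
  have hSF : ∀ᶠ z in F, z ∈ S := mem_inf_of_right (mem_principal_self S)
  have hfst : Tendsto (fun z : (ℝ × V) × (ℝ × V) × V => z.1) F (𝓝 (0, x)) :=
    tendsto_comap.mono_left inf_le_left
  set tx : (ℝ × V) × (ℝ × V) × V → ℝ × V := fun z => (√z.1.1, z.1.2) with htx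
  have htx0 : Tendsto tx F (𝓝 (0, x)) := by
    have : Tendsto (fun u : ℝ × V => (√u.1, u.2)) (𝓝 (0, x)) (𝓝 (0, x)) :=
      Continuous.tendsto' (by fun_prop) _ _ (by simp)
    exact this.comp hfst
  have htpos : ∀ᶠ z in F, 0 < (tx z).1 := hSF.mono fun z hz => Real.sqrt_pos.2 hz.1
  have htxne : Tendsto tx F (𝓝[{u | u.1 ≠ 0}] (0, x)) :=
    tendsto_nhdsWithin_iff.2 ⟨htx0, htpos.mono fun z hz => hz.ne'⟩
  have ht0 : Tendsto (fun z => (tx z).1) F (𝓝 0) := (continuous_fst.tendsto _).comp htx0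
  have hP := (hF.tendsto_inv_smul_momentum hC hx).comp htxne
  have hQd := (hF.tendsto_inv_smul_velocity hC hx).comp htxne
  have hZ : Tendsto (fun z => (Q (tx z).1 (tx z).2, P (tx z).1 (tx z).2)) F (𝓝 (x, 0)) := by
    have := ((hF.contDiffAt 0 hF.zero_mem x).continuousAt.tendsto).comp htx0
    simpa only [hF.zero, Function.comp_def] using this
  have hq : Tendsto (fun z => Q (tx z).1 (tx z).2) F (𝓝 x) := (continuous_fst.tendsto _).comp hZ
  obtain ⟨ν, hνc, hν0, hν⟩ := hC.hessian
  have hνx := hν0 x (mem_univ x)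
  have hνq : ∀ᶠ z in F, ν x / 2 < ν (Q (tx z).1 (tx z).2) :=
    ((continuousOn_univ.1 hνc).continuousAt.tendsto.comp hq).eventually
      (lt_mem_nhds (half_lt_self hνx))
  have hin : ∀ᶠ z in F, (tx z).1 ∈ Ioo (-T) T ∧ (tx z).2 ∈ Metric.ball (0 : V) R :=
    htx0.eventually ((continuous_fst.continuousAt.eventually (Ioo_mem_nhds
      (by simpa using hT) hT)).and (continuous_snd.continuousAt.eventually
        (Metric.isOpen_ball.mem_nhds hx)))
  -- Convexity bounds `E - V` at the point by `⟪∂H/∂p, P⟫ ≤ K₁ t²`. From this follow `‖y‖ ≤ K₂ t`,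
  -- `‖ξ‖ ≤ K₃ t`, and the bound `C * K₃` for the rescaled `w`.
  set K₁ := (‖restAccel H x‖ + 1) * (‖b‖ + 1) with hK₁
  have hy : ∀ᶠ z in F, ‖z.2.2‖ ≤ √(2 * K₁ / (ν x / 2)) * (tx z).1 := by
    filter_upwards [hSF, htpos, hνq, hin, hP.norm.eventually (gt_mem_nhds (lt_add_one ‖b‖)),
      hQd.norm.eventually (gt_mem_nhds (lt_add_one ‖restAccel H x‖))] with z hz h0 h1 h2 h3 h4
    simp only [Function.comp, norm_smul, norm_inv, Real.norm_eq_abs, abs_of_pos h0] at h3 h4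
    rw [inv_mul_lt_iff₀ h0] at h3 h4
    set q := Q (tx z).1 (tx z).2
    set p := P (tx z).1 (tx z).2
    have hen : H (q, p) = H ((tx z).2, 0) := hF.energy hH h2.1 h2.2
    have h5 := hC.norm_sq_le_of_energy_le (E := H (q, p)) (hν0 q (mem_univ q)) (mem_univ q)
      (hν q (mem_univ q)) (p := z.2.2) (le_of_eq (hz.2.1.trans hen.symm))
    have h6 := hC.add_le_of_hessian (mem_univ q) (hν q (mem_univ q)) p 0
    rw [zero_sub, inner_neg_right] at h6
    have h7 : ⟪pGrad H (q, p), p⟫ ≤ K₁ * (tx z).1 ^ 2 := by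
      calc ⟪pGrad H (q, p), p⟫ ≤ ‖pGrad H (q, p)‖ * ‖p‖ := real_inner_le_norm _ _
        _ ≤ ((tx z).1 * (‖restAccel H x‖ + 1)) * ((tx z).1 * (‖b‖ + 1)) :=
          mul_le_mul h4.le h3.le (norm_nonneg _) (by positivity)
        _ = K₁ * (tx z).1 ^ 2 := by rw [hK₁]; ring
    have h8 : 0 ≤ ν q / 2 * ‖-p‖ ^ 2 :=
      mul_nonneg (half_pos (hν0 q (mem_univ q))).le (by positivity)
    have h9 : ‖z.2.2‖ ^ 2 ≤ 2 * K₁ / (ν x / 2) * (tx z).1 ^ 2 := by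
      refine h5.trans ?_
      rw [div_mul_eq_mul_div]
      exact div_le_div₀ (by positivity) (by nlinarith) (by positivity) h1.le
    have h10 := Real.sqrt_le_sqrt h9
    rwa [Real.sqrt_sq (norm_nonneg _), Real.sqrt_mul' _ (by positivity), Real.sqrt_sq h0.le] at h10
  set K₂ := √(2 * K₁ / (ν x / 2)) with hK₂
  have hy0 : Tendsto (fun z : (ℝ × V) × (ℝ × V) × V => z.2.2) F (𝓝 0) := by
    refine squeeze_zero_norm' hy ?_
    simpa using ht0.const_mul K₂
  have hqy : Tendsto (fun z => (Q (tx z).1 (tx z).2, z.2.2)) F (𝓝 (x, 0)) := hq.prodMk_nhds hy0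
  have hq0 : Tendsto (fun z => (Q (tx z).1 (tx z).2, (0 : V))) F (𝓝 (x, 0)) :=
    hq.prodMk_nhds tendsto_const_nhds
  obtain ⟨L, s, hs, hL⟩ := ((hC.contDiffAt_pGrad (mem_univ x) 0).hasStrictFDerivAt
    one_ne_zero).exists_lipschitzOnWith
  have hξ : ∀ᶠ z in F, ‖pGrad H (Q (tx z).1 (tx z).2, z.2.2)‖ ≤ L * K₂ * (tx z).1 := by
    filter_upwards [hqy.eventually hs, hq0.eventually hs, hy] with z h1 h2 h3
    have h4 := hL.norm_sub_le h1 h2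
    rw [hC.pGrad_zero (mem_univ _), sub_zero] at h4
    refine h4.trans ?_
    rw [mul_assoc]
    refine mul_le_mul_of_nonneg_left ?_ L.2
    rw [Prod.mk_sub_mk, sub_self, sub_zero, Prod.norm_mk, norm_zero]
    exact max_le (h3.trans' (norm_nonneg _)) h3
  set K₃ := (L : ℝ) * K₂ with hK₃
  have hK₃0 : 0 ≤ K₃ := mul_nonneg L.2 (Real.sqrt_nonneg _)
  have hξ0 : Tendsto (fun z => pGrad H (Q (tx z).1 (tx z).2, z.2.2)) F (𝓝 0) := by
    refine squeeze_zero_norm' hξ ?_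
    simpa using ht0.const_mul K₃
  have hw : ∀ᶠ z in F, ‖((z.2.1.1 / (2 * (tx z).1), z.2.1.2) : ℝ × V)‖ ≤ C * K₃ := by
    filter_upwards [hSF, htpos, hξ, ht0.eventually (gt_mem_nhds one_pos)] with z h1 h2 h3 h4
    have h5 : ‖z.2.1‖ ≤ C * K₃ * (tx z).1 := by
      rw [mul_assoc]
      exact h1.2.2.1.trans (mul_le_mul_of_nonneg_left h3 hC0)
    have h6 : 0 ≤ C * K₃ := mul_nonneg hC0 hK₃0
    rw [Prod.norm_mk]
    refine max_le ?_ ?_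
    · rw [norm_div, Real.norm_of_nonneg (by positivity : 0 ≤ 2 * (tx z).1),
        div_le_iff₀ (by positivity)]
      have := (norm_fst_le z.2.1).trans h5
      nlinarith
    · have := (norm_snd_le z.2.1).trans h5
      nlinarith
  set DZ : ℝ × V → ℝ × V →L[ℝ] V × V := fderiv ℝ (fun v : ℝ × V => (Q v.1 v.2, P v.1 v.2)) with hDZ
  set L₀ := (ContinuousLinearMap.snd ℝ ℝ V).prod
        ((ContinuousLinearMap.fst ℝ ℝ V).smulRight b) with hL₀
  have hM : Tendsto (fun z => ‖DZ (tx z) - L₀‖) F (𝓝 0) :=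
    (tendsto_iff_norm_sub_tendsto_zero (E := ℝ × V →L[ℝ] V × V)).1
      ((hF.tendsto_fderiv hC hx).comp htx0)
  have hbP : Tendsto (fun z => ‖b - (tx z).1⁻¹ • P (tx z).1 (tx z).2‖) F (𝓝 0) := by
    have := (hP.const_sub b).norm
    rwa [sub_self, norm_zero] at this
  have hfirst : Tendsto (fun z => (tx z).1⁻¹ * ⟪(DZ (tx z) (z.2.1.1 / (2 * (tx z).1), z.2.1.2)).2,
      pGrad H (Q (tx z).1 (tx z).2, z.2.2)⟫) F (𝓝 0) := by
    refine squeeze_zero_norm' (a := fun z => (‖DZ (tx z) - L₀‖ +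
      ‖b - (tx z).1⁻¹ • P (tx z).1 (tx z).2‖) * (C * K₃ * K₃)) ?_ (by
        simpa using (hM.add hbP).mul_const (C * K₃ * K₃))
    filter_upwards [hSF, htpos, hξ, hw] with z h1 h2 h3 h4
    set ξ := pGrad H (Q (tx z).1 (tx z).2, z.2.2)
    set w' : ℝ × V := (z.2.1.1 / (2 * (tx z).1), z.2.1.2)
    -- Replacing `b` by `b - t⁻¹ • P`, which tends to `0`, is free because `⟪P, ξ⟫ = 0`.
    have e1 : ⟪(DZ (tx z) w').2, ξ⟫ = ⟪((DZ (tx z) - L₀) w').2, ξ⟫ +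
        w'.1 * ⟪b - (tx z).1⁻¹ • P (tx z).1 (tx z).2, ξ⟫ := by
      have : ⟪P (tx z).1 (tx z).2, ξ⟫ = 0 := h1.2.2.2
      rw [inner_sub_left b, real_inner_smul_left, this, mul_zero, sub_zero, sub_apply,
        Prod.snd_sub, inner_sub_left, hL₀]
      simp [real_inner_smul_left]
    have n1 : ‖⟪((DZ (tx z) - L₀) w').2, ξ⟫‖ ≤ ‖DZ (tx z) - L₀‖ * (C * K₃) * (K₃ * (tx z).1) :=
      (norm_inner_le_norm _ _).trans (mul_le_mul ((norm_snd_le _).trans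
        (((DZ (tx z) - L₀).le_opNorm w').trans (mul_le_mul_of_nonneg_left h4 (norm_nonneg _)))) h3
        (norm_nonneg _) (by positivity))
    have n2 : ‖w'.1 * ⟪b - (tx z).1⁻¹ • P (tx z).1 (tx z).2, ξ⟫‖ ≤
        (C * K₃) * (‖b - (tx z).1⁻¹ • P (tx z).1 (tx z).2‖ * (K₃ * (tx z).1)) := by
      rw [norm_mul]
      exact mul_le_mul ((norm_fst_le w').trans h4) ((norm_inner_le_norm _ _).trans
        (mul_le_mul_of_nonneg_left h3 (norm_nonneg _))) (norm_nonneg _) (by positivity)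
    rw [e1, norm_mul, norm_inv, Real.norm_of_nonneg h2.le, inv_mul_le_iff₀ h2]
    refine (norm_add_le _ _).trans ((add_le_add n1 n2).trans (le_of_eq ?_))
    ring
  have hsecond : Tendsto (fun z => (tx z).1⁻¹ * ⟪P (tx z).1 (tx z).2,
      fderiv ℝ (pGrad H) (Q (tx z).1 (tx z).2, z.2.2) (pGrad H (Q (tx z).1 (tx z).2, z.2.2),
        -qGrad H (Q (tx z).1 (tx z).2, z.2.2))⟫) F (𝓝 ⟪b, restAccel H x⟫) := by
    have h1 : Tendsto (fun z => fderiv ℝ (pGrad H) (Q (tx z).1 (tx z).2, z.2.2)) F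
        (𝓝 (fderiv ℝ (pGrad H) (x, 0))) :=
      ((continuous_fderiv_pGrad hH).tendsto (x, 0)).comp hqy
    have h2 : Tendsto (fun z => -qGrad H (Q (tx z).1 (tx z).2, z.2.2)) F (𝓝 b) :=
      ((contDiffAt_qGrad (z := (x, 0)) hH.contDiffAt).continuousAt.neg.tendsto).comp hqy
    have h3 := hP.inner (𝕜 := ℝ) ((isBoundedBilinearMap_apply (𝕜 := ℝ) (E := V × V) (F := V)).continuous.tendsto
      (fderiv ℝ (pGrad H) (x, 0), ((0 : V), b)) |>.comp (h1.prodMk_nhds (hξ0.prodMk_nhds h2)))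
    refine h3.congr fun z => ?_
    simp only [Function.comp, real_inner_smul_left]
  have htot := hfirst.add hsecond
  rw [zero_add] at htot
  filter_upwards [htot.eventually (lt_mem_nhds (hC.inner_restForce_restAccel_pos hb)), htpos]
    with z h1 h2
  rw [← mul_add] at h1
  exact (mul_pos_iff_of_pos_left (inv_pos.2 h2)).1 h1

end IsBrakeFlow

end Concavity

/-! ### The action along the brake flow and its first variation -/

section Action

open scoped RealInnerProductSpace

variable {V : Type*} [NormedAddCommGroup V] [InnerProductSpace ℝ V] [CompleteSpace V]
  [FiniteDimensional ℝ V]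

/-- The action along the brake flow. -/
noncomputable def brakeAction (H : V × V → ℝ) (Q P : ℝ → V → V) (t : ℝ) (x : V) : ℝ :=
  ∫ s in (0 : ℝ)..t, ⟪P s x, pGrad H (Q s x, P s x)⟫

theorem brakeAction_zero (H : V × V → ℝ) (Q P : ℝ → V → V) (x : V) :
    brakeAction H Q P 0 x = 0 := by
  rw [brakeAction, intervalIntegral.integral_same]

namespace IsBrakeFlow

variable {H : V × V → ℝ} {R T : ℝ} {Q P : ℝ → V → V} (hF : IsBrakeFlow H R T Q P)

include hF

theorem hasDerivAt_brakeAction (hH : ContDiff ℝ 2 H) {t : ℝ} (ht : t ∈ Ioo (-T) T) {x : V}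
    (hx : x ∈ Metric.ball (0 : V) R) :
    HasDerivAt (fun r => brakeAction H Q P r x) ⟪P t x, pGrad H (Q t x, P t x)⟫ t := by
  have hp : Continuous (pGrad H) := continuous_iff_continuousAt.2 fun z =>
    (contDiffAt_pGrad hH.contDiffAt).continuousAt
  have hc : ContinuousOn (fun s => ⟪P s x, pGrad H (Q s x, P s x)⟫) (Ioo (-T) T) := fun s hs =>
    ((hF.hasDerivAt_snd hs hx).continuousAt.inner
      (hp.continuousAt.comp (hF.hasDerivAt s hs x hx).continuousAt)).continuousWithinAt
  have hsub : uIcc 0 t ⊆ Ioo (-T) T := (ordConnected_Ioo).uIcc_subset hF.zero_mem ht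
  refine intervalIntegral.integral_hasDerivAt_right ((hc.mono hsub).intervalIntegrable) ?_
    (hc.continuousAt (isOpen_Ioo.mem_nhds ht))
  exact hc.stronglyMeasurableAtFilter isOpen_Ioo t ht

/-- First variation of the action. Both orbits are rescaled to `s ∈ [0, 1]` and the left side is
differentiated in `s`; Hamilton's equations and a Taylor expansion of `H` leave products of two
differences, plus `t` times the difference of the energies. For starting points of equal potential
the last term vanishes, so the action varies with the end point to first order like `⟪P, ·⟫`. -/
theorem brakeAction_sub_le (hH : ContDiff ℝ 2 H) {t : ℝ} (ht : t ∈ Ioo (-T) T) {x : V}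
    (hx : x ∈ Metric.ball (0 : V) R) :
    ∃ K : ℝ, ∀ᶠ u : ℝ × V in 𝓝 (t, x),
      |brakeAction H Q P u.1 u.2 - brakeAction H Q P t x - ⟪P t x, Q u.1 u.2 - Q t x⟫| ≤
        K * ‖u - (t, x)‖ ^ 2 + |t| * |H (u.2, 0) - H (x, 0)| := by
  have hT := hF.pos
  have hscale : ∀ {r : ℝ}, r ∈ Ioo (-T) T → ∀ s ∈ Icc (0 : ℝ) 1, s * r ∈ Ioo (-T) T := by
    intro r hr s hs
    refine abs_lt.1 (lt_of_le_of_lt ?_ (abs_lt.2 hr))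
    rw [abs_mul, abs_of_nonneg hs.1]
    exact mul_le_of_le_one_left (abs_nonneg r) hs.2
  obtain ⟨C, hC0, hlip⟩ := hF.lipschitz t ht x
  have hz₀c : ContinuousOn (fun s : ℝ => (Q (s * t) x, P (s * t) x)) (Icc 0 1) := fun s hs =>
    ((hF.hasDerivAt _ (hscale ht s hs) x hx).continuousAt.comp (f := fun s : ℝ => s * t)
      (by fun_prop)).continuousWithinAt
  obtain ⟨ρ, hρ⟩ := isCompact_Icc.exists_bound_of_continuousOn hz₀c
  set B := Metric.closedBall (0 : V × V) (ρ + 1) with hB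
  have hBc : IsCompact B := isCompact_closedBall _ _
  have hpC : ContDiff ℝ 1 (pGrad H) := contDiff_iff_contDiffAt.2 fun z =>
    contDiffAt_pGrad hH.contDiffAt
  obtain ⟨L₁, hL₁⟩ := ((hH.fderiv_right (m := 1) (by norm_num)).locallyLipschitz.locallyLipschitzOn
    (s := B)).exists_lipschitzOnWith_of_compact hBc
  obtain ⟨L₂, hL₂⟩ := (hpC.locallyLipschitz.locallyLipschitzOn
    (s := B)).exists_lipschitzOnWith_of_compact hBc
  obtain ⟨M, hM⟩ := hBc.exists_bound_of_continuousOn hpC.continuous.continuousOn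
  -- The three summands are the quadratic errors bounded in `b1`, `b2` and `b3` below.
  refine ⟨T * C * L₂ * C + C * M + T * L₁ * C ^ 2, ?_⟩
  have e1 : ∀ᶠ u : ℝ × V in 𝓝 (t, x), u.1 ∈ Ioo (-T) T ∧ u.2 ∈ Metric.ball (0 : V) R :=
    (continuous_fst.continuousAt.eventually (Ioo_mem_nhds ht.1 ht.2)).and
      (continuous_snd.continuousAt.eventually (Metric.isOpen_ball.mem_nhds hx))
  have e2 : ∀ᶠ u : ℝ × V in 𝓝 (t, x), C * ‖u - (t, x)‖ < 1 := by
    have : ContinuousAt (fun u : ℝ × V => C * ‖u - (t, x)‖) (t, x) := by fun_prop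
    exact this.eventually (gt_mem_nhds (by simp))
  filter_upwards [e1, e2, hlip] with u hu hu1 hul
  set δ := ‖u - (t, x)‖ with hδ
  have hδ0 : 0 ≤ δ := norm_nonneg _
  set z₀ : ℝ → V × V := fun s => (Q (s * t) x, P (s * t) x) with hz₀
  set z₁ : ℝ → V × V := fun s => (Q (s * u.1) u.2, P (s * u.1) u.2) with hz₁
  have hder : ∀ s ∈ Icc (0 : ℝ) 1, HasDerivAt (fun s => brakeAction H Q P (s * u.1) u.2 -
      brakeAction H Q P (s * t) x - ⟪P (s * t) x, Q (s * u.1) u.2 - Q (s * t) x⟫)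
      (⟪(z₁ s).2, pGrad H (z₁ s)⟫ * u.1 - ⟪(z₀ s).2, pGrad H (z₀ s)⟫ * t -
        (⟪(z₀ s).2, u.1 • pGrad H (z₁ s) - t • pGrad H (z₀ s)⟫ +
          ⟪t • -qGrad H (z₀ s), (z₁ s).1 - (z₀ s).1⟫)) s := by
    intro s hs
    have m1 : HasDerivAt (fun s : ℝ => s * u.1) u.1 s := hasDerivAt_mul_const u.1
    have m0 : HasDerivAt (fun s : ℝ => s * t) t s := hasDerivAt_mul_const t
    have a1 := (hF.hasDerivAt_brakeAction hH (hscale hu.1 s hs) hu.2).comp s m1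
    have a0 := (hF.hasDerivAt_brakeAction hH (hscale ht s hs) hx).comp s m0
    have q1 := (hF.hasDerivAt_fst (hscale hu.1 s hs) hu.2).scomp s m1
    have q0 := (hF.hasDerivAt_fst (hscale ht s hs) hx).scomp s m0
    have p0 := (hF.hasDerivAt_snd (hscale ht s hs) hx).scomp s m0
    exact (a1.sub a0).sub (p0.inner ℝ (q1.sub q0))
  have hbound : ∀ s ∈ Icc (0 : ℝ) 1,
      ‖⟪(z₁ s).2, pGrad H (z₁ s)⟫ * u.1 - ⟪(z₀ s).2, pGrad H (z₀ s)⟫ * t -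
        (⟪(z₀ s).2, u.1 • pGrad H (z₁ s) - t • pGrad H (z₀ s)⟫ +
          ⟪t • -qGrad H (z₀ s), (z₁ s).1 - (z₀ s).1⟫)‖ ≤
      (T * C * L₂ * C + C * M + T * L₁ * C ^ 2) * δ ^ 2 + |t| * |H (u.2, 0) - H (x, 0)| := by
    intro s hs
    have hΔ : ‖z₁ s - z₀ s‖ ≤ C * δ := hul s hs
    have hb0 : z₀ s ∈ B := by
      rw [hB, mem_closedBall_zero_iff]
      linarith [hρ s hs]
    have hb1 : z₁ s ∈ B := by
      rw [hB, mem_closedBall_zero_iff]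
      have : ‖z₁ s‖ ≤ ‖z₁ s - z₀ s‖ + ‖z₀ s‖ := by
        simpa using norm_add_le (z₁ s - z₀ s) (z₀ s)
      linarith [hρ s hs]
    have hen : H (z₁ s) - H (z₀ s) = H (u.2, 0) - H (x, 0) := by
      rw [hz₁, hz₀]
      simp only
      rw [hF.energy hH (hscale hu.1 s hs) hu.2, hF.energy hH (hscale ht s hs) hx]
    have htay : |H (z₁ s) - H (z₀ s) - fderiv ℝ H (z₀ s) (z₁ s - z₀ s)| ≤ L₁ * (C * δ) ^ 2 := by
      have hseg : segment ℝ (z₀ s) (z₁ s) ⊆ B := (convex_closedBall _ _).segment_subset hb0 hb1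
      have h1 := (convex_segment (z₀ s) (z₁ s)).norm_image_sub_le_of_norm_hasFDerivWithin_le'
        (f := H) (f' := fderiv ℝ H) (φ := fderiv ℝ H (z₀ s)) (C := L₁ * (C * δ))
        (fun z _ => (hH.differentiable two_ne_zero z).hasFDerivAt.hasFDerivWithinAt)
        (fun z hz => by
          refine (hL₁.norm_sub_le (hseg hz) hb0).trans (mul_le_mul_of_nonneg_left ?_ L₁.2)
          refine le_trans ?_ hΔ
          have := norm_sub_le_of_mem_segment hz
          exact this)
        (left_mem_segment _ _ _) (right_mem_segment _ _ _)
      refine h1.trans ?_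
      calc L₁ * (C * δ) * ‖z₁ s - z₀ s‖ ≤ L₁ * (C * δ) * (C * δ) :=
            mul_le_mul_of_nonneg_left hΔ (by positivity)
        _ = L₁ * (C * δ) ^ 2 := by ring
    have hΔp : ‖(z₁ s).2 - (z₀ s).2‖ ≤ C * δ := (norm_snd_le (z₁ s - z₀ s)).trans hΔ
    have hgrad : ‖pGrad H (z₁ s) - pGrad H (z₀ s)‖ ≤ L₂ * (C * δ) :=
      (hL₂.norm_sub_le hb1 hb0).trans (mul_le_mul_of_nonneg_left hΔ L₂.2)
    have hdt : |u.1 - t| ≤ δ := norm_fst_le (u - (t, x))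
    have huT : |u.1| ≤ T := (abs_lt.2 hu.1).le
    have htT : |t| ≤ T := (abs_lt.2 ht).le
    have key : ⟪(z₁ s).2, pGrad H (z₁ s)⟫ * u.1 - ⟪(z₀ s).2, pGrad H (z₀ s)⟫ * t -
        (⟪(z₀ s).2, u.1 • pGrad H (z₁ s) - t • pGrad H (z₀ s)⟫ +
          ⟪t • -qGrad H (z₀ s), (z₁ s).1 - (z₀ s).1⟫) =
        u.1 * ⟪(z₁ s).2 - (z₀ s).2, pGrad H (z₁ s) - pGrad H (z₀ s)⟫ +
        (u.1 - t) * ⟪(z₁ s).2 - (z₀ s).2, pGrad H (z₀ s)⟫ -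
        t * (H (z₁ s) - H (z₀ s) - fderiv ℝ H (z₀ s) (z₁ s - z₀ s)) +
        t * (H (u.2, 0) - H (x, 0)) := by
      rw [← hen, fderiv_eq_inner_add_inner (hH.differentiable two_ne_zero (z₀ s))]
      simp only [inner_sub_left, inner_sub_right, real_inner_smul_left, real_inner_smul_right,
        inner_neg_left, Prod.fst_sub, Prod.snd_sub]
      rw [real_inner_comm (z₁ s).2 (pGrad H (z₀ s)), real_inner_comm (z₀ s).2 (pGrad H (z₀ s))]
      ring
    rw [key]
    have b1 : ‖u.1 * ⟪(z₁ s).2 - (z₀ s).2, pGrad H (z₁ s) - pGrad H (z₀ s)⟫‖ ≤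
        T * ((C * δ) * (L₂ * (C * δ))) := by
      rw [norm_mul]
      exact mul_le_mul huT ((norm_inner_le_norm _ _).trans
        (mul_le_mul hΔp hgrad (norm_nonneg _) (by positivity))) (norm_nonneg _) hT.le
    have b2 : ‖(u.1 - t) * ⟪(z₁ s).2 - (z₀ s).2, pGrad H (z₀ s)⟫‖ ≤ δ * ((C * δ) * M) := by
      rw [norm_mul]
      exact mul_le_mul hdt ((norm_inner_le_norm _ _).trans
        (mul_le_mul hΔp (hM _ hb0) (norm_nonneg _) (by positivity))) (norm_nonneg _) hδ0
    have b3 : ‖t * (H (z₁ s) - H (z₀ s) - fderiv ℝ H (z₀ s) (z₁ s - z₀ s))‖ ≤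
        T * (L₁ * (C * δ) ^ 2) := by
      rw [norm_mul]
      exact mul_le_mul htT htay (norm_nonneg _) hT.le
    have b4 : ‖t * (H (u.2, 0) - H (x, 0))‖ = |t| * |H (u.2, 0) - H (x, 0)| := norm_mul _ _
    refine (norm_add_le _ _).trans ?_
    rw [b4]
    gcongr
    refine (norm_sub_le _ _).trans ((add_le_add ((norm_add_le _ _).trans (add_le_add b1 b2))
      b3).trans (le_of_eq ?_))
    ring
  have h := (convex_Icc (0 : ℝ) 1).norm_image_sub_le_of_norm_hasDerivWithin_le
    (fun s hs => (hder s hs).hasDerivWithinAt) hbound (left_mem_Icc.2 zero_le_one)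
    (right_mem_Icc.2 zero_le_one)
  simp only [one_mul, zero_mul, brakeAction_zero, (hF.zero _).2, inner_zero_left, sub_zero,
    norm_one, mul_one, Real.norm_eq_abs] at h
  exact h

theorem continuousAt_brakeAction (hH : ContDiff ℝ 2 H) {t : ℝ} (ht : t ∈ Ioo (-T) T) {x : V}
    (hx : x ∈ Metric.ball (0 : V) R) :
    ContinuousAt (fun u : ℝ × V => brakeAction H Q P u.1 u.2) (t, x) := by
  obtain ⟨K, hK⟩ := hF.brakeAction_sub_le hH ht hx
  have c1 : ContinuousAt (fun u : ℝ × V => ⟪P t x, Q u.1 u.2 - Q t x⟫) (t, x) :=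
    continuousAt_const.inner ((hF.continuousAt_position ht x).sub continuousAt_const)
  have c2 : Continuous fun u : ℝ × V => K * ‖u - (t, x)‖ ^ 2 + |t| * |H (u.2, 0) - H (x, 0)| := by
    have := hH.continuous
    fun_prop
  have h1 : Tendsto (fun u : ℝ × V => brakeAction H Q P u.1 u.2 - brakeAction H Q P t x -
      ⟪P t x, Q u.1 u.2 - Q t x⟫) (𝓝 (t, x)) (𝓝 0) :=
    squeeze_zero_norm' hK (c2.tendsto' _ _ (by simp))
  have h2 := (h1.add c1.tendsto).add_const (brakeAction H Q P t x)
  simp only [sub_self, inner_zero_right, add_zero, zero_add] at h2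
  refine h2.congr fun u => ?_
  ring

end IsBrakeFlow

end Action

/-! ### The collar of brake orbits -/

section Collar

open scoped RealInnerProductSpace

variable {V : Type*} [NormedAddCommGroup V] [InnerProductSpace ℝ V] [CompleteSpace V]
  [FiniteDimensional ℝ V]

/-- Near the boundary of `D`, the points of `closure D` are reached by the brake flow from the
boundary: `q` is reached at time `tm q` from the point `ft q`. -/
structure IsBrakeCollar (H : V × V → ℝ) (E : ℝ) (D : Set V) (T : ℝ) (Q P : ℝ → V → V) (t₀ : ℝ)
    (U : Set V) (tm : V → ℝ) (ft : V → V) : Prop where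
  pos : 0 < t₀
  le : t₀ ≤ T
  isOpen : IsOpen U
  apply_mem : ∀ t ∈ Ico 0 t₀, ∀ x ∈ frontier D, Q t x ∈ U ∧ tm (Q t x) = t ∧ ft (Q t x) = x
  apply_mem_domain : ∀ t ∈ Ioo 0 t₀, ∀ x ∈ frontier D, Q t x ∈ D
  mem : ∀ q ∈ U ∩ closure D, tm q ∈ Ico 0 t₀ ∧ ft q ∈ frontier D ∧ Q (tm q) (ft q) = q
  continuousOn_time : ContinuousOn tm U
  continuousOn_foot : ContinuousOn ft U
  potential_foot : ∀ q ∈ U, H (ft q, 0) = E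
  contDiffAt_time : ∀ q ∈ U ∩ D, ContDiffAt ℝ 1 tm q
  contDiffAt_foot : ∀ q ∈ U ∩ D, ContDiffAt ℝ 1 ft q
  concave : ∀ q ∈ U ∩ D, ∀ y, H (q, y) = E → ⟪P (tm q) (ft q), pGrad H (q, y)⟫ = 0 →
    0 < ⟪fderiv ℝ (fun x => P (tm x) (ft x)) q (pGrad H (q, y)), pGrad H (q, y)⟫ +
      ⟪P (tm q) (ft q), fderiv ℝ (pGrad H) (q, y) (pGrad H (q, y), -qGrad H (q, y))⟫

/-- The open conditions on `(τ, x)` from which the collar is built. -/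
structure IsCollarPoint (H : V × V → ℝ) (E : ℝ) (D : Set V) (T : ℝ) (Q P : ℝ → V → V)
    (u : ℝ × V) : Prop where
  time : |u.1| < T ^ 2
  map_nhds : map (collarMap H Q) (𝓝 u) = 𝓝 (collarMap H Q u)
  foot : u.2 ∈ frontier D ↔ H (u.2, 0) = E
  domain : unfoldedFlow Q u.1 u.2 ∈ D ↔ H (unfoldedFlow Q u.1 u.2, 0) < E
  boundary : unfoldedFlow Q u.1 u.2 ∈ frontier D ↔ H (unfoldedFlow Q u.1 u.2, 0) = E
  of_pos : 0 < u.1 → H (unfoldedFlow Q u.1 u.2, 0) < H (u.2, 0)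
  of_neg : u.1 < 0 → H (u.2, 0) < H (unfoldedFlow Q u.1 u.2, 0)
  injective : 0 < u.1 → ∀ w, fderiv ℝ (collarMap H Q) u w = 0 → w = 0
  concave : 0 < u.1 → ∀ (w : ℝ × V) (y : V), H (Q (√u.1) u.2, y) = H (u.2, 0) →
    fderiv ℝ (collarMap H Q) u w = (pGrad H (Q (√u.1) u.2, y), 0) →
    ⟪P (√u.1) u.2, pGrad H (Q (√u.1) u.2, y)⟫ = 0 →
      0 < ⟪(fderiv ℝ (fun v : ℝ × V => (Q v.1 v.2, P v.1 v.2)) (√u.1, u.2)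
          (w.1 / (2 * √u.1), w.2)).2, pGrad H (Q (√u.1) u.2, y)⟫ +
        ⟪P (√u.1) u.2, fderiv ℝ (pGrad H) (Q (√u.1) u.2, y)
          (pGrad H (Q (√u.1) u.2, y), -qGrad H (Q (√u.1) u.2, y))⟫

variable {H : V × V → ℝ} {E R T : ℝ} {D : Set V} {Q P : ℝ → V → V}

/-- Near an invertible strict derivative all derivatives are bounded below by one constant. This
gives injectivity, and also the bound `‖w‖ ≤ C ‖ξ‖` that the concavity estimate requires. -/
theorem IsBrakeFlow.eventually_isCollarPoint (hF : IsBrakeFlow H R T Q P) (hH : ContDiff ℝ 2 H)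
    (hC : IsConvexHamiltonian univ H) {x : V} (hx : x ∈ Metric.ball (0 : V) R)
    (hb : restForce H x ≠ 0)
    (hloc : ∀ᶠ q in 𝓝 x, (q ∈ D ↔ H (q, 0) < E) ∧ (q ∈ frontier D ↔ H (q, 0) = E)) :
    ∀ᶠ u in 𝓝 (0, x), IsCollarPoint H E D T Q P u := by
  have hT := hF.pos
  obtain ⟨e, he⟩ := hF.exists_hasStrictFDerivAt_collarMap hH hC hx hb
  obtain ⟨C, hC0, hlow⟩ := exists_norm_le_of_hasStrictFDerivAt he
  have c1 : ContinuousAt (fun u : ℝ × V => |u.1|) (0, x) := by fun_prop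
  have c2 : ContinuousAt (fun u : ℝ × V => u.2) (0, x) := by fun_prop
  have c3 : Tendsto (fun u : ℝ × V => unfoldedFlow Q u.1 u.2) (𝓝 (0, x)) (𝓝 x) := by
    have := (hF.hasStrictFDerivAt_unfoldedFlow hH hC hx).hasFDerivAt.continuousAt.tendsto
    simpa only [hF.unfoldedFlow_zero] using this
  have hsrc : ∀ᶠ u in 𝓝 (0, x), u ∈ (he.toOpenPartialHomeomorph (collarMap H Q)).source :=
    (he.toOpenPartialHomeomorph (collarMap H Q)).open_source.mem_nhds
      he.mem_toOpenPartialHomeomorph_source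
  filter_upwards [c1.eventually (gt_mem_nhds (show |((0 : ℝ), x).1| < T ^ 2 by simpa using pow_pos hT 2)),
    hsrc, c2.eventually hloc, c3.eventually hloc,
    hF.eventually_potential_unfoldedFlow hH hC hx hb, hlow,
    hF.eventually_concave hH hC hx hb hC0.le] with u h1 h3 h4 h5 h6 h7 h8
  have hd : 0 < u.1 → HasFDerivAt (collarMap H Q) (fderiv ℝ (collarMap H Q) u) u := fun h0 =>
    ((hF.contDiffAt_collarMap hH h1 h0).differentiableAt one_ne_zero).hasFDerivAt
  refine ⟨h1, ?_, h4.2, h5.1, h5.2, h6.1, h6.2, fun h0 w hw => ?_, fun h0 w y h9 h10 h11 => ?_⟩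
  · exact (he.toOpenPartialHomeomorph (collarMap H Q)).map_nhds_eq h3
  · have := h7 _ (hd h0) w
    rw [hw, norm_zero, mul_zero] at this
    exact norm_le_zero_iff.1 this
  · refine h8 h0 w y h9 ?_ h11
    have := h7 _ (hd h0) w
    have hn : ∀ a : V, ‖((a, 0) : V × ℝ)‖ = ‖a‖ := fun a => by simp [Prod.norm_def]
    rwa [h10, hn] at this

/-- With the starting potential as an extra coordinate, the collar map acts between spaces of equal
dimension, and its slice at potential `E` replaces charts of `∂D`. It is injective on `{0} × ∂D` and
locally injective there, hence by compactness injective on a neighbourhood. The inverse gives `tm =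
√τ` and `ft`. -/
theorem IsBrakeFlow.exists_isBrakeCollar (hF : IsBrakeFlow H R T Q P) (hH : ContDiff ℝ 2 H)
    (hC : IsConvexHamiltonian univ H) (hB : IsCompact (frontier D))
    (hBR : frontier D ⊆ Metric.ball 0 R) (hb : ∀ x ∈ frontier D, restForce H x ≠ 0)
    (hloc : ∀ x ∈ frontier D, ∀ᶠ q in 𝓝 x,
      (q ∈ D ↔ H (q, 0) < E) ∧ (q ∈ frontier D ↔ H (q, 0) = E)) :
    ∃ t₀ U tm ft, IsBrakeCollar H E D T Q P t₀ U tm ft := by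
  have hT := hF.pos
  set κ := collarMap H Q with hκ
  set K : Set (ℝ × V) := {0} ×ˢ frontier D with hK
  have hKc : IsCompact K := isCompact_singleton.prod hB
  have hκ0 : ∀ x, κ (0, x) = (x, H (x, 0)) := fun x => by
    rw [hκ, collarMap, hF.unfoldedFlow_zero]
  obtain ⟨O₁, hO₁, hKO₁, hinj⟩ := InjOn.exists_isOpen_superset (f := κ) (s := K) (by
    rintro ⟨a, x⟩ ⟨ha, hx⟩ ⟨a', x'⟩ ⟨ha', hx'⟩ h
    obtain rfl : a = 0 := ha
    obtain rfl : a' = 0 := ha'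
    rw [hκ0, hκ0] at h
    obtain rfl : x = x' := congrArg Prod.fst h
    rfl) hKc (by
    rintro ⟨a, x⟩ ⟨ha, hx⟩
    obtain rfl : a = 0 := ha
    exact hF.continuousAt_collarMap hH (by simpa using pow_pos hT 2)) (by
    rintro ⟨a, x⟩ ⟨ha, hx⟩
    obtain rfl : a = 0 := ha
    obtain ⟨e, he⟩ := hF.exists_hasStrictFDerivAt_collarMap hH hC (hBR hx) (hb x hx)
    exact ⟨_, (he.toOpenPartialHomeomorph (collarMap H Q)).open_source.mem_nhds
      he.mem_toOpenPartialHomeomorph_source, (he.toOpenPartialHomeomorph (collarMap H Q)).injOn⟩)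
  have hpt : ∀ᶠ u in 𝓝ˢ K, IsCollarPoint H E D T Q P u := by
    rw [eventually_nhdsSet_iff_forall]
    rintro ⟨a, x⟩ ⟨ha, hx⟩
    obtain rfl : a = 0 := ha
    exact hF.eventually_isCollarPoint hH hC (hBR hx) (hb x hx) (hloc x hx)
  obtain ⟨O₂, hO₂, hKO₂, hgood⟩ := mem_nhdsSet_iff_exists.1 hpt
  obtain ⟨u₁, v, hu₁, hv, hu₁0, hBv, huv⟩ := generalized_tube_lemma isCompact_singleton hB
    (hO₁.inter hO₂) (subset_inter hKO₁ hKO₂)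
  obtain ⟨r', hr'0, hr'⟩ := Metric.isOpen_iff.1 hu₁ 0 (hu₁0 rfl)
  set r := min r' (T ^ 2) with hr
  have hr0 : 0 < r := lt_min hr'0 (pow_pos hT 2)
  set O : Set (ℝ × V) := Ioo (-r) r ×ˢ v with hO
  have hOo : IsOpen O := isOpen_Ioo.prod hv
  have hOsub : O ⊆ O₁ ∩ O₂ := fun u hu => huv ⟨hr' (by
    rw [mem_ball_zero_iff, Real.norm_eq_abs]
    exact (abs_lt.2 hu.1).trans_le (min_le_left _ _)), hu.2⟩
  have hp : ∀ u ∈ O, IsCollarPoint H E D T Q P u := fun u hu => hgood (hOsub hu).2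
  have hinjO : InjOn κ O := hinj.mono fun u hu => (hOsub hu).1
  have hopen : IsOpenMap (O.domRestrict κ) := by
    refine isOpenMap_iff_nhds_le.2 fun u => ?_
    have h1 : map (O.domRestrict κ) (𝓝 u) = map κ (𝓝 (u : ℝ × V)) := by
      rw [← hOo.nhdsWithin_eq u.2, ← map_nhds_subtype_val, map_map]
      rfl
    exact ((hp u u.2).map_nhds.symm.trans h1.symm).le
  set e : OpenPartialHomeomorph (ℝ × V) (V × ℝ) :=
    OpenPartialHomeomorph.ofContinuousOpenRestrict hinjO.toPartialEquiv
      (fun u hu => (hF.continuousAt_collarMap hH (hp u hu).time).continuousWithinAt) hopen hOo with he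
  have heκ : ∀ u, e u = κ u := fun u => rfl
  have hes : e.source = O := rfl
  set U : Set V := {q | (q, E) ∈ e.target} with hU
  set g : V → ℝ × V := fun q => e.symm (q, E) with hg
  have hgO : ∀ q ∈ U, g q ∈ O := fun q hq => e.map_target hq
  have hκg : ∀ q ∈ U, κ (g q) = (q, E) := fun q hq => e.right_inv hq
  have hfg : ∀ q ∈ U, unfoldedFlow Q (g q).1 (g q).2 = q := fun q hq => congrArg Prod.fst (hκg q hq)
  have hVg : ∀ q ∈ U, H ((g q).2, 0) = E := fun q hq => congrArg Prod.snd (hκg q hq)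
  have hgc : ContinuousOn g U := e.continuousOn_symm.comp (f := fun q => (q, E)) (by fun_prop)
    fun q hq => hq
  have hsqrt : ∀ q ∈ U, √(g q).1 ∈ Ico 0 (√r) := fun q hq =>
    ⟨Real.sqrt_nonneg _, (Real.sqrt_lt_sqrt_iff_of_pos hr0).2 (hgO q hq).1.2⟩
  -- Along the unfolded flow the potential is below its starting value for `τ > 0` and above it for
  -- `τ < 0`, so the sign of `τ` tells on which side of `∂D` a point lies.
  have hposg : ∀ q ∈ U ∩ D, 0 < (g q).1 := by
    rintro q ⟨hq, hqD⟩
    have hpt := hp _ (hgO q hq)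
    have h1 := hpt.domain
    rw [hfg q hq] at h1
    have h2 := h1.1 hqD
    by_contra hle
    rcases (not_lt.1 hle).lt_or_eq with h | h
    · have := hpt.of_neg h
      rw [hfg q hq, hVg q hq] at this
      linarith
    · have h3 := hfg q hq
      rw [h, hF.unfoldedFlow_zero] at h3
      rw [← h3, hVg q hq] at h2
      exact lt_irrefl _ h2
  have hgd : ∀ q ∈ U ∩ D, ∃ A : (ℝ × V) ≃L[ℝ] (V × ℝ),
      fderiv ℝ κ (g q) = (A : (ℝ × V) →L[ℝ] (V × ℝ)) ∧ ContDiffAt ℝ 1 g q ∧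
      HasFDerivAt g ((A.symm : (V × ℝ) →L[ℝ] (ℝ × V)) ∘L .inl ℝ V ℝ) q := by
    rintro q ⟨hq, hqD⟩
    have h0 := hposg q ⟨hq, hqD⟩
    have hpt := hp _ (hgO q hq)
    have hcd := hF.contDiffAt_collarMap hH hpt.time h0
    have hfr : Module.finrank ℝ (ℝ × V) = Module.finrank ℝ (V × ℝ) := by
      rw [Module.finrank_prod, Module.finrank_prod, add_comm]
    have hi : Function.Injective (fderiv ℝ κ (g q) : (ℝ × V) →ₗ[ℝ] (V × ℝ)) := by
      rw [← LinearMap.ker_eq_bot, LinearMap.ker_eq_bot']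
      exact hpt.injective h0
    set A := (LinearEquiv.ofInjectiveOfFinrankEq _ hi hfr).toContinuousLinearEquiv with hA
    have hAe : fderiv ℝ κ (g q) = (A : (ℝ × V) →L[ℝ] (V × ℝ)) := by
      ext w <;> rfl
    have hdA : HasFDerivAt e (A : (ℝ × V) →L[ℝ] (V × ℝ)) (e.symm (q, E)) := by
      have := (hcd.differentiableAt one_ne_zero).hasFDerivAt
      rw [← hκ, hAe] at this
      exact this
    refine ⟨A, hAe, ?_, ?_⟩
    · exact (e.contDiffAt_symm (a := (q, E)) hq hdA hcd).comp (f := fun q => (q, E)) q (by fun_prop)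
    · exact HasFDerivAt.comp (g := e.symm) (f := fun q => (q, E)) q
        (e.hasFDerivAt_symm (a := (q, E)) hq hdA) (hasFDerivAt_prodMk_left q E)
  have happ : ∀ t ∈ Ico 0 (√r), ∀ x ∈ frontier D, Q t x ∈ U ∧ g (Q t x) = (t ^ 2, x) ∧
      (0 < t → Q t x ∈ D) := by
    intro t ht x hx
    have htr : t ^ 2 < r := by
      have := (Real.lt_sqrt ht.1).1 ht.2
      exact this
    have hm : (t ^ 2, x) ∈ O := ⟨⟨by nlinarith, htr⟩, hBv hx⟩
    have hf : unfoldedFlow Q (t ^ 2) x = Q t x := by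
      rw [hF.unfoldedFlow_of_nonneg (by positivity), Real.sqrt_sq ht.1]
    have hpt := hp _ hm
    have hxE : H (x, 0) = E := hpt.foot.1 hx
    have hk : e (t ^ 2, x) = (Q t x, E) := by
      rw [heκ, hκ, collarMap, hf, hxE]
    refine ⟨?_, ?_, fun h0 => ?_⟩
    · change (Q t x, E) ∈ e.target
      rw [← hk]
      exact e.map_source hm
    · change e.symm (Q t x, E) = _
      rw [← hk]
      exact e.left_inv hm
    · have h1 := hpt.domain
      have h2 := hpt.of_pos (by positivity)
      simp only [hf] at h1 h2
      exact h1.2 (h2.trans_eq hxE)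
  refine ⟨√r, U, fun q => √(g q).1, fun q => (g q).2, Real.sqrt_pos.2 hr0, ?_, ?_, ?_, ?_, ?_, ?_,
    ?_, hVg, ?_, ?_, ?_⟩
  · exact (Real.sqrt_le_left hT.le).2 (min_le_right _ _)
  · exact e.open_target.preimage (f := fun q => (q, E)) (by fun_prop)
  · intro t ht x hx
    obtain ⟨h1, h2, -⟩ := happ t ht x hx
    simp only [h2]
    exact ⟨h1, Real.sqrt_sq ht.1, trivial⟩
  · exact fun t ht x hx => (happ t ⟨ht.1.le, ht.2⟩ x hx).2.2 ht.1
  · rintro q ⟨hq, hqc⟩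
    have hpt := hp _ (hgO q hq)
    refine ⟨hsqrt q hq, hpt.foot.2 (hVg q hq), ?_⟩
    rw [closure_eq_self_union_frontier] at hqc
    have h0 : 0 ≤ (g q).1 := by
      rcases hqc with hqD | hqB
      · exact (hposg q ⟨hq, hqD⟩).le
      · have h1 := hpt.boundary
        rw [hfg q hq] at h1
        by_contra hlt
        have := hpt.of_neg (not_le.1 hlt)
        rw [hfg q hq, hVg q hq, h1.1 hqB] at this
        exact lt_irrefl _ this
    rw [← hF.unfoldedFlow_of_nonneg h0]
    exact hfg q hq
  · exact Real.continuous_sqrt.comp_continuousOn (continuous_fst.comp_continuousOn hgc)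
  · exact continuous_snd.comp_continuousOn hgc
  · intro q hq
    obtain ⟨A, -, h2, -⟩ := hgd q hq
    exact h2.fst.sqrt (hposg q hq).ne'
  · intro q hq
    obtain ⟨A, -, h2, -⟩ := hgd q hq
    exact h2.snd
  · rintro q ⟨hq, hqD⟩ y hy hort
    obtain ⟨A, hA, -, hgA⟩ := hgd q ⟨hq, hqD⟩
    have h0 := hposg q ⟨hq, hqD⟩
    have hpt := hp _ (hgO q hq)
    have hQq : Q (√(g q).1) (g q).2 = q := by
      rw [← hF.unfoldedFlow_of_nonneg h0.le]
      exact hfg q hq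
    set ξ := pGrad H (q, y) with hξ
    -- The second component `0` expresses that the starting potential stays equal to `E` as the
    -- point moves with velocity `ξ`.
    set w := A.symm (ξ, 0) with hw
    have hmain := hpt.concave h0 w y (by rw [hQq, hy, hVg q hq])
      (by rw [hQq, ← hκ, hA]; exact A.apply_symm_apply _) (by rw [hQq]; exact hort)
    rw [hQq] at hmain
    have hsq : HasFDerivAt (fun x => (√(g x).1, (g x).2))
        (((1 / (2 * √(g q).1)) • (.fst ℝ ℝ V ∘L
          ((A.symm : (V × ℝ) →L[ℝ] (ℝ × V)) ∘L .inl ℝ V ℝ))).prod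
          (.snd ℝ ℝ V ∘L ((A.symm : (V × ℝ) →L[ℝ] (ℝ × V)) ∘L .inl ℝ V ℝ))) q :=
      (hgA.fst.sqrt h0.ne').prodMk hgA.snd
    have hπ := (HasFDerivAt.comp (g := fun v : ℝ × V => (Q v.1 v.2, P v.1 v.2))
      (f := fun x => (√(g x).1, (g x).2)) q ((hF.contDiffAt _ (hF.sqrt_mem hpt.time).1
        (g q).2).differentiableAt one_ne_zero).hasFDerivAt hsq).snd
    have hπ' : fderiv ℝ (fun x => P (√(g x).1) (g x).2) q ξ =
        (fderiv ℝ (fun v : ℝ × V => (Q v.1 v.2, P v.1 v.2)) (√(g q).1, (g q).2)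
          (w.1 / (2 * √(g q).1), w.2)).2 := by
      rw [HasFDerivAt.fderiv (f := fun x => P (√(g x).1) (g x).2) hπ]
      simp only [ContinuousLinearMap.comp_apply, ContinuousLinearMap.prod_apply,
        ContinuousLinearMap.coe_snd', smul_apply, ContinuousLinearMap.coe_fst',
        ContinuousLinearMap.inl_apply, smul_eq_mul]
      rw [one_div, inv_mul_eq_div]
      rfl
    rw [hπ']
    exact hmain

end Collar

/-! ### The action from the boundary as a function on the closure of the well -/

section BoundaryAction

open scoped RealInnerProductSpace

variable {V : Type*} [NormedAddCommGroup V] [InnerProductSpace ℝ V] [CompleteSpace V]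
  [FiniteDimensional ℝ V] {H : V × V → ℝ} {E R T t₀ : ℝ} {D U : Set V} {Q P : ℝ → V → V}
  {tm : V → ℝ} {ft : V → V}

namespace IsBrakeCollar

variable (hc : IsBrakeCollar H E D T Q P t₀ U tm ft)

include hc

theorem time_mem {q : V} (hq : q ∈ U ∩ closure D) : tm q ∈ Ioo (-T) T := by
  have h := (hc.mem q hq).1
  have := hc.le
  have := hc.pos
  exact ⟨by linarith [h.1], by linarith [h.2]⟩

theorem Ico_subset : Ico 0 t₀ ⊆ Ioo (-T) T := fun t ht => by
  have := hc.le
  have := hc.pos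
  exact ⟨by linarith [ht.1], by linarith [ht.2]⟩

theorem time_pos (hF : IsBrakeFlow H R T Q P) (hDo : IsOpen D) {q : V} (hq : q ∈ U ∩ D) :
    0 < tm q := by
  have h := hc.mem q ⟨hq.1, subset_closure hq.2⟩
  refine h.1.1.lt_of_ne fun h0 => ?_
  have h1 := h.2.2
  rw [← h0, (hF.zero _).1] at h1
  have h2 := h.2.1
  rw [h1, hDo.frontier_eq] at h2
  exact h2.2 hq.2

theorem energy (hF : IsBrakeFlow H R T Q P) (hH : ContDiff ℝ 2 H)
    (hBR : frontier D ⊆ Metric.ball 0 R) {q : V} (hq : q ∈ U ∩ closure D) :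
    H (q, P (tm q) (ft q)) = E := by
  have h := hc.mem q hq
  have h1 := hF.energy hH (hc.time_mem hq) (hBR h.2.1)
  rw [h.2.2] at h1
  rw [h1]
  exact hc.potential_foot q hq.1

theorem contDiffAt_momentum (hF : IsBrakeFlow H R T Q P) {q : V} (hq : q ∈ U ∩ D) :
    ContDiffAt ℝ 1 (fun q => P (tm q) (ft q)) q :=
  ContDiffAt.comp (g := fun u : ℝ × V => P u.1 u.2) (f := fun q => (tm q, ft q)) q
    (hF.contDiffAt _ (hc.time_mem ⟨hq.1, subset_closure hq.2⟩) _).snd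
    ((hc.contDiffAt_time q hq).prodMk (hc.contDiffAt_foot q hq))

/-- The action from the boundary generates the momentum. -/
theorem hasFDerivAt_action (hF : IsBrakeFlow H R T Q P) (hH : ContDiff ℝ 2 H) (hDo : IsOpen D)
    (hBR : frontier D ⊆ Metric.ball 0 R) {q : V} (hq : q ∈ U ∩ D) :
    HasFDerivAt (fun q => brakeAction H Q P (tm q) (ft q)) (innerSL ℝ (P (tm q) (ft q))) q := by
  have hqc : q ∈ U ∩ closure D := ⟨hq.1, subset_closure hq.2⟩
  have hm := hc.mem q hqc
  set u : V → ℝ × V := fun q => (tm q, ft q) with hu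
  have hud : ContDiffAt ℝ 1 u q := (hc.contDiffAt_time q hq).prodMk (hc.contDiffAt_foot q hq)
  obtain ⟨K, hK⟩ := hF.brakeAction_sub_le hH (hc.time_mem hqc) (hBR hm.2.1)
  obtain ⟨L, s, hs, hL⟩ := (hud.hasStrictFDerivAt one_ne_zero).exists_lipschitzOnWith
  have hev : ∀ᶠ x in 𝓝 q, x ∈ U ∩ D := (hc.isOpen.inter hDo).mem_nhds hq
  -- All starting points have potential `E`, so the first variation formula has only a quadratic
  -- error.
  have hO : (fun x => brakeAction H Q P (tm x) (ft x) - brakeAction H Q P (tm q) (ft q) -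
      ⟪P (tm q) (ft q), x - q⟫) =O[𝓝 q] fun x => ‖x - q‖ ^ 2 := by
    refine Asymptotics.IsBigO.of_bound (|K| * L ^ 2) ?_
    filter_upwards [hev, hud.continuousAt.eventually hK, hs] with x hx h1 hxs
    have hxm := hc.mem x ⟨hx.1, subset_closure hx.2⟩
    simp only [hu, hxm.2.2, hm.2.2, hc.potential_foot x hx.1, hc.potential_foot q hq.1, sub_self,
      abs_zero, mul_zero, add_zero] at h1
    have h2 := hL.norm_sub_le hxs (mem_of_mem_nhds hs)
    rw [Real.norm_eq_abs, norm_pow, norm_norm]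
    calc _ ≤ K * ‖(tm x, ft x) - (tm q, ft q)‖ ^ 2 := h1
      _ ≤ |K| * (L * ‖x - q‖) ^ 2 := by
        gcongr
        exact le_abs_self K
      _ = |K| * L ^ 2 * ‖x - q‖ ^ 2 := by ring
  have h0 := hO.hasFDerivAt (𝕜 := ℝ) one_lt_two
  have h1 : HasFDerivAt (fun x => brakeAction H Q P (tm q) (ft q) + ⟪P (tm q) (ft q), x - q⟫)
      (innerSL ℝ (P (tm q) (ft q))) q :=
    ((innerSL ℝ (P (tm q) (ft q))).hasFDerivAt.comp q
      ((hasFDerivAt_id q).sub_const q)).const_add _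
  have h2 := h0.add h1
  rw [zero_add] at h2
  refine h2.congr_of_eventuallyEq (Eventually.of_forall fun x => ?_)
  simp only [Pi.add_apply]
  ring

theorem continuousOn_action (hF : IsBrakeFlow H R T Q P) (hH : ContDiff ℝ 2 H)
    (hBR : frontier D ⊆ Metric.ball 0 R) :
    ContinuousOn (fun q => brakeAction H Q P (tm q) (ft q)) (U ∩ closure D) := fun q hq =>
  ContinuousAt.comp_continuousWithinAt (g := fun u : ℝ × V => brakeAction H Q P u.1 u.2)
    (f := fun q => (tm q, ft q))
    (hF.continuousAt_brakeAction hH (hc.time_mem hq) (hBR (hc.mem q hq).2.1))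
    (((hc.continuousOn_time.prodMk hc.continuousOn_foot) q hq.1).mono inter_subset_left)

theorem momentum_ne_zero (hF : IsBrakeFlow H R T Q P) (hH : ContDiff ℝ 2 H)
    (hBR : frontier D ⊆ Metric.ball 0 R) (hlt : ∀ q ∈ D, H (q, 0) < E)
    (heq : ∀ x ∈ frontier D, H (x, 0) = E) {t : ℝ} (ht : t ∈ Ioo 0 t₀) {x : V}
    (hx : x ∈ frontier D) : P t x ≠ 0 := fun h0 => by
  have h1 := hF.energy hH (hc.Ico_subset ⟨ht.1.le, ht.2⟩) (hBR hx)
  rw [h0, heq x hx] at h1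
  exact (hlt _ (hc.apply_mem_domain t ht x hx)).ne h1

theorem strictMonoOn_action (hF : IsBrakeFlow H R T Q P) (hH : ContDiff ℝ 2 H)
    (hC : IsConvexHamiltonian univ H)
    (hBR : frontier D ⊆ Metric.ball 0 R) (hlt : ∀ q ∈ D, H (q, 0) < E)
    (heq : ∀ x ∈ frontier D, H (x, 0) = E) {x : V} (hx : x ∈ frontier D) :
    StrictMonoOn (fun t => brakeAction H Q P t x) (Ico 0 t₀) := by
  refine strictMonoOn_of_deriv_pos (convex_Ico _ _) (fun t ht =>
    (hF.hasDerivAt_brakeAction hH (hc.Ico_subset ht) (hBR hx)).continuousAt.continuousWithinAt)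
    fun t ht => ?_
  rw [interior_Ico] at ht
  rw [(hF.hasDerivAt_brakeAction hH (hc.Ico_subset ⟨ht.1.le, ht.2⟩) (hBR hx)).deriv]
  exact hC.inner_pGrad_self_pos (mem_univ _) (hc.momentum_ne_zero hF hH hBR hlt heq ht hx)

end IsBrakeCollar

/-- `ℓ` is the action from the boundary, cut off at the value `δ₀`. -/
structure IsBoundaryAction (H : V × V → ℝ) (D : Set V) (Q P : ℝ → V → V) (t₀ : ℝ) (U : Set V)
    (tm : V → ℝ) (ft : V → V) (δ₀ : ℝ) (ℓ : V → ℝ) : Prop where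
  pos : 0 < δ₀
  continuousOn : ContinuousOn ℓ (closure D)
  nonneg : ∀ q ∈ closure D, 0 ≤ ℓ q
  pos_of_mem : ∀ q ∈ D, 0 < ℓ q
  eq_zero : ∀ q ∈ frontier D, ℓ q = 0
  mem : ∀ q ∈ closure D, ℓ q < δ₀ → q ∈ U ∧ ℓ q = brakeAction H Q P (tm q) (ft q)
  eventuallyEq : ∀ q ∈ D, ℓ q < δ₀ → ℓ =ᶠ[𝓝 q] fun q => brakeAction H Q P (tm q) (ft q)
  exists_time : ∀ x ∈ frontier D, ∀ s ∈ Ico 0 δ₀, ∃ t ∈ Ico 0 t₀, ℓ (Q t x) = s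

open Classical in
-- `δ₀` is the least action at time `t₁ = t₀ / 2` over all starting points (any positive number if
-- there are none). An action below `δ₀` forces the time to be below `t₁`, hence occurs only in the
-- compact set reached by time `t₁`. Capping at `δ₀` therefore extends the action continuously.
theorem IsBrakeCollar.exists_isBoundaryAction (hc : IsBrakeCollar H E D T Q P t₀ U tm ft)
    (hF : IsBrakeFlow H R T Q P) (hH : ContDiff ℝ 2 H) (hC : IsConvexHamiltonian univ H)
    (hDo : IsOpen D) (hB : IsCompact (frontier D))
    (hBR : frontier D ⊆ Metric.ball 0 R) (hlt : ∀ q ∈ D, H (q, 0) < E)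
    (heq : ∀ x ∈ frontier D, H (x, 0) = E) :
    ∃ δ₀ ℓ, IsBoundaryAction H D Q P t₀ U tm ft δ₀ ℓ := by
  set t₁ := t₀ / 2 with ht₁
  have hpos := hc.pos
  have ht₁m : t₁ ∈ Ioo 0 t₀ := ⟨by positivity, half_lt_self hpos⟩
  set W : V → ℝ := fun q => brakeAction H Q P (tm q) (ft q) with hW
  have hmono := fun x (hx : x ∈ frontier D) => hc.strictMonoOn_action hF hH hC hBR hlt heq hx
  have h0m : (0 : ℝ) ∈ Ico 0 t₀ := ⟨le_rfl, hpos⟩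
  have hS0 : ∀ x ∈ frontier D, ∀ t ∈ Ioo 0 t₀, 0 < brakeAction H Q P t x := fun x hx t ht => by
    have := hmono x hx h0m ⟨ht.1.le, ht.2⟩ ht.1
    simpa only [brakeAction_zero] using this
  have hcS : ContinuousOn (fun x => brakeAction H Q P t₁ x) (frontier D) := fun x hx =>
    (ContinuousAt.comp (g := fun u : ℝ × V => brakeAction H Q P u.1 u.2) (f := fun x => (t₁, x))
      (hF.continuousAt_brakeAction hH (hc.Ico_subset ⟨ht₁m.1.le, ht₁m.2⟩) (hBR hx))
      (by fun_prop)).continuousWithinAt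
  obtain ⟨δ₀, hδ₀, hδ⟩ : ∃ δ₀ > 0, ∀ x ∈ frontier D, δ₀ ≤ brakeAction H Q P t₁ x := by
    rcases (frontier D).eq_empty_or_nonempty with h | h
    · exact ⟨1, one_pos, by simp [h]⟩
    · obtain ⟨x, hx, hmin⟩ := hB.exists_isMinOn h hcS
      exact ⟨_, hS0 x hx t₁ ht₁m, fun y hy => hmin hy⟩
  set K : Set V := (fun u : ℝ × V => Q u.1 u.2) '' (Icc 0 t₁ ×ˢ frontier D) with hK
  have hKc : IsCompact K := (isCompact_Icc.prod hB).image_of_continuousOn fun u hu =>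
    (hF.continuousAt_position (hc.Ico_subset ⟨hu.1.1, hu.1.2.trans_lt ht₁m.2⟩)
      u.2).continuousWithinAt
  have hKU : K ⊆ U := by
    rintro q ⟨u, hu, rfl⟩
    exact (hc.apply_mem u.1 ⟨hu.1.1, hu.1.2.trans_lt ht₁m.2⟩ u.2 hu.2).1
  set ℓ : V → ℝ := fun q => if q ∈ K then min (W q) δ₀ else δ₀ with hℓ
  have hmemK : ∀ q ∈ U ∩ closure D, W q < δ₀ → q ∈ K := by
    intro q hq hlt'
    have hm := hc.mem q hq
    have : tm q < t₁ := by
      have h1 : brakeAction H Q P (tm q) (ft q) < brakeAction H Q P t₁ (ft q) :=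
        hlt'.trans_le (hδ _ hm.2.1)
      exact ((hmono _ hm.2.1).lt_iff_lt hm.1 ⟨ht₁m.1.le, ht₁m.2⟩).1 h1
    exact ⟨(tm q, ft q), ⟨⟨hm.1.1, this.le⟩, hm.2.1⟩, hm.2.2⟩
  have hℓU : ∀ q ∈ U ∩ closure D, ℓ q = min (W q) δ₀ := by
    intro q hq
    by_cases h : q ∈ K
    · rw [hℓ]; exact if_pos h
    · rw [hℓ]
      simp only
      rw [if_neg h, min_eq_right]
      by_contra hlt'
      exact h (hmemK q hq (not_le.1 hlt'))
  have hℓK : ∀ q, q ∉ K → ℓ q = δ₀ := fun q h => if_neg h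
  have hWc := hc.continuousOn_action hF hH hBR
  have hWpos : ∀ q ∈ U ∩ D, 0 < W q := fun q hq => by
    have hm := hc.mem q ⟨hq.1, subset_closure hq.2⟩
    exact hS0 _ hm.2.1 _ ⟨hc.time_pos hF hDo hq, hm.1.2⟩
  have hW0 : ∀ x ∈ frontier D, x ∈ U ∧ W x = 0 := fun x hx => by
    have h1 := hc.apply_mem 0 h0m x hx
    rw [(hF.zero x).1] at h1
    refine ⟨h1.1, ?_⟩
    rw [hW]
    simp only
    rw [h1.2.1, brakeAction_zero]
  have hpos_mem : ∀ q ∈ D, 0 < ℓ q := by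
    intro q hq
    by_cases h : q ∈ U
    · rw [hℓU q ⟨h, subset_closure hq⟩]
      exact lt_min (hWpos q ⟨h, hq⟩) hδ₀
    · rw [hℓK q fun hk => h (hKU hk)]
      exact hδ₀
  have hzero : ∀ x ∈ frontier D, ℓ x = 0 := fun x hx => by
    rw [hℓU x ⟨(hW0 x hx).1, frontier_subset_closure hx⟩, (hW0 x hx).2, min_eq_left hδ₀.le]
  have hmem : ∀ q ∈ closure D, ℓ q < δ₀ → q ∈ U ∧ ℓ q = W q := by
    intro q hq hlt'
    have hk : q ∈ K := by
      by_contra h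
      rw [hℓK q h] at hlt'
      exact lt_irrefl _ hlt'
    refine ⟨hKU hk, ?_⟩
    rw [hℓU q ⟨hKU hk, hq⟩] at hlt' ⊢
    exact min_eq_left (by
      by_contra h
      rw [min_eq_right (not_le.1 h).le] at hlt'
      exact lt_irrefl _ hlt')
  refine ⟨δ₀, ℓ, hδ₀, ?_, ?_, hpos_mem, hzero, hmem, ?_, ?_⟩
  · intro q hq
    by_cases h : q ∈ U
    · have h1 : ContinuousWithinAt (fun q => min (W q) δ₀) (U ∩ closure D) q :=
        (hWc q ⟨h, hq⟩).min continuousWithinAt_const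
      have h2 : ContinuousWithinAt ℓ (U ∩ closure D) q := h1.congr hℓU (hℓU q ⟨h, hq⟩)
      exact h2.mono_of_mem_nhdsWithin
        (inter_mem (mem_nhdsWithin_of_mem_nhds (hc.isOpen.mem_nhds h)) self_mem_nhdsWithin)
    · have h1 : ℓ =ᶠ[𝓝 q] fun _ => δ₀ := by
        filter_upwards [hKc.isClosed.isOpen_compl.mem_nhds (show q ∈ Kᶜ from fun hk => h (hKU hk))]
          with x hx using hℓK x hx
      exact (continuousAt_const.congr h1.symm).continuousWithinAt
  · intro q hq
    rw [closure_eq_self_union_frontier] at hq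
    rcases hq with hq | hq
    · exact (hpos_mem q hq).le
    · exact (hzero q hq).ge
  · intro q hq hlt'
    obtain ⟨hqU, hqW⟩ := hmem q (subset_closure hq) hlt'
    have hcW : ContinuousAt W q := ((hWc q ⟨hqU, subset_closure hq⟩).mono
      (inter_subset_inter_right U subset_closure)).continuousAt ((hc.isOpen.inter hDo).mem_nhds
        ⟨hqU, hq⟩)
    filter_upwards [(hc.isOpen.inter hDo).mem_nhds ⟨hqU, hq⟩,
      hcW.eventually (gt_mem_nhds (hqW ▸ hlt'))] with x hx hxW
    rw [hℓU x ⟨hx.1, subset_closure hx.2⟩]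
    exact min_eq_left (le_of_lt hxW)
  · intro x hx s hs
    have hcont : ContinuousOn (fun t => brakeAction H Q P t x) (Icc 0 t₁) := fun t ht =>
      (hF.hasDerivAt_brakeAction hH (hc.Ico_subset ⟨ht.1, ht.2.trans_lt ht₁m.2⟩)
        (hBR hx)).continuousAt.continuousWithinAt
    obtain ⟨t, ht, hts⟩ := intermediate_value_Icc ht₁m.1.le hcont
      (show s ∈ Icc _ _ from ⟨by simp only [brakeAction_zero]; exact hs.1,
        hs.2.le.trans (hδ x hx)⟩)
    have htm : t ∈ Ico 0 t₀ := ⟨ht.1, ht.2.trans_lt ht₁m.2⟩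
    have h1 := hc.apply_mem t htm x hx
    refine ⟨t, htm, ?_⟩
    have hcl : Q t x ∈ closure D := by
      rcases ht.1.eq_or_lt with h | h
      · rw [← h, (hF.zero x).1]
        exact frontier_subset_closure hx
      · exact subset_closure (hc.apply_mem_domain t ⟨h, htm.2⟩ x hx)
    have hts : brakeAction H Q P t x = s := hts
    rw [hℓU _ ⟨h1.1, hcl⟩, hW]
    simp only
    rw [h1.2.1, h1.2.2, hts, min_eq_left hs.2.le]

end BoundaryAction

/-! ### The standing data, and regularity of the action -/

section CollarData

open scoped RealInnerProductSpace

variable {V : Type*} [NormedAddCommGroup V] [InnerProductSpace ℝ V] [CompleteSpace V]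
  [FiniteDimensional ℝ V]

/-- A potential well with compact closure, together with its brake collar. -/
structure CollarData (H : V × V → ℝ) (E : ℝ) (D : Set V) where
  (R T t₀ δ₀ : ℝ)
  (Q P : ℝ → V → V)
  (U : Set V)
  (tm : V → ℝ)
  (ft : V → V)
  (ℓ : V → ℝ)
  contDiff : ContDiff ℝ 2 H
  convex : IsConvexHamiltonian univ H
  isOpen : IsOpen D
  isCompact : IsCompact (closure D)
  lt_energy : ∀ q ∈ D, H (q, 0) < E
  eq_energy : ∀ q ∈ frontier D, H (q, 0) = E
  force_ne_zero : ∀ q ∈ frontier D, restForce H q ≠ 0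
  frontier_subset : frontier D ⊆ Metric.ball 0 R
  flow : IsBrakeFlow H R T Q P
  collar : IsBrakeCollar H E D T Q P t₀ U tm ft
  action : IsBoundaryAction H D Q P t₀ U tm ft δ₀ ℓ

theorem exists_collarData {H : V × V → ℝ} {E : ℝ} {D : Set V} (hH : ContDiff ℝ 2 H)
    (hC : IsConvexHamiltonian univ H) (hDo : IsOpen D) (hDc : IsCompact (closure D))
    (hlt : ∀ q ∈ D, H (q, 0) < E) (heq : ∀ q ∈ frontier D, H (q, 0) = E)
    (hb : ∀ q ∈ frontier D, restForce H q ≠ 0)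
    (hloc : ∀ x ∈ frontier D, ∀ᶠ q in 𝓝 x,
      (q ∈ D ↔ H (q, 0) < E) ∧ (q ∈ frontier D ↔ H (q, 0) = E)) :
    Nonempty (CollarData H E D) := by
  have hB : IsCompact (frontier D) := hDc.of_isClosed_subset isClosed_frontier
    frontier_subset_closure
  obtain ⟨R, hR⟩ := hB.isBounded.subset_ball 0
  obtain ⟨T, Q, P, hF⟩ := exists_isBrakeFlow hH R
  obtain ⟨t₀, U, tm, ft, hc⟩ := hF.exists_isBrakeCollar hH hC hB hR hb hloc
  obtain ⟨δ₀, ℓ, ha⟩ := hc.exists_isBoundaryAction hF hH hC hDo hB hR hlt heq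
  exact ⟨⟨R, T, t₀, δ₀, Q, P, U, tm, ft, ℓ, hH, hC, hDo, hDc, hlt, heq, hb, hR, hF, hc, ha⟩⟩

namespace CollarData

variable {H : V × V → ℝ} {E : ℝ} {D : Set V} (K : CollarData H E D)

/-- The momentum of the brake orbit through a point of the collar. -/
noncomputable def mom (q : V) : V := K.P (K.tm q) (K.ft q)

variable {q : V}

theorem mem_collar (hq : q ∈ D) (hl : K.ℓ q < K.δ₀) : q ∈ K.U ∩ D :=
  ⟨(K.action.mem q (subset_closure hq) hl).1, hq⟩

theorem hasFDerivAt_action (hq : q ∈ D) (hl : K.ℓ q < K.δ₀) :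
    HasFDerivAt K.ℓ (innerSL ℝ (K.mom q)) q :=
  (K.collar.hasFDerivAt_action K.flow K.contDiff K.isOpen K.frontier_subset
    (K.mem_collar hq hl)).congr_of_eventuallyEq (K.action.eventuallyEq q hq hl)

theorem contDiffAt_mom (hq : q ∈ D) (hl : K.ℓ q < K.δ₀) : ContDiffAt ℝ 1 K.mom q :=
  K.collar.contDiffAt_momentum K.flow (K.mem_collar hq hl)

theorem continuousAt_action (hq : q ∈ D) : ContinuousAt K.ℓ q :=
  (K.action.continuousOn.mono subset_closure).continuousAt (K.isOpen.mem_nhds hq)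

theorem eventually_mem_lt (hq : q ∈ D) (hl : K.ℓ q < K.δ₀) :
    ∀ᶠ x in 𝓝 q, x ∈ D ∧ K.ℓ x < K.δ₀ :=
  Eventually.and (K.isOpen.mem_nhds hq) ((K.continuousAt_action hq).eventually (gt_mem_nhds hl))

/-- The gradient of the action is the momentum, which is `C¹`; this yields two derivatives although
the collar coordinates have only one. -/
theorem contDiffAt_action (hq : q ∈ D) (hl : K.ℓ q < K.δ₀) : ContDiffAt ℝ 2 K.ℓ q := by
  rw [show (2 : WithTop ℕ∞) = ((1 : ℕ) : WithTop ℕ∞) + 1 by norm_num,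
    contDiffAt_succ_iff_hasFDerivAt]
  exact ⟨fun x => innerSL ℝ (K.mom x), ⟨_, K.eventually_mem_lt hq hl, fun x hx =>
    K.hasFDerivAt_action hx.1 hx.2⟩,
    (innerSL ℝ).contDiff.contDiffAt.comp q (K.contDiffAt_mom hq hl)⟩

theorem energy_mom (hq : q ∈ D) (hl : K.ℓ q < K.δ₀) : H (q, K.mom q) = E :=
  K.collar.energy K.flow K.contDiff K.frontier_subset
    ⟨(K.mem_collar hq hl).1, subset_closure hq⟩

theorem mom_ne_zero (hq : q ∈ D) (hl : K.ℓ q < K.δ₀) : K.mom q ≠ 0 :=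
  IsConvexHamiltonian.ne_zero_of_energy_eq K.lt_energy hq (K.energy_mom hq hl)

theorem concave (hq : q ∈ D) (hl : K.ℓ q < K.δ₀) {y : V} (hy : H (q, y) = E)
    (h : ⟪K.mom q, pGrad H (q, y)⟫ = 0) :
    0 < ⟪fderiv ℝ K.mom q (pGrad H (q, y)), pGrad H (q, y)⟫ +
      ⟪K.mom q, fderiv ℝ (pGrad H) (q, y) (pGrad H (q, y), -qGrad H (q, y))⟫ :=
  K.collar.concave q (K.mem_collar hq hl) y hy h

/-- A function of the action that is constant for large values is of class `C²`. -/
theorem contDiffAt_comp_action {g : ℝ → ℝ} {δ c : ℝ} (hδ : δ < K.δ₀)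
    (hg : ∀ w, 0 < w → ContDiffAt ℝ 2 g w) (hgc : ∀ w, δ ≤ w → g w = c) (hq : q ∈ D) :
    ContDiffAt ℝ 2 (fun x => g (K.ℓ x)) q := by
  rcases lt_or_ge (K.ℓ q) K.δ₀ with h | h
  · exact ContDiffAt.comp (g := g) (f := K.ℓ) q (hg _ (K.action.pos_of_mem q hq))
      (K.contDiffAt_action hq h)
  · refine (contDiffAt_const (c := c)).congr_of_eventuallyEq ?_
    filter_upwards [(K.continuousAt_action hq).eventually (lt_mem_nhds (hδ.trans_le h))] with x hx
    exact hgc _ (le_of_lt hx)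

end CollarData

end CollarData

/-! ### Profiles of the conformal factor and of the defining function -/

section Cutoff

/-- A smooth step, equal to `0` for `w ≤ a` and to `1` for `b ≤ w`. -/
noncomputable def smoothStep (a b w : ℝ) : ℝ := Real.smoothTransition ((w - a) / (b - a))

variable {a b w : ℝ}

theorem smoothStep_of_le (hab : a < b) (hw : w ≤ a) : smoothStep a b w = 0 :=
  Real.smoothTransition.zero_of_nonpos
    (div_nonpos_of_nonpos_of_nonneg (sub_nonpos.2 hw) (sub_pos.2 hab).le)

theorem smoothStep_of_ge (hab : a < b) (hw : b ≤ w) : smoothStep a b w = 1 :=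
  Real.smoothTransition.one_of_one_le ((one_le_div (sub_pos.2 hab)).2 (by linarith))

theorem smoothStep_nonneg : 0 ≤ smoothStep a b w := Real.smoothTransition.nonneg _

theorem smoothStep_le_one : smoothStep a b w ≤ 1 := Real.smoothTransition.le_one _

theorem contDiff_smoothStep : ContDiff ℝ 2 (smoothStep a b) :=
  (Real.smoothTransition.contDiff (n := 2)).comp ((contDiff_id.sub contDiff_const).div_const _)

/-- The conformal factor: `w ^ (2/3)` for `w ≤ a`, and `1` for `b ≤ w`. -/
noncomputable def conformalFactor (a b w : ℝ) : ℝ :=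
  w ^ (2 / 3 : ℝ) * (1 - smoothStep a b w) + smoothStep a b w

theorem conformalFactor_of_le (hab : a < b) (hw : w ≤ a) :
    conformalFactor a b w = w ^ (2 / 3 : ℝ) := by
  rw [conformalFactor, smoothStep_of_le hab hw]
  ring

theorem conformalFactor_of_ge (hab : a < b) (hw : b ≤ w) : conformalFactor a b w = 1 := by
  rw [conformalFactor, smoothStep_of_ge hab hw]
  ring

theorem conformalFactor_pos (hw : 0 < w) : 0 < conformalFactor a b w := by
  have h1 : 0 < w ^ (2 / 3 : ℝ) := Real.rpow_pos_of_pos hw _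
  have h2 := smoothStep_nonneg (a := a) (b := b) (w := w)
  have h3 := smoothStep_le_one (a := a) (b := b) (w := w)
  rw [conformalFactor]
  rcases h2.eq_or_lt with h | h
  · rw [← h]; linarith
  · have := mul_nonneg h1.le (sub_nonneg.2 h3)
    linarith

theorem contDiffAt_conformalFactor (hw : 0 < w) : ContDiffAt ℝ 2 (conformalFactor a b) w := by
  have h := (contDiff_smoothStep (a := a) (b := b)).contDiffAt (x := w)
  exact ((contDiffAt_id.rpow_const_of_ne hw.ne').mul (contDiffAt_const.sub h)).add h

/-- A function that is `w - a` near `w = a`, positive for `a < w`, and constant for `c ≤ w`. -/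
noncomputable def definingProfile (a b c w : ℝ) : ℝ :=
  (w - a) * (1 - smoothStep b c w) + smoothStep b c w

variable {c : ℝ}

theorem definingProfile_of_le (hbc : b < c) (hw : w ≤ b) : definingProfile a b c w = w - a := by
  rw [definingProfile, smoothStep_of_le hbc hw]
  ring

theorem definingProfile_of_ge (hbc : b < c) (hw : c ≤ w) : definingProfile a b c w = 1 := by
  rw [definingProfile, smoothStep_of_ge hbc hw]
  ring

theorem definingProfile_pos (hw : a < w) : 0 < definingProfile a b c w := by
  have h2 := smoothStep_nonneg (a := b) (b := c) (w := w)
  have h3 := smoothStep_le_one (a := b) (b := c) (w := w)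
  rw [definingProfile]
  rcases h2.eq_or_lt with h | h
  · rw [← h]; linarith
  · have := mul_nonneg (sub_pos.2 hw).le (sub_nonneg.2 h3)
    linarith

theorem contDiff_definingProfile : ContDiff ℝ 2 (definingProfile a b c) := by
  have h := contDiff_smoothStep (a := b) (b := c)
  exact ((contDiff_id.sub contDiff_const).mul (contDiff_const.sub h)).add h

end Cutoff

/-! ### Conformal change by scaling the momenta -/

section Scaling

open scoped RealInnerProductSpace

variable {V : Type*} [NormedAddCommGroup V] [InnerProductSpace ℝ V] [CompleteSpace V]
  [FiniteDimensional ℝ V]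

/-- The Hamiltonian whose Jacobi-Finsler metrics are those of `H`, multiplied by `1 / μ`. -/
def scaledHamiltonian (H : V × V → ℝ) (μ : V → ℝ) (z : V × V) : ℝ := H (z.1, μ z.1 • z.2)

variable {H : V × V → ℝ} {μ : V → ℝ} {M : Set V} {q : V}

theorem differentiableAt_scaledHamiltonian {p : V} (hd : DifferentiableAt ℝ H (q, μ q • p))
    (hμ : DifferentiableAt ℝ μ q) : DifferentiableAt ℝ (scaledHamiltonian H μ) (q, p) := by
  have h1 : DifferentiableAt ℝ (fun z : V × V => μ z.1) (q, p) :=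
    DifferentiableAt.comp (g := μ) (f := Prod.fst) (q, p) hμ differentiableAt_fst
  exact DifferentiableAt.comp (g := H) (f := fun z : V × V => (z.1, μ z.1 • z.2)) (q, p) hd
    (differentiableAt_fst.prodMk (h1.smul differentiableAt_snd))

theorem fderiv_scaledHamiltonian {p : V} (hd : DifferentiableAt ℝ H (q, μ q • p))
    (hμ : DifferentiableAt ℝ μ q) (w : V × V) :
    fderiv ℝ (scaledHamiltonian H μ) (q, p) w = ⟪qGrad H (q, μ q • p), w.1⟫ +
      ⟪pGrad H (q, μ q • p), μ q • w.2 + fderiv ℝ μ q w.1 • p⟫ := by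
  have h1 : HasFDerivAt (fun z : V × V => μ z.1) (fderiv ℝ μ q ∘L .fst ℝ V V) (q, p) :=
    HasFDerivAt.comp (g := μ) (f := Prod.fst) (q, p) hμ.hasFDerivAt hasFDerivAt_fst
  have h2 : HasFDerivAt (scaledHamiltonian H μ) _ (q, p) :=
    HasFDerivAt.comp (g := H) (f := fun z : V × V => (z.1, μ z.1 • z.2)) (q, p)
      hd.hasFDerivAt (hasFDerivAt_fst.prodMk (h1.smul hasFDerivAt_snd))
  rw [h2.fderiv, ContinuousLinearMap.comp_apply, fderiv_eq_inner_add_inner hd]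
  simp

theorem pGrad_scaledHamiltonian {p : V} (hd : DifferentiableAt ℝ H (q, μ q • p))
    (hμ : DifferentiableAt ℝ μ q) :
    pGrad (scaledHamiltonian H μ) (q, p) = μ q • pGrad H (q, μ q • p) := by
  refine ext_inner_right ℝ fun w => ?_
  rw [inner_pGrad (differentiableAt_scaledHamiltonian hd hμ), fderiv_scaledHamiltonian hd hμ]
  simp [real_inner_smul_left, real_inner_smul_right]

theorem inner_qGrad_scaledHamiltonian {p : V} (hd : DifferentiableAt ℝ H (q, μ q • p))
    (hμ : DifferentiableAt ℝ μ q) (w : V) :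
    ⟪qGrad (scaledHamiltonian H μ) (q, p), w⟫ =
      ⟪qGrad H (q, μ q • p), w⟫ + fderiv ℝ μ q w * ⟪pGrad H (q, μ q • p), p⟫ := by
  rw [inner_qGrad (differentiableAt_scaledHamiltonian hd hμ), fderiv_scaledHamiltonian hd hμ]
  simp [real_inner_smul_right]

/-- The momentum Hessian of `H(q, μ p)` is `μ²` times that of `H` at `μ p`, so the convexity
constant `ν` becomes `μ² ν`. -/
theorem IsConvexHamiltonian.scaledHamiltonian (hC : IsConvexHamiltonian M H)
    (hμ : ∀ q ∈ M, ContDiffAt ℝ 2 μ q) (hμ0 : ∀ q ∈ M, 0 < μ q) :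
    IsConvexHamiltonian M (scaledHamiltonian H μ) where
  isOpen := hC.isOpen
  contDiffOn := by
    rintro ⟨q, p⟩ ⟨hq, -⟩
    have h1 : ContDiffAt ℝ 2 (fun z : V × V => μ z.1) (q, p) :=
      ContDiffAt.comp (g := μ) (f := Prod.fst) (q, p) (hμ q hq) contDiffAt_fst
    exact (ContDiffAt.comp (g := H) (f := fun z : V × V => (z.1, μ z.1 • z.2)) (q, p)
      (hC.contDiffAt hq _) (contDiffAt_fst.prodMk (h1.smul contDiffAt_snd))).contDiffWithinAt
  even := fun q hq p => by
    rw [BrakeOrbit.scaledHamiltonian, BrakeOrbit.scaledHamiltonian, smul_neg]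
    exact hC.even q hq _
  hessian := by
    obtain ⟨ν, h1, h2, h3⟩ := hC.hessian
    refine ⟨fun q => μ q ^ 2 * ν q, ?_, fun q hq => mul_pos (pow_pos (hμ0 q hq) 2) (h2 q hq),
      fun q hq p ξ => ?_⟩
    · exact (ContinuousOn.pow (fun q hq => (hμ q hq).continuousAt.continuousWithinAt) 2).mul h1
    · have hμd : DifferentiableAt ℝ μ q := (hμ q hq).differentiableAt two_ne_zero
      have e1 : ∀ p, pGrad (BrakeOrbit.scaledHamiltonian H μ) (q, p) = μ q • pGrad H (q, μ q • p) :=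
        fun p => pGrad_scaledHamiltonian (hC.differentiableAt hq _) hμd
      have hd : DifferentiableAt ℝ (pGrad (BrakeOrbit.scaledHamiltonian H μ)) (q, p) := by
        refine (BrakeOrbit.contDiffAt_pGrad ?_).differentiableAt one_ne_zero
        have h1 : ContDiffAt ℝ 2 (fun z : V × V => μ z.1) (q, p) :=
          ContDiffAt.comp (g := μ) (f := Prod.fst) (q, p) (hμ q hq) contDiffAt_fst
        exact ContDiffAt.comp (g := H) (f := fun z : V × V => (z.1, μ z.1 • z.2)) (q, p)
          (hC.contDiffAt hq _) (contDiffAt_fst.prodMk (h1.smul contDiffAt_snd))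
      have a1 : HasFDerivAt (fun p => pGrad (BrakeOrbit.scaledHamiltonian H μ) (q, p)) _ p :=
        HasFDerivAt.comp (g := pGrad (BrakeOrbit.scaledHamiltonian H μ)) (f := fun p => (q, p)) p
          hd.hasFDerivAt (hasFDerivAt_prodMk_right q p)
      have a2 : HasFDerivAt (fun p => μ q • pGrad H (q, μ q • p)) _ p :=
        (HasFDerivAt.comp (g := pGrad H) (f := fun p => (q, μ q • p)) p
          (hC.hasFDerivAt_pGrad hq (μ q • p)) ((hasFDerivAt_const q p).prodMk
            ((hasFDerivAt_id p).const_smul (μ q)))).const_smul (μ q)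
      simp only [e1] at a1
      have e2 := congrArg (fun A : V →L[ℝ] V => A ξ) (a1.unique a2)
      simp only [ContinuousLinearMap.comp_apply, ContinuousLinearMap.inr_apply,
        smul_apply, ContinuousLinearMap.prod_apply, zero_apply, ContinuousLinearMap.id_apply] at e2
      have e3 : ((0 : V), μ q • ξ) = μ q • ((0 : V), ξ) := by simp
      rw [e2, e3, map_smul, smul_smul, real_inner_smul_left, mul_assoc]
      have := mul_le_mul_of_nonneg_left (h3 q hq (μ q • p) ξ) (sq_nonneg (μ q))
      rwa [pow_two] at this ⊢

/-- Where the factor is locally `1`, scaling changes nothing. -/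
theorem grad_scaledHamiltonian_of_eventuallyEq_one (hH : Differentiable ℝ H) (h : μ =ᶠ[𝓝 q] 1)
    (p : V) : scaledHamiltonian H μ (q, p) = H (q, p) ∧
      pGrad (scaledHamiltonian H μ) (q, p) = pGrad H (q, p) ∧
      qGrad (scaledHamiltonian H μ) (q, p) = qGrad H (q, p) := by
  have h1 : μ q = 1 := h.eq_of_nhds
  have hd : DifferentiableAt ℝ μ q := (differentiableAt_const (1 : ℝ)).congr_of_eventuallyEq h
  have hf : fderiv ℝ μ q = 0 := by
    rw [h.fderiv_eq]
    exact fderiv_const_apply (1 : ℝ)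
  refine ⟨by rw [scaledHamiltonian, h1, one_smul], ?_, ?_⟩
  · rw [pGrad_scaledHamiltonian (hH _) hd, h1, one_smul, one_smul]
  · refine ext_inner_right ℝ fun w => ?_
    rw [inner_qGrad_scaledHamiltonian (hH _) hd, hf, h1, one_smul]
    simp

end Scaling

namespace CollarData

/-! ### The inner domain and the modified Hamiltonian -/

section Domain

open scoped RealInnerProductSpace

variable {V : Type*} [NormedAddCommGroup V] [InnerProductSpace ℝ V] [CompleteSpace V]
  [FiniteDimensional ℝ V] {H : V × V → ℝ} {E : ℝ} {D : Set V} (K : CollarData H E D)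

/-- The conformal factor, which is `1` away from the boundary. -/
noncomputable def factor (q : V) : ℝ := conformalFactor (K.δ₀ / 8) (K.δ₀ / 4) (K.ℓ q)

/-- The Hamiltonian of the conformally changed Jacobi-Finsler metric. -/
noncomputable def ham : V × V → ℝ := scaledHamiltonian H K.factor

/-- The domain of points with action larger than `δ₀ / 2`. -/
def inner : Set V := {q | q ∈ D ∧ K.δ₀ / 2 < K.ℓ q}

/-- A defining function of the inner domain. -/
noncomputable def defining (q : V) : ℝ :=
  definingProfile (K.δ₀ / 2) (5 * K.δ₀ / 8) (3 * K.δ₀ / 4) (K.ℓ q)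

variable {q : V}

theorem contDiffAt_factor (hq : q ∈ D) : ContDiffAt ℝ 2 K.factor q := by
  have h0 := K.action.pos
  exact K.contDiffAt_comp_action (δ := K.δ₀ / 4) (c := 1) (by linarith)
    (fun w hw => contDiffAt_conformalFactor hw)
    (fun w hw => conformalFactor_of_ge (by linarith) hw) hq

theorem factor_pos (hq : q ∈ D) : 0 < K.factor q := conformalFactor_pos (K.action.pos_of_mem q hq)

/-- The closure of the inner domain has action at least `δ₀ / 2`, so near it the metric is the
unmodified Jacobi-Finsler metric of `H`. -/
theorem factor_eventuallyEq_one (hq : q ∈ D) (hl : K.δ₀ / 4 < K.ℓ q) : K.factor =ᶠ[𝓝 q] 1 := by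
  have h0 := K.action.pos
  filter_upwards [(K.continuousAt_action hq).eventually (lt_mem_nhds hl)] with x hx
  exact conformalFactor_of_ge (by linarith) (le_of_lt hx)

theorem convex_ham : IsConvexHamiltonian D K.ham :=
  (K.convex.mono K.isOpen (subset_univ D)).scaledHamiltonian (fun _ hq => K.contDiffAt_factor hq)
    fun _ hq => K.factor_pos hq

theorem ham_lt : ∀ q ∈ D, K.ham (q, 0) < E := fun q hq => by
  rw [ham, scaledHamiltonian, smul_zero]
  exact K.lt_energy q hq

theorem ham_eq (hq : q ∈ D) (hl : K.δ₀ / 4 < K.ℓ q) (p : V) :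
    K.ham (q, p) = H (q, p) ∧ pGrad K.ham (q, p) = pGrad H (q, p) ∧
      qGrad K.ham (q, p) = qGrad H (q, p) :=
  grad_scaledHamiltonian_of_eventuallyEq_one (K.contDiff.differentiable two_ne_zero)
    (K.factor_eventuallyEq_one hq hl) p

theorem isOpen_inner : IsOpen K.inner := by
  rw [isOpen_iff_mem_nhds]
  rintro q ⟨hq, hl⟩
  filter_upwards [K.isOpen.mem_nhds hq, (K.continuousAt_action hq).eventually (lt_mem_nhds hl)]
    with x h1 h2 using ⟨h1, h2⟩

theorem mem_of_action_pos (hq : q ∈ closure D) (hl : 0 < K.ℓ q) : q ∈ D := by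
  rw [closure_eq_self_union_frontier] at hq
  refine hq.resolve_right fun h => ?_
  rw [K.action.eq_zero q h] at hl
  exact lt_irrefl _ hl

theorem contDiffAt_defining (hq : q ∈ D) : ContDiffAt ℝ 2 K.defining q := by
  have h0 := K.action.pos
  exact K.contDiffAt_comp_action (δ := 3 * K.δ₀ / 4) (c := 1) (by linarith)
    (fun w _ => contDiff_definingProfile.contDiffAt)
    (fun w hw => definingProfile_of_ge (by linarith) hw) hq

theorem defining_of_le (hl : K.ℓ q ≤ 5 * K.δ₀ / 8) : K.defining q = K.ℓ q - K.δ₀ / 2 := by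
  have h0 := K.action.pos
  exact definingProfile_of_le (by linarith) hl

theorem defining_pos_iff : K.δ₀ / 2 < K.ℓ q ↔ 0 < K.defining q := by
  have h0 := K.action.pos
  refine ⟨fun h => definingProfile_pos h, fun h => ?_⟩
  by_contra hle
  rw [K.defining_of_le (by linarith)] at h
  linarith

theorem hasFDerivAt_defining (hq : q ∈ D) (hl : K.ℓ q < 5 * K.δ₀ / 8) :
    HasFDerivAt K.defining (innerSL ℝ (K.mom q)) q := by
  have h0 := K.action.pos
  refine ((K.hasFDerivAt_action hq (by linarith)).sub_const (K.δ₀ / 2)).congr_of_eventuallyEq ?_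
  filter_upwards [(K.continuousAt_action hq).eventually (gt_mem_nhds hl)] with x hx
  exact K.defining_of_le (le_of_lt hx)

/-- A point at level exactly `δ₀ / 2` is a limit of inner points, because the action strictly
increases in the direction of its nonzero gradient `mom`. -/
theorem closure_inner : closure K.inner = {q | q ∈ D ∧ K.δ₀ / 2 ≤ K.ℓ q} := by
  have h0 := K.action.pos
  apply Subset.antisymm
  · have hcl : IsClosed (closure D ∩ K.ℓ ⁻¹' Ici (K.δ₀ / 2)) :=
      K.action.continuousOn.preimage_isClosed_of_isClosed isClosed_closure isClosed_Ici
    have h1 : closure K.inner ⊆ closure D ∩ K.ℓ ⁻¹' Ici (K.δ₀ / 2) :=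
      closure_minimal (fun q hq => ⟨subset_closure hq.1, hq.2.le⟩) hcl
    intro q hq
    have h2 := h1 hq
    have h3 : K.δ₀ / 2 ≤ K.ℓ q := h2.2
    exact ⟨K.mem_of_action_pos h2.1 (by linarith), h3⟩
  · rintro q ⟨hq, hl⟩
    rcases hl.lt_or_eq with h | h
    · exact subset_closure ⟨hq, h⟩
    · have hd := K.hasFDerivAt_defining hq (by linarith)
      have h1 := eventually_pos_line (e := K.mom q) hd.differentiableAt
        (by rw [K.defining_of_le (by linarith), ← h, sub_self]) (by
          rw [hd.fderiv, innerSL_apply_apply]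
          exact real_inner_self_pos.2 (K.mom_ne_zero hq (by linarith)))
      refine mem_closure_of_tendsto (tendsto_line q (K.mom q)) ?_
      filter_upwards [h1, (tendsto_line q (K.mom q)).eventually (K.isOpen.mem_nhds hq)] with s a b
      exact ⟨b, K.defining_pos_iff.2 a⟩

theorem frontier_inner : frontier K.inner = {q | q ∈ D ∧ K.ℓ q = K.δ₀ / 2} := by
  rw [K.isOpen_inner.frontier_eq, K.closure_inner]
  ext q
  constructor
  · rintro ⟨⟨hq, hl⟩, hn⟩
    exact ⟨hq, le_antisymm (not_lt.1 fun h => hn ⟨hq, h⟩) hl⟩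
  · rintro ⟨hq, hl⟩
    exact ⟨⟨hq, hl.ge⟩, fun h => h.2.ne' hl⟩

end Domain

/-! ### Regularity and strong concavity of the inner domain -/

section Boundary

open scoped RealInnerProductSpace

variable {n : ℕ} {H : EuclideanSpace ℝ (Fin n) × EuclideanSpace ℝ (Fin n) → ℝ} {E : ℝ}
  {D : Set (EuclideanSpace ℝ (Fin n))} (K : CollarData H E D) {q : EuclideanSpace ℝ (Fin n)}

theorem fderiv_defining (hq : q ∈ frontier K.inner) :
    fderiv ℝ K.defining q = innerSL ℝ (K.mom q) := by
  rw [K.frontier_inner] at hq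
  have h0 := K.action.pos
  exact (K.hasFDerivAt_defining hq.1 (by linarith [hq.2])).fderiv

theorem mom_ne_zero_of_frontier (hq : q ∈ frontier K.inner) : K.mom q ≠ 0 := by
  rw [K.frontier_inner] at hq
  have h0 := K.action.pos
  exact K.mom_ne_zero hq.1 (by linarith [hq.2])

theorem defining_eq_zero (hq : q ∈ frontier K.inner) : K.defining q = 0 := by
  rw [K.frontier_inner] at hq
  have h0 := K.action.pos
  rw [K.defining_of_le (by linarith [hq.2]), hq.2, sub_self]

theorem fderiv_defining_ne_zero (hq : q ∈ frontier K.inner) : fderiv ℝ K.defining q ≠ 0 := by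
  intro h
  have h1 := congrArg (fun A : EuclideanSpace ℝ (Fin n) →L[ℝ] ℝ => A (K.mom q)) h
  rw [K.fderiv_defining hq] at h1
  exact (real_inner_self_pos.2 (K.mom_ne_zero_of_frontier hq)).ne' h1

theorem isLocalDefining (hq : q ∈ frontier K.inner) :
    IsLocalDefining K.inner q K.defining := by
  have hq' := hq
  rw [K.frontier_inner] at hq'
  refine ⟨K.contDiffAt_defining hq'.1, K.defining_eq_zero hq, K.fderiv_defining_ne_zero hq, ?_⟩
  filter_upwards [K.isOpen.mem_nhds hq'.1] with x hx
  exact ⟨fun h => K.defining_pos_iff.1 h.2, fun h => ⟨hx, K.defining_pos_iff.2 h⟩⟩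

theorem hasC2Boundary : HasC2Boundary K.inner := fun _ hq => ⟨_, K.isLocalDefining hq⟩

/-- Local defining functions are positive on the same side. If `v` were not orthogonal to `mom q`,
then `v` or `-v` would have positive derivative under each of them. -/
theorem mem_boundaryTangent (hq : q ∈ frontier K.inner) {v : EuclideanSpace ℝ (Fin n)} :
    v ∈ boundaryTangent K.inner q ↔ ⟪K.mom q, v⟫ = 0 := by
  have h1 := K.isLocalDefining hq
  have hfd : fderiv ℝ K.defining q v = ⟪K.mom q, v⟫ := by
    rw [K.fderiv_defining hq]; rfl
  constructor
  · rintro ⟨ψ, h2, h3⟩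
    have key : ∀ w, 0 < fderiv ℝ K.defining q w → 0 < fderiv ℝ ψ q w := fun w hw =>
      fderiv_pos_of_imp (h1.contDiffAt.differentiableAt two_ne_zero)
        (h2.contDiffAt.differentiableAt two_ne_zero) h1.eq_zero h2.eq_zero h2.fderiv_ne_zero
        (by
          filter_upwards [h1.mem_iff, h2.mem_iff] with x a b h
          exact b.1 (a.2 h)) hw
    rw [← hfd]
    rcases lt_trichotomy (fderiv ℝ K.defining q v) 0 with h | h | h
    · have := key (-v) (by rw [map_neg]; linarith)
      rw [map_neg, h3, neg_zero] at this
      exact absurd this (lt_irrefl _)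
    · exact h
    · have := key v h
      rw [h3] at this
      exact absurd this (lt_irrefl _)
  · exact fun h => ⟨_, h1, hfd.trans h⟩

/-- Near `s = 0` the curve is an orbit of `H` run at rate `r`, and the first derivative is `r ⟪mom,
∂H/∂p⟫`. At `s = 0` the inner product vanishes by tangency, so the derivative of `r` drops out, and
the second derivative is `r²` times the quantity that the collar makes positive. -/
theorem iteratedDeriv_defining_pos (hq : q ∈ frontier K.inner) {v : EuclideanSpace ℝ (Fin n)}
    (hv : ⟪K.mom q, v⟫ = 0) {ε : ℝ} (hε : 0 < ε) {γ : ℝ → EuclideanSpace ℝ (Fin n)}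
    (hγ : IsGeodesicOn D (jacobiMetric K.ham E) γ (Ioo (-ε) ε)) (hγ0 : γ 0 = q)
    (hγ' : deriv γ 0 = v) : 0 < iteratedDeriv 2 (K.defining ∘ γ) 0 := by
  have hδ := K.action.pos
  have hq' := hq
  rw [K.frontier_inner] at hq'
  obtain ⟨hqD, hql⟩ := hq'
  have h0 : (0 : ℝ) ∈ Ioo (-ε) ε := ⟨by linarith, hε⟩
  have hJ := hγ.isJacobiOrbit K.convex_ham K.ham_lt isOpen_Ioo.uniqueDiffOn (convex_Ioo _ _) h0
  have hc : 0 < jacobiMetric K.ham E (γ 0) (derivWithin γ (Ioo (-ε) ε) 0) :=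
    K.convex_ham.jacobiMetric_pos K.ham_lt (hγ.mapsTo h0) (hγ.velocity_ne_zero 0 h0)
  set c := jacobiMetric K.ham E (γ 0) (derivWithin γ (Ioo (-ε) ε) 0)
  set y := fun s => jacobiMomentum K.ham E (γ s) (derivWithin γ (Ioo (-ε) ε) s) with hy
  set r := fun s => jacobiRate K.ham c (γ s, y s) with hr
  have hd : ∀ s ∈ Ioo (-ε) ε, HasDerivAt (fun s => (γ s, y s))
      (jacobiField K.ham c (γ s, y s)) s := fun s hs =>
    (hJ.hasDerivWithinAt s hs).hasDerivAt (isOpen_Ioo.mem_nhds hs)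
  have hγc : ContinuousAt γ 0 := (hd 0 h0).continuousAt.fst
  have hlc : ContinuousAt (fun s => K.ℓ (γ s)) 0 :=
    ContinuousAt.comp (g := K.ℓ) (f := γ) (K.continuousAt_action (hγ.mapsTo h0)) hγc
  have hl0 : K.ℓ (γ 0) = K.δ₀ / 2 := by rw [hγ0, hql]
  have hev : ∀ᶠ s in 𝓝 (0 : ℝ), s ∈ Ioo (-ε) ε ∧ K.ℓ (γ s) ∈ Ioo (K.δ₀ / 4) (5 * K.δ₀ / 8) :=
    Eventually.and (isOpen_Ioo.mem_nhds h0) (hlc.eventually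
      (Ioo_mem_nhds (by simp only [hl0]; linarith) (by simp only [hl0]; linarith)))
  have hder1 : ∀ s ∈ Ioo (-ε) ε, K.ℓ (γ s) ∈ Ioo (K.δ₀ / 4) (5 * K.δ₀ / 8) →
      HasDerivAt (K.defining ∘ γ) (r s * ⟪K.mom (γ s), pGrad H (γ s, y s)⟫) s := by
    intro s hs hls
    have h1 := (K.hasFDerivAt_defining (hγ.mapsTo hs) hls.2).comp_hasDerivAt s (hd s hs).fst
    refine h1.congr_deriv ?_
    simp only [jacobiField]
    rw [(K.ham_eq (hγ.mapsTo hs) hls.1 _).2.1, innerSL_apply_apply, real_inner_smul_right]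
  have hderiv : deriv (K.defining ∘ γ) =ᶠ[𝓝 0]
      fun s => r s * ⟪K.mom (γ s), pGrad H (γ s, y s)⟫ :=
    hev.mono fun s hs => (hder1 s hs.1 hs.2).deriv
  have hm0 := hev.self_of_nhds
  obtain ⟨e1, e2, e3⟩ := K.ham_eq (hγ.mapsTo h0) hm0.2.1 (y 0)
  have hmom := hJ.isJacobiMomentum K.convex_ham K.ham_lt hc h0
  have hen : H (γ 0, y 0) = E := e1.symm.trans (hJ.energy 0 h0)
  have hr0 : 0 < r 0 := hmom.1
  set ξ := pGrad H (γ 0, y 0) with hξ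
  have hort : ⟪K.mom (γ 0), ξ⟫ = 0 := by
    have h1 : v = r 0 • ξ := by
      have h2 : HasDerivAt γ (jacobiField K.ham c (γ 0, y 0)).1 0 := (hd 0 h0).fst
      rw [← hγ', h2.deriv, ← e2]
      rfl
    rw [h1, real_inner_smul_right, ← hγ0] at hv
    exact (mul_eq_zero.1 hv).resolve_left hr0.ne'
  have hz0 : HasDerivAt (fun s => (γ s, y s)) (r 0 • ξ, r 0 • -qGrad H (γ 0, y 0)) 0 := by
    refine (hd 0 h0).congr_deriv ?_
    rw [jacobiField, e2, e3, smul_neg]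
  have hrd : DifferentiableAt ℝ r 0 :=
    DifferentiableAt.comp (g := jacobiRate K.ham c) (f := fun s => (γ s, y s)) 0
      ((K.convex_ham.contDiffAt_jacobiRate (z := (γ 0, y 0)) (hγ.mapsTo h0)
        (IsConvexHamiltonian.ne_zero_of_energy_eq K.ham_lt (hγ.mapsTo h0) (hJ.energy 0 h0))
        c).differentiableAt one_ne_zero) (hd 0 h0).differentiableAt
  have hlt : K.ℓ (γ 0) < K.δ₀ := by linarith
  have hm : HasDerivAt (fun s => K.mom (γ s)) (fderiv ℝ K.mom (γ 0) (r 0 • ξ)) 0 :=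
    ((K.contDiffAt_mom (hγ.mapsTo h0) hlt).differentiableAt one_ne_zero).hasFDerivAt.comp_hasDerivAt
      0 hz0.fst
  have hp : HasDerivAt (fun s => pGrad H (γ s, y s))
      (fderiv ℝ (pGrad H) (γ 0, y 0) (r 0 • ξ, r 0 • -qGrad H (γ 0, y 0))) 0 :=
    HasFDerivAt.comp_hasDerivAt (l := pGrad H) (f := fun s => (γ s, y s)) 0
      (K.convex.hasFDerivAt_pGrad (mem_univ _) _) hz0
  have htot := hrd.hasDerivAt.mul (hm.inner ℝ hp)
  have hconc := K.concave (hγ.mapsTo h0) hlt hen hort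
  have hval : iteratedDeriv 2 (K.defining ∘ γ) 0 = r 0 * (r 0 *
      (⟪fderiv ℝ K.mom (γ 0) ξ, ξ⟫ +
        ⟪K.mom (γ 0), fderiv ℝ (pGrad H) (γ 0, y 0) (ξ, -qGrad H (γ 0, y 0))⟫)) := by
    rw [iteratedDeriv_succ, iteratedDeriv_one, hderiv.deriv_eq]
    refine (HasDerivAt.deriv (f := fun s => r s * ⟪K.mom (γ s), pGrad H (γ s, y s)⟫) htot).trans ?_
    have e4 : (r 0 • ξ, r 0 • -qGrad H (γ 0, y 0)) = r 0 • (ξ, -qGrad H (γ 0, y 0)) := by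
      simp
    rw [hort, mul_zero, zero_add, e4, map_smul, map_smul, real_inner_smul_left,
      real_inner_smul_right]
    ring
  rw [hval]
  exact mul_pos hr0 (mul_pos hr0 hconc)

theorem isStronglyConcave : IsStronglyConcave D (jacobiMetric K.ham E) K.inner := by
  refine ⟨K.defining, fun q hq => (K.contDiffAt_defining hq).contDiffWithinAt,
    fun q hq => K.defining_pos_iff.1 hq.2,
    fun q hq => ⟨K.defining_eq_zero hq, K.fderiv_defining_ne_zero hq⟩, fun q hq v hv hv0 => ?_⟩
  have hqD : q ∈ D := by
    rw [K.frontier_inner] at hq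
    exact hq.1
  refine ⟨?_, fun ε hε γ hγ hγ0 hγ' =>
    K.iteratedDeriv_defining_pos hq ((K.mem_boundaryTangent hq).1 hv) hε hγ hγ0 hγ'⟩
  have hmom := K.convex_ham.isJacobiMomentum K.ham_lt hqD hv0
  have hc := K.convex_ham.jacobiMetric_pos K.ham_lt hqD hv0
  have hpos := K.convex_ham.inner_pGrad_self_pos hqD
    (IsConvexHamiltonian.ne_zero_of_energy_eq K.ham_lt hqD hmom.2.1)
  -- Taking the metric length of `v` as speed makes the initial velocity equal to `v` itself.
  obtain ⟨ε, hε, γ, y, hJ, hγ0, hy0⟩ := K.convex_ham.exists_isJacobiOrbit K.ham_lt hqD hmom.2.1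
    (jacobiMetric K.ham E q v)
  have h0 : (0 : ℝ) ∈ Ioo (-ε) ε := ⟨by linarith, hε⟩
  refine ⟨ε, hε, γ, hJ.isGeodesicOn K.convex_ham K.ham_lt hc isOpen_Ioo.uniqueDiffOn, hγ0, ?_⟩
  rw [((hJ.hasDerivWithinAt_fst h0).hasDerivAt (isOpen_Ioo.mem_nhds h0)).deriv, hγ0, hy0,
    jacobiRate, K.convex_ham.jacobiMetric_eq K.ham_lt hqD hv0, mul_div_cancel_right₀ _ hpos.ne']
  exact hmom.2.2.symm

end Boundary

end CollarData

namespace CollarData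

/-! ### Stretching the collar -/

section Homeomorphism

variable {V : Type*} [NormedAddCommGroup V] [InnerProductSpace ℝ V] [CompleteSpace V]
  [FiniteDimensional ℝ V] {H : V × V → ℝ} {E : ℝ} {D : Set V} (K : CollarData H E D)

theorem flow_mem_closure {t : ℝ} (ht : t ∈ Ico 0 K.t₀) {x : V}
    (hx : x ∈ frontier D) : K.Q t x ∈ closure D := by
  rcases ht.1.eq_or_lt with h | h
  · rw [← h, (K.flow.zero x).1]
    exact frontier_subset_closure hx
  · exact subset_closure (K.collar.apply_mem_domain t ⟨h, ht.2⟩ x hx)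

theorem action_flow {t : ℝ} (ht : t ∈ Ico 0 K.t₀) {x : V} (hx : x ∈ frontier D)
    (hl : K.ℓ (K.Q t x) < K.δ₀) : K.ℓ (K.Q t x) = brakeAction H K.Q K.P t x := by
  have h := (K.action.mem _ (K.flow_mem_closure ht hx) hl).2
  rwa [(K.collar.apply_mem t ht x hx).2.1, (K.collar.apply_mem t ht x hx).2.2] at h

open Classical in
/-- The point of action `u.1` on the brake orbit that starts from `u.2`. -/
noncomputable def atLevel (u : ℝ × V) : V :=
  if h : ∃ t ∈ Ico 0 K.t₀, K.ℓ (K.Q t u.2) = u.1 then K.Q h.choose u.2 else u.2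

theorem exists_atLevel_eq {s : ℝ} (hs : s ∈ Ico 0 K.δ₀) {x : V} (hx : x ∈ frontier D) :
    ∃ t ∈ Ico 0 K.t₀, K.ℓ (K.Q t x) = s ∧ K.atLevel (s, x) = K.Q t x := by
  have h := K.action.exists_time x hx s hs
  refine ⟨h.choose, h.choose_spec.1, h.choose_spec.2, ?_⟩
  rw [atLevel, dif_pos h]

theorem atLevel_spec {s : ℝ} (hs : s ∈ Ico 0 K.δ₀) {x : V} (hx : x ∈ frontier D) :
    K.atLevel (s, x) ∈ closure D ∧ K.ℓ (K.atLevel (s, x)) = s ∧ K.ft (K.atLevel (s, x)) = x := by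
  obtain ⟨t, ht, h1, h2⟩ := K.exists_atLevel_eq hs hx
  rw [h2]
  exact ⟨K.flow_mem_closure ht hx, h1, (K.collar.apply_mem t ht x hx).2.2⟩

theorem collar_of_lt {q : V} (hq : q ∈ closure D) (hl : K.ℓ q < K.δ₀) :
    K.tm q ∈ Ico 0 K.t₀ ∧ K.ft q ∈ frontier D ∧ K.Q (K.tm q) (K.ft q) = q :=
  K.collar.mem q ⟨(K.action.mem q hq hl).1, hq⟩

theorem atLevel_action_foot {q : V} (hq : q ∈ closure D) (hl : K.ℓ q < K.δ₀) :
    K.atLevel (K.ℓ q, K.ft q) = q := by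
  obtain ⟨h1, h2, h3⟩ := K.collar_of_lt hq hl
  obtain ⟨t, ht, h4, h5⟩ := K.exists_atLevel_eq ⟨K.action.nonneg q hq, hl⟩ h2
  have h6 := K.action_flow ht h2 (h4 ▸ hl)
  have h7 := (K.action.mem q hq hl).2
  have h8 := (K.collar.strictMonoOn_action K.flow K.contDiff K.convex K.frontier_subset K.lt_energy
    K.eq_energy h2).injOn ht h1 (h6.symm.trans (h4.trans h7))
  rw [h5, h8, h3]

theorem isClosed_action_le (a : ℝ) : IsClosed {q | q ∈ closure D ∧ K.ℓ q ≤ a} :=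
  K.action.continuousOn.preimage_isClosed_of_isClosed isClosed_closure isClosed_Iic

theorem continuousOn_action_foot {δ : ℝ} (hδ : δ < K.δ₀) :
    ContinuousOn (fun q => (K.ℓ q, K.ft q)) {q | q ∈ closure D ∧ K.ℓ q ≤ δ} :=
  (K.action.continuousOn.mono fun _ h => h.1).prodMk (K.collar.continuousOn_foot.mono fun _ h =>
    (K.action.mem _ h.1 (h.2.trans_lt hδ)).1)

/-- On this set it inverts the continuous map `q ↦ (ℓ q, ft q)` of a compact set, so preimages of
closed sets are images of compact sets. -/
theorem continuousOn_atLevel {δ : ℝ} (hδ : δ < K.δ₀) :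
    ContinuousOn K.atLevel (Icc 0 δ ×ˢ frontier D) := by
  rw [continuousOn_iff_isClosed]
  intro C hC
  have hN : IsCompact ({q | q ∈ closure D ∧ K.ℓ q ≤ δ} ∩ C) :=
    (K.isCompact.of_isClosed_subset (K.isClosed_action_le δ) fun _ h => h.1).inter_right hC
  refine ⟨(fun q => (K.ℓ q, K.ft q)) '' ({q | q ∈ closure D ∧ K.ℓ q ≤ δ} ∩ C),
    (hN.image_of_continuousOn
      ((K.continuousOn_action_foot hδ).mono inter_subset_left)).isClosed, ?_⟩
  ext ⟨s, x⟩
  refine and_congr_left fun h => ?_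
  obtain ⟨h1, h2, h3⟩ := K.atLevel_spec ⟨h.1.1, h.1.2.trans_lt hδ⟩ h.2
  constructor
  · exact fun hC' => ⟨_, ⟨⟨h1, h2.trans_le h.1.2⟩, hC'⟩, Prod.ext h2 h3⟩
  · rintro ⟨q, ⟨hq, hqC⟩, hqe⟩
    rw [mem_preimage, ← hqe, K.atLevel_action_foot hq.1 (hq.2.trans_lt hδ)]
    exact hqC

open Classical in
/-- Change the action by `φ` along the brake orbits, where it is at most `δ`. -/
noncomputable def push (δ : ℝ) (φ : ℝ → ℝ) (q : V) : V :=
  if K.ℓ q ≤ δ then K.atLevel (φ (K.ℓ q), K.ft q) else q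

variable {δ a : ℝ} {φ : ℝ → ℝ}

theorem continuousOn_push (hδ : δ < K.δ₀) (hφ : Continuous φ) (hφδ : φ δ = δ)
    (hmaps : MapsTo φ (Icc a δ) (Icc 0 δ)) :
    ContinuousOn (K.push δ φ) {q | q ∈ closure D ∧ a ≤ K.ℓ q} := by
  rw [continuousOn_iff_continuous_domRestrict]
  have hl : Continuous fun q : {q | q ∈ closure D ∧ a ≤ K.ℓ q} => K.ℓ q :=
    continuousOn_iff_continuous_domRestrict.1 (K.action.continuousOn.mono fun _ h => h.1)
  refine continuous_if_le hl continuous_const ?_ continuous_subtype_val.continuousOn ?_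
  · refine ContinuousOn.comp (g := K.atLevel)
      (f := fun q : {q | q ∈ closure D ∧ a ≤ K.ℓ q} => (φ (K.ℓ q), K.ft q))
      (K.continuousOn_atLevel hδ) ((hφ.comp hl).continuousOn.prodMk ?_) ?_
    · exact ContinuousOn.comp (g := K.ft) K.collar.continuousOn_foot
        continuous_subtype_val.continuousOn
        fun q hq => (K.action.mem _ q.2.1 (lt_of_le_of_lt hq hδ)).1
    · exact fun q hq => ⟨hmaps ⟨q.2.2, hq⟩, (K.collar_of_lt q.2.1 (lt_of_le_of_lt hq hδ)).2.1⟩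
  · intro q hq
    have h := K.atLevel_action_foot q.2.1 (hq.trans_lt hδ)
    rw [hq] at h
    simp only [hq, hφδ, h]

theorem push_spec (hδ : δ < K.δ₀) (hmaps : MapsTo φ (Icc a δ) (Icc 0 δ)) {q : V}
    (hq : q ∈ closure D) (hl : K.ℓ q ∈ Icc a δ) :
    K.push δ φ q ∈ closure D ∧ K.ℓ (K.push δ φ q) = φ (K.ℓ q) ∧ K.ft (K.push δ φ q) = K.ft q := by
  rw [push, if_pos hl.2]
  have h := hmaps hl
  exact K.atLevel_spec ⟨h.1, h.2.trans_lt hδ⟩ (K.collar_of_lt hq (hl.2.trans_lt hδ)).2.1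

theorem push_push {ψ : ℝ → ℝ} (hδ : δ < K.δ₀) (hmaps : MapsTo φ (Icc a δ) (Icc 0 δ))
    (hinv : ∀ s, ψ (φ s) = s) {q : V} (hq : q ∈ closure D) (hl : a ≤ K.ℓ q) :
    K.push δ ψ (K.push δ φ q) = q := by
  by_cases h : K.ℓ q ≤ δ
  · obtain ⟨h1, h2, h3⟩ := K.push_spec hδ hmaps hq ⟨hl, h⟩
    have h4 : K.ℓ (K.push δ φ q) ≤ δ := by
      rw [h2]
      exact (hmaps ⟨hl, h⟩).2
    rw [push, if_pos h4, h2, h3, hinv, K.atLevel_action_foot hq (h.trans_lt hδ)]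
  · have h1 : K.push δ φ q = q := by rw [push, if_neg h]
    rw [h1, push, if_neg h]

theorem mapsTo_push {b : ℝ} (hδ : δ < K.δ₀) (hb : b ≤ δ)
    (hmaps : MapsTo φ (Icc a δ) (Icc b δ)) (hb0 : 0 ≤ b) :
    MapsTo (K.push δ φ) {q | q ∈ closure D ∧ a ≤ K.ℓ q} {q | q ∈ closure D ∧ b ≤ K.ℓ q} := by
  rintro q ⟨hq, hl⟩
  by_cases h : K.ℓ q ≤ δ
  · obtain ⟨h1, h2, -⟩ := K.push_spec (φ := φ) hδ
      (hmaps.mono_right (Icc_subset_Icc_left hb0)) hq ⟨hl, h⟩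
    refine ⟨h1, ?_⟩
    rw [h2]
    exact (hmaps ⟨hl, h⟩).1
  · rw [push, if_neg h]
    exact ⟨hq, hb.trans (not_le.1 h).le⟩

/-- The affine map `φ` takes the action interval `[δ₀ / 2, 3 δ₀ / 4]` onto `[0, 3 δ₀ / 4]` and fixes
the right end. Pushing along the brake orbits therefore glues with the identity on larger actions,
and `ψ = φ⁻¹` gives the inverse. -/
theorem nonempty_homeomorph : Nonempty (closure K.inner ≃ₜ closure D) := by
  have h0 := K.action.pos
  have e1 : closure K.inner = {q | q ∈ closure D ∧ K.δ₀ / 2 ≤ K.ℓ q} := by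
    rw [K.closure_inner]
    ext q
    exact ⟨fun h => ⟨subset_closure h.1, h.2⟩, fun h =>
      ⟨K.mem_of_action_pos h.1 (by linarith [h.2]), h.2⟩⟩
  have e2 : closure D = {q | q ∈ closure D ∧ 0 ≤ K.ℓ q} := by
    ext q
    exact ⟨fun h => ⟨h, K.action.nonneg q h⟩, fun h => h.1⟩
  set δ := 3 * K.δ₀ / 4 with hδ
  set φ : ℝ → ℝ := fun s => 3 * (s - K.δ₀ / 2) with hφ
  set ψ : ℝ → ℝ := fun s => K.δ₀ / 2 + s / 3 with hψ
  have hδ0 : δ < K.δ₀ := by linarith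
  have m1 : MapsTo φ (Icc (K.δ₀ / 2) δ) (Icc 0 δ) := fun s hs => by
    simp only [hφ, mem_Icc] at hs ⊢
    constructor <;> linarith [hs.1, hs.2]
  have m2 : MapsTo ψ (Icc 0 δ) (Icc (K.δ₀ / 2) δ) := fun s hs => by
    simp only [hψ, mem_Icc] at hs ⊢
    constructor <;> linarith [hs.1, hs.2]
  have m3 : MapsTo ψ (Icc 0 δ) (Icc 0 δ) := m2.mono_right (Icc_subset_Icc_left (by linarith))
  have M1 := K.mapsTo_push hδ0 (by linarith) m1 le_rfl
  have M2 := K.mapsTo_push hδ0 (by linarith) m2 (by linarith)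
  have hφψ : ∀ s, φ (ψ s) = s := fun s => by simp only [hφ, hψ]; ring
  have hψφ : ∀ s, ψ (φ s) = s := fun s => by simp only [hφ, hψ]; ring
  rw [e1]
  refine ⟨Homeomorph.trans ?_ (Homeomorph.setCongr e2).symm⟩
  exact {
    toFun := M1.restrict
    invFun := M2.restrict
    left_inv := fun q => Subtype.ext (K.push_push hδ0 m1 hψφ q.2.1 q.2.2)
    right_inv := fun q => Subtype.ext (K.push_push hδ0 m3 hφψ q.2.1 q.2.2)
    continuous_toFun := (K.continuousOn_push hδ0 (by fun_prop)
      (by simp only [hφ]; linarith) m1).mapsToRestrict M1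
    continuous_invFun := (K.continuousOn_push hδ0 (by fun_prop)
      (by simp only [hψ]; linarith) m3).mapsToRestrict M2 }

end Homeomorphism

end CollarData

/-! ### Changes of time and concatenation of solutions -/

section TimeChange

/-- A positive continuous function on an interval is the derivative of a change of time. -/
theorem exists_orderIso_hasDerivAt {g : ℝ → ℝ} {a b : ℝ} (hab : a ≤ b)
    (hg : ContinuousOn g (Icc a b)) (hpos : ∀ t ∈ Icc a b, 0 < g t) (t₁ s₁ : ℝ) :
    ∃ e : ℝ ≃o ℝ, e t₁ = s₁ ∧ (∀ t ∈ Icc a b, HasDerivAt e (g t) t) ∧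
      ∀ t ∈ Icc a b, HasDerivAt e.symm (g t)⁻¹ (e t) := by
  obtain ⟨m, hmem, hmin⟩ := isCompact_Icc.exists_isMinOn (nonempty_Icc.2 hab) hg
  -- The extension by constants stays above the positive minimum of `g`, so its primitive grows at
  -- least linearly and is a bijection of `ℝ`.
  set f : ℝ → ℝ := IccExtend hab ((Icc a b).domRestrict g) with hf
  have hfc : Continuous f := (continuousOn_iff_continuous_domRestrict.1 hg).Icc_extend'
  have hfg : ∀ t ∈ Icc a b, f t = g t := fun t ht => IccExtend_of_mem hab _ ht
  have hm : ∀ t, g m ≤ f t := fun t => hmin (projIcc a b hab t).2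
  have hm0 : 0 < g m := hpos m hmem
  set G : ℝ → ℝ := fun t => s₁ + ∫ r in t₁..t, f r with hG
  have hd : ∀ t, HasDerivAt G (f t) t := fun t =>
    (intervalIntegral.integral_hasDerivAt_right (hfc.intervalIntegrable _ _)
      (hfc.stronglyMeasurableAtFilter _ _) hfc.continuousAt).const_add s₁
  have hmono : StrictMono G := strictMono_of_deriv_pos fun t => by
    rw [(hd t).deriv]
    exact hm0.trans_le (hm t)
  have hlow : Monotone fun t => G t - g m * t := by
    have hd' : ∀ t, HasDerivAt (fun t => G t - g m * t) (f t - g m * 1) t := fun t =>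
      (hd t).sub ((hasDerivAt_id t).const_mul _)
    refine monotone_of_deriv_nonneg (fun t => (hd' t).differentiableAt) fun t => ?_
    rw [(hd' t).deriv]
    linarith [hm t]
  have hcont : Continuous G := continuous_iff_continuousAt.2 fun t => (hd t).continuousAt
  have hsurj : Function.Surjective G := by
    refine hcont.surjective ?_ ?_
    · refine tendsto_atTop_mono' _ ?_ (tendsto_atTop_add_const_right atTop (G 0 - g m * 0)
        (tendsto_id.const_mul_atTop hm0))
      filter_upwards [eventually_ge_atTop 0] with t ht
      have := hlow ht
      simp only [id] at this ⊢
      linarith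
    · refine tendsto_atBot_mono' _ ?_ (tendsto_atBot_add_const_right atBot (G 0 - g m * 0)
        (tendsto_id.const_mul_atBot hm0))
      filter_upwards [eventually_le_atBot 0] with t ht
      have := hlow ht
      simp only [id] at this ⊢
      linarith
  set e := hmono.orderIsoOfSurjective G hsurj with he
  have heG : ∀ t, e t = G t := fun t => rfl
  have hed : ∀ t ∈ Icc a b, HasDerivAt e (g t) t := fun t ht => hfg t ht ▸ hd t
  refine ⟨e, ?_, hed, fun t ht => ?_⟩
  · rw [heG, hG]
    simp
  · refine HasDerivAt.of_local_left_inverse e.toHomeomorph.symm.continuous.continuousAt ?_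
      (hpos t ht).ne' (Eventually.of_forall e.apply_symm_apply)
    have h1 : e.symm (e t) = t := e.symm_apply_apply t
    change HasDerivAt e (g t) (e.symm (e t))
    rw [h1]
    exact hed t ht

/-- Two solutions of an autonomous differential equation can be joined. -/
theorem hasDerivWithinAt_ite {X : Type*} [NormedAddCommGroup X] [NormedSpace ℝ X] {f : X → X}
    {z₁ z₂ : ℝ → X} {a b c : ℝ} (hab : a ≤ b) (hbc : b ≤ c)
    (h₁ : ∀ t ∈ Icc a b, HasDerivWithinAt z₁ (f (z₁ t)) (Icc a b) t)
    (h₂ : ∀ t ∈ Icc b c, HasDerivWithinAt z₂ (f (z₂ t)) (Icc b c) t) (hb : z₁ b = z₂ b) :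
    ∀ t ∈ Icc a c, HasDerivWithinAt (fun t => if t ≤ b then z₁ t else z₂ t)
      (f (if t ≤ b then z₁ t else z₂ t)) (Icc a c) t := by
  set z := fun t => if t ≤ b then z₁ t else z₂ t with hz
  have e₁ : ∀ t ≤ b, z t = z₁ t := fun t ht => if_pos ht
  have e₂ : ∀ t, b ≤ t → z t = z₂ t := fun t ht => by
    rcases ht.eq_or_lt with h | h
    · rw [← h, e₁ b le_rfl, hb]
    · exact if_neg (not_le.2 h)
  have d₁ : ∀ t ∈ Icc a b, HasDerivWithinAt z (f (z t)) (Icc a b) t := fun t ht => by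
    rw [e₁ t ht.2]
    exact (h₁ t ht).congr (fun r hr => e₁ r hr.2) (e₁ t ht.2)
  have d₂ : ∀ t ∈ Icc b c, HasDerivWithinAt z (f (z t)) (Icc b c) t := fun t ht => by
    rw [e₂ t ht.1]
    exact (h₂ t ht).congr (fun r hr => e₂ r hr.1) (e₂ t ht.1)
  intro t ht
  change HasDerivWithinAt z (f (z t)) (Icc a c) t
  rcases lt_trichotomy t b with h | h | h
  · refine (d₁ t ⟨ht.1, h.le⟩).mono_of_mem_nhdsWithin ?_
    filter_upwards [self_mem_nhdsWithin, mem_nhdsWithin_of_mem_nhds (Iio_mem_nhds h)]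
      with r hr hr' using ⟨hr.1, le_of_lt hr'⟩
  · rw [← Icc_union_Icc_eq_Icc hab hbc]
    exact (d₁ t ⟨ht.1, h.le⟩).union (d₂ t ⟨h.ge, ht.2⟩)
  · refine (d₂ t ⟨h.le, ht.2⟩).mono_of_mem_nhdsWithin ?_
    filter_upwards [self_mem_nhdsWithin, mem_nhdsWithin_of_mem_nhds (Ioi_mem_nhds h)]
      with r hr hr' using ⟨le_of_lt hr', hr.2⟩

end TimeChange

namespace CollarData

/-! ### The limit of the metric speed at the boundary -/

section Speed

open scoped RealInnerProductSpace

variable {V : Type*} [NormedAddCommGroup V] [InnerProductSpace ℝ V] [CompleteSpace V]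
  [FiniteDimensional ℝ V] {H : V × V → ℝ} {E : ℝ} {D : Set V} (K : CollarData H E D)

/-- The Jacobi-Finsler speed of a Hamiltonian orbit. -/
noncomputable def speed (z : V × V) : ℝ := ⟪z.2, pGrad H z⟫ / K.factor z.1

variable {x : V} {t : ℝ}

/-- The collar identifies `ℓ` with the action only where `ℓ < δ₀`, whereas here the action is small.
Some time `t'` realizes its value as a value of `ℓ`, and strict monotonicity of the action gives `t'
= t`. -/
theorem action_flow_of_lt (ht : t ∈ Ico 0 K.t₀) (hx : x ∈ frontier D)
    (hl : brakeAction H K.Q K.P t x < K.δ₀) : K.ℓ (K.Q t x) = brakeAction H K.Q K.P t x := by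
  have hmono := K.collar.strictMonoOn_action K.flow K.contDiff K.convex K.frontier_subset
    K.lt_energy K.eq_energy hx
  have h0 : 0 ≤ brakeAction H K.Q K.P t x := by
    have := hmono.monotoneOn ⟨le_rfl, K.collar.pos⟩ ht ht.1
    simpa only [brakeAction_zero] using this
  obtain ⟨t', ht', h1⟩ := K.action.exists_time x hx _ ⟨h0, hl⟩
  have h2 := K.action_flow ht' hx (h1 ▸ hl)
  rw [h2] at h1
  rw [← hmono.injOn ht' ht h1]
  exact h2

/-- Momentum and velocity both grow linearly from rest, at the rates `restForce` and `restAccel`. -/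
theorem tendsto_inv_sq_mul (hx : x ∈ frontier D) :
    Tendsto (fun t => ⟪K.P t x, pGrad H (K.Q t x, K.P t x)⟫ / t ^ 2) (𝓝[>] 0)
      (𝓝 ⟪restForce H x, restAccel H x⟫) := by
  have hl : Tendsto (fun t : ℝ => (t, x)) (𝓝[>] 0) (𝓝[{u : ℝ × V | u.1 ≠ 0}] (0, x)) := by
    refine tendsto_nhdsWithin_iff.2 ⟨?_, ?_⟩
    · exact tendsto_nhdsWithin_of_tendsto_nhds
        (Continuous.tendsto' (by fun_prop) (0 : ℝ) ((0 : ℝ), x) rfl)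
    · filter_upwards [self_mem_nhdsWithin] with t ht
      exact ne_of_gt ht
  have h1 := (K.flow.tendsto_inv_smul_momentum K.convex (K.frontier_subset hx)).comp hl
  have h2 := (K.flow.tendsto_inv_smul_velocity K.convex (K.frontier_subset hx)).comp hl
  refine (h1.inner h2).congr fun t => ?_
  simp only [Function.comp, real_inner_smul_left, real_inner_smul_right]
  rw [div_eq_mul_inv]
  ring

theorem tendsto_brakeAction (hx : x ∈ frontier D) :
    Tendsto (fun t => brakeAction H K.Q K.P t x) (𝓝[>] 0) (𝓝 0) := by
  have h := (K.flow.hasDerivAt_brakeAction K.contDiff K.flow.zero_mem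
    (K.frontier_subset hx)).continuousAt.tendsto
  rw [brakeAction_zero] at h
  exact tendsto_nhdsWithin_of_tendsto_nhds h

theorem tendsto_brakeAction_div (hx : x ∈ frontier D) :
    Tendsto (fun t => brakeAction H K.Q K.P t x / t ^ 3) (𝓝[>] 0)
      (𝓝 (⟪restForce H x, restAccel H x⟫ / 3)) := by
  refine HasDerivAt.lhopital_zero_nhdsGT
    (f' := fun t => ⟪K.P t x, pGrad H (K.Q t x, K.P t x)⟫) (g' := fun t => 3 * t ^ 2)
    ?_ ?_ ?_ (K.tendsto_brakeAction hx) ?_ ?_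
  · filter_upwards [Ioo_mem_nhdsGT K.flow.pos] with t ht
    exact K.flow.hasDerivAt_brakeAction K.contDiff ⟨by linarith [ht.1, K.flow.pos], ht.2⟩
      (K.frontier_subset hx)
  · exact Eventually.of_forall fun t => by simpa using hasDerivAt_pow 3 t
  · filter_upwards [self_mem_nhdsWithin] with t ht
    have : (0 : ℝ) < t := ht
    positivity
  · exact tendsto_nhdsWithin_of_tendsto_nhds
      (Continuous.tendsto' (by fun_prop) (0 : ℝ) (0 : ℝ) (by norm_num))
  · refine ((K.tendsto_inv_sq_mul hx).div_const 3).congr fun t => ?_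
    rw [div_div, mul_comm]

theorem eventually_factor_flow (hx : x ∈ frontier D) : ∀ᶠ t in 𝓝[>] (0 : ℝ),
    K.factor (K.Q t x) = brakeAction H K.Q K.P t x ^ (2 / 3 : ℝ) := by
  have h0 := K.action.pos
  filter_upwards [Ioo_mem_nhdsGT K.collar.pos, (K.tendsto_brakeAction hx).eventually
    (gt_mem_nhds (show 0 < K.δ₀ / 8 by linarith))] with t ht hl
  rw [factor, K.action_flow_of_lt ⟨ht.1.le, ht.2⟩ hx (by linarith),
    conformalFactor_of_le (by linarith) hl.le]

/-- The reason for the exponent `2 / 3`: the action is of order `t³` and its derivative of order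
`t²`, so dividing by the action to the power `2 / 3` leaves a positive limit. Without the factor the
geodesic parameter would have zero derivative in time at the boundary. -/
theorem exists_tendsto_speed (hx : x ∈ frontier D) :
    ∃ L > 0, Tendsto (fun t => K.speed (K.Q t x, K.P t x)) (𝓝[>] 0) (𝓝 L) := by
  have ha := K.convex.inner_restForce_restAccel_pos (K.force_ne_zero x hx)
  set A := ⟪restForce H x, restAccel H x⟫ with hA
  have hb : 0 < (A / 3) ^ (2 / 3 : ℝ) := Real.rpow_pos_of_pos (by linarith) _
  refine ⟨A / (A / 3) ^ (2 / 3 : ℝ), div_pos ha hb, ?_⟩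
  have h1 := (K.tendsto_brakeAction_div hx).rpow_const (p := (2 / 3 : ℝ))
    (Or.inl (by rw [← hA]; positivity))
  refine ((K.tendsto_inv_sq_mul hx).div h1 hb.ne').congr' ?_
  filter_upwards [K.eventually_factor_flow hx, Ioo_mem_nhdsGT K.collar.pos] with t hf ht
  have ht0 : 0 < t := ht.1
  have hS : 0 ≤ brakeAction H K.Q K.P t x := by
    have := (K.collar.strictMonoOn_action K.flow K.contDiff K.convex K.frontier_subset
      K.lt_energy K.eq_energy hx).monotoneOn ⟨le_rfl, K.collar.pos⟩ ⟨ht0.le, ht.2⟩ ht0.le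
    simpa only [brakeAction_zero] using this
  have e : (t ^ 3) ^ (2 / 3 : ℝ) = t ^ 2 := by
    rw [← Real.rpow_natCast t 3, ← Real.rpow_mul ht0.le, ← Real.rpow_natCast t 2]
    norm_num
  rw [Pi.div_apply, speed, hf, Real.div_rpow hS (by positivity), e,
    div_div_div_cancel_right₀ (by positivity)]

end Speed

end CollarData

namespace CollarData

/-! ### Orbits that stay geodesics under the conformal change -/

section Aligned

open scoped RealInnerProductSpace

variable {V : Type*} [NormedAddCommGroup V] [InnerProductSpace ℝ V] [CompleteSpace V]
  [FiniteDimensional ℝ V] {H : V × V → ℝ} {E : ℝ} {D : Set V} (K : CollarData H E D)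

/-- The points of the energy level whose momentum is parallel to the gradient of the
conformal factor. -/
def aligned : Set (V × V) :=
  {z | z.1 ∈ D ∧ H z = E ∧ ∃ k : ℝ, fderiv ℝ K.factor z.1 = k • innerSL ℝ z.2}

variable {q x : V} {z : V × V} {t : ℝ}

/-- The factor is a function of the action, whose gradient is the momentum of the brake orbit. Hence
brake orbits are aligned. -/
theorem exists_fderiv_factor_eq (hq : q ∈ D) (hl : K.ℓ q < K.δ₀) :
    ∃ k : ℝ, fderiv ℝ K.factor q = k • innerSL ℝ (K.mom q) := by
  have h1 : DifferentiableAt ℝ (conformalFactor (K.δ₀ / 8) (K.δ₀ / 4)) (K.ℓ q) :=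
    (contDiffAt_conformalFactor (K.action.pos_of_mem q hq)).differentiableAt two_ne_zero
  exact ⟨_, (h1.hasDerivAt.comp_hasFDerivAt q (K.hasFDerivAt_action hq hl)).fderiv⟩

theorem fderiv_factor_eq_zero (hq : q ∈ D) (hl : K.δ₀ / 4 < K.ℓ q) : fderiv ℝ K.factor q = 0 := by
  rw [(K.factor_eventuallyEq_one hq hl).fderiv_eq]
  exact fderiv_const_apply (1 : ℝ)

theorem neg_mem_aligned (hz : z ∈ K.aligned) : (z.1, -z.2) ∈ K.aligned := by
  obtain ⟨h1, h2, k, hk⟩ := hz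
  refine ⟨h1, (K.convex.even _ (mem_univ _) _).trans h2, -k, ?_⟩
  rw [hk, map_neg, smul_neg, neg_smul, neg_neg]

theorem flow_mem_aligned (ht : t ∈ Ioo 0 K.t₀) (hx : x ∈ frontier D)
    (hl : brakeAction H K.Q K.P t x < K.δ₀) : (K.Q t x, K.P t x) ∈ K.aligned := by
  have hD := K.collar.apply_mem_domain t ht x hx
  have ht' : t ∈ Ico 0 K.t₀ := ⟨ht.1.le, ht.2⟩
  refine ⟨hD, ?_, ?_⟩
  · rw [K.flow.energy K.contDiff (K.collar.Ico_subset ht') (K.frontier_subset hx),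
      K.eq_energy x hx]
  · have h := K.exists_fderiv_factor_eq hD (by rwa [K.action_flow_of_lt ht' hx hl])
    have e : K.mom (K.Q t x) = K.P t x := by
      rw [mom, (K.collar.apply_mem t ht' x hx).2.1, (K.collar.apply_mem t ht' x hx).2.2]
    rwa [e] at h

theorem mem_aligned_of_ge (hz : z.1 ∈ D) (hl : K.δ₀ / 4 < K.ℓ z.1) (hE : H z = E) :
    z ∈ K.aligned :=
  ⟨hz, hE, 0, by rw [K.fderiv_factor_eq_zero hz hl, zero_smul]⟩

theorem ne_zero_of_mem_aligned (hz : z ∈ K.aligned) : z.2 ≠ 0 :=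
  IsConvexHamiltonian.ne_zero_of_energy_eq K.lt_energy hz.1 hz.2.1

theorem inner_pos_of_mem_aligned (hz : z ∈ K.aligned) : 0 < ⟪z.2, pGrad H z⟫ :=
  K.convex.inner_pGrad_self_pos (mem_univ z.1) (K.ne_zero_of_mem_aligned hz)

theorem speed_pos (hz : z ∈ K.aligned) : 0 < K.speed z :=
  div_pos (K.inner_pos_of_mem_aligned hz) (K.factor_pos hz.1)

theorem continuousAt_speed (hz : z ∈ K.aligned) : ContinuousAt K.speed z := by
  have h1 : ContinuousAt (fun w : V × V => K.factor w.1) z :=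
    ContinuousAt.comp (g := K.factor) (f := Prod.fst) (K.contDiffAt_factor hz.1).continuousAt
      continuousAt_fst
  exact (continuousAt_snd.inner
    (K.convex.contDiffAt_pGrad (mem_univ z.1) z.2).continuousAt).div h1 (K.factor_pos hz.1).ne'

theorem speed_neg (q p : V) : K.speed (q, -p) = K.speed (q, p) := by
  rw [speed, speed, K.convex.pGrad_neg (mem_univ q), inner_neg_neg]

/-- The momentum for the conformally changed Hamiltonian. -/
noncomputable def rescale (z : V × V) : V × V := (z.1, (K.factor z.1)⁻¹ • z.2)

theorem ham_rescale (hz : z.1 ∈ D) : K.ham (K.rescale z) = H z := by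
  rw [ham, rescale, scaledHamiltonian]
  simp only
  rw [smul_inv_smul₀ (K.factor_pos hz).ne']

/-- The derivative of the factor adds to `∂H/∂q` only a multiple of its gradient, which at aligned
points is parallel to the momentum. -/
theorem grad_ham_rescale (hz : z ∈ K.aligned) {k : ℝ}
    (hk : fderiv ℝ K.factor z.1 = k • innerSL ℝ z.2) :
    pGrad K.ham (K.rescale z) = K.factor z.1 • pGrad H z ∧
      qGrad K.ham (K.rescale z) =
        qGrad H z + (k * ⟪z.2, pGrad H z⟫ * (K.factor z.1)⁻¹) • z.2 := by
  have hμ := (K.factor_pos hz.1).ne'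
  have e : (z.1, K.factor z.1 • (K.factor z.1)⁻¹ • z.2) = z := by rw [smul_inv_smul₀ hμ]
  have hd : DifferentiableAt ℝ H (z.1, K.factor z.1 • (K.factor z.1)⁻¹ • z.2) :=
    K.contDiff.differentiable two_ne_zero _
  have hf : DifferentiableAt ℝ K.factor z.1 :=
    (K.contDiffAt_factor hz.1).differentiableAt two_ne_zero
  constructor
  · rw [ham, rescale, pGrad_scaledHamiltonian hd hf, e]
  · refine ext_inner_right ℝ fun w => ?_
    rw [ham, rescale, inner_qGrad_scaledHamiltonian hd hf, e, hk, inner_add_left,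
      smul_apply, innerSL_apply_apply, real_inner_smul_right, real_inner_smul_left,
      real_inner_comm, real_inner_comm (pGrad H z) z.2, smul_eq_mul, real_inner_comm w z.2]
    ring

/-- Along aligned orbits the Hamiltonian flow of the conformally changed Hamiltonian is a time
change of the original one. -/
theorem hasDerivAt_rescale {c : ℝ → V × V} (hc : HasDerivAt c (hamiltonField H (c t)) t)
    (hm : c t ∈ K.aligned) : HasDerivAt (fun r => K.rescale (c r))
      ((K.factor (c t).1)⁻¹ • hamiltonField K.ham (K.rescale (c t))) t := by
  obtain ⟨k, hk⟩ := hm.2.2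
  obtain ⟨e1, e2⟩ := K.grad_ham_rescale hm hk
  have hμ := (K.factor_pos hm.1).ne'
  have h1 : HasDerivAt (fun r => (c r).1) (pGrad H (c t)) t := hc.fst
  have h2 : HasDerivAt (fun r => (c r).2) (-qGrad H (c t)) t := hc.snd
  have h3 : HasDerivAt (fun r => K.factor (c r).1) (fderiv ℝ K.factor (c t).1 (pGrad H (c t))) t :=
    HasFDerivAt.comp_hasDerivAt (l := K.factor) (f := fun r => (c r).1) t
      ((K.contDiffAt_factor hm.1).differentiableAt two_ne_zero).hasFDerivAt h1
  -- The derivative of the scaling `1 / factor` of the momentum is exactly the extra force, parallel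
  -- to the momentum, of the scaled Hamiltonian.
  refine (h1.prodMk ((h3.inv hμ).smul h2)).congr_deriv ?_
  rw [hamiltonField, e1, e2, hk]
  refine Prod.ext ?_ ?_
  · simp [inv_smul_smul₀ hμ]
  · simp only [smul_apply, innerSL_apply_apply, smul_eq_mul, Prod.smul_mk]
    rw [smul_neg, smul_neg, smul_add, smul_smul, neg_add, ← neg_smul]
    congr 1
    · rw [Pi.inv_apply, neg_smul]
    · rw [← neg_smul]
      congr 1
      field_simp

/-- The time change has derivative `speed / c`, so in the parameter `e t` the orbit has constant
metric speed `c`. -/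
theorem isJacobiOrbit_rescale {z : ℝ → V × V} {T c : ℝ}
    (hz : ∀ t ∈ Ioo 0 T, HasDerivAt z (hamiltonField H (z t)) t)
    (hm : ∀ t ∈ Ioo 0 T, z t ∈ K.aligned) (e : ℝ ≃o ℝ)
    (he : ∀ t ∈ Ioo 0 T, HasDerivAt e.symm (K.speed (z t) / c)⁻¹ (e t)) :
    IsJacobiOrbit D K.ham E c (fun s => (z (e.symm s)).1) (fun s => (K.rescale (z (e.symm s))).2)
      (Ioo (e 0) (e T)) := by
  have hmem : ∀ s ∈ Ioo (e 0) (e T), e.symm s ∈ Ioo 0 T := fun s hs =>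
    ⟨e.lt_symm_apply.2 hs.1, e.symm_apply_lt.2 hs.2⟩
  refine ⟨fun s hs => (hm _ (hmem s hs)).1, fun s hs => ?_, fun s hs => ?_⟩
  · exact (K.ham_rescale (hm _ (hmem s hs)).1).trans (hm _ (hmem s hs)).2.1
  · have ht := hmem s hs
    have h1 := K.hasDerivAt_rescale (hz _ ht) (hm _ ht)
    have h2 := he _ ht
    rw [e.apply_symm_apply] at h2
    have h3 := HasDerivAt.scomp (g₁ := fun r => K.rescale (z r)) (h := e.symm) s h1 h2
    refine (h3.congr_deriv ?_).hasDerivWithinAt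
    obtain ⟨k, hk⟩ := (hm _ ht).2.2
    have e1 := (K.grad_ham_rescale (hm _ ht) hk).1
    have hμ := (K.factor_pos (hm _ ht).1).ne'
    change _ = jacobiField K.ham c (K.rescale (z (e.symm s)))
    rw [jacobiField, hamiltonField, jacobiRate, smul_smul, Prod.smul_mk, smul_neg]
    have e3 : (K.speed (z (e.symm s)) / c)⁻¹ * (K.factor (z (e.symm s)).1)⁻¹ =
        c / ⟪(K.rescale (z (e.symm s))).2, pGrad K.ham (K.rescale (z (e.symm s)))⟫ := by
      rw [e1, speed]
      simp only [rescale, real_inner_smul_left, real_inner_smul_right]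
      rw [mul_inv_cancel_left₀ hμ, div_div, inv_div]
      field_simp
    rw [e3]

end Aligned

end CollarData

namespace CollarData

/-! ### Continuing a chord along brake orbits to the boundary -/

section Extension

open scoped RealInnerProductSpace

variable {V : Type*} [NormedAddCommGroup V] [InnerProductSpace ℝ V] [CompleteSpace V]
  [FiniteDimensional ℝ V] {H : V × V → ℝ} {E : ℝ} {D : Set V} (K : CollarData H E D)

theorem collar_orbit {q : V} (hq : q ∈ D) (hl : K.ℓ q < K.δ₀) :
    0 < K.tm q ∧ K.tm q < K.t₀ ∧ K.ft q ∈ frontier D ∧ K.Q (K.tm q) (K.ft q) = q ∧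
      ∀ t ∈ Ioc 0 (K.tm q), (K.Q t (K.ft q), K.P t (K.ft q)) ∈ K.aligned := by
  obtain ⟨h1, h2, h3⟩ := K.collar_of_lt (subset_closure hq) hl
  refine ⟨K.collar.time_pos K.flow K.isOpen (K.mem_collar hq hl), h1.2, h2, h3, fun t ht => ?_⟩
  have h4 : t < K.t₀ := ht.2.trans_lt h1.2
  refine K.flow_mem_aligned ⟨ht.1, h4⟩ h2 (lt_of_le_of_lt ?_ hl)
  rw [(K.action.mem q (subset_closure hq) hl).2]
  exact (K.collar.strictMonoOn_action K.flow K.contDiff K.convex K.frontier_subset K.lt_energy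
    K.eq_energy h2).monotoneOn ⟨ht.1.le, h4⟩ h1 ht.2

theorem hasDerivAt_flow {x : V} (hx : x ∈ frontier D) {t : ℝ} (ht : t ∈ Ico 0 K.t₀) :
    HasDerivAt (fun r => (K.Q r x, K.P r x)) (hamiltonField H (K.Q t x, K.P t x)) t :=
  K.flow.hasDerivAt t (K.collar.Ico_subset ht) x (K.frontier_subset hx)

/-- Evenness in the momenta makes Hamilton's equations reversible: running time backwards and
negating the momentum gives a solution again. -/
theorem hasDerivAt_flow_reverse {x : V} (hx : x ∈ frontier D) {T t : ℝ}
    (ht : T - t ∈ Ico 0 K.t₀) :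
    HasDerivAt (fun r => (K.Q (T - r) x, -K.P (T - r) x))
      (hamiltonField H (K.Q (T - t) x, -K.P (T - t) x)) t := by
  have h := HasDerivAt.comp_const_sub T t (K.hasDerivAt_flow hx ht)
  have h1 : HasDerivAt (fun r => K.Q (T - r) x) (-pGrad H (K.Q (T - t) x, K.P (T - t) x)) t := h.fst
  have h2 : HasDerivAt (fun r => K.P (T - r) x) (- -qGrad H (K.Q (T - t) x, K.P (T - t) x)) t :=
    h.snd
  refine (h1.prodMk h2.neg).congr_deriv ?_
  rw [hamiltonField, K.convex.pGrad_neg (mem_univ _), K.convex.qGrad_neg (mem_univ _), neg_neg]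

/-- `z` is a Hamiltonian orbit on `[0, T]` from boundary to boundary, extending the time change
under `θ` of the curve `(γ, y)`, which is parametrized with speed `c`. -/
structure IsHamiltonExtension (c : ℝ) (γ y : ℝ → V) (T : ℝ) (z : ℝ → V × V) (θ : ℝ → ℝ) :
    Prop where
  pos : 0 < T
  hasDerivWithinAt : ∀ t ∈ Icc 0 T, HasDerivWithinAt z (hamiltonField H (z t)) (Icc 0 T) t
  aligned : ∀ t ∈ Ioo 0 T, z t ∈ K.aligned
  left : ∃ x ∈ frontier D, z 0 = (x, 0)
  right : ∃ x ∈ frontier D, z T = (x, 0)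
  left_speed : ∃ L > 0, Tendsto (fun t => K.speed (z t)) (𝓝[>] 0) (𝓝 L)
  right_speed : ∃ L > 0, Tendsto (fun t => K.speed (z t)) (𝓝[<] T) (𝓝 L)
  time_mem : ∀ s ∈ Icc 0 1, θ s ∈ Ioo 0 T
  apply_time : ∀ s ∈ Icc 0 1, z (θ s) = (γ s, y s)
  hasDerivAt_time : ∀ s ∈ Icc 0 1, HasDerivAt θ (c / K.speed (γ s, y s)) s

/-- By the assumptions on `y 0` and `y 1`, three pieces match in position and momentum: the brake
orbit from the foot of `γ 0`, the chord in Hamiltonian time, and the time reversal of the brake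
orbit from the foot of `γ 1`. -/
theorem exists_isHamiltonExtension {c : ℝ} (hc : 0 < c) {γ y : ℝ → V}
    (hJ : IsJacobiOrbit D K.ham E c γ y (Icc 0 1)) (hl : ∀ s ∈ Icc 0 1, K.δ₀ / 2 ≤ K.ℓ (γ s))
    (hl0 : K.ℓ (γ 0) = K.δ₀ / 2) (hl1 : K.ℓ (γ 1) = K.δ₀ / 2) (hy0 : y 0 = K.mom (γ 0))
    (hy1 : y 1 = -K.mom (γ 1)) : ∃ T z θ, K.IsHamiltonExtension c γ y T z θ := by
  have hδ := K.action.pos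
  have m0 : (0 : ℝ) ∈ Icc (0 : ℝ) 1 := ⟨le_rfl, zero_le_one⟩
  have m1 : (1 : ℝ) ∈ Icc (0 : ℝ) 1 := ⟨zero_le_one, le_rfl⟩
  obtain ⟨a0, a1, a2, a3, a4⟩ := K.collar_orbit (hJ.mapsTo m0) (by rw [hl0]; linarith)
  obtain ⟨b0, b1, b2, b3, b4⟩ := K.collar_orbit (hJ.mapsTo m1) (by rw [hl1]; linarith)
  have hmom0 : K.P (K.tm (γ 0)) (K.ft (γ 0)) = y 0 := hy0.symm
  have hmom1 : -K.P (K.tm (γ 1)) (K.ft (γ 1)) = y 1 := hy1.symm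
  set ta := K.tm (γ 0)
  set tb := K.tm (γ 1)
  set x₀ := K.ft (γ 0)
  set x₁ := K.ft (γ 1)
  have hham : ∀ s ∈ Icc (0 : ℝ) 1, K.ham (γ s, y s) = H (γ s, y s) ∧
      pGrad K.ham (γ s, y s) = pGrad H (γ s, y s) ∧ qGrad K.ham (γ s, y s) = qGrad H (γ s, y s) :=
    fun s hs => K.ham_eq (hJ.mapsTo hs) (by linarith [hl s hs]) _
  have hal : ∀ s ∈ Icc (0 : ℝ) 1, (γ s, y s) ∈ K.aligned := fun s hs =>
    K.mem_aligned_of_ge (hJ.mapsTo hs) (by linarith [hl s hs])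
      ((hham s hs).1.symm.trans (hJ.energy s hs))
  set r : ℝ → ℝ := fun s => jacobiRate K.ham c (γ s, y s) with hr
  have hrpos : ∀ s ∈ Icc (0 : ℝ) 1, 0 < r s := fun s hs =>
    (hJ.isJacobiMomentum K.convex_ham K.ham_lt hc hs).1
  have hrcont : ContinuousOn r (Icc 0 1) := fun s hs =>
    ContinuousAt.comp_continuousWithinAt (g := jacobiRate K.ham c) (f := fun s => (γ s, y s))
      (K.convex_ham.contDiffAt_jacobiRate (z := (γ s, y s)) (hJ.mapsTo hs)
        (K.ne_zero_of_mem_aligned (hal s hs)) c).continuousAt (hJ.continuousOn s hs)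
  have hrspeed : ∀ s ∈ Icc (0 : ℝ) 1, r s = c / K.speed (γ s, y s) := fun s hs => by
    have h1 : K.factor (γ s) = 1 :=
      (K.factor_eventuallyEq_one (hJ.mapsTo hs) (by linarith [hl s hs])).eq_of_nhds
    simp only [hr, jacobiRate, speed, (hham s hs).2.1, h1, div_one]
  -- `r` is the derivative of Hamiltonian time in the chord parameter; the clock starts at `ta`,
  -- when the first brake orbit reaches `γ 0`.
  obtain ⟨θ, hθ0, hθ, hθs⟩ := exists_orderIso_hasDerivAt zero_le_one hrcont hrpos 0 ta
  have hab : ta < θ 1 := hθ0 ▸ θ.strictMono zero_lt_one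
  set T := θ 1 + tb with hT
  set zL : ℝ → V × V := fun t => (K.Q t x₀, K.P t x₀) with hzL
  set zM : ℝ → V × V := fun t => (γ (θ.symm t), y (θ.symm t)) with hzM
  set zR : ℝ → V × V := fun t => (K.Q (T - t) x₁, -K.P (T - t) x₁) with hzR
  have hθm : ∀ t ∈ Icc ta (θ 1), θ.symm t ∈ Icc (0 : ℝ) 1 := fun t ht =>
    ⟨θ.le_symm_apply.2 (hθ0.trans_le ht.1), θ.symm_apply_le.2 ht.2⟩
  have dL : ∀ t ∈ Icc 0 ta, HasDerivWithinAt zL (hamiltonField H (zL t)) (Icc 0 ta) t :=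
    fun t ht => (K.hasDerivAt_flow a2 ⟨ht.1, ht.2.trans_lt a1⟩).hasDerivWithinAt
  have dM : ∀ t ∈ Icc ta (θ 1), HasDerivWithinAt zM (hamiltonField H (zM t)) (Icc ta (θ 1)) t := by
    intro t ht
    have hs := hθm t ht
    have h1 := hθs _ hs
    rw [θ.apply_symm_apply] at h1
    refine (HasDerivWithinAt.scomp (g₁ := fun s => (γ s, y s)) (h := θ.symm) t
      (hJ.hasDerivWithinAt _ hs) h1.hasDerivWithinAt hθm).congr_deriv ?_
    obtain ⟨-, e2, e3⟩ := hham _ hs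
    rw [jacobiField, e2, e3, hamiltonField, Prod.smul_mk, smul_neg]
    have hne := (hrpos _ hs).ne'
    rw [inv_smul_smul₀ hne, inv_smul_smul₀ hne]
  have dR : ∀ t ∈ Icc (θ 1) T, HasDerivWithinAt zR (hamiltonField H (zR t)) (Icc (θ 1) T) t :=
    fun t ht => (K.hasDerivAt_flow_reverse b2
      ⟨by linarith [ht.2], by linarith [ht.1]⟩).hasDerivWithinAt
  have j1 : zL ta = zM ta := by
    have : θ.symm ta = 0 := by rw [← hθ0, θ.symm_apply_apply]
    simp only [hzL, hzM, this, a3, hmom0]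
  set zLM : ℝ → V × V := fun t => if t ≤ ta then zL t else zM t with hzLM
  have j2 : zLM (θ 1) = zR (θ 1) := by
    have h1 : T - θ 1 = tb := by rw [hT, add_sub_cancel_left]
    simp only [hzLM, if_neg (not_le.2 hab), hzM, hzR, θ.symm_apply_apply, h1, b3, hmom1]
  have dz := hasDerivWithinAt_ite (a0.le.trans hab.le) (by linarith : θ 1 ≤ T)
    (hasDerivWithinAt_ite a0.le hab.le dL dM j1) dR j2
  set z : ℝ → V × V := fun t => if t ≤ θ 1 then zLM t else zR t with hz
  have eL : ∀ t ≤ ta, z t = zL t := fun t ht => by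
    simp only [hz, hzLM, if_pos (ht.trans hab.le), if_pos ht]
  have eM : ∀ t, ta ≤ t → t ≤ θ 1 → z t = zM t := fun t ht ht' => by
    rcases ht.eq_or_lt with h | h
    · rw [← h, eL ta le_rfl, j1]
    · simp only [hz, hzLM, if_pos ht', if_neg (not_le.2 h)]
  have eR : ∀ t, θ 1 < t → z t = zR t := fun t ht => by
    simp only [hz, if_neg (not_le.2 ht)]
  refine ⟨T, z, θ, ?_⟩
  exact {
    pos := by linarith
    hasDerivWithinAt := dz
    aligned := fun t ht => by
      rcases le_or_gt t ta with h | h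
      · rw [eL t h]
        exact a4 t ⟨ht.1, h⟩
      · rcases le_or_gt t (θ 1) with h' | h'
        · rw [eM t h.le h']
          exact hal _ (hθm t ⟨h.le, h'⟩)
        · rw [eR t h']
          exact K.neg_mem_aligned (b4 (T - t) ⟨by linarith [ht.2], by linarith⟩)
    left := ⟨x₀, a2, by rw [eL 0 a0.le, hzL]; simp only [K.flow.zero]⟩
    right := ⟨x₁, b2, by
      rw [eR T (by linarith), hzR]; simp only [sub_self, K.flow.zero, neg_zero]⟩
    left_speed := by
      obtain ⟨L, hL, h⟩ := K.exists_tendsto_speed a2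
      refine ⟨L, hL, h.congr' ?_⟩
      filter_upwards [Ioo_mem_nhdsGT a0] with t ht
      rw [eL t ht.2.le]
    right_speed := by
      obtain ⟨L, hL, h⟩ := K.exists_tendsto_speed b2
      have hsub : Tendsto (fun t => T - t) (𝓝[<] T) (𝓝[>] 0) := by
        refine tendsto_nhdsWithin_iff.2 ⟨tendsto_nhdsWithin_of_tendsto_nhds
          (Continuous.tendsto' (by fun_prop) _ _ (sub_self T)), ?_⟩
        filter_upwards [self_mem_nhdsWithin] with t ht
        exact mem_Ioi.2 (sub_pos.2 (mem_Iio.1 ht))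
      refine ⟨L, hL, (h.comp hsub).congr' ?_⟩
      filter_upwards [Ioo_mem_nhdsLT (show θ 1 < T by linarith)] with t ht
      rw [eR t ht.1, Function.comp, hzR, K.speed_neg]
    time_mem := fun s hs => by
      have h1 := θ.monotone hs.1
      have h2 := θ.monotone hs.2
      rw [hθ0] at h1
      exact ⟨by linarith, by linarith⟩
    apply_time := fun s hs => by
      have h1 := θ.monotone hs.1
      rw [hθ0] at h1
      rw [eM _ h1 (θ.monotone hs.2), hzM]
      simp only [θ.symm_apply_apply]
    hasDerivAt_time := fun s hs => by
      rw [← hrspeed s hs]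
      exact hθ s hs }

end Extension

/-! ### Momenta of an orthogonal chord at its ends -/

section Chord

open scoped RealInnerProductSpace

variable {n : ℕ} {H : EuclideanSpace ℝ (Fin n) × EuclideanSpace ℝ (Fin n) → ℝ} {E : ℝ}
  {D : Set (EuclideanSpace ℝ (Fin n))} (K : CollarData H E D)

/-- Orthogonality says that the momentum annihilates the complement of `mom q`, so it is a multiple
of `mom q`; both have energy `E`, which leaves only the sign. -/
theorem eq_mom_or_eq_neg_mom {q v : EuclideanSpace ℝ (Fin n)} (hq : q ∈ frontier K.inner)
    (hv : v ≠ 0) (h : ∀ ξ ∈ boundaryTangent K.inner q,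
      fderiv ℝ (fun v => jacobiMetric K.ham E q v ^ 2) v ξ = 0) :
    jacobiMomentum K.ham E q v = K.mom q ∨ jacobiMomentum K.ham E q v = -K.mom q := by
  have hδ := K.action.pos
  have hq' := hq
  rw [K.frontier_inner] at hq'
  obtain ⟨hqD, hql⟩ := hq'
  have hmom := K.convex_ham.isJacobiMomentum K.ham_lt hqD hv
  have hF := K.convex_ham.jacobiMetric_pos K.ham_lt hqD hv
  set p := jacobiMomentum K.ham E q v with hp
  have horth : ∀ ξ, ⟪K.mom q, ξ⟫ = 0 → ⟪p, ξ⟫ = 0 := fun ξ hξ => by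
    have h1 := h ξ ((K.mem_boundaryTangent hq).2 hξ)
    rw [(K.convex_ham.hasFDerivAt_jacobiMetric_sq_velocity K.ham_lt hqD hv).fderiv,
      smul_apply, innerSL_apply_apply, smul_eq_mul] at h1
    exact (mul_eq_zero.1 h1).resolve_left (by positivity)
  have hspan : p ∈ Submodule.span ℝ {K.mom q} := by
    rw [← Submodule.orthogonal_orthogonal (Submodule.span ℝ {K.mom q}),
      Submodule.mem_orthogonal]
    intro ξ hξ
    rw [real_inner_comm]
    exact horth ξ (Submodule.mem_orthogonal_singleton_iff_inner_right.1 hξ)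
  obtain ⟨k, hk⟩ := Submodule.mem_span_singleton.1 hspan
  have hE : H (q, k • K.mom q) = H (q, K.mom q) := by
    rw [hk, K.energy_mom hqD (by linarith), ← (K.ham_eq hqD (by linarith) p).1]
    exact hmom.2.1
  rcases K.convex.eq_one_or_eq_neg_one (mem_univ q) (K.mom_ne_zero_of_frontier hq) hE with h1 | h1
  · left; rw [← hk, h1, one_smul]
  · right; rw [← hk, h1, neg_one_smul]

theorem hasDerivWithinAt_action {c : ℝ} {γ y : ℝ → EuclideanSpace ℝ (Fin n)} {I : Set ℝ}
    (hJ : IsJacobiOrbit D K.ham E c γ y I) {s : ℝ} (hs : s ∈ I)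
    (hl : K.ℓ (γ s) = K.δ₀ / 2) : HasDerivWithinAt (fun s => K.ℓ (γ s))
      (jacobiRate K.ham c (γ s, y s) * ⟪K.mom (γ s), pGrad H (γ s, y s)⟫) I s := by
  have hδ := K.action.pos
  have h1 := HasFDerivAt.comp_hasDerivWithinAt (l := K.ℓ) (f := γ) s
    (K.hasFDerivAt_action (hJ.mapsTo hs) (by linarith)) (hJ.hasDerivWithinAt_fst hs)
  refine h1.congr_deriv ?_
  rw [(K.ham_eq (hJ.mapsTo hs) (by linarith) _).2.1, innerSL_apply_apply, real_inner_smul_right]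

/-- The signs of the end momenta come from `ℓ ≥ δ₀ / 2` along the chord: the action is minimal at
both ends, so it cannot decrease at the start or increase at the end. -/
theorem exists_isJacobiOrbit_of_chord {γ : ℝ → EuclideanSpace ℝ (Fin n)}
    (hγ : IsOrthogonalChord D (jacobiMetric K.ham E) K.inner 0 1 γ) :
    ∃ c > 0, ∃ y, IsJacobiOrbit D K.ham E c γ y (Icc 0 1) ∧
      (∀ s ∈ Icc 0 1, K.δ₀ / 2 ≤ K.ℓ (γ s)) ∧ K.ℓ (γ 0) = K.δ₀ / 2 ∧ K.ℓ (γ 1) = K.δ₀ / 2 ∧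
      y 0 = K.mom (γ 0) ∧ y 1 = -K.mom (γ 1) := by
  have m0 : (0 : ℝ) ∈ Icc (0 : ℝ) 1 := ⟨le_rfl, zero_le_one⟩
  have m1 : (1 : ℝ) ∈ Icc (0 : ℝ) 1 := ⟨zero_le_one, le_rfl⟩
  have hI : UniqueDiffOn ℝ (Icc (0 : ℝ) 1) := uniqueDiffOn_Icc zero_lt_one
  have hJ := hγ.geodesic.isJacobiOrbit K.convex_ham K.ham_lt hI (convex_Icc _ _) m0
  have hc : 0 < jacobiMetric K.ham E (γ 0) (derivWithin γ (Icc 0 1) 0) :=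
    K.convex_ham.jacobiMetric_pos K.ham_lt (hγ.geodesic.mapsTo m0)
      (hγ.geodesic.velocity_ne_zero 0 m0)
  have hl0 : K.ℓ (γ 0) = K.δ₀ / 2 := by
    have := hγ.left_mem
    rw [K.frontier_inner] at this
    exact this.2
  have hl1 : K.ℓ (γ 1) = K.δ₀ / 2 := by
    have := hγ.right_mem
    rw [K.frontier_inner] at this
    exact this.2
  have hl : ∀ s ∈ Icc (0 : ℝ) 1, K.δ₀ / 2 ≤ K.ℓ (γ s) := fun s hs => by
    rcases hs.1.eq_or_lt with h | h
    · rw [← h, hl0]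
    · rcases hs.2.eq_or_lt with h' | h'
      · rw [h', hl1]
      · exact (hγ.interior_mem s ⟨h, h'⟩).2.le
  set c := jacobiMetric K.ham E (γ 0) (derivWithin γ (Icc 0 1) 0)
  set y := fun s => jacobiMomentum K.ham E (γ s) (derivWithin γ (Icc 0 1) s) with hy
  have hrate : ∀ s ∈ Icc (0 : ℝ) 1, 0 < jacobiRate K.ham c (γ s, y s) := fun s hs =>
    (hJ.isJacobiMomentum K.convex_ham K.ham_lt hc hs).1
  have hpos : ∀ s, γ s ∈ frontier K.inner →
      0 < ⟪K.mom (γ s), pGrad H (γ s, K.mom (γ s))⟫ := fun s hs =>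
    K.convex.inner_pGrad_self_pos (mem_univ _) (K.mom_ne_zero_of_frontier hs)
  refine ⟨c, hc, y, hJ, hl, hl0, hl1, ?_, ?_⟩
  · refine (K.eq_mom_or_eq_neg_mom hγ.left_mem (hγ.geodesic.velocity_ne_zero 0 m0)
      hγ.left_orthogonal).resolve_right fun h => ?_
    have hmin : IsLocalMinOn (fun s => K.ℓ (γ s)) (Icc 0 1) 0 := by
      filter_upwards [self_mem_nhdsWithin] with s hs
      rw [hl0]
      exact hl s hs
    have h1 := hmin.hasFDerivWithinAt_nonneg
      (K.hasDerivWithinAt_action hJ m0 hl0).hasFDerivWithinAt (y := 1)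
      (mem_posTangentConeAt_of_segment_subset (by rw [zero_add, segment_eq_Icc zero_le_one]))
    have hy0 : y 0 = -K.mom (γ 0) := h
    have h2 := mul_pos (hrate 0 m0) (hpos 0 hγ.left_mem)
    simp only [hy0, K.convex.pGrad_neg (mem_univ _), inner_neg_right, mul_neg] at h1 h2
    simp at h1
    linarith
  · refine (K.eq_mom_or_eq_neg_mom hγ.right_mem (hγ.geodesic.velocity_ne_zero 1 m1)
      hγ.right_orthogonal).resolve_left fun h => ?_
    have hmin : IsLocalMinOn (fun s => K.ℓ (γ s)) (Icc 0 1) 1 := by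
      filter_upwards [self_mem_nhdsWithin] with s hs
      rw [hl1]
      exact hl s hs
    have h1 := hmin.hasFDerivWithinAt_nonneg
      (K.hasDerivWithinAt_action hJ m1 hl1).hasFDerivWithinAt (y := -1)
      (mem_posTangentConeAt_of_segment_subset (by
        rw [add_neg_cancel, segment_symm, segment_eq_Icc zero_le_one]))
    have hy1 : y 1 = K.mom (γ 1) := h
    have h2 := mul_pos (hrate 1 m1) (hpos 1 hγ.right_mem)
    simp only [hy1] at h1 h2
    simp at h1
    linarith

end Chord

end CollarData

/-! ### Time reparametrizations -/

section Reparametrization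

/-- An increasing homeomorphism with continuous positive derivative on `[0, T]` is a time
reparametrization. -/
theorem isTimeReparametrization_orderIso {T : ℝ} (hT : 0 < T) {g : ℝ → ℝ} (e : ℝ ≃o ℝ)
    (hg : ContinuousOn g (Icc 0 T)) (hpos : ∀ t ∈ Icc 0 T, 0 < g t)
    (he : ∀ t ∈ Icc 0 T, HasDerivAt e (g t) t) : IsTimeReparametrization T (e 0) (e T) e := by
  have hu : UniqueDiffOn ℝ (Icc 0 T) := uniqueDiffOn_Icc hT
  have hd : ∀ t ∈ Icc 0 T, derivWithin e (Icc 0 T) t = g t := fun t ht =>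
    (he t ht).hasDerivWithinAt.derivWithin (hu t ht)
  refine ⟨(contDiffOn_one_iff_derivWithin hu).2 ⟨fun t ht =>
    (he t ht).differentiableAt.differentiableWithinAt, hg.congr hd⟩, fun t ht => ?_, rfl, rfl⟩
  rw [hd t ht]
  exact hpos t ht

end Reparametrization

/-! ### Uniqueness of brake extensions -/

section Uniqueness

variable {n : ℕ} {H G : EuclideanSpace ℝ (Fin n) × EuclideanSpace ℝ (Fin n) → ℝ} {E : ℝ}
  {D : Set (EuclideanSpace ℝ (Fin n))} {γ γ₁ γ₂ : ℝ → EuclideanSpace ℝ (Fin n)}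
  {α₁ β₁ α₂ β₂ : ℝ} {F : EuclideanSpace ℝ (Fin n) → EuclideanSpace ℝ (Fin n) → ℝ}

theorem IsBrakeExtension.apply_mem_frontier (h : IsBrakeExtension H D E F γ α₁ β₁ γ₁) :
    γ₁ α₁ ∈ frontier D ∧ γ₁ β₁ ∈ frontier D := by
  obtain ⟨T, σ, hσ, hb⟩ := h.brake
  rw [← hσ.left, ← hσ.right]
  exact ⟨hb.2.2.2.1, hb.2.2.2.2⟩

theorem IsBrakeExtension.lt (hDo : IsOpen D) (hγ : MapsTo γ (Icc 0 1) D)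
    (h : IsBrakeExtension H D E F γ α₁ β₁ γ₁) : α₁ < 0 ∧ 1 < β₁ := by
  have hdisj : ∀ s ∈ Icc (0 : ℝ) 1, γ₁ s ∉ frontier D := fun s hs hf => by
    rw [h.extends_eq hs] at hf
    rw [hDo.frontier_eq] at hf
    exact hf.2 (hγ hs)
  constructor
  · refine h.left_le.lt_of_ne fun h0 => hdisj 0 ⟨le_rfl, zero_le_one⟩ ?_
    rw [← h0]
    exact h.apply_mem_frontier.1
  · refine h.le_right.lt_of_ne fun h0 => hdisj 1 ⟨zero_le_one, le_rfl⟩ ?_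
    rw [h0]
    exact h.apply_mem_frontier.2

/-- Both curves agree with `γ` near the parameter `1 / 2`, so they have the same speed, point and
momentum there, and uniqueness of orbits applies on the common open interval. Continuity adds the
end points. -/
theorem IsBrakeExtension.eqOn (hG : IsConvexHamiltonian D G) (hE : ∀ q ∈ D, G (q, 0) < E)
    (hγ : MapsTo γ (Icc 0 1) D)
    (h₁ : IsBrakeExtension H D E (jacobiMetric G E) γ α₁ β₁ γ₁)
    (h₂ : IsBrakeExtension H D E (jacobiMetric G E) γ α₂ β₂ γ₂) :
    EqOn γ₁ γ₂ (Icc (max α₁ α₂) (min β₁ β₂)) := by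
  obtain ⟨a₁, b₁⟩ := h₁.lt hG.isOpen hγ
  obtain ⟨a₂, b₂⟩ := h₂.lt hG.isOpen hγ
  have ha : max α₁ α₂ < 0 := max_lt a₁ a₂
  have hb : 1 < min β₁ β₂ := lt_min b₁ b₂
  have hmem : ∀ {a b : ℝ}, a < 0 → 1 < b → (1 / 2 : ℝ) ∈ Ioo a b := fun h h' =>
    ⟨by linarith, by linarith⟩
  have hm₁ := hmem a₁ b₁
  have hm₂ := hmem a₂ b₂
  have hJ₁ := h₁.geodesic.isJacobiOrbit hG hE isOpen_Ioo.uniqueDiffOn (convex_Ioo _ _) hm₁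
  have hJ₂ := h₂.geodesic.isJacobiOrbit hG hE isOpen_Ioo.uniqueDiffOn (convex_Ioo _ _) hm₂
  have hev : γ₁ =ᶠ[𝓝 (1 / 2)] γ₂ := by
    filter_upwards [Icc_mem_nhds (show (0 : ℝ) < 1 / 2 by norm_num)
      (show (1 / 2 : ℝ) < 1 by norm_num)] with s hs
    rw [h₁.extends_eq hs, h₂.extends_eq hs]
  have hd : derivWithin γ₁ (Ioo α₁ β₁) (1 / 2) = derivWithin γ₂ (Ioo α₂ β₂) (1 / 2) := by
    rw [derivWithin_of_isOpen isOpen_Ioo hm₁, derivWithin_of_isOpen isOpen_Ioo hm₂, hev.deriv_eq]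
  rw [hev.eq_of_nhds, hd] at hJ₁
  have s₁ : Ioo (max α₁ α₂) (min β₁ β₂) ⊆ Ioo α₁ β₁ :=
    Ioo_subset_Ioo (le_max_left _ _) (min_le_left _ _)
  have s₂ : Ioo (max α₁ α₂) (min β₁ β₂) ⊆ Ioo α₂ β₂ :=
    Ioo_subset_Ioo (le_max_right _ _) (min_le_right _ _)
  have key := hG.eqOn_of_isJacobiOrbit hE (hJ₁.mono s₁) (hJ₂.mono s₂) (hmem ha hb)
    (by rw [hev.eq_of_nhds, hd])
  have key' : EqOn γ₁ γ₂ (Ioo (max α₁ α₂) (min β₁ β₂)) := fun s hs => congrArg Prod.fst (key hs)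
  exact key'.of_subset_closure
    (h₁.continuousOn.mono (Icc_subset_Icc (le_max_left _ _) (min_le_left _ _)))
    (h₂.continuousOn.mono (Icc_subset_Icc (le_max_right _ _) (min_le_right _ _)))
    Ioo_subset_Icc_self (closure_Ioo (by linarith : max α₁ α₂ ≠ min β₁ β₂)).ge

/-- An extension lies in `D` on its open interval and on the frontier at its ends, so none can end
strictly inside the interval of another one with which it agrees. -/
theorem IsBrakeExtension.le (hG : IsConvexHamiltonian D G) (hE : ∀ q ∈ D, G (q, 0) < E)
    (hγ : MapsTo γ (Icc 0 1) D)
    (h₁ : IsBrakeExtension H D E (jacobiMetric G E) γ α₁ β₁ γ₁)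
    (h₂ : IsBrakeExtension H D E (jacobiMetric G E) γ α₂ β₂ γ₂) : α₁ ≤ α₂ ∧ β₂ ≤ β₁ := by
  obtain ⟨a₁, b₁⟩ := h₁.lt hG.isOpen hγ
  obtain ⟨a₂, b₂⟩ := h₂.lt hG.isOpen hγ
  have heq := h₁.eqOn hG hE hγ h₂
  have hdisj : ∀ s ∈ Ioo α₂ β₂, γ₂ s ∉ frontier D := fun s hs hf => by
    rw [hG.isOpen.frontier_eq] at hf
    exact hf.2 (h₂.geodesic.mapsTo hs)
  have hlt : max α₁ α₂ < min β₁ β₂ := (max_lt a₁ a₂).trans (zero_lt_one.trans (lt_min b₁ b₂))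
  constructor
  · by_contra! h
    refine hdisj α₁ ⟨h, by linarith⟩ ?_
    rw [← heq ⟨(max_eq_left h.le).le, (le_max_left _ _).trans hlt.le⟩]
    exact h₁.apply_mem_frontier.1
  · by_contra! h
    refine hdisj β₁ ⟨by linarith, h⟩ ?_
    rw [← heq ⟨hlt.le.trans (min_le_left _ _), (min_eq_left h.le).ge⟩]
    exact h₁.apply_mem_frontier.2

/-- Brake extensions are unique. -/
theorem IsBrakeExtension.unique (hG : IsConvexHamiltonian D G) (hE : ∀ q ∈ D, G (q, 0) < E)
    (hγ : MapsTo γ (Icc 0 1) D)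
    (h₁ : IsBrakeExtension H D E (jacobiMetric G E) γ α₁ β₁ γ₁)
    (h₂ : IsBrakeExtension H D E (jacobiMetric G E) γ α₂ β₂ γ₂) :
    α₁ = α₂ ∧ β₁ = β₂ ∧ EqOn γ₁ γ₂ (Icc α₂ β₂) := by
  obtain ⟨l₁, r₁⟩ := h₁.le hG hE hγ h₂
  obtain ⟨l₂, r₂⟩ := h₂.le hG hE hγ h₁
  obtain rfl := le_antisymm l₁ l₂
  obtain rfl := le_antisymm r₁ r₂
  refine ⟨rfl, rfl, ?_⟩
  have := h₁.eqOn hG hE hγ h₂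
  rwa [max_self, min_self] at this

end Uniqueness

/-! ### Existence of brake extensions and of the collar data -/

section Existence

variable {n : ℕ} {H : EuclideanSpace ℝ (Fin n) × EuclideanSpace ℝ (Fin n) → ℝ} {E : ℝ}
  {D : Set (EuclideanSpace ℝ (Fin n))}

/-- The metric speed extends continuously and positively to both ends of `[0, T]`. Its primitive,
divided by `c`, is therefore a `C¹` diffeomorphism from time to geodesic parameter, normalized by `e
(θ 0) = 0`. -/
theorem CollarData.IsHamiltonExtension.exists_isBrakeExtension {K : CollarData H E D} {c : ℝ}
    (hc : 0 < c)
    {γ y : ℝ → EuclideanSpace ℝ (Fin n)} {T : ℝ}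
    {z : ℝ → EuclideanSpace ℝ (Fin n) × EuclideanSpace ℝ (Fin n)} {θ : ℝ → ℝ}
    (h : K.IsHamiltonExtension c γ y T z θ) :
    ∃ α β γ', IsBrakeExtension H D E (jacobiMetric K.ham E) γ α β γ' := by
  have hT := h.pos
  have hz : ∀ t ∈ Ioo 0 T, HasDerivAt z (hamiltonField H (z t)) t := fun t ht =>
    (h.hasDerivWithinAt t ⟨ht.1.le, ht.2.le⟩).hasDerivAt (Icc_mem_nhds ht.1 ht.2)
  obtain ⟨L₀, hL₀, hl₀⟩ := h.left_speed
  obtain ⟨L₁, hL₁, hl₁⟩ := h.right_speed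
  set w : ℝ → ℝ := fun t => K.speed (z t) / c with hw
  set g := extendFrom (Ioo 0 T) w with hg
  have hwc : ContinuousOn w (Ioo 0 T) := fun t ht =>
    ((ContinuousAt.comp (g := K.speed) (f := z) (K.continuousAt_speed (h.aligned t ht))
      (hz t ht).continuousAt).div_const c).continuousWithinAt
  have hgc : ContinuousOn g (Icc 0 T) :=
    continuousOn_Icc_extendFrom_Ioo hwc (hl₀.div_const c) (hl₁.div_const c)
  have hgw : ∀ t ∈ Ioo 0 T, g t = w t := extendFrom_extends hwc
  have hgpos : ∀ t ∈ Icc 0 T, 0 < g t := fun t ht => by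
    rcases ht.1.eq_or_lt with h0 | h0
    · rw [← h0, hg, eq_lim_at_left_extendFrom_Ioo hT (hl₀.div_const c)]
      exact div_pos hL₀ hc
    · rcases ht.2.eq_or_lt with h1 | h1
      · rw [h1, hg, eq_lim_at_right_extendFrom_Ioo hT (hl₁.div_const c)]
        exact div_pos hL₁ hc
      · rw [hgw t ⟨h0, h1⟩]
        exact div_pos (K.speed_pos (h.aligned t ⟨h0, h1⟩)) hc
  obtain ⟨e, he0, he, hes⟩ := exists_orderIso_hasDerivAt hT.le hgc hgpos (θ 0) 0
  -- `e ∘ θ` has derivative `(speed / c) * (c / speed) = 1` and vanishes at `0`, so the new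
  -- parameter restricts to the given one on the chord.
  have heθ : ∀ s ∈ Icc (0 : ℝ) 1, e (θ s) = s := by
    have hd : ∀ s ∈ Icc (0 : ℝ) 1, HasDerivWithinAt (fun s => e (θ s) - s) 0 (Icc 0 1) s := by
      intro s hs
      have ht := h.time_mem s hs
      have h1 := (he _ ⟨ht.1.le, ht.2.le⟩).comp s (h.hasDerivAt_time s hs)
      refine ((h1.sub (hasDerivAt_id s)).congr_deriv ?_).hasDerivWithinAt
      have hp := (K.speed_pos (h.aligned _ ht)).ne'
      rw [hgw _ ht, hw]
      simp only
      rw [h.apply_time s hs] at hp ⊢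
      field_simp
      simp
    intro s hs
    have h2 := (convex_Icc (0 : ℝ) 1).norm_image_sub_le_of_norm_hasDerivWithin_le (C := 0) hd
      (fun _ _ => by simp) ⟨le_rfl, zero_le_one⟩ hs
    rw [zero_mul, norm_le_zero_iff, sub_eq_zero, he0, sub_zero] at h2
    linarith
  have hzc : ContinuousOn z (Icc 0 T) := fun t ht => (h.hasDerivWithinAt t ht).continuousWithinAt
  have hend : ∀ t ∈ Icc 0 T, t ∈ Ioo 0 T ∨ ∃ x ∈ frontier D, z t = (x, 0) := fun t ht => by
    rcases ht.1.eq_or_lt with h0 | h0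
    · exact Or.inr (h0 ▸ h.left)
    · rcases ht.2.eq_or_lt with h1 | h1
      · exact Or.inr (h1 ▸ h.right)
      · exact Or.inl ⟨h0, h1⟩
  have hsymm : MapsTo e.symm (Icc (e 0) (e T)) (Icc 0 T) := fun s hs =>
    ⟨e.le_symm_apply.2 hs.1, e.symm_apply_le.2 hs.2⟩
  have hcomp : (fun s => (z (e.symm s)).1) ∘ e = fun t => (z t).1 := by
    funext t
    simp only [Function.comp, e.symm_apply_apply]
  refine ⟨e 0, e T, fun s => (z (e.symm s)).1, ?_⟩
  exact {
    left_le := (e.monotone (h.time_mem 0 ⟨le_rfl, zero_le_one⟩).1.le).trans he0.le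
    le_right := by
      have h1 := e.monotone (h.time_mem 1 ⟨zero_le_one, le_rfl⟩).2.le
      rwa [heθ 1 ⟨zero_le_one, le_rfl⟩] at h1
    continuousOn := continuous_fst.comp_continuousOn
      (hzc.comp e.toHomeomorph.symm.continuous.continuousOn hsymm)
    mapsTo := fun s hs => by
      rcases hend _ (hsymm hs) with h1 | ⟨x, hx, h1⟩
      · exact subset_closure (h.aligned _ h1).1
      · simp only [h1]
        exact frontier_subset_closure hx
    extends_eq := fun s hs => by
      have h1 : e.symm s = θ s := by rw [e.symm_apply_eq, heθ s hs]
      simp only [h1, h.apply_time s hs]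
    geodesic := (K.isJacobiOrbit_rescale hz h.aligned e fun t ht => by
      have h1 := hes t ⟨ht.1.le, ht.2.le⟩
      rwa [hgw t ht] at h1).isGeodesicOn K.convex_ham K.ham_lt hc isOpen_Ioo.uniqueDiffOn
    brake := by
      refine ⟨T, e, isTimeReparametrization_orderIso hT e hgc hgpos he, ?_⟩
      rw [hcomp]
      refine ⟨hT, ⟨fun t => (z t).2, fun t ht => ?_, fun t ht => ?_⟩,
        fun t ht => (h.aligned t ht).1, ?_, ?_⟩
      · have h1 := h.hasDerivWithinAt t ht
        rw [hamiltonField, pGrad, qGrad] at h1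
        exact ⟨h1.fst, h1.snd⟩
      · change H (z t) = E
        rcases hend t ht with h1 | ⟨x, hx, h1⟩
        · exact (h.aligned t h1).2.1
        · rw [h1]
          exact K.eq_energy x hx
      · obtain ⟨x, hx, h1⟩ := h.left
        simp only [h1]
        exact hx
      · obtain ⟨x, hx, h1⟩ := h.right
        simp only [h1]
        exact hx }

theorem IsPotentialWell.exists_collarData (hH : IsClassicalType H) (hD : IsPotentialWell H D E)
    (hc : IsCompact (closure D)) : Nonempty (CollarData H E D) := by
  have hpot : ∀ q, HasFDerivAt (fun x => H (x, 0)) (-innerSL ℝ (restForce H q)) q :=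
    hasFDerivAt_potential hH.contDiff
  have hb : ∀ q ∈ frontier D, restForce H q ≠ 0 := fun q hq h0 => by
    refine hD.gradient_ne_zero q hq ?_
    have h1 : HasFDerivAt (potential H) (-innerSL ℝ (restForce H q)) q := hpot q
    rw [gradient, h1.fderiv, h0, map_zero, neg_zero, map_zero]
  refine BrakeOrbit.exists_collarData hH.contDiff hH.isConvexHamiltonian hD.isOpen hc hD.lt_energy
    hD.eq_energy hb fun x hx => ?_
  obtain ⟨ψ, hψ⟩ := hD.boundary x hx
  have hpot2 : ContDiff ℝ 1 fun x => H (x, 0) :=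
    (hH.contDiff.comp (contDiff_id.prodMk contDiff_const)).of_le one_le_two
  refine eventually_mem_iff_lt hpot2.contDiffAt (hψ.contDiffAt.of_le one_le_two) hψ.eq_zero
    hψ.fderiv_ne_zero hψ.mem_iff hD.lt_energy hD.eq_energy hx fun h0 => hb x hx ?_
  rw [(hpot x).fderiv, neg_eq_zero] at h0
  have h1 := congrArg (fun A : EuclideanSpace ℝ (Fin n) →L[ℝ] ℝ => A (restForce H x)) h0
  exact inner_self_eq_zero.1 h1

end Existence

end BrakeOrbit

/-! ### The main theorem -/

theorem mainTheorem1 {n : ℕ}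
    (H : EuclideanSpace ℝ (Fin n) × EuclideanSpace ℝ (Fin n) → ℝ)
    (hH : BrakeOrbit.IsClassicalType H)
    (D : Set (EuclideanSpace ℝ (Fin n))) (E : ℝ)
    (hD : BrakeOrbit.IsPotentialWell H D E)
    (hcompact : IsCompact (closure D)) :
    ∃ (Ω : Set (EuclideanSpace ℝ (Fin n)))
      (F : EuclideanSpace ℝ (Fin n) → EuclideanSpace ℝ (Fin n) → ℝ),
      IsOpen Ω ∧
      BrakeOrbit.IsFinslerMetric D F ∧
      closure Ω ⊆ D ∧
      BrakeOrbit.HasC2Boundary Ω ∧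
      Nonempty (closure Ω ≃ₜ closure D) ∧
      BrakeOrbit.IsStronglyConcave D F Ω ∧
      ∀ γ : ℝ → EuclideanSpace ℝ (Fin n), BrakeOrbit.IsOrthogonalChord D F Ω 0 1 γ →
        ∃ (α β : ℝ) (γ' : ℝ → EuclideanSpace ℝ (Fin n)),
          BrakeOrbit.IsBrakeExtension H D E F γ α β γ' ∧
          ∀ (α₁ β₁ : ℝ) (γ₁ : ℝ → EuclideanSpace ℝ (Fin n)),
            BrakeOrbit.IsBrakeExtension H D E F γ α₁ β₁ γ₁ →
              α₁ = α ∧ β₁ = β ∧ EqOn γ₁ γ' (Icc α β) := by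
  obtain ⟨K⟩ := hD.exists_collarData hH hcompact
  have hcl : closure K.inner ⊆ D := fun q hq => by
    rw [K.closure_inner] at hq
    exact hq.1
  refine ⟨K.inner, BrakeOrbit.jacobiMetric K.ham E, K.isOpen_inner,
    K.convex_ham.isFinslerMetric K.ham_lt, hcl, K.hasC2Boundary, K.nonempty_homeomorph,
    K.isStronglyConcave, fun γ hγ => ?_⟩
  obtain ⟨c, hc, y, hJ, hl, hl0, hl1, hy0, hy1⟩ := K.exists_isJacobiOrbit_of_chord hγ
  obtain ⟨T, z, θ, hext⟩ := K.exists_isHamiltonExtension hc hJ hl hl0 hl1 hy0 hy1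
  obtain ⟨α, β, γ', hγ'⟩ := hext.exists_isBrakeExtension hc
  exact ⟨α, β, γ', hγ', fun α₁ β₁ γ₁ h₁ =>
    h₁.unique K.convex_ham K.ham_lt hγ.geodesic.mapsTo hγ'⟩
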